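/- Let $d\ge 2$ be even. A parity game consists of a sinkless directed graph $G=(V,E)$ with $n=|V|\ge 2$ nodes partitioned into $V_0$ (Even) and $V_1$ (Odd), and a priority function $\pi:V\to\{1,\dots,d\}$; for a strategy $\tau$ of Odd, $G_\tau$ is the subgraph in which every $v\in V_1$ keeps only the arc $v\tau(v)$, and $m$ is the number of arcs of $G_\tau$. Let $T$ be the succinct $(n,d/2)$-universal tree: its leaves are the $d/2$-tuples $\xi=(\xi_{d-1},\xi_{d-3},\dots,\xi_1)$ of binary strings with at most $\lfloor\log_2 n\rfloor$ bits in total, ordered lexicographically, where binary strings are ordered by $0s<\varepsilon<1s'$ and $bs<bs'\iff s<s'$. Let $\bar L(T)$ be the set of its leaves with an additional top element $\top$. For a leaf $\xi$, $\xi|_p$ is obtained by deleting the components of index less than $p$, and $\top|_p=\top$. With respect to labels $\mu:V\to\bar L(T)$, an arc $vw$ is *violated* unless $\mu(v)|_{\pi(v)}\ge\mu(w)|_{\pi(v)}$ (if $\pi(v)$ is even), respectively $\mu(v)|_{\pi(v)}>\mu(w)|_{\pi(v)}$ or $\mu(v)=\mu(w)=\top$ (if $\pi(v)$ is odd); it is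 *tight* if $\mu(v)$ is the smallest label for which $vw$ is not violated, given $\mu(w)$, and *loose* if it is neither violated nor tight. $\mathrm{Drop}_{vw}$ replaces the label of $v$ by the largest label $\xi\le\mu(v)$ for which $vw$ is not loose. $\mathrm{lift}(\mu,vw)$ is the smallest label $\xi\ge\mu(v)$ of $v$ for which $vw$ is not violated; the lift operators of $G_\tau$ replace $\mu(v)$ by $\min_{vw\in E(G_\tau)}\mathrm{lift}(\mu,vw)$ for $v\in V_0$, and by $\mathrm{lift}(\mu,vw)$ for an arc $vw$ with $v\in V_1$. Let $\mu^{\mathcal G_\tau^\uparrow}$ denote their least simultaneous fixed point that is pointwise at least $\mu$. For trees write $S\sqsubseteq S'$ if there is an injective order-preserving homomorphism $S\to S'$ mapping leaves to leaves. For $0\le j\le d/2$ let $\mathcal T_j$ be the set of (distinct) subtrees of $T$ of height $j$; it is a chain $T_{0,j}\sqsubset T_{1,j}\sqsubset\cdots$, and $\mathcal C=(\mathcal T_0,\dots,\mathcal T_{d/2})$ is the resulting cover with one chain per subcover. A *base node* is a node of even priority that has the highest priority on some cycle of $G_\tau$. For a base node $w$ with $\pi(w)=2j$, let $K_w$ be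 the strongly connected component of $w$ in the subgraph of $G_\tau$ induced by the nodes of priority at most $2j$; let $K'_w$ be $K_w$ without the incoming arcs of the nodes $v\ne w$ of $K_w$ of priority $2j$; and let $J_w$ be the subgraph of $K'_w$ induced by the nodes that can reach $w$ in $K'_w$. The auxiliary digraph $D$ on the base nodes has an arc $vw$, $v\neq w$, if $v$ has the highest priority in $J_w$, and a loop $ww$ if $w$ has an outgoing arc in $J_w$. For an arc $vw$ of $D$, $\underline c(vw)$ is the least $i$ for which the greatest simultaneous fixed point $\lambda:V(J_w)\to\bar L(T_{i,j})$ of the drop operators of $J_w$ subject to $\lambda(w)=\min L(T_{i,j})$ is finite at some out-neighbour of $v$ in $J_w$; and $\overline c(vw)$ is the least $i$ for which some path in $J_w$ to $w$ from an out-neighbour of $v$ in $J_w$ has a labeling by leaves of $T_{i,j}$ without violated arcs (both $\infty$ if there is no such $i$). The label-correcting algorithm, given $G_\tau$, $\pi$, $\mathcal C$ and a labeling $\mu:V\to\bar L(T)$ such that $G_\tau$ has no loose arcs with respect to $\mu$, works as follows. It chooses arc costs $c$ with $\underline c\le c\le\overline c$ on $D$ and determines, for every base node $w$, the minimum $i_w$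 over the cycles of $D$ through $w$ of the maximum arc cost on the cycle. It sets $\nu(w)$, for every base node $w$ with $\pi(w)=2j$ and $i_w<\infty$, to the smallest leaf $\xi'\ge\mu(w)$ of $T$ that is the smallest leaf of a copy of $T_{i',j}$ in $T$ for some $i'\ge i_w$ (to $\top$ if there is none), and $\nu(v)=\top$ for all other nodes. Finally it applies $n-1$ rounds of the Bellman--Ford procedure to $\nu$, each round applying $\mathrm{Drop}_{vw}$ once for every arc $vw$ of $G_\tau$ in any order, and returns $\nu$. **Theorem.** The label-correcting algorithm for the succinct $(n,d/2)$-universal tree $T$ with cover $\mathcal C=(\mathcal T_0,\dots,\mathcal T_{d/2})$ can be implemented to return $\mu^{\mathcal G_\tau^\uparrow}$ in $O(mn^2\log n\log d)$ time. More precisely, there are a single unit-cost word-RAM program and a constant $A$ such that, for all $n\ge 2$, all even $d\geq 2$ and every input $(G_\tau,\pi,\mu)$ as above, the program, using machine words of $O(\log n+\log d)$ bits, halts after at most $A\,m\,n^2\lfloor\log_2 n\rfloor\lfloor\log_2 d\rfloor$ steps, having stored the arc costs $c$, the values $i_w$, the initial labels and the returned labels $\nu$ of an execution of the label-correcting algorithm,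 and $\nu=\mu^{\mathcal G_\tau^\uparrow}$. (A label is stored as the list of its bits, each with the position of its component.) -/

import Mathlib

open scoped Classical

noncomputable section

namespace ParityLC

/-! ### Ordered trees, embeddings, subtrees -/

/-- An ordered tree of height `h` over the linearly ordered set `M` of branching directions: a
finite prefix-closed set of tuples containing the root `[]`, all of whose leaves are at depth `h`.
The order of the vertices is the lexicographic order of `List M`. -/
structure OrderedTree (M : Type*) (h : ℕ) where
  carrier : Set (List M)
  finite : carrier.Finite
  root_mem : [] ∈ carrier
  prefix_closed : ∀ u v : List M, u ++ v ∈ carrier → u ∈ carrier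
  extends_to_leaf : ∀ u ∈ carrier, ∃ v, u ++ v ∈ carrier ∧ (u ++ v).length = h
  length_le : ∀ u ∈ carrier, u.length ≤ h

/-- `L(T)`: the leaves of `T`, linearly ordered lexicographically. -/
abbrev Leaf {M : Type*} {h : ℕ} (T : OrderedTree M h) : Type _ :=
  {ξ : List M // ξ ∈ T.carrier ∧ ξ.length = h}

/-- `L(T)` together with a top element. -/
abbrev Label {M : Type*} {h : ℕ} (T : OrderedTree M h) : Type _ := WithTop (Leaf T)

/-- `T ⊑ T'`: there is an injective order-preserving homomorphism that maps leaves to leaves. -/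
def Embeds {M : Type*} [LinearOrder M] {h h' : ℕ} (T : OrderedTree M h) (T' : OrderedTree M h') :
    Prop :=
  ∃ f : T.carrier → T'.carrier, Function.Injective f ∧
    (∀ u v : T.carrier, (∃ a, (v : List M) = (u : List M) ++ [a]) →
      ∃ a, (f v : List M) = (f u : List M) ++ [a]) ∧
    (∀ u v : T.carrier, (u : List M) ≤ v → (f u : List M) ≤ f v) ∧
    (∀ u : T.carrier, (u : List M).length = h → (f u : List M).length = h')

/-- `T ≡ T'`. -/
def EquivTree {M : Type*} [LinearOrder M] {h h' : ℕ} (T : OrderedTree M h)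
    (T' : OrderedTree M h') : Prop :=
  Embeds T T' ∧ Embeds T' T

/-- `T ⊏ T'`. -/
def StrictEmbeds {M : Type*} [LinearOrder M] {h h' : ℕ} (T : OrderedTree M h)
    (T' : OrderedTree M h') : Prop :=
  Embeds T T' ∧ ¬ Embeds T' T

/-- `S` is the (whole) subtree of `T` rooted at the vertex `v` of depth `h - j`. -/
def IsSubtreeAt {M : Type*} {h j : ℕ} (T : OrderedTree M h) (v : List M) (S : OrderedTree M j) :
    Prop :=
  v ∈ T.carrier ∧ v.length + j = h ∧ S.carrier = {t | v ++ t ∈ T.carrier}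

/-- A cover of the poset of distinct subtrees of `T`: for every `j ≤ h`, a tuple of chains of
subtrees of height `j` (each chain listed in strictly increasing order), such that every subtree
of height `j` is equivalent to a member of one of the chains. -/
structure Cover {M : Type*} [LinearOrder M] {h : ℕ} (T : OrderedTree M h) where
  chains : (j : ℕ) → List (List (OrderedTree M j))
  isSubtree : ∀ j ≤ h, ∀ c ∈ chains j, ∀ S ∈ c, ∃ v, IsSubtreeAt T v S
  isChain : ∀ j ≤ h, ∀ c ∈ chains j, c.Pairwise (fun S S' => StrictEmbeds S S')
  covers : ∀ j ≤ h, ∀ (v : List M) (S : OrderedTree M j), IsSubtreeAt T v S →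
    ∃ c ∈ chains j, ∃ S' ∈ c, EquivTree S S'

/-! ### Labels: least and greatest elements, truncation, tight / loose / violated -/

/-- The least element of a set of labels (`⊤` for the empty set). -/
def minOf {M : Type*} [LinearOrder M] {h : ℕ} {T : OrderedTree M h} (A : Set (Label T)) :
    Label T :=
  if H : ∃ x, IsLeast A x then H.choose else ⊤

/-- The greatest element of a nonempty set of labels. -/
def maxOf {M : Type*} [LinearOrder M] {h : ℕ} {T : OrderedTree M h} (A : Set (Label T)) :
    Label T :=
  if H : ∃ x, IsGreatest A x then H.choose else ⊤

lemma finite_label {M : Type*} {h : ℕ} (T : OrderedTree M h) : Finite (Label T) := by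
  have h1 : {ξ : List M | ξ ∈ T.carrier ∧ ξ.length = h}.Finite :=
    T.finite.subset (fun _ hx => hx.1)
  have h2 : Finite (Leaf T) := h1.to_subtype
  have h3 : Finite (Option (Leaf T)) := inferInstance
  exact h3

lemma minOf_isLeast {M : Type*} [LinearOrder M] {h : ℕ} {T : OrderedTree M h}
    {A : Set (Label T)} (hA : A.Nonempty) : IsLeast A (minOf A) := by
  have := finite_label T
  have H : ∃ x, IsLeast A x := by
    obtain ⟨x, hx, hle⟩ := Set.exists_min_image A id A.toFinite hA
    exact ⟨x, hx, fun y hy => hle y hy⟩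
  rw [minOf, dif_pos H]
  exact H.choose_spec

lemma maxOf_isGreatest {M : Type*} [LinearOrder M] {h : ℕ} {T : OrderedTree M h}
    {A : Set (Label T)} (hA : A.Nonempty) : IsGreatest A (maxOf A) := by
  have := finite_label T
  have H : ∃ x, IsGreatest A x := by
    obtain ⟨x, hx, hle⟩ := Set.exists_max_image A id A.toFinite hA
    exact ⟨x, hx, fun y hy => hle y hy⟩
  rw [maxOf, dif_pos H]
  exact H.choose_spec

/-- The `p`-truncation. A leaf `(ξ_{2h-1}, ξ_{2h-3}, …, ξ_1)` keeps its components of index at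
least `p`; these are the first `h - ⌊p/2⌋` components. -/
def trunc {M : Type*} {h : ℕ} {T : OrderedTree M h} (p : ℕ) (x : Label T) : WithTop (List M) :=
  WithTop.map (fun ξ : Leaf T => ξ.1.take (h - p / 2)) x

/-- The feasibility condition of an arc whose tail has priority `p` and label `a` and whose head
has label `b`. The arc is violated if this fails. -/
def NonViolated {M : Type*} [LinearOrder M] {h : ℕ} {T : OrderedTree M h} (p : ℕ)
    (a b : Label T) : Prop :=
  if Even p then trunc p b ≤ trunc p a else trunc p b < trunc p a ∨ (a = ⊤ ∧ b = ⊤)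

/-- Tight: the label `a` of the tail is the smallest one for which the arc is not violated. -/
def Tight {M : Type*} [LinearOrder M] {h : ℕ} {T : OrderedTree M h} (p : ℕ)
    (a b : Label T) : Prop :=
  IsLeast {ξ : Label T | NonViolated p ξ b} a

/-- Loose: neither tight nor violated. -/
def Loose {M : Type*} [LinearOrder M] {h : ℕ} {T : OrderedTree M h} (p : ℕ)
    (a b : Label T) : Prop :=
  NonViolated p a b ∧ ¬ Tight p a b

/-- The smallest label `ξ ≥ a` of the tail for which the arc is not violated. -/
def lift {M : Type*} [LinearOrder M] {h : ℕ} {T : OrderedTree M h} (p : ℕ) (a b : Label T) :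
    Label T :=
  minOf {ξ | a ≤ ξ ∧ NonViolated p ξ b}

/-- The largest label `ξ ≤ a` of the tail for which the arc is not loose. -/
def drop {M : Type*} [LinearOrder M] {h : ℕ} {T : OrderedTree M h} (p : ℕ) (a b : Label T) :
    Label T :=
  maxOf {ξ | ξ ≤ a ∧ ¬ Loose p ξ b}

/-! ### Parity games and one-player games -/

/-- A parity game on the nodes `0, …, n - 1` with priorities in `{1, …, d}`, `d` even. The nodes in
`V₁` belong to Odd, all the others to Even. -/
structure ParityGame (n d : ℕ) where
  arcs : Finset (Fin n × Fin n)
  V₁ : Finset (Fin n)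
  prio : Fin n → ℕ
  prio_pos : ∀ v, 1 ≤ prio v
  prio_le : ∀ v, prio v ≤ d
  sinkless : ∀ v, ∃ w, (v, w) ∈ arcs
  even_d : Even d

/-- A (positional) strategy for Odd. -/
structure OddStrategy {n d : ℕ} (G : ParityGame n d) where
  next : G.V₁ → Fin n
  next_arc : ∀ v : G.V₁, ((v : Fin n), next v) ∈ G.arcs

/-- The arc set of the strategy subgraph `G_τ`. -/
def stratArcs {n d : ℕ} (G : ParityGame n d) (τ : OddStrategy G) : Finset (Fin n × Fin n) :=
  G.arcs.filter (fun e => ∀ hv : e.1 ∈ G.V₁, e.2 = τ.next ⟨e.1, hv⟩)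

/-- `vw` is an arc of the one-player game `G_τ`. -/
def Arc {n d : ℕ} (G : ParityGame n d) (τ : OddStrategy G) (v w : Fin n) : Prop :=
  (v, w) ∈ stratArcs G τ

/-- Node labelings. -/
abbrev Labeling (n : ℕ) {M : Type*} {h : ℕ} (T : OrderedTree M h) : Type _ := Fin n → Label T

/-- The node labeling `μ` is feasible in the subgraph with arc relation `H`. -/
def Feasible {n d : ℕ} (G : ParityGame n d) {M : Type*} [LinearOrder M] {h : ℕ}
    {T : OrderedTree M h} (H : Fin n → Fin n → Prop) (μ : Labeling n T) : Prop :=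
  ∃ σ : Fin n → Fin n, (∀ v, v ∉ G.V₁ → (∃ w, H v w) → H v (σ v)) ∧
    ∀ v w, H v w → (v ∉ G.V₁ → w = σ v) → NonViolated (G.prio v) (μ v) (μ w)

/-- The operator `Lift_v` of `G_τ`, for a node `v` of Even. -/
def liftNode {n d : ℕ} (G : ParityGame n d) (τ : OddStrategy G) {M : Type*} [LinearOrder M]
    {h : ℕ} {T : OrderedTree M h} (v : Fin n) (μ : Labeling n T) : Labeling n T :=
  Function.update μ v (minOf {x | ∃ w, Arc G τ v w ∧ x = lift (G.prio v) (μ v) (μ w)})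

/-- The operator `Lift_{vw}`, for an arc whose tail belongs to Odd. -/
def liftArc {n d : ℕ} (G : ParityGame n d) {M : Type*} [LinearOrder M]
    {h : ℕ} {T : OrderedTree M h} (v w : Fin n) (μ : Labeling n T) : Labeling n T :=
  Function.update μ v (lift (G.prio v) (μ v) (μ w))

/-- The operators of `G_τ`. -/
def liftOps {n d : ℕ} (G : ParityGame n d) (τ : OddStrategy G) {M : Type*} [LinearOrder M]
    {h : ℕ} (T : OrderedTree M h) : Set (Labeling n T → Labeling n T) :=
  {φ | ∃ v, v ∉ G.V₁ ∧ φ = liftNode G τ v} ∪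
    {φ | ∃ v w, v ∈ G.V₁ ∧ Arc G τ v w ∧ φ = liftArc G v w}

/-- `ν` is the least simultaneous fixed point of the lift operators of `G_τ` that is pointwise at
least `μ`. -/
def IsLeastFixedPoint {n d : ℕ} (G : ParityGame n d) (τ : OddStrategy G) {M : Type*}
    [LinearOrder M] {h : ℕ} {T : OrderedTree M h} (μ ν : Labeling n T) : Prop :=
  IsLeast {ν' | μ ≤ ν' ∧ ∀ φ ∈ liftOps G τ T, φ ν' = ν'} ν

/-- The operator `Drop_{vw}`. -/
def dropArc {n d : ℕ} (G : ParityGame n d) {M : Type*} [LinearOrder M]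
    {h : ℕ} {T : OrderedTree M h} (v w : Fin n) (ν : Labeling n T) : Labeling n T :=
  Function.update ν v (drop (G.prio v) (ν v) (ν w))

/-! ### Cycles, base nodes, the auxiliary digraph -/

/-- The consecutive pairs of a path given by its list of nodes. -/
def pathArcs {V : Type*} (P : List V) : List (V × V) := P.zip P.tail

/-- `P` is a (simple) `u`-`w` path. -/
def IsPath {V : Type*} (R : V → V → Prop) (u w : V) (P : List V) : Prop :=
  P.head? = some u ∧ P.getLast? = some w ∧ P.Nodup ∧ ∀ e ∈ pathArcs P, R e.1 e.2

/-- The arcs of the closed walk that traverses the nodes of `C` and returns to the first one. -/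
def cycleArcs {V : Type*} (C : List V) : List (V × V) := C.zip (C.rotate 1)

/-- `C` is the list of nodes of a (simple, directed) cycle; a self-loop is a cycle. -/
def IsCycle {V : Type*} (R : V → V → Prop) (C : List V) : Prop :=
  C ≠ [] ∧ C.Nodup ∧ ∀ e ∈ cycleArcs C, R e.1 e.2

/-- The nodes of highest priority in a set of nodes. -/
def dominators {n d : ℕ} (G : ParityGame n d) (A : Set (Fin n)) : Set (Fin n) :=
  {v | v ∈ A ∧ ∀ u ∈ A, G.prio u ≤ G.prio v}

/-- Base nodes: the nodes that dominate an even cycle of `G_τ`. -/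
def baseNodes {n d : ℕ} (G : ParityGame n d) (τ : OddStrategy G) : Set (Fin n) :=
  {v | Even (G.prio v) ∧ ∃ C, IsCycle (Arc G τ) C ∧ v ∈ dominators G {u | u ∈ C}}

/-- The subgraph of `G_τ` induced by the nodes of priority at most `p`. -/
def ArcUpTo {n d : ℕ} (G : ParityGame n d) (τ : OddStrategy G) (p : ℕ) (u v : Fin n) : Prop :=
  Arc G τ u v ∧ G.prio u ≤ p ∧ G.prio v ≤ p

/-- The nodes of `K_w`, the strongly connected component of `w` in the subgraph of `G_τ` induced by
the nodes of priority at most the priority of `w`. -/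
def nodesK {n d : ℕ} (G : ParityGame n d) (τ : OddStrategy G) (w : Fin n) : Set (Fin n) :=
  {v | Relation.ReflTransGen (ArcUpTo G τ (G.prio w)) v w ∧
    Relation.ReflTransGen (ArcUpTo G τ (G.prio w)) w v}

/-- The arcs of `K'_w`: those of `K_w`, without the incoming arcs of the nodes other than `w` that
have the highest priority in `K_w`. -/
def ArcK' {n d : ℕ} (G : ParityGame n d) (τ : OddStrategy G) (w u v : Fin n) : Prop :=
  u ∈ nodesK G τ w ∧ v ∈ nodesK G τ w ∧ Arc G τ u v ∧
    ¬ (v ∈ dominators G (nodesK G τ w) ∧ v ≠ w)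

/-- The nodes of `J_w`: those which can reach `w` in `K'_w`. -/
def nodesJ {n d : ℕ} (G : ParityGame n d) (τ : OddStrategy G) (w : Fin n) : Set (Fin n) :=
  {v | v ∈ nodesK G τ w ∧ Relation.ReflTransGen (ArcK' G τ w) v w}

/-- The arcs of `J_w`. -/
def ArcJ {n d : ℕ} (G : ParityGame n d) (τ : OddStrategy G) (w u v : Fin n) : Prop :=
  u ∈ nodesJ G τ w ∧ v ∈ nodesJ G τ w ∧ ArcK' G τ w u v

/-- The arcs of the auxiliary digraph `D` on the base nodes. -/
def ArcD {n d : ℕ} (G : ParityGame n d) (τ : OddStrategy G) (v w : Fin n) : Prop :=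
  v ∈ baseNodes G τ ∧ w ∈ baseNodes G τ ∧
    ((v ≠ w ∧ v ∈ dominators G (nodesJ G τ w)) ∨ (v = w ∧ ∃ u, ArcJ G τ w w u))

/-! ### Arc costs of the auxiliary digraph -/

/-- `ν` is the greatest simultaneous fixed point of the drop operators of `J_w`, with values in the
labels of `S`, subject to `ν w` being the smallest leaf of `S`. (Outside `J_w` its values are
irrelevant.) -/
def IsLambda {n d : ℕ} (G : ParityGame n d) (τ : OddStrategy G) {M : Type*} [LinearOrder M]
    {j : ℕ} (S : OrderedTree M j) (w : Fin n) (ν : Labeling n S) : Prop :=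
  IsGreatest {ν' : Labeling n S | (∀ u v, ArcJ G τ w u v → dropArc G u v ν' = ν') ∧
    ν' w = minOf Set.univ} ν

/-- The lower bound on the cost of the arc `vw` of `D` with respect to a chain of subtrees: the
least index `i` such that the fixed point for the `i`th tree is finite at some out-neighbour of `v`
in `J_w`. -/
def costLower {n d : ℕ} (G : ParityGame n d) (τ : OddStrategy G) {M : Type*} [LinearOrder M]
    {j : ℕ} (chain : List (OrderedTree M j)) (v w : Fin n) : ℕ∞ :=
  sInf {x : ℕ∞ | ∃ (i : ℕ) (hi : i < chain.length), x = i ∧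
    ∃ ν : Labeling n (chain[i]), IsLambda G τ (chain[i]) w ν ∧ ∃ u, ArcJ G τ w v u ∧ ν u ≠ ⊤}

/-- The width of a path with respect to a chain of subtrees: the least index `i` such that the path
admits a finite feasible node labeling by leaves of the `i`th tree. -/
def pathWidth {n d : ℕ} (G : ParityGame n d) {M : Type*} [LinearOrder M]
    {j : ℕ} (chain : List (OrderedTree M j)) (P : List (Fin n)) : ℕ∞ :=
  sInf {x : ℕ∞ | ∃ (i : ℕ) (hi : i < chain.length), x = i ∧
    ∃ ν : Labeling n (chain[i]), (∀ v ∈ P, ν v ≠ ⊤) ∧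
      Feasible G (fun u v => (u, v) ∈ pathArcs P) ν}

/-- The upper bound on the cost of the arc `vw` of `D`: the least width of a path in `J_w` to `w`
from an out-neighbour of `v` in `J_w`. (The node `w`, of even priority `2 j`, has the highest
priority on such a path, so its width refers to chains of subtrees of height `j`.) -/
def costUpper {n d : ℕ} (G : ParityGame n d) (τ : OddStrategy G) {M : Type*} [LinearOrder M]
    {j : ℕ} (chain : List (OrderedTree M j)) (v w : Fin n) : ℕ∞ :=
  sInf {x : ℕ∞ | ∃ u P, ArcJ G τ w v u ∧ IsPath (ArcJ G τ w) u w P ∧ x = pathWidth G chain P}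

/-- The bottleneck cost of a cycle. -/
def bottleneck {n : ℕ} (c : Fin n → Fin n → ℕ∞) (C : List (Fin n)) : ℕ∞ :=
  ⨆ e ∈ cycleArcs C, c e.1 e.2

/-- The minimum bottleneck cost of a cycle of `D` containing `w` (`⊤` if there is none). -/
def minCycleCost {n d : ℕ} (G : ParityGame n d) (τ : OddStrategy G)
    (c : Fin n → Fin n → ℕ∞) (w : Fin n) : ℕ∞ :=
  sInf {x : ℕ∞ | ∃ C, IsCycle (ArcD G τ) C ∧ w ∈ C ∧ x = bottleneck c C}

/-- `Raise`: the smallest leaf `ξ' ≥ ξ` of `T` that is the smallest leaf of a copy in `T` of the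
tree of index `i'` of the chain, for some `i' ≥ i`; `⊤` if there is none. -/
def raise {M : Type*} [LinearOrder M] {h j : ℕ} {T : OrderedTree M h}
    (chain : List (OrderedTree M j)) (ξ : Label T) (i : ℕ∞) : Label T :=
  minOf {x : Label T | ξ ≤ x ∧ ∃ ξ' : Leaf T, x = ξ' ∧
    ∃ (v : List M) (S : OrderedTree M j), IsSubtreeAt T v S ∧
      (∃ (i' : ℕ) (hi' : i' < chain.length), i ≤ i' ∧ EquivTree S (chain[i'])) ∧
      IsLeast {η : Leaf T | v <+: η.1} ξ'}

/-! ### The algorithm -/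

/-- `es` lists every arc of `G_τ` exactly once. -/
def ListsArcs {n d : ℕ} (G : ParityGame n d) (τ : OddStrategy G) (es : List (Fin n × Fin n)) :
    Prop :=
  es.Nodup ∧ ∀ e, e ∈ es ↔ e ∈ stratArcs G τ

/-- `ν'` is a possible result of the Bellman--Ford procedure on `G_τ` with input `ν`: in each of
`n - 1` iterations the label of the tail of every arc is dropped, for the arcs in any order. -/
def IsBellmanFord {n d : ℕ} (G : ParityGame n d) (τ : OddStrategy G) {M : Type*} [LinearOrder M]
    {h : ℕ} {T : OrderedTree M h} (ν ν' : Labeling n T) : Prop :=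
  ∃ orders : List (List (Fin n × Fin n)), orders.length = n - 1 ∧
    (∀ es ∈ orders, ListsArcs G τ es) ∧
    ν' = orders.flatten.foldl (fun κ e => dropArc G e.1 e.2 κ) ν

/-- An execution of the label-correcting algorithm on the one-player game `G_τ`, a cover `𝒞` of the
subtrees of `T` and the node labeling `μ`: `c k v w` are the arc costs chosen for the `k`th chains,
`i k w` the minimum bottleneck costs, `ν₀` the initial labels and `ν` the returned labels. -/
structure IsExecution {n d : ℕ} (G : ParityGame n d) (τ : OddStrategy G) {M : Type*}
    [LinearOrder M] {h : ℕ} {T : OrderedTree M h} (𝒞 : Cover T) (μ : Labeling n T)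
    (c : ℕ → Fin n → Fin n → ℕ∞) (i : ℕ → Fin n → ℕ∞) (ν₀ ν : Labeling n T) : Prop where
  cost_lower : ∀ v w, ArcD G τ v w → ∀ (k : ℕ) (hk : k < (𝒞.chains (G.prio w / 2)).length),
    costLower G τ ((𝒞.chains (G.prio w / 2))[k]) v w ≤ c k v w
  cost_upper : ∀ v w, ArcD G τ v w → ∀ (k : ℕ) (hk : k < (𝒞.chains (G.prio w / 2)).length),
    c k v w ≤ costUpper G τ ((𝒞.chains (G.prio w / 2))[k]) v w
  min_cycle : ∀ w ∈ baseNodes G τ, ∀ k < (𝒞.chains (G.prio w / 2)).length,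
    i k w = minCycleCost G τ (c k) w
  init_base : ∀ w ∈ baseNodes G τ,
    ν₀ w = minOf {x | ∃ (k : ℕ) (hk : k < (𝒞.chains (G.prio w / 2)).length), i k w < ⊤ ∧
      x = raise ((𝒞.chains (G.prio w / 2))[k]) (μ w) (i k w)}
  init_other : ∀ w, w ∉ baseNodes G τ → ν₀ w = ⊤
  bellman_ford : IsBellmanFord G τ ν₀ ν

/-! ### Succinct universal trees -/

/-- Finite binary strings. -/
structure BinStr where
  bits : List Bool

/-- Comparing strings by their keys gives the order `0s < ε < 1s'`, `bs < bs' ↔ s < s'`. -/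
def BinStr.key (s : BinStr) : List ℕ := s.bits.map (fun b => if b then 2 else 0) ++ [1]

lemma BinStr.key_injective : Function.Injective BinStr.key := by
  rintro ⟨s⟩ ⟨t⟩ h
  have h1 : s.map (fun b : Bool => if b then 2 else 0) = t.map (fun b => if b then 2 else 0) :=
    List.append_cancel_right h
  have h2 : Function.Injective (fun b : Bool => if b then 2 else 0) := by
    intro a b; cases a <;> cases b <;> simp
  rw [List.map_injective_iff.mpr h2 h1]

instance : LinearOrder BinStr := LinearOrder.lift' BinStr.key BinStr.key_injective

lemma BinStr.zero_lt_nil (s : List Bool) : BinStr.mk (false :: s) < BinStr.mk [] := by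
  change BinStr.key _ < BinStr.key _
  simp [BinStr.key, List.cons_lt_cons_iff]

lemma BinStr.nil_lt_one (s : List Bool) : BinStr.mk [] < BinStr.mk (true :: s) := by
  change BinStr.key _ < BinStr.key _
  simp [BinStr.key, List.cons_lt_cons_iff]

lemma BinStr.cons_lt_cons (b : Bool) (s t : List Bool) :
    BinStr.mk (b :: s) < BinStr.mk (b :: t) ↔ BinStr.mk s < BinStr.mk t := by
  change BinStr.key _ < BinStr.key _ ↔ BinStr.key _ < BinStr.key _
  simp [BinStr.key]

/-- The total number of bits of a tuple of binary strings. -/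
def numBits (v : List BinStr) : ℕ := (v.map (fun s => s.bits.length)).sum

lemma numBits_append (u v : List BinStr) : numBits (u ++ v) = numBits u + numBits v := by
  simp [numBits]

lemma numBits_replicate (k : ℕ) : numBits (List.replicate k ⟨[]⟩) = 0 := by
  simp [numBits]

lemma length_bits_le (v : List BinStr) : ∀ s ∈ v, s.bits.length ≤ numBits v := by
  intro s hs
  exact List.single_le_sum (by simp) _ (List.mem_map_of_mem hs)

lemma finite_tuples (b h : ℕ) : {v : List BinStr | v.length ≤ h ∧ numBits v ≤ b}.Finite := by
  have h1 : {l : List Bool | l.length ≤ b}.Finite := List.finite_length_le Bool b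
  have h2 : Finite {l : List Bool // l.length ≤ b} := h1.to_subtype
  have h3 : {l : List {l : List Bool // l.length ≤ b} | l.length ≤ h}.Finite :=
    List.finite_length_le _ h
  refine (h3.image (List.map (fun x => BinStr.mk x.1))).subset ?_
  rintro v ⟨hv, hb⟩
  refine ⟨v.pmap (fun s hs => ⟨s.bits, hs⟩)
    (fun s hs => (length_bits_le v s hs).trans hb), ?_, ?_⟩
  · simpa using hv
  · simp [List.map_pmap]

/-- The tree of height `h` whose leaves are the `h`-tuples of binary strings with at most `b` bits
in total. -/
def bitTree (b h : ℕ) : OrderedTree BinStr h where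
  carrier := {v | v.length ≤ h ∧ numBits v ≤ b}
  finite := finite_tuples b h
  root_mem := by simp [numBits]
  prefix_closed := by
    rintro u v ⟨h1, h2⟩
    rw [numBits_append] at h2
    rw [List.length_append] at h1
    exact ⟨by omega, by omega⟩
  extends_to_leaf := by
    rintro u ⟨h1, h2⟩
    refine ⟨List.replicate (h - u.length) ⟨[]⟩, ⟨?_, ?_⟩, ?_⟩
    · simp; omega
    · rw [numBits_append, numBits_replicate]; exact h2
    · simp; omega
  length_le := fun u hu => hu.1

/-- The succinct `(ℓ, h)`-universal tree. -/
def succinctTree (ℓ h : ℕ) : OrderedTree BinStr h := bitTree (Nat.log 2 ℓ) h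

lemma OrderedTree.ext' {M : Type*} {h : ℕ} {S T : OrderedTree M h} (H : S.carrier = T.carrier) :
    S = T := by
  cases S; cases T; simp_all

lemma embeds_refl {M : Type*} [LinearOrder M] {h : ℕ} (T : OrderedTree M h) : Embeds T T :=
  ⟨id, Function.injective_id, fun _ _ h => h, fun _ _ h => h, fun _ h => h⟩

lemma bitTree_strict {b b' j : ℕ} (hb : b < b') (hj : 0 < j) :
    StrictEmbeds (bitTree b j) (bitTree b' j) := by
  have hsub : (bitTree b j).carrier ⊆ (bitTree b' j).carrier :=
    fun v hv => ⟨hv.1, hv.2.trans hb.le⟩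
  constructor
  · exact ⟨fun v => ⟨v.1, hsub v.2⟩,
      fun u v h => Subtype.ext (by simpa using h), fun _ _ h => h, fun _ _ h => h, fun _ h => h⟩
  · rintro ⟨f, hf, -⟩
    have h1 : (bitTree b j).carrier ⊂ (bitTree b' j).carrier := by
      refine ⟨hsub, fun h => ?_⟩
      have h2 : [BinStr.mk (List.replicate b' false)] ∈ (bitTree b' j).carrier :=
        ⟨by simp; omega, by simp [numBits]⟩
      have h3 := (h h2).2
      simp [numBits] at h3
      omega
    have h4 := Set.ncard_lt_ncard h1 (bitTree b' j).finite
    have : Finite (bitTree b j).carrier := (bitTree b j).finite.to_subtype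
    have h5 := Nat.card_le_card_of_injective f hf
    rw [Nat.card_coe_set_eq, Nat.card_coe_set_eq] at h5
    omega

lemma bitTree_subtree {b h j : ℕ} {v : List BinStr} (hv : v ∈ (bitTree b h).carrier)
    (hj : v.length + j = h) : IsSubtreeAt (bitTree b h) v (bitTree (b - numBits v) j) := by
  refine ⟨hv, hj, ?_⟩
  have h2 := hv.2
  ext t
  simp only [bitTree, Set.mem_ofPred_eq, List.length_append, numBits_append]
  omega

/-- The cover `(𝒯_0, …, 𝒯_h)` of the subtrees of the succinct `(ℓ, h)`-universal tree in which each
subcover consists of a single chain. For `0 < j < h` that chain is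
`T_{0,j} ⊏ T_{1,j} ⊏ ⋯ ⊏ T_{⌊log ℓ⌋,j}`, where the leaves of `T_{b,j}` are the `j`-tuples with at most
`b` bits; there is only one subtree of height `0` and only one of height `h`. -/
def succinctCover (ℓ h : ℕ) : Cover (succinctTree ℓ h) where
  chains j :=
    if 0 < j ∧ j < h then [(List.range (Nat.log 2 ℓ + 1)).map (fun b => bitTree b j)]
    else [[bitTree (Nat.log 2 ℓ) j]]
  isSubtree := by
    intro j hj c hc S hS
    set L := Nat.log 2 ℓ with hL
    have key : ∀ b ≤ L, (b = L ∨ j < h) → ∃ v, IsSubtreeAt (succinctTree ℓ h) v (bitTree b j) := by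
      rintro b hb (hbL | hlt)
      · subst hbL
        have := bitTree_subtree (b := L) (h := h) (j := j) (v := List.replicate (h - j) ⟨[]⟩)
          ⟨by simp, by rw [numBits_replicate]; omega⟩ (by simp; omega)
        rw [numBits_replicate, Nat.sub_zero] at this
        exact ⟨_, by rw [hL] at this; rw [hL]; exact this⟩
      · have hnum : numBits (⟨List.replicate (L - b) false⟩ :: List.replicate (h - j - 1) ⟨[]⟩)
            = L - b := by simp [numBits]
        have := bitTree_subtree (b := L) (h := h) (j := j)
          (v := ⟨List.replicate (L - b) false⟩ :: List.replicate (h - j - 1) ⟨[]⟩)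
          ⟨by simp; omega, by omega⟩ (by simp; omega)
        rw [hnum, Nat.sub_sub_self hb] at this
        exact ⟨_, this⟩
    by_cases hcase : 0 < j ∧ j < h
    · rw [if_pos hcase, List.mem_singleton] at hc
      subst hc
      obtain ⟨b, hb, rfl⟩ := List.mem_map.mp hS
      rw [List.mem_range] at hb
      exact key b (by omega) (Or.inr hcase.2)
    · rw [if_neg hcase, List.mem_singleton] at hc
      subst hc
      rw [List.mem_singleton] at hS
      subst hS
      exact key L le_rfl (Or.inl rfl)
  isChain := by
    intro j hj c hc
    by_cases hcase : 0 < j ∧ j < h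
    · rw [if_pos hcase, List.mem_singleton] at hc
      subst hc
      rw [List.pairwise_map]
      exact List.pairwise_lt_range.imp (fun hab => bitTree_strict hab hcase.1)
    · rw [if_neg hcase, List.mem_singleton] at hc
      subst hc
      exact List.pairwise_singleton _ _
  covers := by
    intro j hj v S hS
    have hv := bitTree_subtree hS.1 hS.2.1
    have hSeq : S = bitTree (Nat.log 2 ℓ - numBits v) j :=
      OrderedTree.ext' (hS.2.2.trans hv.2.2.symm)
    by_cases hcase : 0 < j ∧ j < h
    · rw [if_pos hcase]
      refine ⟨_, List.mem_singleton.mpr rfl, S, ?_, embeds_refl S, embeds_refl S⟩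
      exact List.mem_map.mpr ⟨_, List.mem_range.mpr (by omega), hSeq.symm⟩
    · rw [if_neg hcase]
      refine ⟨_, List.mem_singleton.mpr rfl, S, ?_, embeds_refl S, embeds_refl S⟩
      rw [List.mem_singleton, hSeq]
      have hlen := hS.2.1
      rcases Nat.eq_zero_or_pos j with rfl | hpos
      · apply OrderedTree.ext'
        ext t
        simp only [bitTree, Set.mem_ofPred_eq, Nat.le_zero, List.length_eq_zero_iff]
        constructor <;> rintro ⟨rfl, -⟩ <;> simp [numBits]
      · have hnil : v = [] := List.length_eq_zero_iff.mp (by omega)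
        subst hnil
        simp [numBits]

/-! ### The machine model: word RAM programs with unit cost -/

/-- Binary operations of the machine: truncated subtraction, integer division (`x / 0 = 0`), and the
comparisons with value `0` or `1`. -/
inductive BinOp
  | add | sub | mul | div | lt | eq

def BinOp.eval : BinOp → ℕ → ℕ → ℕ
  | .add, x, y => x + y
  | .sub, x, y => x - y
  | .mul, x, y => x * y
  | .div, x, y => x / y
  | .lt, x, y => if x < y then 1 else 0
  | .eq, x, y => if x = y then 1 else 0

/-- Expressions: constants, registers, array cells (array `a`, indirect address), operations. -/
inductive Expr
  | lit (k : ℕ)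
  | reg (x : ℕ)
  | get (a : ℕ) (idx : Expr)
  | op (o : BinOp) (e f : Expr)

/-- Programs. -/
inductive Prog
  | skip
  | assign (x : ℕ) (e : Expr)
  | store (a : ℕ) (idx e : Expr)
  | seq (p q : Prog)
  | ite (e : Expr) (p q : Prog)
  | while (e : Expr) (p : Prog)

/-- The memory: registers and arrays, all holding natural numbers. A program mentions only a fixed
finite number of registers and of arrays. -/
structure Mem where
  reg : ℕ → ℕ
  arr : ℕ → ℕ → ℕ

def Expr.eval (s : Mem) : Expr → ℕ
  | .lit k => k
  | .reg x => s.reg x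
  | .get a idx => s.arr a (idx.eval s)
  | .op o e f => o.eval (e.eval s) (f.eval s)

/-- The number of elementary steps needed to evaluate an expression. -/
def Expr.cost : Expr → ℕ
  | .lit _ => 1
  | .reg _ => 1
  | .get _ idx => idx.cost + 1
  | .op _ e f => e.cost + f.cost + 1

/-- All values (hence all addresses) that occur in the evaluation are at most `W`. -/
def Expr.Fits (W : ℕ) (s : Mem) : Expr → Prop
  | .lit k => k ≤ W
  | .reg x => s.reg x ≤ W
  | .get a idx => idx.Fits W s ∧ s.arr a (idx.eval s) ≤ W
  | .op o e f => e.Fits W s ∧ f.Fits W s ∧ o.eval (e.eval s) (f.eval s) ≤ W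

/-- `Exec W p s t s'`: with machine words that hold the numbers `0, …, W`, the program `p` started in
memory `s` halts after exactly `t` elementary steps with memory `s'`, without any overflow. -/
inductive Exec (W : ℕ) : Prog → Mem → ℕ → Mem → Prop
  | skip (s) : Exec W .skip s 1 s
  | assign (s x e) (he : e.Fits W s) :
      Exec W (.assign x e) s (e.cost + 1) ⟨Function.update s.reg x (e.eval s), s.arr⟩
  | store (s a idx e) (hi : idx.Fits W s) (he : e.Fits W s) :
      Exec W (.store a idx e) s (idx.cost + e.cost + 1)
        ⟨s.reg, Function.update s.arr a (Function.update (s.arr a) (idx.eval s) (e.eval s))⟩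
  | seq {s s' s'' p q t t'} (hp : Exec W p s t s') (hq : Exec W q s' t' s'') :
      Exec W (.seq p q) s (t + t') s''
  | ite_true {s s' e p q t} (he : e.Fits W s) (hne : e.eval s ≠ 0) (hp : Exec W p s t s') :
      Exec W (.ite e p q) s (e.cost + 1 + t) s'
  | ite_false {s s' e p q t} (he : e.Fits W s) (hz : e.eval s = 0) (hq : Exec W q s t s') :
      Exec W (.ite e p q) s (e.cost + 1 + t) s'
  | while_false {s e p} (he : e.Fits W s) (hz : e.eval s = 0) :
      Exec W (.while e p) s (e.cost + 1) s
  | while_true {s s' s'' e p t t'} (he : e.Fits W s) (hne : e.eval s ≠ 0) (hp : Exec W p s t s')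
      (hw : Exec W (.while e p) s' t' s'') : Exec W (.while e p) s (e.cost + 1 + t + t') s''

/-! ### Encoding of the input and of the output -/

/-- The bits of a tuple of binary strings in reading order, each one paired with the position
(`0` for the first component) of the component that it belongs to. -/
def bitList (v : List BinStr) : List (ℕ × Bool) :=
  (v.mapIdx (fun q s => s.bits.map (fun b => (q, b)))).flatten

/-- The bits of a label. -/
def labelBits {h : ℕ} {T : OrderedTree BinStr h} : Label T → List (ℕ × Bool)
  | none => []
  | some ξ => bitList ξ.1

/-- `0` for `⊤`, and one more than the number of bits for a leaf. -/
def labelSize {h : ℕ} {T : OrderedTree BinStr h} : Label T → ℕ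
  | none => 0
  | some ξ => numBits ξ.1 + 1

/-- An extended natural number as a machine word: `0` for `∞`, and `x + 1` for a finite `x`. -/
def codeENat (x : ℕ∞) : ℕ := if x = ⊤ then 0 else x.toNat + 1

/-- The node labeling `ν` is stored in the arrays `a`, `a + 1`, `a + 2`: cell `v` of array `a` holds
the size of the label of the node `v`, and the cells `L v + t`, `t = 0, 1, …`, of the other two
arrays hold the component position and the value of the `t`th bit of that label, where `L` is the
maximum number of bits. -/
def StoresLabeling {n h : ℕ} {T : OrderedTree BinStr h} (s : Mem) (a L : ℕ) (ν : Labeling n T) :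
    Prop :=
  ∀ v : Fin n, s.arr a v = labelSize (ν v) ∧
    ∀ (t : ℕ) (ht : t < (labelBits (ν v)).length),
      s.arr (a + 1) (L * v + t) = ((labelBits (ν v))[t]).1 ∧
      s.arr (a + 2) (L * v + t) = ((labelBits (ν v))[t]).2.toNat

/-- The initial memory. Registers `0`, `1`, `2` hold `n`, `d` and the number of arcs of `G_τ`; arrays
`0` and `1` the tails and heads of the arcs of `G_τ`; array `2` the priorities; array `3` the owners
of the nodes; arrays `4`, `5`, `6` the node labeling `μ`. All other
registers and arrays are `0`. -/
structure IsInput {n d h : ℕ} {T : OrderedTree BinStr h} (G : ParityGame n d)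
    (es : List (Fin n × Fin n)) (μ : Labeling n T) (s : Mem) : Prop where
  reg_n : s.reg 0 = n
  reg_d : s.reg 1 = d
  reg_m : s.reg 2 = es.length
  reg_other : ∀ x, 3 ≤ x → s.reg x = 0
  tail : ∀ (t : ℕ) (ht : t < es.length), s.arr 0 t = (es[t]).1
  head : ∀ (t : ℕ) (ht : t < es.length), s.arr 1 t = (es[t]).2
  prio : ∀ v : Fin n, s.arr 2 v = G.prio v
  owner : ∀ v : Fin n, s.arr 3 v = if v ∈ G.V₁ then 1 else 0
  labels : StoresLabeling s 4 (Nat.log 2 n) μ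
  arr_other : ∀ a x, 7 ≤ a → s.arr a x = 0

/-- The final memory describes an execution with a single chain per subcover: array `7` holds the
arc costs of the auxiliary digraph (row by row), array `8` the minimum bottleneck costs of the base
nodes, arrays `9`, `10`, `11` the initial labels and arrays `12`, `13`, `14` the returned labels. -/
structure IsOutput {n d h : ℕ} {T : OrderedTree BinStr h} (G : ParityGame n d) (τ : OddStrategy G)
    (c : Fin n → Fin n → ℕ∞) (i : Fin n → ℕ∞) (ν₀ ν : Labeling n T) (s : Mem) : Prop where
  costs : ∀ v w : Fin n, ArcD G τ v w → s.arr 7 (n * v + w) = codeENat (c v w)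
  cycles : ∀ w : Fin n, w ∈ baseNodes G τ → s.arr 8 w = codeENat (i w)
  initial : StoresLabeling s 9 (Nat.log 2 n) ν₀
  final : StoresLabeling s 12 (Nat.log 2 n) ν

end ParityLC

end

/-!
Write `L` for `⌊log₂ n⌋`, and `G_τ` for the game under the strategy. The theorem consists of a
statement about labelings, that the label-correcting algorithm returns the least fixed point of the
lift operators, and of a statement about a machine, that the algorithm runs in time `O(m n² L)` on
words of `O(log n + log d)` bits.

**Codes of labels.** A leaf of the tree of height `j` with at most `L` bits is coded by `L` integers:
a bit of the `i`th component from the end becomes `i` or `-i`, zeros fill the row, and the top label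
has constant code. The order of binary strings is designed in such a way that labels are ordered like
their codes, lexicographically (`code_lt_iff`). Deleting components means deleting the entries of
small absolute value (`truncSeq`), and the two kinds of labels that the algorithm needs, tight labels
and raised labels, arise from a code by filling up with least entries (`fillSeq`) or by increasing the
last entry that can be increased (`nextSeq`). Both take time `O(L)`, see `code_tight_even`,
`code_tight_odd` and `raise_of_not_copyMinSeq`.

**Arc costs.** For `j < d / 2`, the chain of subtrees of height `j` consists of the trees with
`0, 1, …, L` bits, and the tree with `i` bits is an initial segment of the one with `L` bits that is
recognized by leading minimal entries of the codes (`exists_padLeaf_eq`). Feasible labelings of walks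
that start in the segment stay in it (`WalkLabel.of_padLeaf`). Hence, for every node `w`, a single
Bellman–Ford computation with the largest tree, on the arcs whose tails have smaller priority than
`w`, yields all costs of arcs with head `w` (`arcCost`); the subgraphs `K_w` and `J_w` need not be
computed. A finite label is realized by a labeled walk to `w`, which bounds the greatest fixed point in
the definition of the lower bound (`costLower_le_arcCost`), and a labeled path, as in the definition
of the upper bound, bounds the computed label (`arcCost_le_costUpper`). Computed costs of arcs that
are not in the auxiliary digraph do no harm, as every closed walk lies in the digraph
(`minCycleCost_arcCost_le_iff`). Bottleneck costs of cycles are found by the Floyd–Warshall algorithm.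

**Correctness.** A labeling is a fixed point of the lift operators if and only if every node has an
outgoing arc that is not violated (`fixed_iff_supported`). Let `κ` be the least such labeling above `μ`.
If there are no loose arcs with respect to `μ`, then there are none with respect to `κ`
(`least_le_tight`), so the Bellman–Ford procedure preserves the property of being above `κ`. The
initial labels have this property by `least_le_raise`: a closed walk of cost at most `i` carries a
feasible labeling by leaves of one copy of the `i`th tree, and a labeling that supports itself in this
way bounds `κ` from above (`least_le_of_relation`). Conversely, a node with a finite label `κ` starts a
walk of tight arcs, which ends in a cycle. The labels of the cycle lie in a single copy of some tree,
so the initial label of its node of highest priority is at most its label in `κ` (`raise_le_least`),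
and the Bellman–Ford procedure propagates this bound along the walk.

**The machine.** The program is written in a language whose only loops are counting loops
(`LoopProg`), and is translated by `exec_compile`. Its running time is bounded by the product of the
bounds of nested loops (`timeBound_le`). Since no instruction stores more than a constant plus a number
from memory, all numbers remain polynomial in `n d` (`fits_of_tame`).

The register `0` holds `n`, `1` holds `d`, `2` holds `m`, `3` holds `L`, `4` holds `d / 2`, `5` and `6`
hold `d + 1` and `d + 2`, and `7` holds `n - 1`. The array `15` holds the current labels, `16` a single
label, `17` the labels `μ`, `18` the costs in the form `L + 1 - i` (with `0` for `∞`), and `19` to `21`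
the arcs and the priorities. An entry `z` of a code is stored as `z + d / 2`.
-/

namespace ParityLC

/-! ### Integer codes of labels -/

/-- The lexicographic order on integer sequences of length `L`. -/
def LexLT (L : ℕ) (a b : ℕ → ℤ) : Prop := ∃ t < L, (∀ s < t, a s = b s) ∧ a t < b t

lemma LexLT.asymm {L : ℕ} {a b : ℕ → ℤ} (h : LexLT L a b) : ¬ LexLT L b a := by
  rintro ⟨t', ht', he', hl'⟩
  obtain ⟨t, ht, he, hl⟩ := h
  rcases lt_trichotomy t t' with h1 | h1 | h1
  · have := he' t h1; omega
  · subst h1; omega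
  · have := he t' h1; omega

lemma not_lexLT_of_le {L : ℕ} {a b : ℕ → ℤ} (h : ∀ t < L, a t ≤ b t) : ¬ LexLT L b a := by
  rintro ⟨t, ht, -, hl⟩
  have := h t ht; omega

lemma LexLT.congr {L : ℕ} {a b a' b' : ℕ → ℤ} (h : LexLT L a b) (ha : ∀ t < L, a t = a' t)
    (hb : ∀ t < L, b t = b' t) : LexLT L a' b' := by
  obtain ⟨t, ht, he, hl⟩ := h
  refine ⟨t, ht, fun s hs => ?_, ?_⟩
  · rw [← ha s (by omega), ← hb s (by omega)]; exact he s hs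
  · rw [← ha t ht, ← hb t ht]; exact hl

/-- The sequences that occur as codes of leaves of a tree of height `J` (with `L` bits). -/
def ValidSeq (L J : ℕ) (z : ℕ → ℤ) : Prop :=
  (∀ t < L, |z t| ≤ J) ∧ ∀ s t, s ≤ t → t < L → |z t| ≤ |z s|

/-- Truncation of sequences: the entries of absolute value at most `g` are deleted. -/
def truncSeq (g : ℕ) (z : ℕ → ℤ) (t : ℕ) : ℤ := if |z t| ≤ g then 0 else z t

/-- The least sequence with the same truncation. -/
def fillSeq (g : ℕ) (z : ℕ → ℤ) (t : ℕ) : ℤ := if |z t| ≤ g then -g else z t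

/-- Filling up with `-g` keeps the absolute values nonincreasing. -/
lemma fillSeq_valid {L J g : ℕ} {z : ℕ → ℤ} (hz : ValidSeq L J z) (hg : g ≤ J) :
    ValidSeq L J (fillSeq g z) := by
  constructor
  · intro t ht
    have := hz.1 t ht
    unfold fillSeq; split_ifs
    · rw [abs_neg, Nat.abs_cast]; exact_mod_cast hg
    · exact this
  · intro s t hst ht
    have := hz.2 s t hst ht
    unfold fillSeq; split_ifs with h1 h2 h2
    · rfl
    · rw [abs_neg, Nat.abs_cast]; omega
    · omega
    · exact this

lemma truncSeq_fillSeq (g : ℕ) (z : ℕ → ℤ) : truncSeq g (fillSeq g z) = truncSeq g z := by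
  funext t
  unfold truncSeq fillSeq
  split_ifs <;> simp_all

/-- A sequence below the truncation of which `z` does not lie cannot be below `fillSeq g z`. -/
lemma fillSeq_least {L g : ℕ} {z x : ℕ → ℤ}
    (h : ¬ LexLT L (truncSeq g x) (truncSeq g z)) : ¬ LexLT L x (fillSeq g z) := by
  rintro ⟨t, ht, he, hl⟩
  apply h
  have key : ∀ s, x s = fillSeq g z s → truncSeq g x s = truncSeq g z s := by
    intro s hs
    rw [← truncSeq_fillSeq g z]
    unfold truncSeq; rw [hs]
  by_cases h1 : |z t| ≤ g
  · refine ⟨t, ht, fun s hs => key s (he s hs), ?_⟩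
    rw [fillSeq, if_pos h1] at hl
    have h2 : ¬ |x t| ≤ g := by rw [abs_le]; omega
    unfold truncSeq; rw [if_neg h2, if_pos h1]; omega
  · refine ⟨t, ht, fun s hs => key s (he s hs), ?_⟩
    rw [fillSeq, if_neg h1] at hl
    unfold truncSeq; rw [if_neg h1]
    split_ifs with h2
    · rw [abs_le] at h1 h2; omega
    · exact hl

/-- The absolute value of the predecessor of position `t` in the truncation of `z`, with the value
`J` in front of the first position. -/
def prevAbs (g J : ℕ) (z : ℕ → ℤ) (t : ℕ) : ℤ := if t = 0 then J else |truncSeq g z (t - 1)|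

/-- The value by which a truncated sequence is increased at position `t`. -/
def incr (g : ℕ) (z : ℕ → ℤ) (t : ℕ) : ℤ := if |z t| ≤ g then g + 1 else z t + 1

/-- The truncation of `z` has a larger sequence with at most `B` nonzero entries that agrees with it
up to position `t` and differs from it there. -/
def CanIncr (L g B J : ℕ) (z : ℕ → ℤ) (t : ℕ) : Prop :=
  (t < B ∧ incr g z t ≤ prevAbs g J z t) ∨ (t = B ∧ t < L ∧ z t < -g)

/-- The value at the position of the increase. -/
def incrVal (g B : ℕ) (z : ℕ → ℤ) (t : ℕ) : ℤ := if t < B then incr g z t else -g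

/-- The sequence `z`, increased at position `b`, and continued in the least possible way. -/
def nextSeq (g B : ℕ) (z : ℕ → ℤ) (b t : ℕ) : ℤ :=
  if t < b then z t else if t = b then incrVal g B z b
  else if t < B then -|incrVal g B z b| else -g

lemma abs_le_incr {g : ℕ} {z : ℕ → ℤ} {t : ℕ} {c : ℤ} (h : incr g z t ≤ c) (h2 : |z t| ≤ c) :
    |incr g z t| ≤ c := by
  unfold incr at *
  split_ifs at * with h1
  · rw [abs_of_nonneg (by omega)]; exact h
  · rw [abs_le] at *; omega

lemma le_abs_incr (g : ℕ) (z : ℕ → ℤ) (t : ℕ) : (g : ℤ) ≤ |incr g z t| := by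
  unfold incr
  split_ifs with h1
  · rw [abs_of_nonneg (by omega)]; omega
  · rw [abs_le] at h1; rw [le_abs]; omega

lemma abs_truncSeq_le (g : ℕ) (z : ℕ → ℤ) (t : ℕ) : |truncSeq g z t| ≤ |z t| := by
  unfold truncSeq; split_ifs
  · simp
  · rfl

/-- All positions before a position of increase survive the truncation. -/
lemma CanIncr.lt_abs {L g B J : ℕ} {z : ℕ → ℤ} {b : ℕ} (hz : ValidSeq L J z) (hBL : B ≤ L)
    (hb : CanIncr L g B J z b) {s : ℕ} (hs : s < b) : (g : ℤ) < |z s| := by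
  have hbL : b < L := by rcases hb with h | h <;> omega
  have h0 : |z (b - 1)| ≤ |z s| := hz.2 s (b - 1) (by omega) (by omega)
  have h0' : |z b| ≤ |z s| := hz.2 s b (by omega) (by omega)
  rcases hb with ⟨h1, h2⟩ | ⟨h1, h2, h3⟩
  · by_cases h3 : |z b| ≤ g
    · rw [incr, if_pos h3, prevAbs, if_neg (by omega)] at h2
      have : |truncSeq g z (b - 1)| ≤ |z (b - 1)| := abs_truncSeq_le _ _ _
      omega
    · omega
  · have : -z b ≤ |z b| := neg_le_abs _
    omega

lemma prevAbs_le {g J : ℕ} {z : ℕ → ℤ} {b : ℕ} (hb : b ≠ 0) :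
    prevAbs g J z b ≤ |z (b - 1)| := by
  rw [prevAbs, if_neg hb]; exact abs_truncSeq_le _ _ _

/-- The new entry fits behind the entries in front of it, so that the result is again a code. -/
lemma abs_incrVal_le {L g B J : ℕ} {z : ℕ → ℤ} {b : ℕ} (hz : ValidSeq L J z) (hBL : B ≤ L)
    (hb : CanIncr L g B J z b) :
    |incrVal g B z b| ≤ J ∧ ∀ s < b, |incrVal g B z b| ≤ |z s| := by
  have hbL : b < L := by rcases hb with h | h <;> omega
  rcases hb with ⟨h1, h2⟩ | ⟨h1, h2, h3⟩
  · rw [incrVal, if_pos h1]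
    have hJ := hz.1 b hbL
    have hp : |incr g z b| ≤ J := by
      apply abs_le_incr _ hJ
      rcases Nat.eq_zero_or_pos b with h0 | h0
      · rw [prevAbs, if_pos h0] at h2; exact h2
      · have := prevAbs_le (g := g) (J := J) (z := z) h0.ne'
        have := hz.1 (b - 1) (by omega)
        omega
    refine ⟨hp, fun s hs => ?_⟩
    have h4 : |z (b - 1)| ≤ |z s| := hz.2 s (b - 1) (by omega) (by omega)
    have := prevAbs_le (g := g) (J := J) (z := z) (b := b) (by omega)
    have h5 : |z b| ≤ |z s| := hz.2 s b (by omega) (by omega)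
    exact abs_le_incr (by omega) h5
  · rw [incrVal, if_neg (by omega), abs_neg, Nat.abs_cast]
    have h5 : (g : ℤ) < |z b| := by rw [lt_abs]; omega
    refine ⟨by have := hz.1 b hbL; omega, fun s hs => ?_⟩
    have h5 : |z b| ≤ |z s| := hz.2 s b (by omega) (by omega)
    omega

lemma le_abs_incrVal (g B : ℕ) (z : ℕ → ℤ) (b : ℕ) : (g : ℤ) ≤ |incrVal g B z b| := by
  unfold incrVal; split_ifs
  · exact le_abs_incr _ _ _
  · rw [abs_neg, Nat.abs_cast]

lemma nextSeq_valid {L g B J : ℕ} {z : ℕ → ℤ} {b : ℕ} (hz : ValidSeq L J z) (hBL : B ≤ L)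
    (hb : CanIncr L g B J z b) : ValidSeq L J (nextSeq g B z b) := by
  obtain ⟨h1, h2⟩ := abs_incrVal_le hz hBL hb
  have h3 := le_abs_incrVal g B z b
  constructor
  · intro t ht
    have := hz.1 t ht
    unfold nextSeq; split_ifs
    · exact this
    · exact h1
    · simpa using h1
    · simp; omega
  · intro s t hst ht
    have := hz.2 s t hst ht
    have h4 := h2 s
    unfold nextSeq
    split_ifs <;> first | omega | (simp only [abs_neg, abs_abs, Nat.abs_cast]; try omega)

/-- Before position `B`, the entries of `nextSeq` are the ones of a least completion. -/
lemma nextSeq_canonical {L g B J : ℕ} {z : ℕ → ℤ} {b : ℕ} (hz : ValidSeq L J z) (hBL : B ≤ L)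
    (hb : CanIncr L g B J z b) (t : ℕ) :
    (t < B → (g : ℤ) < |nextSeq g B z b t| ∨ nextSeq g B z b t = -g) ∧
      (B ≤ t → nextSeq g B z b t = -g) := by
  have hbB : b ≤ B := by rcases hb with h | h <;> omega
  have h1 := hb.lt_abs hz hBL (s := t)
  have h2 : b < B → (g : ℤ) < |incrVal g B z b| ∨ incrVal g B z b = -g := by
    intro h
    rw [incrVal, if_pos h, incr]
    split_ifs with h1
    · left; rw [abs_of_nonneg] <;> omega
    · rw [abs_le] at h1; rw [lt_abs]; omega
  constructor
  · intro ht
    unfold nextSeq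
    split_ifs with h3 h4
    · exact Or.inl (h1 h3)
    · exact h2 (by omega)
    · rcases h2 (by omega) with h5 | h5
      · left; simpa using h5
      · right; rw [h5]; simp
  · intro ht
    unfold nextSeq
    split_ifs with h3 h4
    · omega
    · rw [incrVal, if_neg (by omega)]
    · omega
    · rfl

/-- The increase is visible after truncation: either a deleted entry is replaced by `g + 1`, or a
surviving entry grows, or the sequence ends at a surviving negative entry. -/
lemma truncSeq_lt_incrVal {L g B J : ℕ} {z : ℕ → ℤ} {b : ℕ} (hb : CanIncr L g B J z b) :
    truncSeq g z b < truncSeq g (nextSeq g B z b) b := by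
  have hn : nextSeq g B z b b = incrVal g B z b := by simp [nextSeq]
  unfold truncSeq
  rw [hn]
  rcases hb with ⟨h1, h2⟩ | ⟨h1, h2, h3⟩
  · rw [incrVal, if_pos h1]
    unfold incr
    split_ifs with h4 h5 h5
    · rw [abs_le] at h5; omega
    · omega
    · rw [abs_le] at h4 h5; omega
    · omega
  · have h4 : ¬ |z b| ≤ g := by rw [abs_le]; omega
    have h5 : incrVal g B z b = -g := by rw [incrVal, if_neg (by omega)]
    rw [if_neg h4, h5, if_pos (by simp)]
    omega

lemma lexLT_truncSeq_nextSeq {L g B J : ℕ} {z : ℕ → ℤ} {b : ℕ} (hBL : B ≤ L)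
    (hb : CanIncr L g B J z b) :
    LexLT L (truncSeq g z) (truncSeq g (nextSeq g B z b)) := by
  refine ⟨b, by rcases hb with h | h <;> omega, fun s hs => ?_, truncSeq_lt_incrVal hb⟩
  simp [truncSeq, nextSeq, hs]

/-- A valid sequence with a larger truncation that vanishes from position `B` on shows that an
increase is possible, and it is not smaller than the one obtained by increasing as late as
possible. -/
lemma nextSeq_least {L g B J : ℕ} {z x : ℕ → ℤ} (hz : ValidSeq L J z) (hBL : B ≤ L)
    (hx : ValidSeq L J x) (hxB : ∀ t, B ≤ t → t < L → |x t| ≤ g)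
    (h : LexLT L (truncSeq g z) (truncSeq g x)) :
    (∃ t, CanIncr L g B J z t) ∧ ∀ b, CanIncr L g B J z b → (∀ t, CanIncr L g B J z t → t ≤ b) →
      ¬ LexLT L x (nextSeq g B z b) := by
  obtain ⟨t0, ht0, he, hl⟩ := h
  have hcan : CanIncr L g B J z t0 := by
    rcases lt_or_ge t0 B with h1 | h1
    · left
      refine ⟨h1, ?_⟩
      by_cases h2 : |z t0| ≤ g
      · have h3 : ¬ |x t0| ≤ g := by
          intro h3
          simp [truncSeq, h2, h3] at hl
        have h4 : (g : ℤ) < x t0 := by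
          simp only [truncSeq, h2, h3, if_true, if_false] at hl
          rw [abs_of_pos hl] at h3; omega
        rw [incr, if_pos h2]
        unfold prevAbs
        split_ifs with h5
        · have := hx.1 t0 ht0
          rw [abs_of_pos (by omega)] at this; omega
        · rw [he (t0 - 1) (by omega)]
          have := hx.2 (t0 - 1) t0 (by omega) ht0
          rw [truncSeq, if_neg (by omega)]
          rw [abs_of_pos (a := x t0) (by omega)] at this; omega
      · rw [incr, if_neg h2]
        rw [truncSeq, if_neg h2] at hl
        have h6 : truncSeq g x t0 ≤ |truncSeq g x t0| := le_abs_self _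
        unfold prevAbs
        split_ifs with h5
        · have := hx.1 t0 ht0
          have := abs_truncSeq_le g x t0
          omega
        · rw [he (t0 - 1) (by omega)]
          have := hx.2 (t0 - 1) t0 (by omega) ht0
          have : |truncSeq g x t0| ≤ |truncSeq g x (t0 - 1)| := by
            unfold truncSeq
            split_ifs
            · simp
            · simp
            · omega
            · exact this
          omega
    · have hx0 : truncSeq g x t0 = 0 := by rw [truncSeq, if_pos (hxB t0 h1 ht0)]
      rw [hx0] at hl
      have h2 : z t0 < -g := by
        unfold truncSeq at hl
        split_ifs at hl with h3
        · omega
        · rw [abs_le] at h3; omega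
      rcases h1.lt_or_eq with h3 | h3
      · exfalso
        have h4 := he B h3
        rw [truncSeq, truncSeq, if_pos (hxB B le_rfl (by omega))] at h4
        have h5 := hz.2 B t0 (by omega) ht0
        have : -z t0 ≤ |z t0| := neg_le_abs _
        rw [if_neg (by omega)] at h4
        rw [h4] at h5; simp at h5; omega
      · exact Or.inr ⟨h3.symm, by omega, h2⟩
  refine ⟨⟨t0, hcan⟩, fun b hb hmax => ?_⟩
  have htb := hmax t0 hcan
  have hbL : b < L := by rcases hb with h | h <;> omega
  have hbB : b ≤ B := by rcases hb with h | h <;> omega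
  have hbig : ∀ s < b, (g : ℤ) < |z s| := fun s hs => hb.lt_abs hz hBL hs
  have hagree : ∀ s < t0, nextSeq g B z b s = x s := by
    intro s hs
    have h1 := he s hs
    have h2 := hbig s (by omega)
    rw [truncSeq, if_neg (by omega), truncSeq] at h1
    rw [nextSeq, if_pos (by omega), h1]
    split_ifs at h1 ⊢ with h3
    · rw [h1] at h2; simp at h2; omega
    · rfl
  rcases htb.lt_or_eq with h1 | h1
  · apply LexLT.asymm
    refine ⟨t0, ht0, hagree, ?_⟩
    have h2 := hbig t0 h1
    rw [nextSeq, if_pos h1]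
    rw [truncSeq, if_neg (by omega), truncSeq] at hl
    split_ifs at hl with h3
    · rw [abs_of_neg hl] at h2
      rw [abs_le] at h3; omega
    · exact hl
  · subst h1
    have hge : incrVal g B z t0 ≤ x t0 := by
      unfold incrVal
      split_ifs with h2
      · unfold incr
        unfold truncSeq at hl
        split_ifs at * with h3 h4 h4
        · omega
        · rw [abs_of_pos hl] at h4; omega
        · rw [abs_le] at h3 h4; omega
        · omega
      · have := hxB t0 (by omega) ht0
        rw [abs_le] at this; omega
    rcases hge.lt_or_eq with h2 | h2
    · apply LexLT.asymm
      refine ⟨t0, ht0, hagree, ?_⟩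
      simpa [nextSeq] using h2
    · apply not_lexLT_of_le
      intro t ht
      rcases lt_trichotomy t t0 with h3 | h3 | h3
      · exact (hagree t h3).le
      · subst h3
        simp [nextSeq, h2]
      · rw [nextSeq, if_neg (by omega), if_neg (by omega)]
        split_ifs with h4
        · rw [h2]
          have := hx.2 t0 t h3.le ht
          exact (abs_le.mp this).1
        · exact (abs_le.mp (hxB t (by omega) ht)).1

/-! ### Lexicographic order of lists -/

lemma take_le_take {M : Type*} [LinearOrder M] (k : ℕ) {a b : List M} (h : a ≤ b) :
    a.take k ≤ b.take k := by
  rw [← not_lt] at h ⊢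
  refine fun hlt => h ?_
  clear h
  induction k generalizing a b with
  | zero => simp at hlt
  | succ k ih =>
    cases b with
    | nil =>
      cases a with
      | nil => simp at hlt
      | cons x a => exact List.nil_lt_cons _ _
    | cons y b =>
      cases a with
      | nil => simp at hlt
      | cons x a =>
        rw [List.take_succ_cons, List.take_succ_cons, List.cons_lt_cons_iff] at hlt
        rw [List.cons_lt_cons_iff]
        exact hlt.imp id (And.imp id ih)

lemma append_lt_append_iff {M : Type*} [LinearOrder M] {u u' : List M}
    (h : u.length = u'.length) (w : List M) : u ++ w < u' ++ w ↔ u < u' := by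
  induction u generalizing u' with
  | nil =>
    have : u' = [] := List.length_eq_zero_iff.mp h.symm
    subst this; simp
  | cons x u ih =>
    cases u' with
    | nil => simp at h
    | cons y u' =>
      simp only [List.cons_append, List.cons_lt_cons_iff]
      rw [ih (by simpa using h)]

lemma append_lt_append_left_iff {M : Type*} [LinearOrder M] (w u u' : List M) :
    w ++ u < w ++ u' ↔ u < u' := by
  induction w with
  | nil => simp
  | cons x w ih => simp [ih]

/-! ### Tight labels -/

section Tight

variable {M : Type*} {h : ℕ} {T : OrderedTree M h}

lemma trunc_coe (p : ℕ) (x : Leaf T) :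
    trunc p (x : Label T) = ((x.1.take (h - p / 2) : List M) : WithTop (List M)) := rfl

variable [LinearOrder M]

/-- The smallest label of the tail of an arc for which the arc is not violated. -/
noncomputable def tight (p : ℕ) (b : Label T) : Label T := minOf {ξ | NonViolated p ξ b}

lemma trunc_mono (p : ℕ) {a b : Label T} (hab : a ≤ b) : trunc p a ≤ trunc p b := by
  refine WithTop.monotone_map_iff.mpr ?_ hab
  intro x y hxy
  exact take_le_take _ hxy

lemma nonViolated_top (p : ℕ) (b : Label T) : NonViolated p ⊤ b := by
  unfold NonViolated
  split_ifs
  · exact le_top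
  · rcases eq_or_ne b ⊤ with rfl | hb
    · exact Or.inr ⟨rfl, rfl⟩
    · left
      obtain ⟨b, rfl⟩ := WithTop.ne_top_iff_exists.mp hb
      exact WithTop.coe_lt_top _

lemma NonViolated.mono {p : ℕ} {a a' b b' : Label T} (hv : NonViolated p a b) (ha : a ≤ a')
    (hb : b' ≤ b) : NonViolated p a' b' := by
  have h1 := trunc_mono p ha
  have h2 := trunc_mono p hb
  unfold NonViolated at *
  split_ifs at * with hp
  · exact h2.trans (hv.trans h1)
  · rcases hv with hv | ⟨rfl, rfl⟩
    · exact Or.inl (h2.trans_lt (hv.trans_le h1))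
    · rw [top_le_iff] at ha
      subst ha
      have := nonViolated_top p b'
      rw [NonViolated, if_neg hp] at this
      exact this

/-- The labels of the tail for which an arc is not violated form an upper set, which is determined
by its least element. -/
lemma nonViolated_iff {p : ℕ} {a b : Label T} : NonViolated p a b ↔ tight p b ≤ a := by
  have h1 : IsLeast {ξ : Label T | NonViolated p ξ b} (tight p b) :=
    minOf_isLeast ⟨⊤, nonViolated_top p b⟩
  exact ⟨fun h => h1.2 h, fun h => NonViolated.mono h1.1 h le_rfl⟩

lemma nonViolated_tight (p : ℕ) (b : Label T) : NonViolated p (tight p b) b :=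
  nonViolated_iff.mpr le_rfl

lemma tight_mono (p : ℕ) {b b' : Label T} (hb : b ≤ b') : tight p b ≤ tight p b' :=
  nonViolated_iff.mp ((nonViolated_tight p b').mono le_rfl hb)

lemma tight_iff {p : ℕ} {a b : Label T} : Tight p a b ↔ a = tight p b := by
  have h1 : IsLeast {ξ : Label T | NonViolated p ξ b} (tight p b) :=
    minOf_isLeast ⟨⊤, nonViolated_top p b⟩
  exact ⟨fun h => h.unique h1, fun h => h ▸ h1⟩

lemma loose_iff {p : ℕ} {a b : Label T} : Loose p a b ↔ tight p b < a := by
  rw [Loose, nonViolated_iff, tight_iff, lt_iff_le_and_ne, ne_comm]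

lemma drop_eq (p : ℕ) (a b : Label T) : drop p a b = min a (tight p b) := by
  have h1 : IsGreatest {ξ | ξ ≤ a ∧ ¬ Loose p ξ b} (min a (tight p b)) := by
    constructor
    · exact ⟨min_le_left _ _, by rw [loose_iff, not_lt]; exact min_le_right _ _⟩
    · rintro x ⟨hx, hl⟩
      rw [loose_iff, not_lt] at hl
      exact le_min hx hl
  exact (maxOf_isGreatest ⟨_, h1.1⟩).unique h1

lemma lift_eq (p : ℕ) (a b : Label T) : lift p a b = max a (tight p b) := by
  have h1 : IsLeast {ξ | a ≤ ξ ∧ NonViolated p ξ b} (max a (tight p b)) := by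
    constructor
    · exact ⟨le_max_left _ _, nonViolated_iff.mpr (le_max_right _ _)⟩
    · rintro x ⟨hx, hl⟩
      exact max_le hx (nonViolated_iff.mp hl)
  exact (minOf_isLeast ⟨_, h1.1⟩).unique h1

lemma tight_top (p : ℕ) : tight p (⊤ : Label T) = ⊤ := by
  have h1 := nonViolated_tight p (⊤ : Label T)
  unfold NonViolated at h1
  by_contra hne
  obtain ⟨x, hx⟩ := WithTop.ne_top_iff_exists.mp hne
  rw [← hx] at h1
  split_ifs at h1
  · exact absurd h1 (not_le_of_gt (WithTop.coe_lt_top _))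
  · rcases h1 with h1 | h1
    · exact absurd h1 (not_lt_of_ge le_top)
    · exact hne (hx ▸ h1.1)

lemma nonViolated_coe {p : ℕ} {a b : Leaf T} : NonViolated p (a : Label T) b ↔
    if Even p then b.1.take (h - p / 2) ≤ a.1.take (h - p / 2)
    else b.1.take (h - p / 2) < a.1.take (h - p / 2) := by
  unfold NonViolated
  simp only [trunc_coe, WithTop.coe_le_coe, WithTop.coe_lt_coe, WithTop.coe_ne_top, false_and,
    or_false]

/-- Finiteness propagates along arcs that are not violated. -/
lemma NonViolated.ne_top {p : ℕ} {a b : Label T} (hv : NonViolated p a b) (ha : a ≠ ⊤) :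
    b ≠ ⊤ := by
  rintro rfl
  rw [nonViolated_iff, tight_top, top_le_iff] at hv
  exact ha hv

end Tight

/-! ### Codes of tuples of binary strings -/

/-- The nonzero entries of the code of a tuple of binary strings: a bit of the `i`th component from
the end is coded by `i` or `-i`. -/
def symb : List BinStr → List ℤ
  | [] => []
  | s :: r => s.bits.map (fun b => if b then (r.length + 1 : ℤ) else -(r.length + 1)) ++ symb r

/-- The code of a tuple of binary strings, continued by zeros. -/
def codeSeq (ξ : List BinStr) (t : ℕ) : ℤ := (symb ξ).getD t 0

lemma length_symb (ξ : List BinStr) : (symb ξ).length = numBits ξ := by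
  induction ξ with
  | nil => rfl
  | cons s r ih => simp [symb, numBits] at *; exact ih

lemma symb_bounds (ξ : List BinStr) : ∀ x ∈ symb ξ, x ≠ 0 ∧ |x| ≤ ξ.length := by
  induction ξ with
  | nil => simp [symb]
  | cons s r ih =>
    intro x hx
    simp only [symb, List.mem_append, List.mem_map] at hx
    rcases hx with ⟨b, -, rfl⟩ | hx
    · have : (0 : ℤ) ≤ (r.length : ℤ) + 1 := by omega
      cases b
      · simp only [Bool.false_eq_true, if_false, abs_neg, abs_of_nonneg this, List.length_cons,
          Nat.cast_add, Nat.cast_one, le_refl, and_true, ne_eq]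
        intro h0; linarith
      · simp only [if_true, abs_of_nonneg this, List.length_cons,
          Nat.cast_add, Nat.cast_one, le_refl, and_true, ne_eq]
        intro h0; linarith
    · have := ih x hx
      refine ⟨this.1, this.2.trans ?_⟩
      simp

/-- Bits of earlier components have larger absolute values, so a code determines its components. -/
lemma symb_pairwise (ξ : List BinStr) : (symb ξ).Pairwise (fun x y => |y| ≤ |x|) := by
  induction ξ with
  | nil => simp [symb]
  | cons s r ih =>
    have hab : ∀ b : Bool, |(if b then (r.length + 1 : ℤ) else -(r.length + 1))| = r.length + 1 := by
      have : (0 : ℤ) ≤ (r.length : ℤ) + 1 := by omega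
      intro b; cases b
      · simp only [Bool.false_eq_true, if_false, abs_neg, abs_of_nonneg this]
      · simp only [if_true, abs_of_nonneg this]
    rw [symb, List.pairwise_append]
    refine ⟨?_, ih, ?_⟩
    · rw [List.pairwise_map]
      exact List.pairwise_of_forall (fun x y => by rw [hab, hab])
    · intro x hx y hy
      obtain ⟨b, -, rfl⟩ := List.mem_map.mp hx
      rw [hab]
      have := (symb_bounds r y hy).2
      omega

lemma codeSeq_of_lt {ξ : List BinStr} {t : ℕ} (ht : t < (symb ξ).length) :
    codeSeq ξ t = (symb ξ)[t] := by
  rw [codeSeq, List.getD_eq_getElem?_getD, List.getElem?_eq_getElem ht]; rfl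

lemma codeSeq_of_ge {ξ : List BinStr} {t : ℕ} (ht : numBits ξ ≤ t) : codeSeq ξ t = 0 := by
  rw [codeSeq, List.getD_eq_getElem?_getD, List.getElem?_eq_none (by rw [length_symb]; exact ht)]
  rfl

lemma codeSeq_ne_zero {ξ : List BinStr} {t : ℕ} (ht : t < numBits ξ) : codeSeq ξ t ≠ 0 := by
  rw [← length_symb] at ht
  rw [codeSeq_of_lt ht]
  exact (symb_bounds ξ _ (List.getElem_mem ht)).1

lemma abs_codeSeq_le (ξ : List BinStr) (t : ℕ) : |codeSeq ξ t| ≤ ξ.length := by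
  by_cases ht : t < (symb ξ).length
  · rw [codeSeq_of_lt ht]
    exact (symb_bounds ξ _ (List.getElem_mem ht)).2
  · rw [codeSeq_of_ge (by rw [← length_symb]; omega)]; simp

lemma codeSeq_valid (L : ℕ) (ξ : List BinStr) : ValidSeq L ξ.length (codeSeq ξ) := by
  refine ⟨fun t _ => abs_codeSeq_le ξ t, fun s t hst _ => ?_⟩
  by_cases ht : t < (symb ξ).length
  · rcases hst.lt_or_eq with h1 | rfl
    · rw [codeSeq_of_lt ht, codeSeq_of_lt (h1.trans ht)]
      exact List.pairwise_iff_getElem.mp (symb_pairwise ξ) s t _ _ h1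
    · rfl
  · rw [codeSeq_of_ge (by rw [← length_symb]; omega)]; simp

lemma codeSeq_cons (s : BinStr) (r : List BinStr) (t : ℕ) : codeSeq (s :: r) t =
    if h : t < s.bits.length then (if s.bits[t] then (r.length + 1 : ℤ) else -(r.length + 1))
    else codeSeq r (t - s.bits.length) := by
  unfold codeSeq
  rw [symb, List.getD_eq_getElem?_getD, List.getElem?_append, List.length_map]
  split_ifs with h1 <;> simp_all

lemma bits_lt_cases {a b : List Bool} (h : BinStr.mk a < BinStr.mk b) :
    ∃ t, (∀ s < t, ∃ (h1 : s < a.length) (h2 : s < b.length), a[s] = b[s]) ∧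
      ((∃ h1 : t < a.length, a[t] = false ∧ (t = b.length ∨ ∃ h2 : t < b.length, b[t] = true)) ∨
        (t = a.length ∧ ∃ h2 : t < b.length, b[t] = true)) := by
  induction a generalizing b with
  | nil =>
    cases b with
    | nil => exact absurd h (lt_irrefl _)
    | cons y b =>
      refine ⟨0, by simp, Or.inr ⟨rfl, by simp, ?_⟩⟩
      cases y
      · exact absurd h (BinStr.zero_lt_nil b).asymm
      · rfl
  | cons x a ih =>
    cases b with
    | nil =>
      refine ⟨0, by simp, Or.inl ⟨by simp, ?_, Or.inl rfl⟩⟩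
      cases x
      · rfl
      · exact absurd h (BinStr.nil_lt_one a).asymm
    | cons y b =>
      by_cases hxy : x = y
      · subst hxy
        rw [BinStr.cons_lt_cons] at h
        obtain ⟨t, h1, h2⟩ := ih h
        refine ⟨t + 1, ?_, ?_⟩
        · intro s hs
          cases s with
          | zero => simp
          | succ s =>
            obtain ⟨h3, h4, h5⟩ := h1 s (by omega)
            exact ⟨by simpa using h3, by simpa using h4, by simpa using h5⟩
        · simpa using h2
      · refine ⟨0, by simp, Or.inl ⟨by simp, ?_⟩⟩
        cases x <;> cases y
        · exact absurd rfl hxy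
        · simp
        · exact absurd h ((BinStr.zero_lt_nil b).trans (BinStr.nil_lt_one a)).asymm
        · exact absurd rfl hxy

/-- Codes are strictly monotone. -/
lemma codeSeq_lt {ξ η : List BinStr} (hlen : ξ.length = η.length) (h : ξ < η) :
    ∃ t, (∀ s < t, codeSeq ξ s = codeSeq η s) ∧ codeSeq ξ t < codeSeq η t := by
  induction ξ generalizing η with
  | nil =>
    have : η = [] := List.length_eq_zero_iff.mp hlen.symm
    subst this; exact absurd h (lt_irrefl _)
  | cons s r ih =>
    cases η with
    | nil => simp at hlen
    | cons s' r' =>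
      have hlen' : r.length = r'.length := by simpa using hlen
      rw [List.cons_lt_cons_iff] at h
      rcases h with h | ⟨rfl, h⟩
      · obtain ⟨t, h1, h2⟩ := bits_lt_cases h
        have hb : ∀ u : List BinStr, ∀ k : ℕ, -(u.length : ℤ) ≤ codeSeq u k ∧
            codeSeq u k ≤ u.length := fun u k => abs_le.mp (abs_codeSeq_le u k)
        refine ⟨t, ?_, ?_⟩
        · intro k hk
          obtain ⟨h3, h4, h5⟩ := h1 k hk
          rw [codeSeq_cons, codeSeq_cons, dif_pos h3, dif_pos h4, h5, hlen']
        · rw [codeSeq_cons, codeSeq_cons]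
          have hb1 := hb r (t - s.bits.length)
          have hb2 := hb r' (t - s'.bits.length)
          rcases h2 with ⟨h3, h4, rfl | ⟨h5, h6⟩⟩ | ⟨rfl, h5, h6⟩
          · rw [dif_pos h3, dif_neg (lt_irrefl _), h4]
            simp only [Bool.false_eq_true, if_false]; omega
          · rw [dif_pos h3, dif_pos h5, h4, h6]
            simp only [Bool.false_eq_true, if_false, if_true]; omega
          · rw [dif_neg (lt_irrefl _), dif_pos h5, h6]
            simp only [if_true]; omega
      · obtain ⟨t, h1, h2⟩ := ih hlen' h
        refine ⟨t + s.bits.length, ?_, ?_⟩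
        · intro k hk
          rw [codeSeq_cons, codeSeq_cons, hlen']
          split_ifs <;> first | rfl | exact h1 _ (by omega)
        · rw [codeSeq_cons, codeSeq_cons, dif_neg (by omega), dif_neg (by omega)]
          simpa using h2

lemma codeSeq_lexLT {L : ℕ} {ξ η : List BinStr} (hlen : ξ.length = η.length)
    (hξ : numBits ξ ≤ L) (hη : numBits η ≤ L) :
    ξ < η ↔ LexLT L (codeSeq ξ) (codeSeq η) := by
  have key : ∀ {ξ η : List BinStr}, ξ.length = η.length → numBits ξ ≤ L → numBits η ≤ L →
      ξ < η → LexLT L (codeSeq ξ) (codeSeq η) := by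
    intro ξ η hlen hξ hη h
    obtain ⟨t, h1, h2⟩ := codeSeq_lt hlen h
    refine ⟨t, ?_, h1, h2⟩
    by_contra ht
    rw [codeSeq_of_ge (by omega), codeSeq_of_ge (by omega)] at h2
    exact lt_irrefl _ h2
  refine ⟨key hlen hξ hη, fun h => ?_⟩
  rcases lt_trichotomy ξ η with h1 | rfl | h1
  · exact h1
  · exact absurd h h.asymm
  · exact absurd h (key hlen.symm hη hξ h1).asymm

lemma exists_symb_eq (j : ℕ) (l : List ℤ) (h1 : l.Pairwise (fun x y => |y| ≤ |x|))
    (h2 : ∀ x ∈ l, x ≠ 0 ∧ |x| ≤ j) : ∃ ξ : List BinStr, ξ.length = j ∧ symb ξ = l := by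
  induction j generalizing l with
  | zero =>
    refine ⟨[], rfl, ?_⟩
    cases l with
    | nil => rfl
    | cons x l =>
      have := h2 x (by simp)
      simp at this
  | succ j ih =>
    set f : ℤ → Bool := fun x => decide (|x| = j + 1) with hf
    have hsplit : l.takeWhile f ++ l.dropWhile f = l := List.takeWhile_append_dropWhile
    have hd : ∀ x ∈ l.dropWhile f, x ≠ 0 ∧ |x| ≤ j := by
      have hp : (l.dropWhile f).Pairwise (fun x y => |y| ≤ |x|) :=
        h1.sublist (List.dropWhile_sublist _)
      have hm : ∀ x ∈ l.dropWhile f, x ∈ l := fun x hx => (List.dropWhile_sublist _).subset hx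
      have hh := List.head?_dropWhile_not f l
      cases hl : l.dropWhile f with
      | nil => simp
      | cons y l' =>
        rw [hl] at hp hm hh
        simp only [List.head?_cons, hf, decide_eq_false_iff_not] at hh
        have hy := h2 y (hm y (by simp))
        have hy' : |y| ≤ j := by have := hy.2; push_cast at this; omega
        intro x hx
        refine ⟨(h2 x (hm x hx)).1, ?_⟩
        rcases List.mem_cons.mp hx with rfl | hx
        · exact hy'
        · exact ((List.pairwise_cons.mp hp).1 x hx).trans hy'
    obtain ⟨r, hr, hr'⟩ := ih _ (h1.sublist (List.dropWhile_sublist f)) hd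
    refine ⟨⟨(l.takeWhile f).map (fun x => decide (0 < x))⟩ :: r, by simp [hr], ?_⟩
    rw [symb, hr', List.map_map]
    conv_rhs => rw [← hsplit]
    congr 1
    conv_rhs => rw [← List.map_id (l.takeWhile f)]
    apply List.map_congr_left
    intro x hx
    have h3 := List.mem_takeWhile_imp hx
    simp only [hf, decide_eq_true_eq] at h3
    simp only [Function.comp, decide_eq_true_eq, hr]
    change _ = x
    split_ifs with h4
    · rw [abs_of_pos h4] at h3; exact h3.symm
    · rw [abs_of_nonpos (not_lt.mp h4)] at h3; linarith

/-- Every valid sequence is the code of a tuple. -/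
lemma exists_codeSeq_eq {L j : ℕ} {z : ℕ → ℤ} (hz : ValidSeq L j z) :
    ∃ ξ : List BinStr, ξ.length = j ∧ numBits ξ ≤ L ∧ ∀ t < L, codeSeq ξ t = z t := by
  -- the nonzero entries form an initial segment, since absolute values decrease
  obtain ⟨k, hk, hk1, hk2⟩ : ∃ k ≤ L, (∀ t < k, z t ≠ 0) ∧ ∀ t, k ≤ t → t < L → z t = 0 := by
    by_cases h : ∃ k, k < L ∧ z k = 0
    · refine ⟨Nat.find h, (Nat.find_spec h).1.le, ?_, ?_⟩
      · intro t ht h0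
        exact Nat.find_min h ht ⟨ht.trans (Nat.find_spec h).1, h0⟩
      · intro t ht htL
        have := hz.2 _ t ht htL
        rw [(Nat.find_spec h).2] at this
        simpa using this
    · push Not at h
      exact ⟨L, le_rfl, h, fun t h1 h2 => by omega⟩
  obtain ⟨ξ, h1, h2⟩ := exists_symb_eq j ((List.range k).map z)
    (by
      rw [List.pairwise_map]
      refine (List.pairwise_lt_range (n := k)).imp_of_mem ?_
      intro a b _ hb hab
      rw [List.mem_range] at hb
      exact hz.2 a b hab.le (by omega))
    (by
      intro x hx
      obtain ⟨t, ht, rfl⟩ := List.mem_map.mp hx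
      rw [List.mem_range] at ht
      exact ⟨hk1 t ht, hz.1 t (by omega)⟩)
  have h3 : numBits ξ = k := by rw [← length_symb, h2]; simp
  refine ⟨ξ, h1, by omega, fun t ht => ?_⟩
  by_cases htk : t < k
  · have : t < (symb ξ).length := by rw [length_symb]; omega
    rw [codeSeq_of_lt this]
    simp [h2]
  · rw [codeSeq_of_ge (by omega), hk2 t (by omega) ht]

/-- The code of a truncated tuple. -/
lemma codeSeq_take (ξ : List BinStr) {g : ℕ} (hg : g ≤ ξ.length) :
    codeSeq (ξ.take (ξ.length - g) ++ List.replicate g ⟨[]⟩) = truncSeq g (codeSeq ξ) := by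
  have hrep : ∀ t, codeSeq (List.replicate g ⟨[]⟩) t = 0 := fun t =>
    codeSeq_of_ge (by rw [numBits_replicate]; omega)
  induction ξ with
  | nil =>
    funext t
    rw [List.take_nil, List.nil_append, hrep, truncSeq, if_pos]
    rw [codeSeq_of_ge (by simp [numBits])]; simp
  | cons s r ih =>
    funext t
    rcases hg.lt_or_eq with h1 | h1
    · have h2 : g ≤ r.length := by simpa [Nat.lt_succ_iff] using h1
      have h3 : (s :: r).length - g = (r.length - g) + 1 := by simp; omega
      have h4 : (r.take (r.length - g) ++ List.replicate g (⟨[]⟩ : BinStr)).length = r.length := by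
        simp; omega
      rw [h3, List.take_succ_cons, List.cons_append, codeSeq_cons, truncSeq, codeSeq_cons, h4]
      split_ifs with h5 h6 h7 h7 h7
      · rw [abs_of_nonneg (by omega)] at h7; omega
      · rfl
      · rw [abs_neg, abs_of_nonneg (by omega)] at h7; omega
      · rfl
      · rw [ih h2, truncSeq, if_pos h7]
      · rw [ih h2, truncSeq, if_neg h7]
    · rw [h1, Nat.sub_self, List.take_zero, List.nil_append, ← h1, hrep, truncSeq, if_pos]
      rw [h1]; exact abs_codeSeq_le _ _

lemma numBits_take_le (k : ℕ) (ξ : List BinStr) : numBits (ξ.take k) ≤ numBits ξ := by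
  conv_rhs => rw [← List.take_append_drop k ξ, numBits_append]
  omega

/-- Deleting the last `g` components of tuples corresponds to truncating their codes at `g`. -/
lemma take_lt_take_iff {L j g : ℕ} {ξ η : List BinStr} (hξ : ξ.length = j) (hη : η.length = j)
    (hξL : numBits ξ ≤ L) (hηL : numBits η ≤ L) (hg : g ≤ j) :
    ξ.take (j - g) < η.take (j - g) ↔
      LexLT L (truncSeq g (codeSeq ξ)) (truncSeq g (codeSeq η)) := by
  rw [← codeSeq_take ξ (by omega), ← codeSeq_take η (by omega), hξ, hη, ← codeSeq_lexLT,
    append_lt_append_iff]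
  · simp [hξ, hη]
  · simp [hξ, hη]
  · rw [numBits_append, numBits_replicate]
    have := numBits_take_le (j - g) ξ; omega
  · rw [numBits_append, numBits_replicate]
    have := numBits_take_le (j - g) η; omega

/-! ### Codes of labels -/

/-- The code of a label; the label `⊤` is coded by the constant sequence `H + 1`, where `H` bounds
the height of the tree. -/
def code {L j : ℕ} (H : ℕ) : Label (bitTree L j) → ℕ → ℤ
  | none => fun _ => (H : ℤ) + 1
  | some ξ => codeSeq ξ.1

section Code

variable {L j H : ℕ}

lemma code_top (t : ℕ) : code H (⊤ : Label (bitTree L j)) t = H + 1 := rfl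

lemma code_coe (ξ : Leaf (bitTree L j)) : code H (ξ : Label (bitTree L j)) = codeSeq ξ.1 := rfl

lemma leaf_numBits (ξ : Leaf (bitTree L j)) : numBits ξ.1 ≤ L := ξ.2.1.2

lemma leaf_valid (ξ : Leaf (bitTree L j)) : ValidSeq L j (codeSeq ξ.1) := by
  have := codeSeq_valid L ξ.1
  rwa [ξ.2.2] at this

lemma leaf_lt_iff {ξ η : Leaf (bitTree L j)} :
    ξ < η ↔ LexLT L (codeSeq ξ.1) (codeSeq η.1) :=
  codeSeq_lexLT (ξ.2.2.trans η.2.2.symm) (leaf_numBits ξ) (leaf_numBits η)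

/-- Labels are ordered like their codes, so that they can be compared entry by entry. -/
lemma code_lt_iff (hj : j ≤ H) (hL : 0 < L) {a b : Label (bitTree L j)} :
    a < b ↔ LexLT L (code H a) (code H b) := by
  have key : ∀ ξ : Leaf (bitTree L j), LexLT L (code H (ξ : Label (bitTree L j)))
      (code H (⊤ : Label (bitTree L j))) := by
    intro ξ
    refine ⟨0, hL, by simp, ?_⟩
    have := (abs_le.mp ((leaf_valid ξ).1 0 hL)).2
    rw [code_top, code_coe]; omega
  rcases eq_or_ne a ⊤ with rfl | ha
  · refine iff_of_false (not_lt_of_ge le_top) ?_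
    rcases eq_or_ne b ⊤ with rfl | hb
    · exact fun h => h.asymm h
    · obtain ⟨b, rfl⟩ := WithTop.ne_top_iff_exists.mp hb
      exact (key b).asymm
  · obtain ⟨a, rfl⟩ := WithTop.ne_top_iff_exists.mp ha
    rcases eq_or_ne b ⊤ with rfl | hb
    · exact iff_of_true (WithTop.coe_lt_top _) (key a)
    · obtain ⟨b, rfl⟩ := WithTop.ne_top_iff_exists.mp hb
      rw [WithTop.coe_lt_coe, leaf_lt_iff]; rfl

lemma exists_leaf_of_valid {z : ℕ → ℤ} (hz : ValidSeq L j z) :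
    ∃ ξ : Leaf (bitTree L j), ∀ t < L, codeSeq ξ.1 t = z t := by
  obtain ⟨ξ, h1, h2, h3⟩ := exists_codeSeq_eq hz
  exact ⟨⟨ξ, ⟨h1.le, h2⟩, h1⟩, h3⟩

lemma take_leaf_lt_iff {g : ℕ} (hg : g ≤ j) {ξ η : Leaf (bitTree L j)} :
    ξ.1.take (j - g) < η.1.take (j - g) ↔
      LexLT L (truncSeq g (codeSeq ξ.1)) (truncSeq g (codeSeq η.1)) :=
  take_lt_take_iff ξ.2.2 η.2.2 (leaf_numBits ξ) (leaf_numBits η) hg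

lemma truncSeq_congr {g : ℕ} {z x : ℕ → ℤ} (h : ∀ t < L, z t = x t) :
    ∀ t < L, truncSeq g z t = truncSeq g x t := by
  intro t ht; rw [truncSeq, truncSeq, h t ht]

/-- A tight label of a tail of even priority is the least completion of a truncation. -/
lemma code_tight_even (hj : j ≤ H) {p : ℕ} (hp : Even p) (hpj : p / 2 ≤ j)
    (b : Label (bitTree L j)) :
    ∀ t < L, code H (tight p b) t = fillSeq (p / 2) (code H b) t := by
  rcases eq_or_ne b ⊤ with rfl | hb
  · intro t _
    rw [tight_top, fillSeq, code_top, if_neg]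
    rw [abs_of_nonneg (by omega)]; omega
  · obtain ⟨b, rfl⟩ := WithTop.ne_top_iff_exists.mp hb
    obtain ⟨x, hx⟩ := exists_leaf_of_valid (fillSeq_valid (leaf_valid b) hpj)
    have h1 : tight p (b : Label (bitTree L j)) = x := by
      apply le_antisymm
      · rw [← nonViolated_iff, nonViolated_coe, if_pos hp, ← not_lt, take_leaf_lt_iff hpj]
        apply not_lexLT_of_le
        intro t ht
        rw [truncSeq_congr hx t ht, truncSeq_fillSeq]
      · refine le_of_not_gt fun hlt => ?_
        have hv := nonViolated_tight p (b : Label (bitTree L j))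
        obtain ⟨y, hy⟩ := WithTop.ne_top_iff_exists.mp hlt.ne_top
        rw [← hy] at hlt hv
        rw [nonViolated_coe, if_pos hp, ← not_lt, take_leaf_lt_iff hpj] at hv
        rw [WithTop.coe_lt_coe, leaf_lt_iff] at hlt
        exact fillSeq_least hv (hlt.congr (fun _ _ => rfl) hx)
    intro t ht
    rw [h1, code_coe, hx t ht]; rfl

/-- The code of `⊤` cannot be increased, since its entries exceed `J`. -/
lemma not_canIncr_top (hj : j ≤ H) (g B t : ℕ) :
    ¬ CanIncr L g B j (code H (⊤ : Label (bitTree L j))) t := by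
  have ha : |code H (⊤ : Label (bitTree L j)) (t - 1)| = H + 1 := by
    rw [code_top, abs_of_nonneg (by omega)]
  rintro (⟨h1, h2⟩ | ⟨h1, h2, h3⟩)
  · have h3 : (H : ℤ) + 1 < incr g (code H (⊤ : Label (bitTree L j))) t := by
      unfold incr
      split_ifs with h4
      · rw [code_top, abs_of_nonneg (by omega)] at h4; omega
      · rw [code_top]; omega
    have h4 : prevAbs g j (code H (⊤ : Label (bitTree L j))) t ≤ H + 1 := by
      rcases Nat.eq_zero_or_pos t with h0 | h0
      · rw [prevAbs, if_pos h0]; omega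
      · rw [← ha]; exact prevAbs_le h0.ne'
    omega
  · rw [code_top] at h3; omega

/-- A tight label of a tail of odd priority arises by increasing a truncation as late as possible;
it is `⊤` if this is impossible. -/
lemma code_tight_odd (hj : j ≤ H) {p : ℕ} (hp : ¬ Even p) (hpj : p / 2 ≤ j)
    (b : Label (bitTree L j)) :
    ((∀ t, ¬ CanIncr L (p / 2) L j (code H b) t) → tight p b = ⊤) ∧
    ∀ t₀, CanIncr L (p / 2) L j (code H b) t₀ →
      (∀ t, CanIncr L (p / 2) L j (code H b) t → t ≤ t₀) →
      ∀ t < L, code H (tight p b) t = nextSeq (p / 2) L (code H b) t₀ t := by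
  rcases eq_or_ne b ⊤ with rfl | hb
  · exact ⟨fun _ => tight_top p, fun t₀ h => absurd h (not_canIncr_top hj _ _ _)⟩
  · obtain ⟨b, rfl⟩ := WithTop.ne_top_iff_exists.mp hb
    have key : ∀ y : Leaf (bitTree L j), NonViolated p (y : Label (bitTree L j)) b ↔
        LexLT L (truncSeq (p / 2) (codeSeq b.1)) (truncSeq (p / 2) (codeSeq y.1)) := by
      intro y
      rw [nonViolated_coe, if_neg hp, take_leaf_lt_iff hpj]
    have least : ∀ y : Leaf (bitTree L j), NonViolated p (y : Label (bitTree L j)) b → _ :=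
      fun y hy => nextSeq_least (leaf_valid b) le_rfl (leaf_valid y)
        (fun t h1 h2 => absurd h1 (by omega)) ((key y).mp hy)
    constructor
    · intro hno
      by_contra hne
      obtain ⟨y, hy⟩ := WithTop.ne_top_iff_exists.mp hne
      have hv := nonViolated_tight p (b : Label (bitTree L j))
      rw [← hy] at hv
      obtain ⟨t, ht⟩ := (least y hv).1
      exact hno t ht
    · intro t₀ hcan hmax
      obtain ⟨x, hx⟩ := exists_leaf_of_valid (nextSeq_valid (leaf_valid b) le_rfl hcan)
      have h1 : tight p (b : Label (bitTree L j)) = x := by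
        apply le_antisymm
        · rw [← nonViolated_iff, key]
          exact (lexLT_truncSeq_nextSeq le_rfl hcan).congr (fun _ _ => rfl)
            (fun t ht => (truncSeq_congr hx t ht).symm)
        · refine le_of_not_gt fun hlt => ?_
          have hv := nonViolated_tight p (b : Label (bitTree L j))
          obtain ⟨y, hy⟩ := WithTop.ne_top_iff_exists.mp hlt.ne_top
          rw [← hy] at hlt hv
          rw [WithTop.coe_lt_coe, leaf_lt_iff] at hlt
          exact (least y hv).2 t₀ hcan hmax (hlt.congr (fun _ _ => rfl) hx)
      intro t ht
      rw [h1, code_coe, hx t ht]; rfl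

/-- The smallest label. -/
lemma code_min :
    ∀ t < L, code H (minOf (Set.univ : Set (Label (bitTree L j)))) t = -j := by
  have hval : ValidSeq L j (fun _ => -(j : ℤ)) := by
    constructor
    · intro t _; simp
    · intro s t _ _; exact le_rfl
  obtain ⟨x, hx⟩ := exists_leaf_of_valid hval
  have h1 : IsLeast (Set.univ : Set (Label (bitTree L j))) x := by
    refine ⟨trivial, fun y _ => le_of_not_gt fun hlt => ?_⟩
    obtain ⟨y, rfl⟩ := WithTop.ne_top_iff_exists.mp hlt.ne_top
    rw [WithTop.coe_lt_coe, leaf_lt_iff] at hlt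
    refine not_lexLT_of_le ?_ hlt
    intro t ht
    rw [hx t ht]
    exact (abs_le.mp ((leaf_valid y).1 t ht)).1
  have h2 := (minOf_isLeast ⟨_, h1.1⟩).unique h1
  intro t ht
  rw [h2, code_coe, hx t ht]

end Code

/-! ### Raising a label -/

/-- The only chain of the subcover of height `j`. -/
def chainOf (L h j : ℕ) : List (OrderedTree BinStr j) :=
  if 0 < j ∧ j < h then (List.range (L + 1)).map (fun b => bitTree b j)
  else [bitTree (L) j]

lemma succinctCover_chains (ℓ h j : ℕ) :
    (succinctCover ℓ h).chains j = [chainOf (Nat.log 2 ℓ) h j] := by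
  simp only [succinctCover, chainOf]
  split_ifs <;> rfl

/-- The number of bits of the trees of index `i` in the chain of height `j`. -/
def chainBits (L h j i : ℕ) : ℕ := if j < h then i else L

lemma length_chainOf {L h j : ℕ} (hj : 0 < j) :
    (chainOf L h j).length = if j < h then L + 1 else 1 := by
  unfold chainOf
  simp only [hj, true_and]
  split_ifs <;> simp

lemma chainOf_getElem {L h j i : ℕ} (hj : 0 < j) (hi : i < (chainOf L h j).length) :
    (chainOf L h j)[i] = bitTree (chainBits (L) h j i) j := by
  unfold chainOf chainBits at *
  simp only [hj, true_and] at *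
  split_ifs at * <;> simp_all

/-- Trees of positive height with different numbers of bits are not equivalent, so the index of a
subtree in the chain can be read off from its number of bits. -/
lemma bitTree_equiv {b b' j : ℕ} (hj : 0 < j) (h : EquivTree (bitTree b j) (bitTree b' j)) :
    b = b' := by
  rcases lt_trichotomy b b' with h1 | h1 | h1
  · exact absurd h.2 (bitTree_strict h1 hj).2
  · exact h1
  · exact absurd h.1 (bitTree_strict h1 hj).2

/-- A leaf that is the smallest leaf of a copy of a tree of index at least `i`. -/
def IsCopyMin {L h j : ℕ} (i : ℕ) (ξ' : Leaf (bitTree L h)) : Prop :=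
  ∃ (v : List BinStr) (S : OrderedTree BinStr j), IsSubtreeAt (bitTree L h) v S ∧
    (∃ (i' : ℕ) (hi' : i' < (chainOf L h j).length), (i : ℕ∞) ≤ i' ∧
      EquivTree S ((chainOf L h j)[i'])) ∧
    IsLeast {η : Leaf (bitTree L h) | v <+: η.1} ξ'

/-- The codes of the smallest leaves of copies: there are only minimal completions after the first
`B` positions. -/
def CopyMinSeq (L g B : ℕ) (z : ℕ → ℤ) : Prop :=
  ∀ t < L, (t < B → (g : ℤ) < |z t| ∨ z t = -g) ∧ (B ≤ t → z t = -g)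

lemma CopyMinSeq.fillSeq_eq {L g B : ℕ} {z : ℕ → ℤ} (hz : CopyMinSeq L g B z) :
    ∀ t < L, fillSeq g z t = z t := by
  intro t ht
  unfold fillSeq
  split_ifs with h1
  · rcases lt_or_ge t B with h2 | h2
    · rcases (hz t ht).1 h2 with h3 | h3
      · omega
      · exact h3.symm
    · exact ((hz t ht).2 h2).symm
  · rfl

lemma prefix_iff_take {M : Type*} {v η : List M} {k : ℕ} (hv : v.length = k) :
    v <+: η ↔ η.take k = v := by
  rw [List.prefix_iff_eq_take, hv]; exact eq_comm

/-- An entry of absolute value at most `j` at position `B` shows that the components above height `j`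
have at most `B` bits. -/
lemma numBits_take_leaf_le {L h j B : ℕ} (hjh : j ≤ h) (ξ : Leaf (bitTree L h))
    (hz : |codeSeq ξ.1 B| ≤ j) : numBits (ξ.1.take (h - j)) ≤ B := by
  by_contra hlt
  have h1 := codeSeq_take ξ.1 (g := j) (by rw [ξ.2.2]; exact hjh)
  rw [ξ.2.2] at h1
  have h2 := congrFun h1 B
  rw [truncSeq, if_pos hz] at h2
  refine codeSeq_ne_zero ?_ h2
  rw [numBits_append, numBits_replicate]; omega

lemma abs_codeSeq_le_of_numBits_take {L h j t : ℕ} (hjh : j ≤ h) (ξ : Leaf (bitTree L h))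
    (ht : numBits (ξ.1.take (h - j)) ≤ t) : |codeSeq ξ.1 t| ≤ j := by
  have h1 := codeSeq_take ξ.1 (g := j) (by rw [ξ.2.2]; exact hjh)
  rw [ξ.2.2] at h1
  have h2 := congrFun h1 t
  rw [codeSeq_of_ge (by rw [numBits_append, numBits_replicate]; omega)] at h2
  by_contra h3
  rw [truncSeq, if_neg h3] at h2
  rw [← h2] at h3; simp at h3

/-- The subtree at a vertex `v` has `L - numBits v` bits, and its smallest leaf extends `v` by `-j` in
all remaining positions. Hence the smallest leaves of copies of trees of index at least `i` are the
leaves whose entries of absolute value at most `j` are all `-j`, and comprise all positions from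
`L - i` on. -/
lemma isCopyMin_iff {L h j i : ℕ} (hj : 0 < j) (hjh : j ≤ h)
    (hi : i < (chainOf L h j).length) (ξ' : Leaf (bitTree L h)) :
    IsCopyMin (j := j) i ξ' ↔ CopyMinSeq L j (L - i) (codeSeq ξ'.1) := by
  rw [length_chainOf hj] at hi
  have hval := leaf_valid ξ'
  constructor
  · rintro ⟨v, S, ⟨hv, hvj, hS⟩, ⟨i', hi', hii', heq⟩, hpre, hleast⟩
    have hSb : S = bitTree (L - numBits v) j :=
      OrderedTree.ext' (hS.trans (bitTree_subtree hv hvj).2.2.symm)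
    have hvlen : v.length = h - j := by omega
    rw [Set.mem_ofPred_eq, prefix_iff_take hvlen] at hpre
    -- the least completion of the truncation also extends `v`
    obtain ⟨x, hx⟩ := exists_leaf_of_valid (fillSeq_valid hval hjh)
    have htx : ∀ t < L, truncSeq j (codeSeq x.1) t = truncSeq j (codeSeq ξ'.1) t := by
      intro t ht
      rw [truncSeq_congr hx t ht, truncSeq_fillSeq]
    have hxv : x.1.take (h - j) = v := by
      rw [← hpre]
      apply le_antisymm
      · rw [← not_lt, take_leaf_lt_iff hjh]
        exact not_lexLT_of_le fun t ht => (htx t ht).le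
      · rw [← not_lt, take_leaf_lt_iff hjh]
        exact not_lexLT_of_le fun t ht => (htx t ht).ge
    have hle : ξ' ≤ x := hleast ((prefix_iff_take hvlen).mpr hxv)
    have hxeq : x = ξ' := by
      apply le_antisymm _ hle
      rw [← not_lt, leaf_lt_iff]
      apply not_lexLT_of_le
      intro t ht
      rw [hx t ht]
      unfold fillSeq
      split_ifs with h1
      · exact (abs_le.mp h1).1
      · exact le_rfl
    subst hxeq
    have hfill : ∀ t < L, (j : ℤ) < |codeSeq x.1 t| ∨ codeSeq x.1 t = -j := by
      intro t ht
      have h1 := hx t ht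
      unfold fillSeq at h1
      split_ifs at h1 with h2
      · exact Or.inr h1
      · left; omega
    intro t ht
    refine ⟨fun _ => hfill t ht, fun hBt => ?_⟩
    rcases hfill t ht with h1 | h1
    · exfalso
      rcases hjh.lt_or_eq with hlt | heq'
      · rw [chainOf_getElem hj hi', chainBits, if_pos hlt, hSb] at heq
        have h2 := bitTree_equiv hj heq
        have h3 : i ≤ i' := by exact_mod_cast hii'
        have h4 := abs_codeSeq_le_of_numBits_take (j := j) hjh x (t := t) (by rw [hpre]; omega)
        omega
      · have := hval.1 t ht
        omega
    · exact h1
  · intro hz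
    have hfill := hz.fillSeq_eq
    have hmem : ξ'.1.take (h - j) ∈ (bitTree L h).carrier :=
      ⟨by rw [List.length_take, ξ'.2.2]; omega, (numBits_take_le _ _).trans (leaf_numBits ξ')⟩
    have hlen : (ξ'.1.take (h - j)).length = h - j := by rw [List.length_take, ξ'.2.2]; omega
    refine ⟨ξ'.1.take (h - j), bitTree (L - numBits (ξ'.1.take (h - j))) j,
      bitTree_subtree hmem (by omega), ?_, List.take_prefix _ _, ?_⟩
    · rcases hjh.lt_or_eq with hlt | heq'
      · rw [if_pos hlt] at hi
        have hnb : numBits (ξ'.1.take (h - j)) ≤ L - i := by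
          rcases Nat.eq_zero_or_pos i with h0 | h0
          · subst h0
            exact (numBits_take_le _ _).trans (leaf_numBits ξ')
          · apply numBits_take_leaf_le hjh ξ'
            rw [(hz (L - i) (by omega)).2 le_rfl]; simp
        have hlen : L - numBits (ξ'.1.take (h - j)) < (chainOf L h j).length := by
          rw [length_chainOf hj, if_pos hlt]; omega
        refine ⟨_, hlen, by norm_cast; omega, ?_⟩
        rw [chainOf_getElem hj hlen, chainBits, if_pos hlt]
        exact ⟨embeds_refl _, embeds_refl _⟩
      · rw [if_neg (by omega)] at hi
        have hlen : 0 < (chainOf L h j).length := by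
          rw [length_chainOf hj, if_neg (by omega)]; omega
        refine ⟨0, hlen, by norm_cast; omega, ?_⟩
        rw [chainOf_getElem hj hlen, chainBits, if_neg (by omega)]
        have : ξ'.1.take (h - j) = [] := by rw [heq']; simp
        rw [this]
        exact ⟨embeds_refl _, embeds_refl _⟩
    · intro η hη
      rw [Set.mem_ofPred_eq, prefix_iff_take hlen] at hη
      rw [← not_lt, leaf_lt_iff]
      intro hlt
      refine fillSeq_least (g := j) ?_ (hlt.congr (fun _ _ => rfl) (fun t ht => (hfill t ht).symm))
      rw [← take_leaf_lt_iff hjh, hη]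
      exact lt_irrefl _

lemma raise_top {L h j : ℕ} (i : ℕ∞) :
    raise (chainOf L h j) (⊤ : Label (bitTree L h)) i = ⊤ := by
  unfold raise minOf
  rw [dif_neg]
  rintro ⟨x, ⟨hx, ξ', rfl, -⟩, -⟩
  rw [top_le_iff] at hx
  exact WithTop.coe_ne_top hx

section Raise

variable {L h j i : ℕ} (hj : 0 < j) (hjh : j ≤ h)
  (hi : i < (chainOf L h j).length)

include hj hjh hi

/-- A label that is the smallest leaf of a suitable copy need not be raised. -/
lemma raise_of_copyMinSeq {H : ℕ} (ξ : Label (bitTree L h))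
    (hξ : CopyMinSeq L j (L - i) (code H ξ)) :
    raise (chainOf L h j) ξ i = ξ := by
  rcases eq_or_ne ξ ⊤ with rfl | hne
  · exact raise_top _
  · obtain ⟨ξ, rfl⟩ := WithTop.ne_top_iff_exists.mp hne
    have h1 := (isCopyMin_iff hj hjh hi ξ).mpr hξ
    have h2 : IsLeast {x : Label (bitTree L h) | (ξ : Label (bitTree L h)) ≤ x ∧
        ∃ ξ' : Leaf (bitTree L h), x = ξ' ∧ IsCopyMin (j := j) i ξ'} ξ :=
      ⟨⟨le_rfl, ξ, rfl, h1⟩, fun x hx => hx.1⟩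
    exact (minOf_isLeast ⟨_, h2.1⟩).unique h2

/-- Any other label is increased at the last possible position. -/
lemma raise_of_not_copyMinSeq {H : ℕ} (hH : h ≤ H) (ξ : Label (bitTree L h))
    (hξ : ¬ CopyMinSeq L j (L - i) (code H ξ)) :
    ((∀ t, ¬ CanIncr L j (L - i) h (code H ξ) t) →
      raise (chainOf L h j) ξ i = ⊤) ∧
    ∀ t₀, CanIncr L j (L - i) h (code H ξ) t₀ →
      (∀ t, CanIncr L j (L - i) h (code H ξ) t → t ≤ t₀) →
      ∀ t < L, code H (raise (chainOf L h j) ξ i) t =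
        nextSeq j (L - i) (code H ξ) t₀ t := by
  rcases eq_or_ne ξ ⊤ with rfl | hne
  · exact ⟨fun _ => raise_top _, fun t₀ h => absurd h (not_canIncr_top hH _ _ _)⟩
  obtain ⟨ξ, rfl⟩ := WithTop.ne_top_iff_exists.mp hne
  rw [code_coe] at *
  have hBL : L - i ≤ L := Nat.sub_le _ _
  -- a copy above `ξ` has a larger truncation
  have least : ∀ y : Leaf (bitTree L h), ξ ≤ y → IsCopyMin (j := j) i y →
      (∃ t, CanIncr L j (L - i) h (codeSeq ξ.1) t) ∧
      ∀ b, CanIncr L j (L - i) h (codeSeq ξ.1) b →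
        (∀ t, CanIncr L j (L - i) h (codeSeq ξ.1) t → t ≤ b) →
        ¬ LexLT L (codeSeq y.1) (nextSeq j (L - i) (codeSeq ξ.1) b) := by
    intro y hy hc
    rw [isCopyMin_iff hj hjh hi] at hc
    have h1 : LexLT L (truncSeq j (codeSeq ξ.1)) (truncSeq j (codeSeq y.1)) := by
      by_contra hno
      have h2 := fillSeq_least hno
      have h3 : ¬ ξ < y := by
        rw [leaf_lt_iff]
        exact fun hlt => h2 (hlt.congr (fun _ _ => rfl) (fun t ht => (hc.fillSeq_eq t ht).symm))
      rw [not_lt] at h3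
      have := le_antisymm hy h3
      subst this
      exact hξ hc
    exact nextSeq_least (B := L - i) (leaf_valid ξ) hBL (leaf_valid y)
      (fun t h1 h2 => by rw [(hc t h2).2 h1]; simp) h1
  constructor
  · intro hno
    unfold raise minOf
    rw [dif_neg]
    rintro ⟨x, ⟨hx, y, rfl, hy⟩, -⟩
    obtain ⟨t, ht⟩ := (least y (WithTop.coe_le_coe.mp hx) hy).1
    exact hno t ht
  · intro t₀ hcan hmax
    obtain ⟨x, hx⟩ := exists_leaf_of_valid (nextSeq_valid (leaf_valid ξ) hBL hcan)
    have hxc : IsCopyMin (j := j) i x := by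
      rw [isCopyMin_iff hj hjh hi]
      intro t ht
      rw [hx t ht]
      exact nextSeq_canonical (leaf_valid ξ) hBL hcan t
    have h1 : IsLeast {y : Label (bitTree L h) | (ξ : Label (bitTree L h)) ≤ y ∧
        ∃ ξ' : Leaf (bitTree L h), y = ξ' ∧ IsCopyMin (j := j) i ξ'} x := by
      refine ⟨⟨?_, x, rfl, hxc⟩, ?_⟩
      · rw [WithTop.coe_le_coe, ← not_lt]
        intro hlt
        have h2 := take_le_take (h - j) hlt.le
        rw [← not_lt, take_leaf_lt_iff hjh] at h2
        exact h2 ((lexLT_truncSeq_nextSeq hBL hcan).congr (fun _ _ => rfl)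
          (fun t ht => (truncSeq_congr hx t ht).symm))
      · rintro _ ⟨hy, y, rfl, hyc⟩
        rw [WithTop.coe_le_coe] at hy ⊢
        rw [← not_lt, leaf_lt_iff]
        intro hlt
        exact (least y hy hyc).2 t₀ hcan hmax (hlt.congr (fun _ _ => rfl) hx)
    have h2 : raise (chainOf L h j) (ξ : Label (bitTree L h)) i = x :=
      (minOf_isLeast ⟨_, h1.1⟩).unique h1
    intro t ht
    rw [h2, code_coe, hx t ht]

end Raise

/-! ### Subtrees as initial segments and as copies -/

/-- The tuple with `k` zeros in front of its first component. -/
def padHead (k : ℕ) : List BinStr → List BinStr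
  | [] => []
  | s :: r => ⟨List.replicate k false ++ s.bits⟩ :: r

lemma length_padHead (k : ℕ) (ξ : List BinStr) : (padHead k ξ).length = ξ.length := by
  cases ξ <;> simp [padHead]

lemma numBits_padHead_le (k : ℕ) (ξ : List BinStr) : numBits (padHead k ξ) ≤ k + numBits ξ := by
  cases ξ with
  | nil => simp [padHead]
  | cons s r => simp [padHead, numBits]; omega

lemma pad_lt_pad_iff (k : ℕ) (s t : List Bool) :
    BinStr.mk (List.replicate k false ++ s) < BinStr.mk (List.replicate k false ++ t) ↔
      BinStr.mk s < BinStr.mk t := by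
  induction k with
  | zero => simp
  | succ k ih =>
    rw [List.replicate_succ, List.cons_append, List.cons_append, BinStr.cons_lt_cons, ih]

/-- Leading zeros preserve the order. -/
lemma padHead_lt_iff (k : ℕ) {u v : List BinStr} (h : u.length = v.length) :
    padHead k u < padHead k v ↔ u < v := by
  cases u with
  | nil =>
    have : v = [] := List.length_eq_zero_iff.mp h.symm
    subst this; simp
  | cons s r =>
    cases v with
    | nil => simp at h
    | cons t q =>
      obtain ⟨s⟩ := s
      obtain ⟨t⟩ := t
      simp only [padHead, List.cons_lt_cons_iff, pad_lt_pad_iff, BinStr.mk.injEq,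
        List.append_cancel_left_eq]

lemma take_padHead (k q : ℕ) (ξ : List BinStr) :
    (padHead k ξ).take q = if q = 0 then [] else padHead k (ξ.take q) := by
  cases q with
  | zero => simp
  | succ q => cases ξ <;> simp [padHead]

/-- The embedding of a tree with fewer bits as an initial segment. -/
def padLeaf {s L j : ℕ} (hs : s ≤ L) (a : Leaf (bitTree s j)) : Leaf (bitTree L j) :=
  ⟨padHead (L - s) a.1, ⟨by rw [length_padHead]; exact a.2.1.1, by
    have h1 := numBits_padHead_le (L - s) a.1
    have h2 := leaf_numBits a
    omega⟩, by rw [length_padHead]; exact a.2.2⟩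

lemma nonViolated_padLeaf {s L j p : ℕ} (hs : s ≤ L) (hp : p / 2 < j) (a b : Leaf (bitTree s j)) :
    NonViolated p (padLeaf hs a : Label (bitTree L j)) (padLeaf hs b) ↔
      NonViolated p (a : Label (bitTree s j)) b := by
  have h0 : j - p / 2 ≠ 0 := by omega
  have h1 : (b.1.take (j - p / 2)).length = (a.1.take (j - p / 2)).length := by
    rw [List.length_take, List.length_take, a.2.2, b.2.2]
  rw [nonViolated_coe, nonViolated_coe]
  simp only [padLeaf, take_padHead, if_neg h0]
  split_ifs
  · rw [← not_lt, ← not_lt, padHead_lt_iff _ h1.symm]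
  · rw [padHead_lt_iff _ h1]

/-- The `k` leading zeros of the first component are coded by `k` leading entries `-j`. -/
lemma codeSeq_padHead {k j t : ℕ} {ξ : List BinStr} (hξ : ξ.length = j) (hj : 0 < j) :
    codeSeq (padHead k ξ) t = if t < k then -(j : ℤ) else codeSeq ξ (t - k) := by
  cases ξ with
  | nil => simp at hξ; omega
  | cons s r =>
    have hr : (r.length : ℤ) + 1 = j := by exact_mod_cast hξ
    rw [padHead, codeSeq_cons, codeSeq_cons]
    simp only [List.length_append, List.length_replicate]
    split_ifs with h1 h2 h3 h4 h5 h6 h7 <;>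
      simp_all [List.getElem_append, Nat.sub_sub] <;> omega

lemma codeSeq_padLeaf {s L j : ℕ} (hj : 0 < j) (hs : s ≤ L) (a : Leaf (bitTree s j)) :
    ∀ t < L - s, codeSeq (padLeaf hs a).1 t = -(j : ℤ) := by
  intro t ht
  rw [padLeaf, codeSeq_padHead a.2.2 hj, if_pos ht]

/-- The leaves in the initial segment are recognized by the leading entries of their codes. -/
lemma exists_padLeaf_eq {s L j : ℕ} (hs : s ≤ L) (ξ : Leaf (bitTree L j))
    (hj : 0 < j) (h : ∀ t < L - s, codeSeq ξ.1 t = -(j : ℤ)) : ∃ a, ξ = padLeaf hs a := by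
  have hval := leaf_valid ξ
  obtain ⟨a, ha⟩ := exists_leaf_of_valid (L := s) (j := j) (z := fun t => codeSeq ξ.1 (t + (L - s)))
    ⟨fun t ht => hval.1 _ (by omega), fun t u htu hu => hval.2 _ _ (by omega) (by omega)⟩
  refine ⟨a, ?_⟩
  have key : ∀ t < L, codeSeq ξ.1 t = codeSeq (padLeaf hs a).1 t := by
    intro t ht
    rw [padLeaf, codeSeq_padHead a.2.2 hj]
    split_ifs with h1
    · exact h t h1
    · rw [ha _ (by omega)]; congr 1; omega
  apply le_antisymm
  · rw [← not_lt, leaf_lt_iff]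
    exact not_lexLT_of_le fun t ht => (key t ht).le
  · rw [← not_lt, leaf_lt_iff]
    exact not_lexLT_of_le fun t ht => (key t ht).ge

lemma leading_of_not_lexLT {L j g k : ℕ} (hg : g < j) (hk : k ≤ L) {x y : Leaf (bitTree L j)}
    (hx : ∀ t < k, codeSeq x.1 t = -(j : ℤ))
    (h : ¬ LexLT L (truncSeq g (codeSeq x.1)) (truncSeq g (codeSeq y.1))) :
    ∀ t < k, codeSeq y.1 t = -(j : ℤ) := by
  intro t
  induction t using Nat.strong_induction_on with
  | _ t ih =>
    intro ht
    by_contra hne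
    apply h
    refine ⟨t, by omega, fun s hs => ?_, ?_⟩
    · rw [truncSeq, truncSeq, hx s (by omega), ih s hs (by omega)]
    · have h1 := abs_le.mp ((leaf_valid y).1 t (by omega))
      rw [truncSeq, truncSeq, hx t ht, if_neg (by rw [abs_neg, Nat.abs_cast]; omega)]
      split_ifs <;> omega

lemma leading_of_le {L j k : ℕ} (hj : 0 < j) (hk : k ≤ L) {x y : Leaf (bitTree L j)}
    (hx : ∀ t < k, codeSeq x.1 t = -(j : ℤ)) (h : y ≤ x) :
    ∀ t < k, codeSeq y.1 t = -(j : ℤ) := by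
  have h0 : ∀ z : ℕ → ℤ, truncSeq 0 z = z := by
    intro z; funext t; unfold truncSeq; split_ifs with h1
    · simpa using (abs_nonpos_iff.mp h1).symm
    · rfl
  apply leading_of_not_lexLT hj hk hx
  rwa [h0, h0, ← leaf_lt_iff, not_lt]

/-- An initial segment is left by no arc that is not violated and whose tail has priority less than
the height of the tree: truncation at a height below `j` does not affect leading entries `-j`. -/
lemma leading_of_nonViolated {L j k p : ℕ} (hp : p / 2 < j) (hk : k ≤ L) {x y : Leaf (bitTree L j)}
    (hx : ∀ t < k, codeSeq x.1 t = -(j : ℤ))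
    (h : NonViolated p (x : Label (bitTree L j)) y) :
    ∀ t < k, codeSeq y.1 t = -(j : ℤ) := by
  apply leading_of_not_lexLT hp hk hx
  rw [← take_leaf_lt_iff hp.le, not_lt]
  rw [nonViolated_coe] at h
  split_ifs at h
  · exact h
  · exact h.le

/-- The leaf of the copy at the vertex `v` that corresponds to a leaf of the subtree. -/
def copyLeaf {L h b j : ℕ} (v : List BinStr) (hv : v.length + j = h) (hb : numBits v + b ≤ L)
    (a : Leaf (bitTree b j)) : Leaf (bitTree L h) :=
  ⟨v ++ a.1, ⟨by have := a.2.2; rw [List.length_append]; omega, by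
    have := leaf_numBits a; rw [numBits_append]; omega⟩,
    by have := a.2.2; rw [List.length_append]; omega⟩

lemma nonViolated_copyLeaf {L h b j p : ℕ} {v : List BinStr} (hv : v.length + j = h)
    (hb : numBits v + b ≤ L) (hp : p / 2 ≤ j) (x y : Leaf (bitTree b j)) :
    NonViolated p (copyLeaf v hv hb x : Label (bitTree L h)) (copyLeaf v hv hb y) ↔
      NonViolated p (x : Label (bitTree b j)) y := by
  have h0 : h - p / 2 = v.length + (j - p / 2) := by omega
  rw [nonViolated_coe, nonViolated_coe]
  simp only [copyLeaf, h0, List.take_length_add_append]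
  split_ifs
  · rw [← not_lt, ← not_lt, append_lt_append_left_iff]
  · rw [append_lt_append_left_iff]

lemma copyLeaf_lt_iff {L h b j : ℕ} {v : List BinStr} (hv : v.length + j = h)
    (hb : numBits v + b ≤ L) (x y : Leaf (bitTree b j)) :
    copyLeaf (L := L) v hv hb x < copyLeaf v hv hb y ↔ x < y :=
  append_lt_append_left_iff v x.1 y.1

lemma exists_copyLeaf_eq {L h b j : ℕ} {v : List BinStr} (hv : v.length + j = h)
    (hb : numBits v + b = L) (ξ : Leaf (bitTree L h)) (hpre : v <+: ξ.1) :
    ∃ a, ξ = copyLeaf v hv hb.le a := by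
  obtain ⟨w, hw⟩ := hpre
  have h1 := ξ.2.2
  have h2 := leaf_numBits ξ
  rw [← hw, List.length_append] at h1
  rw [← hw, numBits_append] at h2
  exact ⟨⟨w, ⟨by omega, by omega⟩, by omega⟩, Subtype.ext hw.symm⟩

lemma exists_minLeaf (L j : ℕ) : ∃ m : Leaf (bitTree L j), (∀ t < L, codeSeq m.1 t = -(j : ℤ)) ∧
    ((m : Label (bitTree L j)) = minOf Set.univ) := by
  have hmin : IsLeast (Set.univ : Set (Label (bitTree L j))) (minOf Set.univ) :=
    minOf_isLeast ⟨⊤, trivial⟩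
  obtain ⟨x, -⟩ := exists_leaf_of_valid (L := L) (j := j) (z := fun _ => 0)
    ⟨fun t _ => by simp, fun s t _ _ => le_rfl⟩
  have hlt := (hmin.2 (Set.mem_univ (x : Label (bitTree L j)))).trans_lt (WithTop.coe_lt_top x)
  obtain ⟨m, hm⟩ := WithTop.ne_top_iff_exists.mp hlt.ne
  refine ⟨m, fun t ht => ?_, hm⟩
  have := code_min (L := L) (j := j) (H := j) t ht
  rw [← hm, code_coe] at this
  exact this

lemma copyLeaf_min {L h b j : ℕ} {v : List BinStr} (hv : v.length + j = h)
    (hb : numBits v + b = L) {ξ : Leaf (bitTree L h)}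
    (hξ : IsLeast {η : Leaf (bitTree L h) | v <+: η.1} ξ) {m : Leaf (bitTree b j)}
    (hm : (m : Label (bitTree b j)) = minOf Set.univ) : copyLeaf v hv hb.le m = ξ := by
  obtain ⟨a, rfl⟩ := exists_copyLeaf_eq hv hb ξ hξ.1
  apply le_antisymm
  · rw [← not_lt, copyLeaf_lt_iff, not_lt, ← WithTop.coe_le_coe, hm]
    exact (minOf_isLeast ⟨_, Set.mem_univ ⊤⟩).2 (Set.mem_univ _)
  · exact hξ.2 (List.prefix_append _ _)

/-! ### Labeled walks to a base node -/

/-- `a` is the label of `x` in a feasible labeling, by leaves of `S`, of a walk from `x` to `w` all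
of whose nodes but the last have smaller priority than `w`, and whose last label is minimal. -/
inductive WalkLabel {n d : ℕ} (G : ParityGame n d) (τ : OddStrategy G) {j : ℕ}
    (S : OrderedTree BinStr j) (w : Fin n) : Fin n → Leaf S → Prop
  | base (m : Leaf S) (hm : (m : Label S) = minOf Set.univ) : WalkLabel G τ S w w m
  | step {x y : Fin n} {a b : Leaf S} (harc : Arc G τ x y) (hx : G.prio x < G.prio w)
      (hy : WalkLabel G τ S w y b) (hv : NonViolated (G.prio x) (a : Label S) b) :
      WalkLabel G τ S w x a

lemma WalkLabel.eq_or_lt {n d : ℕ} {G : ParityGame n d} {τ : OddStrategy G} {j : ℕ}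
    {S : OrderedTree BinStr j} {w x : Fin n} {a : Leaf S} (h : WalkLabel G τ S w x a) :
    x = w ∨ G.prio x < G.prio w := by
  cases h with
  | base => exact Or.inl rfl
  | step _ hx _ _ => exact Or.inr hx

/-- The labels of a walk with a label in an initial segment all belong to that segment. -/
lemma WalkLabel.of_padLeaf {n d : ℕ} {G : ParityGame n d} {τ : OddStrategy G} {s L j : ℕ}
    (hs : s ≤ L) (hj : 0 < j) {w x : Fin n} (hw : G.prio w = 2 * j) {a : Leaf (bitTree s j)}
    (h : WalkLabel G τ (bitTree L j) w x (padLeaf hs a)) : WalkLabel G τ (bitTree s j) w x a := by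
  have key : ∀ x ξ, WalkLabel G τ (bitTree L j) w x ξ → ∀ a, ξ = padLeaf hs a →
      WalkLabel G τ (bitTree s j) w x a := by
    intro x ξ h
    induction h with
    | base m hm =>
      rintro a rfl
      refine WalkLabel.base a ?_
      obtain ⟨m', hm', hm''⟩ := exists_minLeaf s j
      rw [← hm'', WithTop.coe_eq_coe]
      -- the least leaves correspond to each other
      have h1 : padLeaf hs a ≤ padLeaf hs m' := by
        rw [← WithTop.coe_le_coe, hm]
        exact (minOf_isLeast ⟨_, Set.mem_univ ⊤⟩).2 (Set.mem_univ _)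
      have h2 : m' ≤ a := by
        rw [← WithTop.coe_le_coe, hm'']
        exact (minOf_isLeast ⟨_, Set.mem_univ ⊤⟩).2 (Set.mem_univ _)
      refine le_antisymm ?_ h2
      rw [← not_lt]
      intro hlt
      refine absurd h1 (not_le_of_gt ?_)
      exact (padHead_lt_iff _ (m'.2.2.trans a.2.2.symm)).mpr hlt
    | @step x y a' b harc hx _ hv ih =>
      rintro a rfl
      have hp : G.prio x / 2 < j := by omega
      obtain ⟨b', rfl⟩ := exists_padLeaf_eq hs b hj
        (leading_of_nonViolated hp (Nat.sub_le _ _) (codeSeq_padLeaf hj hs a) hv)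
      rw [nonViolated_padLeaf hs hp] at hv
      exact WalkLabel.step harc hx (ih b' rfl) hv
  exact key x _ h a rfl

/-! ### Bellman–Ford -/

section BellmanFord

variable {n d : ℕ} (G : ParityGame n d) {M : Type*} [LinearOrder M] {h : ℕ} {T : OrderedTree M h}

/-- The labels of the tails of the arcs of a list are dropped. -/
noncomputable def relax (es : List (Fin n × Fin n)) (ν : Labeling n T) : Labeling n T :=
  es.foldl (fun κ e => dropArc G e.1 e.2 κ) ν

/-- The given number of rounds. -/
noncomputable def rounds (es : List (Fin n × Fin n)) (r : ℕ) (ν : Labeling n T) : Labeling n T :=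
  relax G (List.replicate r es).flatten ν

variable {G}

lemma dropArc_eq (u v : Fin n) (ν : Labeling n T) :
    dropArc G u v ν = Function.update ν u (min (ν u) (tight (G.prio u) (ν v))) := by
  rw [dropArc, drop_eq]

lemma dropArc_le (u v : Fin n) (ν : Labeling n T) : dropArc G u v ν ≤ ν := by
  rw [dropArc_eq]
  intro x
  by_cases hx : x = u
  · subst hx; simp
  · simp [hx]

lemma dropArc_eq_self_iff (u v : Fin n) (ν : Labeling n T) :
    dropArc G u v ν = ν ↔ ν u ≤ tight (G.prio u) (ν v) := by
  rw [dropArc_eq, Function.update_eq_self_iff, min_eq_left_iff]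

lemma relax_nil (ν : Labeling n T) : relax G [] ν = ν := rfl

lemma relax_cons (e : Fin n × Fin n) (es : List (Fin n × Fin n)) (ν : Labeling n T) :
    relax G (e :: es) ν = relax G es (dropArc G e.1 e.2 ν) := rfl

lemma relax_append (es es' : List (Fin n × Fin n)) (ν : Labeling n T) :
    relax G (es ++ es') ν = relax G es' (relax G es ν) := by
  simp [relax, List.foldl_append]

lemma rounds_zero (es : List (Fin n × Fin n)) (ν : Labeling n T) : rounds G es 0 ν = ν := rfl

lemma rounds_succ (es : List (Fin n × Fin n)) (r : ℕ) (ν : Labeling n T) :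
    rounds G es (r + 1) ν = relax G es (rounds G es r ν) := by
  rw [rounds, List.replicate_succ', List.flatten_append, relax_append]
  simp [rounds]

lemma relax_le (es : List (Fin n × Fin n)) (ν : Labeling n T) : relax G es ν ≤ ν := by
  induction es generalizing ν with
  | nil => exact le_rfl
  | cons e es ih => exact (ih _).trans (dropArc_le _ _ _)

lemma rounds_anti (es : List (Fin n × Fin n)) (ν : Labeling n T) {r r' : ℕ} (hr : r ≤ r') :
    rounds G es r' ν ≤ rounds G es r ν := by
  induction hr with
  | refl => exact le_rfl
  | step _ ih => rw [rounds_succ]; exact (relax_le _ _).trans ih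

/-- The arc `uv` is not loose after its relaxation, and labels never grow. -/
lemma relax_arc {es : List (Fin n × Fin n)} {u v : Fin n} (he : (u, v) ∈ es) (ν : Labeling n T) :
    relax G es ν u ≤ tight (G.prio u) (ν v) := by
  induction es generalizing ν with
  | nil => simp at he
  | cons e es ih =>
    rw [relax_cons]
    rcases List.mem_cons.mp he with rfl | he
    · refine (relax_le es _ u).trans ?_
      rw [dropArc_eq, Function.update_self]
      exact min_le_right _ _
    · exact (ih he _).trans (tight_mono _ (dropArc_le _ _ _ v))

/-- Labelings without loose arcs stay below. -/
lemma le_relax {es : List (Fin n × Fin n)} {κ ν : Labeling n T}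
    (hκ : ∀ e ∈ es, κ e.1 ≤ tight (G.prio e.1) (κ e.2)) (h : κ ≤ ν) : κ ≤ relax G es ν := by
  induction es generalizing ν with
  | nil => exact h
  | cons e es ih =>
    rw [relax_cons]
    apply ih (fun e' he' => hκ e' (List.mem_cons_of_mem _ he'))
    intro x
    rw [dropArc_eq]
    by_cases hx : x = e.1
    · subst hx
      rw [Function.update_self]
      exact le_min (h _) ((hκ e (by simp)).trans (tight_mono _ (h _)))
    · rw [Function.update_of_ne hx]; exact h x

lemma le_rounds {es : List (Fin n × Fin n)} {κ ν : Labeling n T} (r : ℕ)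
    (hκ : ∀ e ∈ es, κ e.1 ≤ tight (G.prio e.1) (κ e.2)) (h : κ ≤ ν) : κ ≤ rounds G es r ν := by
  refine le_relax (fun e he => hκ e ?_) h
  obtain ⟨l, hl, hel⟩ := List.mem_flatten.mp he
  rwa [List.eq_of_mem_replicate hl] at hel

/-- After `k` rounds, the label of a node is at most its label in any feasible labeling of a walk
with `k` arcs. -/
lemma rounds_le_of_walk {es : List (Fin n × Fin n)} {ν : Labeling n T} (k : ℕ) (x : ℕ → Fin n)
    (ℓ : ℕ → Label T) (harc : ∀ i < k, (x i, x (i + 1)) ∈ es)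
    (hℓ : ∀ i < k, NonViolated (G.prio (x i)) (ℓ i) (ℓ (i + 1))) (hend : ν (x k) ≤ ℓ k) :
    rounds G es k ν (x 0) ≤ ℓ 0 := by
  induction k generalizing x ℓ with
  | zero => exact hend
  | succ k ih =>
    rw [rounds_succ]
    refine (relax_arc (harc 0 (by omega)) _).trans ?_
    refine (tight_mono _ (ih (fun i => x (i + 1)) (fun i => ℓ (i + 1)) ?_ ?_ hend)).trans
      (nonViolated_iff.mp (hℓ 0 (by omega)))
    · exact fun i hi => harc (i + 1) (by omega)
    · exact fun i hi => hℓ (i + 1) (by omega)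

/-- A property of arcs that is preserved by every single step holds in the end. -/
lemma relax_induction {es : List (Fin n × Fin n)} {ν : Labeling n T} (P : Labeling n T → Prop)
    (h0 : P ν) (hstep : ∀ κ, ∀ e ∈ es, P κ → P (dropArc G e.1 e.2 κ)) : P (relax G es ν) := by
  induction es generalizing ν with
  | nil => exact h0
  | cons e es ih =>
    exact ih (hstep ν e (by simp) h0) (fun κ e' he' => hstep κ e' (List.mem_cons_of_mem _ he'))

end BellmanFord

/-! ### Paths and cycles -/

section Paths

variable {V : Type*} {R : V → V → Prop}

lemma forall_pathArcs_iff (P : List V) : (∀ e ∈ pathArcs P, R e.1 e.2) ↔ P.IsChain R := by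
  induction P with
  | nil => simp [pathArcs]
  | cons a l ih =>
    cases l with
    | nil => simp [pathArcs]
    | cons b l =>
      rw [List.isChain_cons_cons, ← ih]
      simp [pathArcs]

lemma forall_cycleArcs_iff (a : V) (l : List V) :
    (∀ e ∈ cycleArcs (a :: l), R e.1 e.2) ↔ (a :: (l ++ [a])).IsChain R := by
  have key : ∀ (l : List V) (x y : V), (∀ e ∈ (x :: l).zip (l ++ [y]), R e.1 e.2) ↔
      (x :: (l ++ [y])).IsChain R := by
    intro l
    induction l with
    | nil => simp
    | cons b l ih =>
      intro x y
      rw [List.cons_append, List.isChain_cons_cons, ← ih b y]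
      simp
  rw [cycleArcs]
  simp only [List.rotate_cons_succ, List.rotate_zero]
  exact key l a a

lemma transGen_of_isChain {x y : V} {l : List V} (h : (x :: l).IsChain R) (hy : y ∈ l) :
    Relation.TransGen R x y := by
  induction l generalizing x with
  | nil => simp at hy
  | cons z l ih =>
    rw [List.isChain_cons_cons] at h
    rcases List.mem_cons.mp hy with rfl | hy
    · exact .single h.1
    · exact .head h.1 (ih h.2 hy)

lemma IsCycle.transGen {C : List V} (h : IsCycle R C) {w : V} (hw : w ∈ C) :
    Relation.TransGen R w w := by
  obtain ⟨h1, -, h2⟩ := h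
  cases C with
  | nil => simp at hw
  | cons a l =>
    rw [forall_cycleArcs_iff] at h2
    obtain ⟨s, t, hst⟩ := List.append_of_mem hw
    cases s with
    | nil =>
      simp only [List.nil_append, List.cons.injEq] at hst
      obtain ⟨rfl, rfl⟩ := hst
      exact transGen_of_isChain h2 (by simp)
    | cons b s =>
      simp only [List.cons_append, List.cons.injEq] at hst
      obtain ⟨rfl, rfl⟩ := hst
      have h3 : Relation.TransGen R a w := transGen_of_isChain h2 (by simp)
      have h4 : (w :: (t ++ [a])).IsChain R := by
        rw [← List.cons_append] at h2
        refine List.IsChain.suffix h2 ⟨a :: s, by simp⟩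
      exact (transGen_of_isChain h4 (by simp)).trans h3

/-- Cutting off loops turns a walk into a path. -/
lemma exists_isPath {u w : V} (h : Relation.ReflTransGen R u w) : ∃ P, IsPath R u w P := by
  induction h using Relation.ReflTransGen.head_induction_on with
  | refl => exact ⟨[w], by simp [IsPath, pathArcs]⟩
  | @head u v huv _ ih =>
    obtain ⟨P, h1, h2, h3, h4⟩ := ih
    rw [forall_pathArcs_iff] at h4
    by_cases hu : u ∈ P
    · obtain ⟨s, t, rfl⟩ := List.append_of_mem hu
      refine ⟨u :: t, by simp, ?_, ?_, ?_⟩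
      · rw [← h2, List.getLast?_append]; simp [List.getLast?_cons]
      · exact (List.nodup_append.mp h3).2.1
      · rw [forall_pathArcs_iff]
        exact h4.suffix ⟨s, rfl⟩
    · cases P with
      | nil => simp at h1
      | cons a l =>
        simp only [List.head?_cons, Option.some.injEq] at h1
        subst h1
        refine ⟨u :: a :: l, by simp, ?_, List.nodup_cons.mpr ⟨hu, h3⟩, ?_⟩
        · rw [← h2]; simp
        · rw [forall_pathArcs_iff]
          exact List.isChain_cons_cons.mpr ⟨huv, h4⟩

lemma exists_isCycle {w : V} (h : Relation.TransGen R w w) : ∃ C, IsCycle R C ∧ w ∈ C := by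
  obtain ⟨u, hu, huw⟩ := Relation.TransGen.head'_iff.mp h
  obtain ⟨P, h1, h2, h3, h4⟩ := exists_isPath huw
  rw [forall_pathArcs_iff] at h4
  obtain ⟨P', rfl⟩ : ∃ P', P = P' ++ [w] := by
    have := List.getLast?_eq_some_iff.mp h2
    exact this
  refine ⟨w :: P', ⟨by simp, ?_, ?_⟩, by simp⟩
  · have := List.nodup_append.mp h3
    refine List.nodup_cons.mpr ⟨fun hw => ?_, this.1⟩
    exact this.2.2 w hw w (by simp) rfl
  · rw [forall_cycleArcs_iff]
    cases hP : P' ++ [w] with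
    | nil => simp at hP
    | cons a l =>
      rw [hP] at h1 h4
      simp only [List.head?_cons, Option.some.injEq] at h1
      subst h1
      exact List.isChain_cons_cons.mpr ⟨hu, h4⟩

lemma mem_pathArcs_iff {P : List V} {a b : V} :
    (a, b) ∈ pathArcs P ↔ ∃ (i : ℕ) (hi : i + 1 < P.length), P[i] = a ∧ P[i + 1] = b := by
  rw [pathArcs, List.mem_iff_getElem]
  constructor
  · rintro ⟨i, hi, h⟩
    rw [List.length_zip, List.length_tail] at hi
    refine ⟨i, by omega, ?_⟩
    simpa using h
  · rintro ⟨i, hi, h⟩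
    refine ⟨i, by rw [List.length_zip, List.length_tail]; omega, ?_⟩
    simpa using h

/-- Every step of a closed walk can be undone by following the walk. -/
lemma transGen_closed {w x : V} (h : Relation.TransGen R w x)
    (hb : Relation.ReflTransGen R x w) :
    Relation.TransGen (fun a b => R a b ∧ Relation.ReflTransGen R b w ∧
      Relation.ReflTransGen R w a) w x := by
  induction h with
  | single h => exact .single ⟨h, hb, .refl⟩
  | tail h1 h2 ih => exact .tail (ih (.head h2 hb)) ⟨h2, hb, h1.to_reflTransGen⟩

end Paths

/-- The minimum bottleneck cost is at most `i` if and only if there is a closed walk that only uses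
arcs of cost at most `i`. -/
lemma minCycleCost_le_iff {n d : ℕ} {G : ParityGame n d} {τ : OddStrategy G}
    (c : Fin n → Fin n → ℕ∞) (w : Fin n) (i : ℕ) :
    minCycleCost G τ c w ≤ i ↔
      Relation.TransGen (fun a b => ArcD G τ a b ∧ c a b ≤ i) w w := by
  constructor
  · intro h
    have hne : {x : ℕ∞ | ∃ C, IsCycle (ArcD G τ) C ∧ w ∈ C ∧ x = bottleneck c C}.Nonempty := by
      by_contra hno
      rw [Set.not_nonempty_iff_eq_empty] at hno
      rw [minCycleCost, hno, sInf_empty, top_le_iff] at h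
      exact absurd h (by simp)
    obtain ⟨C, hC, hwC, hx⟩ := csInf_mem hne
    have h2 : bottleneck c C ≤ i := by rw [← hx]; exact h
    unfold bottleneck at h2
    rw [iSup₂_le_iff] at h2
    exact IsCycle.transGen ⟨hC.1, hC.2.1, fun e he => ⟨hC.2.2 e he, h2 e he⟩⟩ hwC
  · intro h
    obtain ⟨C, hC, hw⟩ := exists_isCycle h
    have hCD : IsCycle (ArcD G τ) C := ⟨hC.1, hC.2.1, fun e he => (hC.2.2 e he).1⟩
    have hle : minCycleCost G τ c w ≤ bottleneck c C := sInf_le ⟨C, hCD, hw, rfl⟩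
    refine hle.trans ?_
    exact iSup₂_le fun e he => (hC.2.2 e he).2

/-! ### Structure of the auxiliary digraph -/

section Auxiliary

variable {n d : ℕ} {G : ParityGame n d} {τ : OddStrategy G}

lemma prio_le_of_mem_nodesK {v w : Fin n} (h : v ∈ nodesK G τ w) : G.prio v ≤ G.prio w := by
  rcases Relation.ReflTransGen.cases_head h.1 with rfl | ⟨u, hu, -⟩
  · exact le_rfl
  · exact hu.2.1

lemma self_mem_nodesJ (w : Fin n) : w ∈ nodesJ G τ w := ⟨⟨.refl, .refl⟩, .refl⟩

lemma mem_dominators_nodesK {v w : Fin n} (hv : v ∈ dominators G (nodesK G τ w)) :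
    G.prio w ≤ G.prio v := hv.2 w (self_mem_nodesJ (τ := τ) w).1

lemma ArcJ.arc {w x y : Fin n} (h : ArcJ G τ w x y) : Arc G τ x y := h.2.2.2.2.1

lemma ArcJ.head {w x y : Fin n} (h : ArcJ G τ w x y) : y = w ∨ G.prio y < G.prio w := by
  by_contra hno
  push Not at hno
  obtain ⟨-, -, -, hy, -, hdom⟩ := h
  refine hdom ⟨⟨hy, fun u hu => ?_⟩, hno.1⟩
  exact (prio_le_of_mem_nodesK hu).trans hno.2

/-- Only arcs that enter a node `v ≠ w` of the highest priority are missing in `K'_w`; therefore arcs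
that lead to `w` or to a node of smaller priority remain in `J_w`. -/
lemma arcJ_of_arc {w x y : Fin n} (harc : Arc G τ x y) (hx : G.prio x ≤ G.prio w)
    (hwx : Relation.ReflTransGen (ArcUpTo G τ (G.prio w)) w x)
    (hy : y ∈ nodesJ G τ w) (hyw : y = w ∨ G.prio y < G.prio w) : ArcJ G τ w x y := by
  have hyp := prio_le_of_mem_nodesK hy.1
  have hxK : x ∈ nodesK G τ w := ⟨.head ⟨harc, hx, hyp⟩ hy.1.1, hwx⟩
  have harc' : ArcK' G τ w x y := by
    refine ⟨hxK, hy.1, harc, ?_⟩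
    rintro ⟨h1, h2⟩
    have := mem_dominators_nodesK h1
    rcases hyw with h3 | h3
    · exact h2 h3
    · omega
  exact ⟨⟨hxK, .head harc' hy.2⟩, hy, harc'⟩

section Walk

variable {j : ℕ} {S : OrderedTree BinStr j} {w : Fin n}

lemma WalkLabel.reflTransGen {x : Fin n} {a : Leaf S} (h : WalkLabel G τ S w x a) :
    Relation.ReflTransGen (ArcUpTo G τ (G.prio w)) x w := by
  induction h with
  | base => exact .refl
  | step harc hx hy _ ih =>
    refine .head ⟨harc, hx.le, ?_⟩ ih
    rcases hy.eq_or_lt with rfl | h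
    · exact le_rfl
    · exact h.le

lemma WalkLabel.prio_le {x : Fin n} {a : Leaf S} (h : WalkLabel G τ S w x a) :
    G.prio x ≤ G.prio w := by
  rcases h.eq_or_lt with rfl | h
  · exact le_rfl
  · exact h.le

/-- A walk from a node that is reachable from `w` lies in `J_w`, and fixed points of the drop
operators lie below its labels. -/
lemma WalkLabel.mem_nodesJ {x : Fin n} {a : Leaf S} (h : WalkLabel G τ S w x a)
    (hwx : Relation.ReflTransGen (ArcUpTo G τ (G.prio w)) w x) :
    x ∈ nodesJ G τ w ∧ ∀ ν : Labeling n S, (∀ u v, ArcJ G τ w u v → dropArc G u v ν = ν) →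
      ν w = minOf Set.univ → ν x ≤ a := by
  induction h with
  | base m hm => exact ⟨self_mem_nodesJ w, fun ν _ h => (h.trans hm.symm).le⟩
  | @step x y a b harc hx hy hv ih =>
    obtain ⟨h1, h2⟩ := ih (hwx.tail ⟨harc, hx.le, hy.prio_le⟩)
    have hJ := arcJ_of_arc harc hx.le hwx h1 hy.eq_or_lt
    refine ⟨hJ.1, fun ν h3 h4 => ?_⟩
    have h5 := (dropArc_eq_self_iff x y ν).mp (h3 x y hJ)
    exact h5.trans ((tight_mono _ (h2 ν h3 h4)).trans (nonViolated_iff.mp hv))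

/-- A closed walk through nodes of priority at most `π(v)` contains a cycle through `v` that
witnesses that `v` is a base node. -/
lemma mem_baseNodes {v : Fin n} (hv : Even (G.prio v))
    (h : Relation.TransGen (ArcUpTo G τ (G.prio v)) v v) : v ∈ baseNodes G τ := by
  obtain ⟨C, hC, hvC⟩ := exists_isCycle h
  refine ⟨hv, C, ⟨hC.1, hC.2.1, fun e he => (hC.2.2 e he).1⟩, hvC, fun u hu => ?_⟩
  obtain ⟨y, hy, -⟩ := Relation.TransGen.head'_iff.mp (hC.transGen hu)
  exact hy.2.1

/-- A labeled walk from an out-neighbour of `v` to `w` lies in `J_w` if it can be closed up, so that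
`vw` is an arc of the auxiliary digraph. -/
lemma arcD_of_walk {v u : Fin n} {a : Leaf S} (hprio : G.prio v = G.prio w)
    (hev : Even (G.prio w)) (harc : Arc G τ v u) (h : WalkLabel G τ S w u a)
    (hwv : Relation.ReflTransGen (ArcUpTo G τ (G.prio w)) w v) : ArcD G τ v w := by
  have hvu : ArcUpTo G τ (G.prio w) v u := ⟨harc, hprio.le, h.prio_le⟩
  have hJ := arcJ_of_arc harc hprio.le hwv (h.mem_nodesJ (hwv.tail hvu)).1 h.eq_or_lt
  have hvw : Relation.TransGen (ArcUpTo G τ (G.prio w)) v w :=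
    Relation.TransGen.head'_iff.mpr ⟨u, hvu, h.reflTransGen⟩
  refine ⟨mem_baseNodes (by rwa [hprio]) (by rw [hprio]; exact hvw.trans_left hwv),
    mem_baseNodes hev (hvw.trans_right hwv), ?_⟩
  by_cases hne : v = w
  · subst hne; exact Or.inr ⟨rfl, u, hJ⟩
  · exact Or.inl ⟨hne, hJ.1, fun x hx => by rw [hprio]; exact prio_le_of_mem_nodesK hx.1⟩

end Walk

lemma ArcD.prio_eq {v w : Fin n} (h : ArcD G τ v w) : G.prio v = G.prio w := by
  obtain ⟨-, -, ⟨-, hv⟩ | ⟨rfl, -⟩⟩ := h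
  · exact le_antisymm (prio_le_of_mem_nodesK hv.1.1) (hv.2 w (self_mem_nodesJ w))
  · rfl

lemma ArcD.even {v w : Fin n} (h : ArcD G τ v w) : Even (G.prio w) := h.2.1.1

lemma ArcD.mem_nodesK {v w : Fin n} (h : ArcD G τ v w) : v ∈ nodesK G τ w := by
  obtain ⟨-, -, ⟨-, hv⟩ | ⟨rfl, -⟩⟩ := h
  · exact hv.1.1
  · exact ⟨.refl, .refl⟩

end Auxiliary

/-! ### Arc costs from a single Bellman–Ford computation for each base node -/

section Costs

variable {n d : ℕ} (G : ParityGame n d) (τ : OddStrategy G) (es : List (Fin n × Fin n)) (L h : ℕ)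

/-- The smallest leaf at `w`, and `⊤` at all other nodes. -/
noncomputable def baseInit (w : Fin n) : Labeling n (bitTree L (G.prio w / 2)) :=
  Function.update (fun _ => ⊤) w (minOf Set.univ)

/-- The labels obtained by `n - 1` rounds of the Bellman–Ford procedure for the tree with the maximum
number of bits, applied to the arcs whose tails have smaller priority than `w`. -/
noncomputable def baseLabels (w : Fin n) : Labeling n (bitTree L (G.prio w / 2)) :=
  rounds G (es.filter (fun e => G.prio e.1 < G.prio w)) (n - 1) (baseInit G L w)

/-- The arc `vw` of the auxiliary digraph has cost at most `i`: the label of some out-neighbour of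
`v` lies in the initial segment formed by the `i`th tree of the chain. A leaf of the largest tree
belongs to that segment if and only if the leading entries of its code are minimal, so one
computation in the largest tree serves all indices. -/
def CostLE (i : ℕ) (v w : Fin n) : Prop :=
  G.prio v = G.prio w ∧ Even (G.prio w) ∧ ∃ u, Arc G τ v u ∧
    ∃ a : Leaf (bitTree L (G.prio w / 2)), baseLabels G es L w u = (a : Label (bitTree L (G.prio w / 2))) ∧
      ∀ t < L - chainBits L h (G.prio w / 2) i, codeSeq a.1 t = -((G.prio w / 2 : ℕ) : ℤ)

/-- The costs of the arcs of the auxiliary digraph. -/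
noncomputable def arcCost (v w : Fin n) : ℕ∞ :=
  sInf {x : ℕ∞ | ∃ i ≤ L, x = (i : ℕ∞) ∧ CostLE G τ es L h i v w}

variable {G τ es L h}

lemma chainBits_le {j i : ℕ} (hi : i ≤ L) : chainBits L h j i ≤ L := by
  unfold chainBits; split_ifs <;> omega

lemma CostLE.mono {i i' : ℕ} (hi : i ≤ i') {v w : Fin n} (hc : CostLE G τ es L h i v w) :
    CostLE G τ es L h i' v w := by
  obtain ⟨h1, h2, u, hu, a, ha, h3⟩ := hc
  refine ⟨h1, h2, u, hu, a, ha, fun t ht => h3 t (ht.trans_le ?_)⟩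
  unfold chainBits; split_ifs <;> omega

/-- The costs are the thresholds of the monotone predicates `CostLE i`. -/
lemma arcCost_le_iff {i : ℕ} (hi : i ≤ L) {v w : Fin n} :
    arcCost G τ es L h v w ≤ i ↔ CostLE G τ es L h i v w := by
  constructor
  · intro hle
    have hne : {x : ℕ∞ | ∃ i ≤ L, x = (i : ℕ∞) ∧ CostLE G τ es L h i v w}.Nonempty := by
      by_contra hno
      rw [Set.not_nonempty_iff_eq_empty] at hno
      rw [arcCost, hno, sInf_empty, top_le_iff] at hle
      exact absurd hle (by simp)
    obtain ⟨i', -, hx, hc⟩ := csInf_mem hne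
    have : (i' : ℕ∞) ≤ i := by rw [← hx]; exact hle
    exact hc.mono (by exact_mod_cast this)
  · exact fun hc => sInf_le ⟨i, hi, rfl, hc⟩

/-- Every finite label that occurs in the Bellman–Ford procedure is realized by a labeled walk: it is
inherited along an arc that is tight at the time of the update. -/
lemma baseLabels_walk (hes : ListsArcs G τ es) {w x : Fin n}
    {a : Leaf (bitTree L (G.prio w / 2))} (ha : baseLabels G es L w x = (a : Label (bitTree L (G.prio w / 2)))) :
    WalkLabel G τ (bitTree L (G.prio w / 2)) w x a := by
  have key : ∀ x (a : Leaf (bitTree L (G.prio w / 2))),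
      baseLabels G es L w x = (a : Label (bitTree L (G.prio w / 2))) →
      WalkLabel G τ (bitTree L (G.prio w / 2)) w x a := by
    unfold baseLabels rounds
    refine relax_induction (fun κ => ∀ x (a : Leaf (bitTree L (G.prio w / 2))), κ x = (a : Label (bitTree L (G.prio w / 2))) →
      WalkLabel G τ (bitTree L (G.prio w / 2)) w x a) ?_ ?_
    · intro x a hx
      unfold baseInit at hx
      by_cases hxw : x = w
      · subst hxw
        rw [Function.update_self] at hx
        exact WalkLabel.base a hx.symm
      · rw [Function.update_of_ne hxw] at hx
        exact absurd hx.symm (WithTop.coe_ne_top)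
    · intro κ e he hκ x a hx
      obtain ⟨l, hl, hel⟩ := List.mem_flatten.mp he
      rw [List.eq_of_mem_replicate hl, List.mem_filter, decide_eq_true_eq] at hel
      rw [dropArc_eq] at hx
      by_cases hxe : x = e.1
      · subst hxe
        rw [Function.update_self] at hx
        rcases min_choice (κ e.1) (tight (G.prio e.1) (κ e.2)) with h1 | h1
        · exact hκ _ a (h1.symm.trans hx)
        · have hv := nonViolated_tight (G.prio e.1) (κ e.2)
          rw [← h1, hx] at hv
          obtain ⟨b, hb⟩ := WithTop.ne_top_iff_exists.mp (hv.ne_top WithTop.coe_ne_top)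
          rw [← hb] at hv
          exact WalkLabel.step ((hes.2 e).mp hel.1) hel.2 (hκ e.2 b hb.symm) hv
      · rw [Function.update_of_ne hxe] at hx
        exact hκ x a hx
  exact key x a ha

/-- An arc of cost at most `i` comes with a walk that is labeled by leaves of the `i`th tree. -/
lemma CostLE.walk (hes : ListsArcs G τ es) {i : ℕ} (hi : i ≤ L) {v w : Fin n}
    (hc : CostLE G τ es L h i v w) : ∃ u, Arc G τ v u ∧
      ∃ a, WalkLabel G τ (bitTree (chainBits L h (G.prio w / 2) i) (G.prio w / 2)) w u a := by
  obtain ⟨-, h2, u, hu, a, ha, h3⟩ := hc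
  have hpos : 0 < G.prio w / 2 := by
    have := G.prio_pos w
    obtain ⟨k, hk⟩ := h2
    omega
  obtain ⟨a', rfl⟩ := exists_padLeaf_eq (chainBits_le hi) a hpos h3
  refine ⟨u, hu, a', WalkLabel.of_padLeaf (chainBits_le hi) hpos ?_ (baseLabels_walk hes ha)⟩
  obtain ⟨k, hk⟩ := h2
  omega

/-- A short walk to `w` that is labeled by leaves of the `i`th tree yields a cost of at most `i`. -/
lemma costLE_of_walk (hes : ListsArcs G τ es) {i : ℕ} (hi : i ≤ L) {v w : Fin n}
    (hprio : G.prio v = G.prio w) (hev : Even (G.prio w)) {k : ℕ} (hk : k ≤ n - 1)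
    {x : ℕ → Fin n} (hv : Arc G τ v (x 0)) (hxk : x k = w)
    (harc : ∀ i < k, Arc G τ (x i) (x (i + 1)) ∧ G.prio (x i) < G.prio w)
    (ℓ : ℕ → Leaf (bitTree (chainBits L h (G.prio w / 2) i) (G.prio w / 2)))
    (hℓ : ∀ t < k, NonViolated (G.prio (x t))
      (ℓ t : Label (bitTree (chainBits L h (G.prio w / 2) i) (G.prio w / 2))) (ℓ (t + 1))) :
    CostLE G τ es L h i v w := by
  have hpos : 0 < G.prio w / 2 := by
    have := G.prio_pos w
    obtain ⟨k, hk⟩ := hev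
    omega
  have hle : baseLabels G es L w (x 0) ≤ padLeaf (chainBits_le hi) (ℓ 0) := by
    refine (rounds_anti _ _ hk _).trans ?_
    refine rounds_le_of_walk k x (fun i => (padLeaf (chainBits_le hi) (ℓ i) :
      Label (bitTree L (G.prio w / 2)))) ?_ ?_ ?_
    · intro i hi
      rw [List.mem_filter, decide_eq_true_eq]
      exact ⟨(hes.2 _).mpr (harc i hi).1, (harc i hi).2⟩
    · intro i' hi'
      rw [nonViolated_padLeaf]
      · exact hℓ i' hi'
      · have := (harc i' hi').2
        obtain ⟨k, hk⟩ := hev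
        omega
    · rw [hxk, baseInit, Function.update_self]
      exact (minOf_isLeast ⟨⊤, Set.mem_univ ⊤⟩).2 (Set.mem_univ _)
  have hne : baseLabels G es L w (x 0) ≠ ⊤ := (hle.trans_lt (WithTop.coe_lt_top _)).ne
  obtain ⟨a, ha⟩ := WithTop.ne_top_iff_exists.mp hne
  rw [← ha, WithTop.coe_le_coe] at hle
  exact ⟨hprio, hev, x 0, hv, a, ha.symm,
    leading_of_le hpos (Nat.sub_le _ _) (codeSeq_padLeaf hpos _ _) hle⟩

/-- The fixed points of the drop operators are closed under pointwise suprema, so a maximal one is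
the greatest. -/
lemma exists_isLambda {j : ℕ} (S : OrderedTree BinStr j) (w : Fin n) :
    ∃ ν : Labeling n S, IsLambda G τ S w ν := by
  have : Finite (Label S) := finite_label S
  set A : Set (Labeling n S) := {ν' | (∀ u v, ArcJ G τ w u v → dropArc G u v ν' = ν') ∧
    ν' w = minOf Set.univ} with hA
  have hmin : IsLeast (Set.univ : Set (Label S)) (minOf Set.univ) := minOf_isLeast ⟨⊤, trivial⟩
  have hne : A.Nonempty :=
    ⟨fun _ => minOf Set.univ, fun u v _ => (dropArc_eq_self_iff _ _ _).mpr (hmin.2 trivial), rfl⟩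
  have hsup : ∀ ν ∈ A, ∀ κ ∈ A, ν ⊔ κ ∈ A := by
    rintro ν ⟨h1, h2⟩ κ ⟨h3, h4⟩
    refine ⟨fun u v huv => ?_, ?_⟩
    · rw [dropArc_eq_self_iff]
      refine sup_le ?_ ?_
      · exact ((dropArc_eq_self_iff _ _ _).mp (h1 u v huv)).trans
          (tight_mono _ (le_sup_left (a := ν v)))
      · exact ((dropArc_eq_self_iff _ _ _).mp (h3 u v huv)).trans
          (tight_mono _ (le_sup_right (a := ν v)))
    · rw [Pi.sup_apply, h2, h4, sup_idem]
  obtain ⟨ν, hν⟩ := (Set.toFinite A).exists_maximal hne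
  refine ⟨ν, hν.1, fun κ hκ => ?_⟩
  exact le_sup_right.trans (hν.2 (hsup ν hν.1 κ hκ) le_sup_left)

/-- A labeled walk bounds the greatest fixed point from above, and thus makes it finite. -/
lemma costLower_le_arcCost (hes : ListsArcs G τ es) {v w : Fin n} (hD : ArcD G τ v w) :
    costLower G τ (chainOf L h (G.prio w / 2)) v w ≤ arcCost G τ es L h v w := by
  have hpos : 0 < G.prio w / 2 := by
    have := G.prio_pos w
    obtain ⟨k, hk⟩ := hD.even
    omega
  refine le_sInf ?_
  rintro _ ⟨i, hi, rfl, hc⟩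
  obtain ⟨i', hi', hlen, hbits⟩ : ∃ i' ≤ i, i' < (chainOf L h (G.prio w / 2)).length ∧
      chainBits L h (G.prio w / 2) i' = chainBits L h (G.prio w / 2) i := by
    -- at full height the chain consists of a single tree, and all costs are `0`
    by_cases hjh : G.prio w / 2 < h
    · exact ⟨i, le_rfl, by rw [length_chainOf hpos, if_pos hjh]; omega, rfl⟩
    · exact ⟨0, Nat.zero_le _, by rw [length_chainOf hpos, if_neg hjh]; omega, by
        simp [chainBits, hjh]⟩
  obtain ⟨u, hu, hwalk⟩ := hc.walk hes hi
  rw [← hbits] at hwalk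
  obtain ⟨a, ha⟩ := hwalk
  have key : ∀ S : OrderedTree BinStr (G.prio w / 2),
      S = bitTree (chainBits L h (G.prio w / 2) i') (G.prio w / 2) →
      ∃ ν : Labeling n S, IsLambda G τ S w ν ∧ ∃ u, ArcJ G τ w v u ∧ ν u ≠ ⊤ := by
    rintro _ rfl
    obtain ⟨ν, hν⟩ := exists_isLambda (G := G) (τ := τ)
      (bitTree (chainBits L h (G.prio w / 2) i') (G.prio w / 2)) w
    have hwv := hD.mem_nodesK.2
    obtain ⟨h1, h2⟩ := ha.mem_nodesJ (hwv.tail ⟨hu, hD.prio_eq.le, ha.prio_le⟩)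
    exact ⟨ν, hν, u, arcJ_of_arc hu hD.prio_eq.le hwv h1 ha.eq_or_lt,
      ((h2 ν hν.1.1 hν.1.2).trans_lt (WithTop.coe_lt_top a)).ne⟩
  refine le_trans (sInf_le ⟨i', hlen, rfl, key _ (chainOf_getElem hpos hlen)⟩) ?_
  exact_mod_cast hi'

/-- A path with a labeling by leaves of the `i`th tree has at most `n - 1` arcs, so that the
Bellman–Ford procedure takes it into account. -/
lemma arcCost_le_costUpper (hes : ListsArcs G τ es) {v w : Fin n}
    (hD : ArcD G τ v w) :
    arcCost G τ es L h v w ≤ costUpper G τ (chainOf L h (G.prio w / 2)) v w := by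
  have hpos : 0 < G.prio w / 2 := by
    have := G.prio_pos w
    obtain ⟨k, hk⟩ := hD.even
    omega
  refine le_sInf ?_
  rintro _ ⟨u, P, huJ, ⟨hhead, hlast, hnodup, harcs⟩, rfl⟩
  refine le_sInf ?_
  rintro _ ⟨i, hi, rfl, hν⟩
  have hiL : i ≤ L := by
    rw [length_chainOf hpos] at hi
    split_ifs at hi <;> omega
  rw [arcCost_le_iff hiL]
  rw [chainOf_getElem hpos hi] at hν
  obtain ⟨ν, hfin, σ, hσ, hfeas⟩ := hν
  have hPlen : 0 < P.length := by
    cases P with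
    | nil => simp at hhead
    | cons a l => simp
  -- the path is viewed as a walk that stays at `w` in the end
  have hx : ∀ i, (hi : i < P.length) → P.getD i w = P[i] := by
    intro i hi
    rw [List.getD_eq_getElem?_getD, List.getElem?_eq_getElem hi]; rfl
  have hx0 : P.getD 0 w = u := by
    rw [hx 0 hPlen]
    rw [List.head?_eq_getElem?, List.getElem?_eq_getElem hPlen] at hhead
    exact Option.some.inj hhead
  have hxlast : P.getD (P.length - 1) w = w := by
    rw [hx _ (by omega)]
    rw [List.getLast?_eq_getElem?, List.getElem?_eq_getElem (by omega)] at hlast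
    exact Option.some.inj hlast
  have hmem : ∀ i < P.length - 1, (P.getD i w, P.getD (i + 1) w) ∈ pathArcs P := by
    intro i hi
    rw [mem_pathArcs_iff]
    exact ⟨i, by omega, (hx i (by omega)).symm, (hx (i + 1) (by omega)).symm⟩
  have hcard : P.length ≤ n := by
    have := hnodup.length_le_card
    rwa [Fintype.card_fin] at this
  have hlabel : ∀ t, ∃ a : Leaf (bitTree (chainBits L h (G.prio w / 2) i) (G.prio w / 2)),
      t < P.length → ν (P.getD t w) =
        (a : Label (bitTree (chainBits L h (G.prio w / 2) i) (G.prio w / 2))) := by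
    intro t
    by_cases hi : t < P.length
    · rw [hx t hi]
      obtain ⟨a, ha⟩ := WithTop.ne_top_iff_exists.mp (hfin _ (List.getElem_mem hi))
      exact ⟨a, fun _ => ha.symm⟩
    · obtain ⟨m, -, -⟩ := exists_minLeaf (chainBits L h (G.prio w / 2) i) (G.prio w / 2)
      exact ⟨m, fun h => absurd h hi⟩
  choose ℓ hℓ using hlabel
  refine costLE_of_walk hes hiL hD.prio_eq hD.even (k := P.length - 1) (by omega)
    (x := fun i => P.getD i w) (by rw [hx0]; exact huJ.arc) hxlast ?_ ℓ ?_
  · intro i hi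
    refine ⟨(harcs _ (hmem i hi)).arc, ?_⟩
    have hne : P.getD i w ≠ w := by
      intro heq
      have heq := heq.trans hxlast.symm
      rw [hx i (by omega), hx _ (by omega)] at heq
      have := (List.Nodup.getElem_inj_iff hnodup).mp heq
      omega
    rcases Nat.eq_zero_or_pos i with h0 | h0
    · subst h0
      rw [hx0] at hne ⊢
      exact huJ.head.resolve_left hne
    · have := (harcs _ (hmem (i - 1) (by omega))).head
      simp only [Nat.sub_add_cancel h0] at this
      exact this.resolve_left hne
  · intro i hi
    rw [← hℓ i (by omega), ← hℓ (i + 1) (by omega)]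
    refine hfeas _ _ (hmem i hi) (fun hV => ?_)
    -- on a simple path a node has only one successor
    obtain ⟨i', hi', h1, h2⟩ := mem_pathArcs_iff.mp (hσ _ hV ⟨_, hmem i hi⟩)
    rw [hx i (by omega)] at h1
    have := (List.Nodup.getElem_inj_iff hnodup).mp h1
    subst this
    rw [← h2, hx _ (by omega)]

end Costs

/-! ### Closed walks of bounded cost -/

section Cycles

variable {n d : ℕ} {G : ParityGame n d} {τ : OddStrategy G} {es : List (Fin n × Fin n)} {L h : ℕ}

lemma CostLE.transGen (hes : ListsArcs G τ es) {i : ℕ} (hi : i ≤ L) {v w : Fin n}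
    (hc : CostLE G τ es L h i v w) : Relation.TransGen (ArcUpTo G τ (G.prio w)) v w := by
  obtain ⟨u, hu, a, ha⟩ := hc.walk hes hi
  exact Relation.TransGen.head'_iff.mpr ⟨u, ⟨hu, hc.1.le, ha.prio_le⟩, ha.reflTransGen⟩

lemma reflTransGen_of_costLE (hes : ListsArcs G τ es) {i : ℕ} (hi : i ≤ L) {v w : Fin n}
    (hc : Relation.ReflTransGen (CostLE G τ es L h i) v w) :
    G.prio v = G.prio w ∧ Relation.ReflTransGen (ArcUpTo G τ (G.prio w)) v w := by
  induction hc using Relation.ReflTransGen.head_induction_on with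
  | refl => exact ⟨rfl, .refl⟩
  | head h1 _ ih =>
    refine ⟨h1.1.trans ih.1, Relation.ReflTransGen.trans ?_ ih.2⟩
    have := (h1.transGen hes hi).to_reflTransGen
    rwa [ih.1] at this

/-- Closed walks with respect to the computed costs lie in the auxiliary digraph. -/
lemma minCycleCost_arcCost_le_iff (hes : ListsArcs G τ es) {i : ℕ} (hi : i ≤ L) (w : Fin n) :
    minCycleCost G τ (arcCost G τ es L h) w ≤ i ↔
      Relation.TransGen (CostLE G τ es L h i) w w := by
  rw [minCycleCost_le_iff]
  constructor
  · intro hc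
    exact Relation.TransGen.mono (p := CostLE G τ es L h i)
      (fun a b hab => (arcCost_le_iff hi).mp hab.2) w w hc
  · intro hc
    refine Relation.TransGen.mono ?_ w w (transGen_closed hc .refl)
    rintro a b ⟨h1, h2, h3⟩
    refine ⟨?_, (arcCost_le_iff hi).mpr h1⟩
    obtain ⟨u, hu, x, hx⟩ := h1.walk hes hi
    have h4 := reflTransGen_of_costLE hes hi (h2.trans h3)
    have h5 := h4.2
    rw [h1.1] at h5
    exact arcD_of_walk h1.1 h1.2.1 hu hx h5

lemma mem_baseNodes_of_minCycleCost {c : Fin n → Fin n → ℕ∞} {w : Fin n} {i : ℕ}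
    (hi : minCycleCost G τ c w ≤ i) : w ∈ baseNodes G τ := by
  rw [minCycleCost_le_iff] at hi
  obtain ⟨u, hu, -⟩ := Relation.TransGen.head'_iff.mp hi
  exact hu.1.1

end Cycles

/-! ### The least simultaneous fixed point -/

section LeastFixedPoint

variable {n d : ℕ} {G : ParityGame n d} {τ : OddStrategy G} {M : Type*} [LinearOrder M] {h : ℕ}
  {T : OrderedTree M h}

/-- Every node has an outgoing arc that is not violated. -/
def Supported (G : ParityGame n d) (τ : OddStrategy G) (ν : Labeling n T) : Prop :=
  ∀ v, ∃ w, Arc G τ v w ∧ tight (G.prio v) (ν w) ≤ ν v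

lemma exists_arc (G : ParityGame n d) (τ : OddStrategy G) (v : Fin n) : ∃ w, Arc G τ v w := by
  by_cases hv : v ∈ G.V₁
  · exact ⟨τ.next ⟨v, hv⟩, Finset.mem_filter.mpr ⟨τ.next_arc ⟨v, hv⟩, fun _ => rfl⟩⟩
  · obtain ⟨w, hw⟩ := G.sinkless v
    exact ⟨w, Finset.mem_filter.mpr ⟨hw, fun h => absurd h hv⟩⟩

lemma liftNode_eq_self_iff (v : Fin n) (ν : Labeling n T) :
    liftNode G τ v ν = ν ↔ ∃ w, Arc G τ v w ∧ tight (G.prio v) (ν w) ≤ ν v := by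
  obtain ⟨w₀, hw₀⟩ := exists_arc G τ v
  have hmin : IsLeast {x | ∃ w, Arc G τ v w ∧ x = lift (G.prio v) (ν v) (ν w)} _ :=
    minOf_isLeast ⟨_, w₀, hw₀, rfl⟩
  rw [liftNode, Function.update_eq_self_iff]
  constructor
  · intro heq
    rw [heq] at hmin
    obtain ⟨w, hw, h1⟩ := hmin.1
    rw [lift_eq] at h1
    exact ⟨w, hw, by rw [h1]; exact le_max_right _ _⟩
  · rintro ⟨w, hw, h1⟩
    apply le_antisymm
    · exact hmin.2 ⟨w, hw, by rw [lift_eq, max_eq_left h1]⟩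
    · obtain ⟨w', -, h2⟩ := hmin.1
      rw [h2, lift_eq]; exact le_max_left _ _

/-- A node of Even needs one outgoing arc that is not violated. A node of Odd has only one outgoing
arc in `G_τ`, so that the two kinds of lift operators impose the same condition. -/
lemma fixed_iff_supported (ν : Labeling n T) :
    (∀ φ ∈ liftOps G τ T, φ ν = ν) ↔ Supported G τ ν := by
  have hV₁ : ∀ v w w', v ∈ G.V₁ → Arc G τ v w → Arc G τ v w' → w = w' := by
    intro v w w' hv hw hw'
    have h1 := (Finset.mem_filter.mp hw).2 hv
    have h2 := (Finset.mem_filter.mp hw').2 hv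
    exact h1.trans h2.symm
  have hlift : ∀ v w, liftArc G v w ν = ν ↔ tight (G.prio v) (ν w) ≤ ν v := by
    intro v w
    rw [liftArc, Function.update_eq_self_iff, lift_eq, max_eq_left_iff]
  constructor
  · intro hfix v
    by_cases hv : v ∈ G.V₁
    · obtain ⟨w, hw⟩ := exists_arc G τ v
      exact ⟨w, hw, (hlift v w).mp (hfix _ (Or.inr ⟨v, w, hv, hw, rfl⟩))⟩
    · exact (liftNode_eq_self_iff v ν).mp (hfix _ (Or.inl ⟨v, hv, rfl⟩))
  · rintro hs φ (⟨v, -, rfl⟩ | ⟨v, w, hv, hw, rfl⟩)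
    · exact (liftNode_eq_self_iff v ν).mpr (hs v)
    · obtain ⟨w', hw', h1⟩ := hs v
      rw [hV₁ v w w' hv hw hw', hlift]
      exact h1

lemma exists_least_supported (μ : Labeling n T) :
    ∃ κ, IsLeast {ν | μ ≤ ν ∧ Supported G τ ν} κ := by
  have : Finite (Label T) := finite_label T
  have hne : {ν : Labeling n T | μ ≤ ν ∧ Supported G τ ν}.Nonempty := by
    refine ⟨fun _ => ⊤, fun _ => le_top, fun v => ?_⟩
    obtain ⟨w, hw⟩ := exists_arc G τ v
    exact ⟨w, hw, le_top⟩
  obtain ⟨κ, hκ⟩ := (Set.toFinite {ν : Labeling n T | μ ≤ ν ∧ Supported G τ ν}).exists_minimal hne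
  refine ⟨κ, hκ.1, fun ν hν => ?_⟩
  -- the set is closed under infima
  have hinf : κ ⊓ ν ∈ {ν : Labeling n T | μ ≤ ν ∧ Supported G τ ν} := by
    refine ⟨le_inf hκ.1.1 hν.1, fun v => ?_⟩
    rcases le_total (κ v) (ν v) with h1 | h1
    · obtain ⟨w, hw, h2⟩ := hκ.1.2 v
      refine ⟨w, hw, ?_⟩
      rw [Pi.inf_apply κ ν v, inf_eq_left.mpr h1]
      exact (tight_mono _ inf_le_left).trans h2
    · obtain ⟨w, hw, h2⟩ := hν.2 v
      refine ⟨w, hw, ?_⟩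
      rw [Pi.inf_apply κ ν v, inf_eq_right.mpr h1]
      exact (tight_mono _ inf_le_right).trans h2
  exact (hκ.2 hinf inf_le_left).trans inf_le_right

variable {μ κ : Labeling n T}

/-- If there are no loose arcs initially, there are none with respect to the least fixed point. -/
lemma least_le_tight (hμ : ∀ v w, Arc G τ v w → μ v ≤ tight (G.prio v) (μ w))
    (hκ : IsLeast {ν | μ ≤ ν ∧ Supported G τ ν} κ) {v w : Fin n} (hvw : Arc G τ v w) :
    κ v ≤ tight (G.prio v) (κ w) := by
  -- `F` arises from `κ` by giving every node the smallest label supported by `κ`; it lies again in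
  -- the set of which `κ` is the least element
  set F : Labeling n T := fun v => minOf {x | ∃ w, Arc G τ v w ∧ x = tight (G.prio v) (κ w)} with hF
  have hmin : ∀ v, IsLeast {x | ∃ w, Arc G τ v w ∧ x = tight (G.prio v) (κ w)} (F v) := by
    intro v
    obtain ⟨w₀, hw₀⟩ := exists_arc G τ v
    exact minOf_isLeast ⟨_, w₀, hw₀, rfl⟩
  have hFκ : F ≤ κ := by
    intro v
    obtain ⟨w, hw, h1⟩ := hκ.1.2 v
    exact ((hmin v).2 ⟨w, hw, rfl⟩).trans h1
  have hle : κ ≤ F := by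
    apply hκ.2
    refine ⟨fun v => ?_, fun v => ?_⟩
    · obtain ⟨w, hw, h1⟩ := (hmin v).1
      rw [h1]
      exact (hμ v w hw).trans (tight_mono _ (hκ.1.1 w))
    · obtain ⟨w, hw, h1⟩ := (hmin v).1
      exact ⟨w, hw, by rw [h1]; exact tight_mono _ (hFκ w)⟩
  exact (hle v).trans ((hmin v).2 ⟨w, hvw, rfl⟩)

/-- A coinduction principle for upper bounds on the least fixed point. -/
lemma least_le_of_relation (hκ : IsLeast {ν | μ ≤ ν ∧ Supported G τ ν} κ)
    (R : Fin n → Leaf T → Prop) (h1 : ∀ x ξ, R x ξ → μ x ≤ ξ)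
    (h2 : ∀ x ξ, R x ξ → ∃ y ξ', Arc G τ x y ∧ R y ξ' ∧
      NonViolated (G.prio x) (ξ : Label T) (ξ' : Leaf T))
    {x : Fin n} {ξ : Leaf T} (hx : R x ξ) : κ x ≤ ξ := by
  -- `U` is the smallest labeling above the relation, and `κ ⊓ U` is again supported
  set U : Labeling n T := fun x => minOf {l | ∃ ξ : Leaf T, R x ξ ∧ l = ξ} with hU
  have hUle : ∀ x ξ, R x ξ → U x ≤ ξ := fun x ξ hx =>
    (minOf_isLeast (A := {l : Label T | ∃ ξ : Leaf T, R x ξ ∧ l = ξ}) ⟨_, ξ, hx, rfl⟩).2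
      ⟨ξ, hx, rfl⟩
  have hUcases : ∀ x, U x = ⊤ ∨ ∃ ξ : Leaf T, R x ξ ∧ U x = ξ := by
    intro x
    by_cases hne : ∃ ξ, R x ξ
    · obtain ⟨ξ, hξ⟩ := hne
      exact Or.inr (minOf_isLeast (A := {l : Label T | ∃ ξ : Leaf T, R x ξ ∧ l = ξ})
        ⟨_, ξ, hξ, rfl⟩).1
    · left
      simp only [hU, minOf]
      rw [dif_neg]
      rintro ⟨l, ⟨ξ, hξ, -⟩, -⟩
      exact hne ⟨ξ, hξ⟩
  have hmem : κ ⊓ U ∈ {ν : Labeling n T | μ ≤ ν ∧ Supported G τ ν} := by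
    refine ⟨le_inf hκ.1.1 fun x => ?_, fun v => ?_⟩
    · rcases hUcases x with h | ⟨ξ, hξ, h⟩
      · rw [h]; exact le_top
      · rw [h]; exact h1 x ξ hξ
    · obtain ⟨w, hw, h3⟩ := hκ.1.2 v
      rcases le_total (κ v) (U v) with h4 | h4
      · refine ⟨w, hw, ?_⟩
        rw [Pi.inf_apply κ U v, inf_eq_left.mpr h4]
        exact (tight_mono _ inf_le_left).trans h3
      · rcases hUcases v with h5 | ⟨ξ, hξ, h5⟩
        · refine ⟨w, hw, ?_⟩
          rw [Pi.inf_apply κ U v, inf_eq_right.mpr h4, h5]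
          exact le_top
        · obtain ⟨y, ξ', hy, hR, h6⟩ := h2 v ξ hξ
          refine ⟨y, hy, ?_⟩
          rw [Pi.inf_apply κ U v, inf_eq_right.mpr h4, h5]
          exact (tight_mono _ (inf_le_right.trans (hUle y ξ' hR))).trans (nonViolated_iff.mp h6)
  exact ((hκ.2 hmem) x).trans (inf_le_right.trans (hUle x ξ hx))

/-- Along an arc that is not violated, labels truncated at a height at least that of its tail do not
increase. -/
lemma trunc_le_of_nonViolated {p q : ℕ} {a b : Label T} (hv : NonViolated q a b) (hqp : q ≤ p) :
    trunc p b ≤ trunc p a := by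
  rcases eq_or_ne a ⊤ with rfl | ha
  · exact le_top
  · have hb := hv.ne_top ha
    obtain ⟨a, rfl⟩ := WithTop.ne_top_iff_exists.mp ha
    obtain ⟨b, rfl⟩ := WithTop.ne_top_iff_exists.mp hb
    have h1 : b.1.take (h - q / 2) ≤ a.1.take (h - q / 2) := by
      rw [nonViolated_coe] at hv
      split_ifs at hv
      · exact hv
      · exact hv.le
    have h2 := take_le_take (h - p / 2) h1
    have h3 : min (h - p / 2) (h - q / 2) = h - p / 2 := by
      have := Nat.div_le_div_right (c := 2) hqp
      omega
    rw [List.take_take, List.take_take, h3] at h2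
    exact WithTop.coe_le_coe.mpr h2

end LeastFixedPoint

/-! ### Correctness of the label-correcting algorithm -/

section Correctness

variable {n d : ℕ} {G : ParityGame n d} {τ : OddStrategy G} {es : List (Fin n × Fin n)} {L h : ℕ}

/-- A closed walk of cost at most `i` shows that raised labels are upper bounds. -/
lemma least_le_raise (hes : ListsArcs G τ es) {μ κ : Labeling n (bitTree L h)}
    (hμ : ∀ v w, Arc G τ v w → μ v ≤ tight (G.prio v) (μ w))
    (hκ : IsLeast {ν | μ ≤ ν ∧ Supported G τ ν} κ) {w : Fin n} (hev : Even (G.prio w)) :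
    κ w ≤ raise (chainOf L h (G.prio w / 2)) (μ w) (minCycleCost G τ (arcCost G τ es L h) w) := by
  set j := G.prio w / 2 with hjdef
  have hj : 0 < j := by
    have := G.prio_pos w
    obtain ⟨k, hk⟩ := hev
    omega
  have hjw : G.prio w = 2 * j := by obtain ⟨k, hk⟩ := hev; omega
  rcases eq_or_ne (raise (chainOf L h j) (μ w) (minCycleCost G τ (arcCost G τ es L h) w)) ⊤
    with htop | htop
  · rw [htop]; exact le_top
  -- the raised label is the smallest leaf of a copy at a vertex `v`
  have hmem := minOf_isLeast (A := {x : Label (bitTree L h) | μ w ≤ x ∧ ∃ ξ' : Leaf (bitTree L h),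
    x = ξ' ∧ ∃ (v : List BinStr) (S : OrderedTree BinStr j), IsSubtreeAt (bitTree L h) v S ∧
      (∃ (i' : ℕ) (hi' : i' < (chainOf L h j).length),
        minCycleCost G τ (arcCost G τ es L h) w ≤ i' ∧ EquivTree S ((chainOf L h j)[i'])) ∧
      IsLeast {η : Leaf (bitTree L h) | v <+: η.1} ξ'}) (by
    by_contra hno
    rw [Set.not_nonempty_iff_eq_empty] at hno
    apply htop
    unfold raise
    rw [hno, minOf, dif_neg]
    rintro ⟨x, hx, -⟩
    exact hx)
  obtain ⟨hle, ξ', hξ', v, S, ⟨hv, hvj, hS⟩, ⟨i', hi', hii', heq⟩, hleast⟩ := hmem.1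
  change raise (chainOf L h j) (μ w) (minCycleCost G τ (arcCost G τ es L h) w) = ξ' at hξ'
  change μ w ≤ raise (chainOf L h j) (μ w) (minCycleCost G τ (arcCost G τ es L h) w) at hle
  rw [hξ'] at hle ⊢
  have hi'L : i' ≤ L := by
    rw [length_chainOf hj] at hi'
    split_ifs at hi' <;> omega
  obtain ⟨b, hbdef⟩ : ∃ b, b = chainBits L h j i' := ⟨_, rfl⟩
  have hb : numBits v + b = L := by
    have hSb : S = bitTree (L - numBits v) j :=
      OrderedTree.ext' (hS.trans (bitTree_subtree hv hvj).2.2.symm)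
    rw [chainOf_getElem hj hi', hSb, ← hbdef] at heq
    have := bitTree_equiv hj heq
    have := hv.2
    omega
  rw [minCycleCost_arcCost_le_iff hes hi'L] at hii'
  obtain ⟨m, -, hm⟩ := exists_minLeaf b j
  have hξm : copyLeaf v hvj hb.le m = ξ' := copyLeaf_min hvj hb hleast hm
  set R := CostLE G τ es L h i'
  have hprio : ∀ {a}, Relation.ReflTransGen R a w → G.prio a = G.prio w := fun ha =>
    (reflTransGen_of_costLE hes hi'L ha).1
  have hstep : ∀ {a a'}, R a a' → Relation.ReflTransGen R a' w → ∃ u, Arc G τ a u ∧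
      ∃ ℓ, WalkLabel G τ (bitTree b j) a' u ℓ := by
    intro a a' haa' ha'
    have h1 : G.prio a' / 2 = j := by rw [hprio ha']
    have h2 := haa'.walk hes hi'L
    have key : ∀ k, k = j → (∃ u, Arc G τ a u ∧ ∃ ℓ,
        WalkLabel G τ (bitTree (chainBits L h k i') k) a' u ℓ) →
        ∃ u, Arc G τ a u ∧ ∃ ℓ, WalkLabel G τ (bitTree b j) a' u ℓ := by
      rintro _ rfl hx
      rw [hbdef]; exact hx
    exact key _ h1 h2
  -- all leaves of the copy agree after truncation at height `j`
  have hnv : ∀ {a} (ℓ : Leaf (bitTree b j)), G.prio a = G.prio w →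
      NonViolated (G.prio a) (copyLeaf v hvj hb.le m : Label (bitTree L h))
        (copyLeaf v hvj hb.le ℓ) := by
    intro a ℓ ha
    rw [ha, nonViolated_copyLeaf hvj hb.le (by omega), nonViolated_coe, if_pos hev]
    have : j - G.prio w / 2 = 0 := by omega
    rw [this]; simp
  -- absence of loose arcs carries upper bounds on `μ` backwards along labeled walks, and hence
  -- around the closed walk
  have hdown : ∀ {a}, G.prio a = G.prio w → μ a ≤ ξ' → ∀ x ℓ,
      WalkLabel G τ (bitTree b j) a x ℓ → μ x ≤ copyLeaf v hvj hb.le ℓ := by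
    intro a ha hle x ℓ hx
    induction hx with
    | base m' hm' =>
      rw [← hm, WithTop.coe_eq_coe] at hm'
      rw [hm', hξm]; exact hle
    | @step x y ℓ ℓ' harc hxa hy hv ih =>
      refine (hμ x y harc).trans ((tight_mono _ ih).trans (nonViolated_iff.mp ?_))
      rw [nonViolated_copyLeaf hvj hb.le (by omega)]
      exact hv
  have hall : ∀ a, Relation.ReflTransGen R a w → μ a ≤ ξ' := by
    intro a ha
    induction ha using Relation.ReflTransGen.head_induction_on with
    | refl => exact hle
    | @head a a' haa' ha' ih =>
      obtain ⟨u, hu, ℓ, hℓ⟩ := hstep haa' ha'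
      refine (hμ a u hu).trans ((tight_mono _ (hdown (hprio ha') ih u ℓ hℓ)).trans
        (nonViolated_iff.mp ?_))
      rw [← hξm]
      exact hnv ℓ (hprio (ha'.head haa'))
  rw [← hξm]
  -- the labels of all walks between consecutive nodes of the closed walk, moved to the copy
  refine least_le_of_relation hκ (fun x ξ => ∃ a, Relation.ReflTransGen R w a ∧
    Relation.ReflTransGen R a w ∧ ∃ ℓ, WalkLabel G τ (bitTree b j) a x ℓ ∧
    ξ = copyLeaf v hvj hb.le ℓ) ?_ ?_ ⟨w, .refl, .refl, m, .base m hm, rfl⟩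
  · rintro x _ ⟨a, h1, h2, ℓ, hℓ, rfl⟩
    exact hdown (hprio h2) (hall a h2) x ℓ hℓ
  · rintro x _ ⟨a, h1, h2, ℓ, hℓ, rfl⟩
    cases hℓ with
    | base m' hm' =>
      rw [← hm, WithTop.coe_eq_coe] at hm'
      obtain ⟨a', haa', ha'⟩ : ∃ a', R x a' ∧ Relation.ReflTransGen R a' w := by
        rcases Relation.ReflTransGen.cases_head h2 with rfl | h3
        · exact Relation.TransGen.head'_iff.mp hii'
        · exact h3
      obtain ⟨u, hu, ℓ, hℓ⟩ := hstep haa' ha'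
      refine ⟨u, _, hu, ⟨a', h1.tail haa', ha', ℓ, hℓ, rfl⟩, ?_⟩
      rw [hm']
      exact hnv ℓ (hprio h2)
    | @step _ y _ ℓ' harc hxa hy hv =>
      refine ⟨y, _, harc, ⟨a, h1, h2, ℓ', hy, rfl⟩, ?_⟩
      rw [nonViolated_copyLeaf hvj hb.le (by rw [hprio h2] at hxa; omega)]
      exact hv

lemma raise_le {M : Type*} [LinearOrder M] {h j : ℕ} {T : OrderedTree M h}
    {C : List (OrderedTree M j)} {x : Label T} {i : ℕ∞} {ξ : Leaf T} {v : List M}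
    {S : OrderedTree M j} (hx : x ≤ ξ) (hS : IsSubtreeAt T v S)
    (hC : ∃ (i' : ℕ) (hi' : i' < C.length), i ≤ i' ∧ EquivTree S (C[i']))
    (hξ : IsLeast {η : Leaf T | v <+: η.1} ξ) : raise C x i ≤ ξ :=
  have hmem : (ξ : Label T) ∈ {x' : Label T | x ≤ x' ∧ ∃ ξ' : Leaf T, x' = ξ' ∧
      ∃ (v : List M) (S : OrderedTree M j), IsSubtreeAt T v S ∧
        (∃ (i' : ℕ) (hi' : i' < C.length), i ≤ i' ∧ EquivTree S (C[i'])) ∧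
        IsLeast {η : Leaf T | v <+: η.1} ξ'} := ⟨hx, ξ, rfl, v, S, hS, hC, hξ⟩
  (minOf_isLeast ⟨_, hmem⟩).2 hmem

/-- On a cycle of tight arcs with finite labels, a node of highest priority has even priority, and
its raised label is a lower bound. -/
lemma raise_le_least (hes : ListsArcs G τ es) (hh : d / 2 ≤ h) {μ κ : Labeling n (bitTree L h)}
    (hμκ : μ ≤ κ) {σ : Fin n → Fin n}
    (hσ : ∀ v, Arc G τ v (σ v) ∧ κ v = tight (G.prio v) (κ (σ v)))
    {w : Fin n} (hw : κ w ≠ ⊤) {c : ℕ} (hc : 0 < c) (hcn : c ≤ n) (hper : σ^[c] w = w)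
    (hmax : ∀ i, G.prio (σ^[i] w) ≤ G.prio w) :
    w ∈ baseNodes G τ ∧ minCycleCost G τ (arcCost G τ es L h) w < ⊤ ∧
    raise (chainOf L h (G.prio w / 2)) (μ w) (minCycleCost G τ (arcCost G τ es L h) w) ≤ κ w := by
  have hnv : ∀ v, NonViolated (G.prio v) (κ v) (κ (σ v)) := fun v =>
    nonViolated_iff.mpr (hσ v).2.ge
  have hsucc : ∀ i, σ^[i + 1] w = σ (σ^[i] w) := fun i => Function.iterate_succ_apply' σ i w
  have hfin : ∀ i, κ (σ^[i] w) ≠ ⊤ := by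
    intro i
    induction i with
    | zero => exact hw
    | succ i ih => rw [hsucc]; exact (hnv _).ne_top ih
  have hanti : ∀ i i', i ≤ i' →
      trunc (G.prio w) (κ (σ^[i'] w)) ≤ trunc (G.prio w) (κ (σ^[i] w)) := by
    intro i i' hii'
    induction hii' with
    | refl => exact le_rfl
    | @step k _ ih =>
      refine le_trans ?_ ih
      rw [hsucc]
      exact trunc_le_of_nonViolated (hnv _) (hmax k)
  have hpow : ∀ m, σ^[c * m] w = w := by
    intro m
    exact Function.IsPeriodicPt.mul_const (f := σ) (m := c) hper m
  -- truncated labels do not increase along the cycle, hence they are constant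
  have heq : ∀ i, trunc (G.prio w) (κ (σ^[i] w)) = trunc (G.prio w) (κ w) := by
    intro i
    apply le_antisymm
    · exact hanti 0 i (Nat.zero_le _)
    · have := hanti i (c * i) (Nat.le_mul_of_pos_left _ hc)
      rwa [hpow] at this
  have hev : Even (G.prio w) := by
    -- at an odd priority the truncation would strictly decrease
    by_contra hodd
    have h1 := hnv w
    rw [NonViolated, if_neg hodd] at h1
    rcases h1 with h1 | h1
    · have h2 := heq 1
      rw [Function.iterate_one] at h2
      rw [h2] at h1
      exact lt_irrefl _ h1
    · exact hw h1.1
  set j := G.prio w / 2 with hjdef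
  have hjw : G.prio w = 2 * j := by obtain ⟨k, hk⟩ := hev; omega
  have hj : 0 < j := by
    have := G.prio_pos w
    omega
  have hjh : j ≤ h := by
    have := G.prio_le w
    omega
  -- all labels on the cycle lie in the subtree at the vertex `v`
  choose ξ hξ using fun i => WithTop.ne_top_iff_exists.mp (hfin i)
  have hξ0 : (ξ 0 : Label (bitTree L h)) = κ w := hξ 0
  set v := (ξ 0).1.take (h - j) with hvdef
  have htake : ∀ i, (ξ i).1.take (h - j) = v := by
    intro i
    have h1 := heq i
    rw [← hξ i, ← hξ0, trunc_coe, trunc_coe] at h1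
    exact WithTop.coe_injective h1
  have hvlen : v.length = h - j := by rw [hvdef, List.length_take, (ξ 0).2.2]; omega
  have hvj : v.length + j = h := by omega
  have hvL : numBits v ≤ L := (numBits_take_le _ _).trans (leaf_numBits _)
  -- the index of the tree that occurs at the vertex `v`
  obtain ⟨i', hi', hbits⟩ : ∃ i' < (chainOf L h j).length, chainBits L h j i' = L - numBits v := by
    rw [length_chainOf hj]
    unfold chainBits
    by_cases hlt : j < h
    · exact ⟨L - numBits v, by rw [if_pos hlt]; omega, by rw [if_pos hlt]⟩
    · have hv0 : v = [] := List.length_eq_zero_iff.mp (by omega)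
      exact ⟨0, by rw [if_neg hlt]; omega, by rw [if_neg hlt, hv0]; simp [numBits]⟩
  have hi'L : i' ≤ L := by
    rw [length_chainOf hj] at hi'
    split_ifs at hi' <;> omega
  have hb : numBits v + chainBits L h j i' = L := by omega
  choose ℓ hℓ using fun i => exists_copyLeaf_eq hvj hb (ξ i)
    ((prefix_iff_take hvlen).mpr (htake i))
  -- between consecutive nodes of highest priority, the cycle is a walk labeled by leaves of the
  -- subtree at `v`
  have hstep : ∀ r s, r < s → s ≤ c → G.prio (σ^[r] w) = G.prio w → G.prio (σ^[s] w) = G.prio w →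
      (∀ t, r < t → t < s → G.prio (σ^[t] w) ≠ G.prio w) →
      CostLE G τ es L h i' (σ^[r] w) (σ^[s] w) := by
    intro r s hrs hsc hr hs hbetween
    have key : ∀ k, k = G.prio (σ^[s] w) / 2 → ∀ ℓ' : ℕ → Leaf (bitTree (chainBits L h k i') k),
        (∀ t < s - r - 1, NonViolated (G.prio (σ^[r + 1 + t] w))
          (ℓ' t : Label (bitTree (chainBits L h k i') k)) (ℓ' (t + 1))) →
        CostLE G τ es L h i' (σ^[r] w) (σ^[s] w) := by
      rintro _ rfl ℓ' hℓ'
      refine costLE_of_walk hes hi'L (hr.trans hs.symm) (by rw [hs]; exact hev)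
        (k := s - r - 1) (by omega) (x := fun t => σ^[r + 1 + t] w) ?_ ?_ ?_ ℓ' hℓ'
      · change Arc G τ (σ^[r] w) (σ^[r + 1] w)
        rw [hsucc]; exact (hσ _).1
      · congr 1
        have : r + 1 + (s - r - 1) = s := by omega
        rw [this]
      · intro t ht
        constructor
        · change Arc G τ (σ^[r + 1 + t] w) (σ^[r + 1 + t + 1] w)
          rw [hsucc]; exact (hσ _).1
        · rw [hs]
          exact lt_of_le_of_ne (hmax _) (hbetween _ (by omega) (by omega))
    refine key j (by rw [hs]) (fun t => ℓ (r + 1 + t)) (fun t ht => ?_)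
    have h1 := hnv (σ^[r + 1 + t] w)
    rw [← hsucc, ← hξ, ← hξ, hℓ (r + 1 + t), hℓ (r + 1 + t + 1),
      nonViolated_copyLeaf hvj hb.le] at h1
    · exact h1
    · have := hmax (r + 1 + t); omega
  have htrans : ∀ s, 0 < s → s ≤ c → G.prio (σ^[s] w) = G.prio w →
      Relation.TransGen (CostLE G τ es L h i') w (σ^[s] w) := by
    intro s
    induction s using Nat.strong_induction_on with
    | _ s ih =>
      intro hs0 hsc hs
      -- the last node of highest priority before position `s`
      obtain ⟨r, hr, hrmax⟩ := Finset.exists_max_image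
        ((Finset.range s).filter (fun r => G.prio (σ^[r] w) = G.prio w)) id
        ⟨0, by simp [hs0]⟩
      rw [Finset.mem_filter, Finset.mem_range] at hr
      have hcost := hstep r s hr.1 hsc hr.2 hs (by
        intro t hrt hts ht
        have := hrmax t (by rw [Finset.mem_filter, Finset.mem_range]; exact ⟨hts, ht⟩)
        simp only [id] at this
        omega)
      rcases Nat.eq_zero_or_pos r with h0 | h0
      · subst h0; exact .single hcost
      · exact (ih r hr.1 h0 (by omega) hr.2).tail hcost
  have hcyc : minCycleCost G τ (arcCost G τ es L h) w ≤ i' := by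
    rw [minCycleCost_arcCost_le_iff hes hi'L]
    have := htrans c hc le_rfl (by rw [hper])
    rwa [hper] at this
  refine ⟨mem_baseNodes_of_minCycleCost hcyc, hcyc.trans_lt (by simp), ?_⟩
  have hmem : v ∈ (bitTree L h).carrier := ⟨by omega, hvL⟩
  -- the label of `w` is tight, so it is the smallest leaf of the subtree at `v`
  have hleast : IsLeast {η : Leaf (bitTree L h) | v <+: η.1} (ξ 0) := by
    refine ⟨List.take_prefix _ _, fun η hη => ?_⟩
    rw [Set.mem_ofPred_eq, prefix_iff_take hvlen] at hη
    rw [← WithTop.coe_le_coe, hξ0, (hσ w).2, ← nonViolated_iff]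
    have h1 : σ w = σ^[1] w := rfl
    rw [h1, ← hξ 1, nonViolated_coe, if_pos hev]
    change (ξ 1).1.take (h - j) ≤ η.1.take (h - j)
    rw [htake 1, hη]
  rw [← hξ0]
  refine raise_le (by rw [hξ0]; exact hμκ w) (bitTree_subtree hmem hvj) ⟨i', hi', hcyc, ?_⟩ hleast
  rw [chainOf_getElem hj hi', hbits]
  exact ⟨embeds_refl _, embeds_refl _⟩

/-- The label-correcting algorithm with the computed arc costs returns the least fixed point. -/
theorem isLeastFixedPoint_rounds (hes : ListsArcs G τ es) (hh : d / 2 ≤ h)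
    {μ ν₀ : Labeling n (bitTree L h)}
    (hμ : ∀ v w, Arc G τ v w → μ v ≤ tight (G.prio v) (μ w))
    (hbase : ∀ w ∈ baseNodes G τ, ν₀ w = if minCycleCost G τ (arcCost G τ es L h) w < ⊤ then
      raise (chainOf L h (G.prio w / 2)) (μ w) (minCycleCost G τ (arcCost G τ es L h) w) else ⊤)
    (hother : ∀ w, w ∉ baseNodes G τ → ν₀ w = ⊤) :
    IsLeastFixedPoint G τ μ (rounds G es (n - 1) ν₀) := by
  obtain ⟨κ, hκ⟩ := exists_least_supported (G := G) (τ := τ) μ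
  have hset : {ν' : Labeling n (bitTree L h) | μ ≤ ν' ∧ ∀ φ ∈ liftOps G τ (bitTree L h), φ ν' = ν'} =
      {ν | μ ≤ ν ∧ Supported G τ ν} := by
    ext ν
    simp only [Set.mem_ofPred_eq, fixed_iff_supported]
  have hloose := fun v w => least_le_tight (v := v) (w := w) hμ hκ
  -- the initial labels are upper bounds, and the drop operators never pass below `κ`
  have hge : κ ≤ rounds G es (n - 1) ν₀ := by
    refine le_rounds _ (fun e he => hloose _ _ ((hes.2 e).mp he)) (fun w => ?_)
    by_cases hw : w ∈ baseNodes G τ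
    · rw [hbase w hw]
      split_ifs
      · exact least_le_raise hes hμ hκ hw.1
      · exact le_top
    · rw [hother w hw]; exact le_top
  -- from a node with a finite label, a walk of at most `n - 1` tight arcs reaches a node of highest
  -- priority on a cycle, whose initial label is a lower bound
  have hle : rounds G es (n - 1) ν₀ ≤ κ := by
    intro v
    rcases eq_or_ne (κ v) ⊤ with htop | hne
    · rw [htop]; exact le_top
    have hσ : ∀ v, ∃ w, Arc G τ v w ∧ κ v = tight (G.prio v) (κ w) := by
      intro v
      obtain ⟨w, hw, h1⟩ := hκ.1.2 v
      exact ⟨w, hw, le_antisymm (hloose _ _ hw) h1⟩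
    choose σ hσ using hσ
    have hnv : ∀ v, NonViolated (G.prio v) (κ v) (κ (σ v)) := fun v =>
      nonViolated_iff.mpr (hσ v).2.ge
    have hfin : ∀ i, κ (σ^[i] v) ≠ ⊤ := by
      intro i
      induction i with
      | zero => exact hne
      | succ i ih => rw [Function.iterate_succ_apply']; exact (hnv _).ne_top ih
    -- following tight arcs leads to a cycle within `n` steps
    obtain ⟨a, b, hab, hbn, heq⟩ : ∃ a b, a < b ∧ b ≤ n ∧ σ^[a] v = σ^[b] v := by
      obtain ⟨x, y, hxy, heq⟩ := Fintype.exists_ne_map_eq_of_card_lt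
        (fun i : Fin (n + 1) => σ^[i.1] v) (by simp)
      rcases lt_or_gt_of_ne (fun h => hxy (Fin.ext h) : x.1 ≠ y.1) with h1 | h1
      · exact ⟨x, y, h1, by omega, heq⟩
      · exact ⟨y, x, h1, by omega, heq.symm⟩
    have hperiod : σ^[b - a] (σ^[a] v) = σ^[a] v := by
      rw [← Function.iterate_add_apply, Nat.sub_add_cancel hab.le, heq]
    obtain ⟨i₀, hi₀, hmax⟩ := Finset.exists_max_image (Finset.range (b - a))
      (fun i => G.prio (σ^[i] (σ^[a] v))) ⟨0, by simp; omega⟩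
    rw [Finset.mem_range] at hi₀
    have hw : σ^[a + i₀] v = σ^[i₀] (σ^[a] v) := by rw [add_comm, Function.iterate_add_apply]
    have hprio : ∀ i, G.prio (σ^[i] (σ^[a + i₀] v)) ≤ G.prio (σ^[a + i₀] v) := by
      intro i
      rw [hw, ← Function.iterate_add_apply,
        ← Function.IsPeriodicPt.iterate_mod_apply (n := b - a) hperiod]
      exact hmax _ (Finset.mem_range.mpr (Nat.mod_lt _ (by omega)))
    have hper : σ^[b - a] (σ^[a + i₀] v) = σ^[a + i₀] v := by
      rw [hw, ← Function.iterate_add_apply, add_comm, Function.iterate_add_apply, hperiod]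
    obtain ⟨h1, h2, h3⟩ := raise_le_least hes hh hκ.1.1 hσ (hfin (a + i₀)) (by omega)
      (by omega) hper hprio
    have hend : ν₀ (σ^[a + i₀] v) ≤ κ (σ^[a + i₀] v) := by
      rw [hbase _ h1, if_pos h2]; exact h3
    refine (rounds_anti (r := a + i₀) _ _ (by omega) v).trans ?_
    refine rounds_le_of_walk (a + i₀) (fun i => σ^[i] v) (fun i => κ (σ^[i] v)) ?_ ?_ hend
    · intro i _
      rw [Function.iterate_succ_apply']
      exact (hes.2 _).mpr (hσ _).1
    · intro i _
      rw [Function.iterate_succ_apply']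
      exact hnv _
  rw [IsLeastFixedPoint, hset, le_antisymm hle hge]
  exact hκ

end Correctness

/-! ### Loop programs -/

instance : Add Expr := ⟨Expr.op .add⟩
instance : Sub Expr := ⟨Expr.op .sub⟩
instance : Mul Expr := ⟨Expr.op .mul⟩
instance : Div Expr := ⟨Expr.op .div⟩
instance (k : ℕ) : OfNat Expr k := ⟨Expr.lit k⟩

/-- The expression with value `1` if `e < f`, and `0` otherwise. -/
def Expr.less (e f : Expr) : Expr := .op .lt e f

/-- The expression with value `1` if `e = f`, and `0` otherwise. -/
def Expr.same (e f : Expr) : Expr := .op .eq e f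

section Eval
variable (s : Mem) (e f : Expr)

@[simp] lemma Expr.eval_add : (e + f).eval s = e.eval s + f.eval s := rfl
@[simp] lemma Expr.eval_sub : (e - f).eval s = e.eval s - f.eval s := rfl
@[simp] lemma Expr.eval_mul : (e * f).eval s = e.eval s * f.eval s := rfl
@[simp] lemma Expr.eval_div : (e / f).eval s = e.eval s / f.eval s := rfl
@[simp] lemma Expr.eval_less : (e.less f).eval s = if e.eval s < f.eval s then 1 else 0 := rfl
@[simp] lemma Expr.eval_same : (e.same f).eval s = if e.eval s = f.eval s then 1 else 0 := rfl
@[simp] lemma Expr.eval_ofNat (k : ℕ) : (no_index (OfNat.ofNat k) : Expr).eval s = k := rfl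
@[simp] lemma Expr.eval_lit (k : ℕ) : (Expr.lit k).eval s = k := rfl
@[simp] lemma Expr.eval_reg (x : ℕ) : (Expr.reg x).eval s = s.reg x := rfl
@[simp] lemma Expr.eval_get (a : ℕ) : (Expr.get a e).eval s = s.arr a (e.eval s) := rfl

end Eval

/-- Programs whose only loops are counting loops: `loop x r b` runs `b` with the register `x` taking
the values `0, 1, …` below the value of the register `r`. -/
inductive LoopProg
  | assign (x : ℕ) (e : Expr)
  | store (a : ℕ) (idx e : Expr)
  | seq (p q : LoopProg)
  | ite (e : Expr) (p q : LoopProg)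
  | loop (x r : ℕ) (b : LoopProg)

/-- The memory after writing a register. -/
def Mem.setReg (s : Mem) (x k : ℕ) : Mem := ⟨Function.update s.reg x k, s.arr⟩

/-- The memory after writing an array cell. -/
def Mem.setArr (s : Mem) (a i k : ℕ) : Mem :=
  ⟨s.reg, Function.update s.arr a (Function.update (s.arr a) i k)⟩

@[simp] lemma Mem.setReg_reg (s : Mem) (x k y : ℕ) :
    (s.setReg x k).reg y = if y = x then k else s.reg y := by
  simp [Mem.setReg, Function.update_apply]

@[simp] lemma Mem.setReg_arr (s : Mem) (x k : ℕ) : (s.setReg x k).arr = s.arr := rfl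

@[simp] lemma Mem.setArr_reg (s : Mem) (a i k : ℕ) : (s.setArr a i k).reg = s.reg := rfl

@[simp] lemma Mem.setArr_arr (s : Mem) (a i k b l : ℕ) :
    (s.setArr a i k).arr b l = if b = a ∧ l = i then k else s.arr b l := by
  by_cases h : b = a
  · subst h; simp [Mem.setArr, Function.update_apply]
  · simp [Mem.setArr, h]

namespace LoopProg

/-- The word RAM program that implements a loop program. -/
def compile : LoopProg → Prog
  | assign x e => .assign x e
  | store a idx e => .store a idx e
  | seq p q => .seq p.compile q.compile
  | ite e p q => .ite e p.compile q.compile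
  | loop x r b => .seq (.assign x 0)
      (.while (.less (.reg x) (.reg r)) (.seq b.compile (.assign x (.reg x + 1))))

/-- The memory after `k` rounds of a counting loop whose body transforms the memory by `f`. -/
def iter (f : Mem → Mem) (x : ℕ) (s : Mem) : ℕ → Mem
  | 0 => s.setReg x 0
  | k + 1 => (f (iter f x s k)).setReg x (k + 1)

/-- The final memory. -/
def run : LoopProg → Mem → Mem
  | assign x e, s => s.setReg x (e.eval s)
  | store a idx e, s => s.setArr a (idx.eval s) (e.eval s)
  | seq p q, s => q.run (p.run s)
  | ite e p q, s => if e.eval s ≠ 0 then p.run s else q.run s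
  | loop x r b, s => iter b.run x s (s.reg r)

/-- The number of steps of the compiled program. -/
def time : LoopProg → Mem → ℕ
  | assign _ e, _ => e.cost + 1
  | store _ idx e, _ => idx.cost + e.cost + 1
  | seq p q, s => p.time s + q.time (p.run s)
  | ite e p q, s => e.cost + 1 + if e.eval s ≠ 0 then p.time s else q.time s
  | loop x r b, s => 6 + ∑ k ∈ Finset.range (s.reg r), (b.time (iter b.run x s k) + 8)

/-- The registers that a program may write. -/
def regs : LoopProg → List ℕ
  | assign x _ => [x]
  | store _ _ _ => []
  | seq p q => p.regs ++ q.regs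
  | ite _ p q => p.regs ++ q.regs
  | loop x _ b => x :: b.regs

/-- The arrays that a program may write. -/
def arrs : LoopProg → List ℕ
  | assign _ _ => []
  | store a _ _ => [a]
  | seq p q => p.arrs ++ q.arrs
  | ite _ p q => p.arrs ++ q.arrs
  | loop _ _ b => b.arrs

/-- The body of no loop writes its counter or its bound. -/
def wf : LoopProg → Bool
  | assign _ _ => true
  | store _ _ _ => true
  | seq p q => p.wf && q.wf
  | ite _ p q => p.wf && q.wf
  | loop x r b => b.wf && decide (x ≠ r) && decide (x ∉ b.regs) && decide (r ∉ b.regs)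

/-- No overflow occurs. -/
def Fits (W : ℕ) : LoopProg → Mem → Prop
  | assign _ e, s => e.Fits W s
  | store _ idx e, s => idx.Fits W s ∧ e.Fits W s
  | seq p q, s => p.Fits W s ∧ q.Fits W (p.run s)
  | ite e p q, s => e.Fits W s ∧ if e.eval s ≠ 0 then p.Fits W s else q.Fits W s
  | loop x r b, s => s.reg r ≤ W ∧ ∀ k < s.reg r, b.Fits W (iter b.run x s k)

lemma run_assign (x : ℕ) (e : Expr) (s : Mem) : (assign x e).run s = s.setReg x (e.eval s) := rfl

lemma run_seq (p q : LoopProg) (s : Mem) : (seq p q).run s = q.run (p.run s) := rfl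

lemma run_ite_less (e f : Expr) (p q : LoopProg) (s : Mem) :
    (ite (e.less f) p q).run s = if e.eval s < f.eval s then p.run s else q.run s := by
  by_cases h : e.eval s < f.eval s <;> simp [run, h]

lemma run_ite_same (e f : Expr) (p q : LoopProg) (s : Mem) :
    (ite (e.same f) p q).run s = if e.eval s = f.eval s then p.run s else q.run s := by
  by_cases h : e.eval s = f.eval s <;> simp [run, h]

lemma run_reg_of_notMem (p : LoopProg) (s : Mem) {y : ℕ} (hy : y ∉ p.regs) :
    (p.run s).reg y = s.reg y := by
  induction p generalizing s with
  | assign x e => simp_all [regs, run]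
  | store a idx e => simp [run]
  | seq p q ihp ihq =>
    simp only [regs, List.mem_append, not_or] at hy
    rw [run, ihq _ hy.2, ihp _ hy.1]
  | ite e p q ihp ihq =>
    simp only [regs, List.mem_append, not_or] at hy
    rw [run]; split
    · exact ihp _ hy.1
    · exact ihq _ hy.2
  | loop x r b ih =>
    simp only [regs, List.mem_cons, not_or] at hy
    rw [run]
    generalize s.reg r = N
    induction N with
    | zero => simp [iter, hy.1]
    | succ k ihk => rw [iter, Mem.setReg_reg, if_neg hy.1, ih _ hy.2, ihk]

lemma run_arr_of_notMem (p : LoopProg) (s : Mem) {a : ℕ} (ha : a ∉ p.arrs) :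
    (p.run s).arr a = s.arr a := by
  induction p generalizing s with
  | assign x e => simp [run]
  | store b idx e =>
    simp only [arrs, List.mem_singleton] at ha
    funext l
    simp [run, ha]
  | seq p q ihp ihq =>
    simp only [arrs, List.mem_append, not_or] at ha
    rw [run, ihq _ ha.2, ihp _ ha.1]
  | ite e p q ihp ihq =>
    simp only [arrs, List.mem_append, not_or] at ha
    rw [run]; split
    · exact ihp _ ha.1
    · exact ihq _ ha.2
  | loop x r b ih =>
    rw [run]
    generalize s.reg r = N
    induction N with
    | zero => simp [iter]
    | succ k ihk => rw [iter, Mem.setReg_arr, ih _ ha, ihk]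

lemma iter_reg_of_notMem (b : LoopProg) (x : ℕ) (s : Mem) (k : ℕ) {y : ℕ} (hyx : y ≠ x)
    (hy : y ∉ b.regs) : (iter b.run x s k).reg y = s.reg y := by
  induction k with
  | zero => simp [iter, hyx]
  | succ k ihk => rw [iter, Mem.setReg_reg, if_neg hyx, run_reg_of_notMem _ _ hy, ihk]

lemma iter_arr_of_notMem (b : LoopProg) (x : ℕ) (s : Mem) (k : ℕ) {a : ℕ}
    (ha : a ∉ b.arrs) : (iter b.run x s k).arr a = s.arr a := by
  induction k with
  | zero => simp [iter]
  | succ k ihk => rw [iter, Mem.setReg_arr, run_arr_of_notMem _ _ ha, ihk]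

lemma iter_reg_self (f : Mem → Mem) (x : ℕ) (s : Mem) (k : ℕ) : (iter f x s k).reg x = k := by
  cases k <;> simp [iter]

/-- Loop invariants. In every round the counter has the value `k`, and everything that the body does
not write is unchanged. -/
lemma loop_induct {x r : ℕ} {b : LoopProg} {s : Mem} (I : ℕ → Mem → Prop)
    (h0 : I 0 (s.setReg x 0))
    (hstep : ∀ k < s.reg r, ∀ s' : Mem, s'.reg x = k →
      (∀ y, y ≠ x → y ∉ b.regs → s'.reg y = s.reg y) → (∀ a, a ∉ b.arrs → s'.arr a = s.arr a) →
      I k s' → I (k + 1) ((b.run s').setReg x (k + 1))) :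
    I (s.reg r) ((loop x r b).run s) := by
  rw [run]
  have : ∀ k ≤ s.reg r, I k (iter b.run x s k) := by
    intro k
    induction k with
    | zero => intro _; exact h0
    | succ k ih =>
      intro hk
      exact hstep k hk _ (iter_reg_self _ _ _ _) (fun y h1 h2 => iter_reg_of_notMem _ _ _ _ h1 h2)
        (fun a h => iter_arr_of_notMem _ _ _ _ h) (ih (by omega))
  exact this _ le_rfl

/-- The compiled program computes `run` in `time` steps. -/
theorem exec_compile {W : ℕ} (hW : 1 ≤ W) (p : LoopProg) (s : Mem) (hp : p.wf = true)
    (hf : p.Fits W s) : Exec W p.compile s (p.time s) (p.run s) := by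
  induction p generalizing s with
  | assign x e => exact Exec.assign s x e hf
  | store a idx e => exact Exec.store s a idx e hf.1 hf.2
  | seq p q ihp ihq =>
    simp only [wf, Bool.and_eq_true] at hp
    exact Exec.seq (ihp s hp.1 hf.1) (ihq _ hp.2 hf.2)
  | ite e p q ihp ihq =>
    simp only [wf, Bool.and_eq_true] at hp
    obtain ⟨he, hf⟩ := hf
    by_cases hz : e.eval s = 0
    · simp only [hz, ne_eq, not_true_eq_false, if_false] at hf
      simp only [compile, time, run, hz, ne_eq, not_true_eq_false, if_false]
      exact Exec.ite_false he hz (ihq s hp.2 hf)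
    · simp only [hz, ne_eq, not_false_eq_true, if_true] at hf
      simp only [compile, time, run, hz, ne_eq, not_false_eq_true, if_true]
      exact Exec.ite_true he hz (ihp s hp.1 hf)
  | loop x r b ih =>
    simp only [wf, Bool.and_eq_true, decide_eq_true_eq] at hp
    obtain ⟨⟨⟨hb, hxr⟩, hx⟩, hr⟩ := hp
    obtain ⟨hN, hf⟩ := hf
    have hreg : ∀ k, (iter b.run x s k).reg r = s.reg r := fun k =>
      iter_reg_of_notMem _ _ _ _ (Ne.symm hxr) hr
    have hcond : ∀ k ≤ s.reg r, (Expr.less (.reg x) (.reg r)).Fits W (iter b.run x s k) := by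
      intro k hk
      refine ⟨?_, ?_, ?_⟩
      · change (iter b.run x s k).reg x ≤ W
        rw [iter_reg_self]; omega
      · change (iter b.run x s k).reg r ≤ W
        rw [hreg]; exact hN
      · change (if _ then 1 else 0) ≤ W
        split <;> omega
    -- the remaining `i` rounds, when `k` rounds are done
    have key : ∀ i k, k + i = s.reg r → Exec W
        (.while (.less (.reg x) (.reg r)) (.seq b.compile (.assign x (.reg x + 1))))
        (iter b.run x s k) (4 + ∑ l ∈ Finset.range i, (b.time (iter b.run x s (k + l)) + 8))
        (iter b.run x s (s.reg r)) := by
      intro i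
      induction i with
      | zero =>
        intro k hk
        have : k = s.reg r := by omega
        subst this
        exact Exec.while_false (hcond _ le_rfl) (by simp [iter_reg_self, hreg])
      | succ i ihi =>
        intro k hk
        have h1 := ih (iter b.run x s k) hb (hf k (by omega))
        have hbx : (b.run (iter b.run x s k)).reg x = k := by
          rw [run_reg_of_notMem _ _ hx, iter_reg_self]
        have h2 : Exec W (.assign x (.reg x + 1)) (b.run (iter b.run x s k)) 4
            (iter b.run x s (k + 1)) := by
          have := Exec.assign (W := W) (b.run (iter b.run x s k)) x (.reg x + 1) (by
            refine ⟨?_, hW, ?_⟩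
            · change (b.run (iter b.run x s k)).reg x ≤ W
              omega
            · change (b.run (iter b.run x s k)).reg x + 1 ≤ W
              omega)
          rw [Expr.eval_add, Expr.eval_reg, hbx] at this
          exact this
        have h3 := Exec.while_true (e := .less (.reg x) (.reg r)) (hcond k (by omega))
          (by simp [iter_reg_self, hreg]; omega) (Exec.seq h1 h2) (ihi (k + 1) (by omega))
        have : (4 + ∑ l ∈ Finset.range (i + 1), (b.time (iter b.run x s (k + l)) + 8)) =
            (Expr.less (.reg x) (.reg r)).cost + 1 + (b.time (iter b.run x s k) + 4) +
            (4 + ∑ l ∈ Finset.range i, (b.time (iter b.run x s (k + 1 + l)) + 8)) := by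
          rw [Finset.sum_range_succ']
          have hc : (Expr.less (.reg x) (.reg r)).cost = 3 := rfl
          rw [Finset.sum_congr rfl (g := fun l => b.time (iter b.run x s (k + 1 + l)) + 8)
            (fun l _ => by rw [add_right_comm, add_assoc]), hc, add_zero]
          omega
        rw [this]
        exact h3
    have h0 : Exec W (.assign x 0) s 2 (iter b.run x s 0) := Exec.assign s x 0 (Nat.zero_le W)
    have := Exec.seq h0 (key (s.reg r) 0 (by omega))
    rw [Finset.sum_congr rfl (g := fun l => b.time (iter b.run x s l) + 8)
      (fun l _ => by rw [Nat.zero_add])] at this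
    rw [compile, run, time]
    convert this using 1
    omega

/-! ### Overflow -/

end LoopProg

/-- Every array cell that is read satisfies `Dom`. -/
def Expr.Safe (Dom : ℕ → ℕ → Prop) (s : Mem) : Expr → Prop
  | .lit _ => True
  | .reg _ => True
  | .get a idx => idx.Safe Dom s ∧ Dom a (idx.eval s)
  | .op _ e f => e.Safe Dom s ∧ f.Safe Dom s

/-- The arrays that are read are among those with number at least `7`. -/
def Expr.noInput : Expr → Bool
  | .lit _ => true
  | .reg _ => true
  | .get a idx => idx.noInput && decide (7 ≤ a)
  | .op _ e f => e.noInput && f.noInput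

/-- A syntactic condition under which the value of the expression exceeds the contents of the memory
by at most `k`. -/
def Expr.growsBy : Expr → ℕ → Bool
  | .lit c, k => decide (c ≤ k)
  | .reg _, _ => true
  | .get _ _, _ => true
  | .op .add e (.lit c), k => decide (c ≤ k) && e.growsBy (k - c)
  | .op .add _ _, _ => false
  | .op .mul _ _, _ => false
  | .op .sub e _, k => e.growsBy k
  | .op .div e _, k => e.growsBy k
  | .op .lt _ _, k => decide (1 ≤ k)
  | .op .eq _ _, k => decide (1 ≤ k)

/-- The literals are at most `c`, and the cost is at most `c`. -/
def Expr.small (c : ℕ) : Expr → Bool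
  | .lit k => decide (k ≤ c) && decide (1 ≤ c)
  | .reg _ => decide (1 ≤ c)
  | .get a idx => idx.small c && decide ((Expr.get a idx).cost ≤ c)
  | .op o e f => e.small c && f.small c && decide ((Expr.op o e f).cost ≤ c)

/-- All registers and all array cells that may be read are at most `M`. -/
def Mem.Bounded (Dom : ℕ → ℕ → Prop) (M : ℕ) (s : Mem) : Prop :=
  (∀ x, s.reg x ≤ M) ∧ ∀ a i, Dom a i → s.arr a i ≤ M

lemma Expr.Safe.of_noInput {Dom : ℕ → ℕ → Prop} (hD : ∀ a i, 7 ≤ a → Dom a i) {s : Mem} :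
    ∀ {e : Expr}, e.noInput = true → e.Safe Dom s
  | .lit _, _ => trivial
  | .reg _, _ => trivial
  | .get a idx, h => by
    simp only [noInput, Bool.and_eq_true, decide_eq_true_eq] at h
    exact ⟨Expr.Safe.of_noInput hD h.1, hD _ _ h.2⟩
  | .op _ e f, h => by
    simp only [noInput, Bool.and_eq_true] at h
    exact ⟨Expr.Safe.of_noInput hD h.1, Expr.Safe.of_noInput hD h.2⟩

lemma Expr.eval_le_of_growsBy {Dom : ℕ → ℕ → Prop} {s : Mem} {M : ℕ} (hs : s.Bounded Dom M)
    (e : Expr) (k : ℕ) (he : e.Safe Dom s) (hk : e.growsBy k = true) : e.eval s ≤ M + k := by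
  fun_induction Expr.growsBy e k with
  | case1 c k => simp at hk; simp; omega
  | case2 x k => have := hs.1 x; simp; omega
  | case3 a idx k => have := hs.2 a _ he.2; simp; omega
  | case4 e c k ih =>
    simp only [Bool.and_eq_true, decide_eq_true_eq] at hk
    have := ih he.1 hk.2
    change e.eval s + c ≤ M + k
    omega
  | case5 => simp at hk
  | case6 => simp at hk
  | case7 e f k ih =>
    have := ih he.1 hk
    change e.eval s - f.eval s ≤ M + k
    omega
  | case8 e f k ih =>
    have := ih he.1 hk
    change e.eval s / f.eval s ≤ M + k
    exact (Nat.div_le_self _ _).trans this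
  | case9 e f k =>
    simp only [decide_eq_true_eq] at hk
    change (if _ then 1 else 0) ≤ M + k
    split <;> omega
  | case10 e f k =>
    simp only [decide_eq_true_eq] at hk
    change (if _ then 1 else 0) ≤ M + k
    split <;> omega

lemma Expr.one_le_cost (e : Expr) : 1 ≤ e.cost := by cases e <;> simp [Expr.cost]

/-- Intermediate results may be products; their size is polynomial in the memory contents. -/
lemma Expr.eval_le_pow {Dom : ℕ → ℕ → Prop} {s : Mem} {M c : ℕ} (hs : s.Bounded Dom M)
    (hM : 2 ≤ M) (hc : c ≤ M) : ∀ (e : Expr), e.Safe Dom s → e.small c = true →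
      e.eval s ≤ M ^ e.cost
  | .lit k, _, h => by
    simp only [small, Bool.and_eq_true, decide_eq_true_eq] at h
    simp [cost]; omega
  | .reg x, _, _ => by simpa [cost] using hs.1 x
  | .get a idx, he, _ => by
    refine (hs.2 a _ he.2).trans ?_
    exact Nat.le_self_pow (by simp [cost]) M
  | .op o e f, he, h => by
    simp only [small, Bool.and_eq_true] at h
    have h1 := Expr.eval_le_pow hs hM hc e he.1 h.1.1
    have h2 := Expr.eval_le_pow hs hM hc f he.2 h.1.2
    have h3 : M ^ e.cost * M ^ f.cost ≤ M ^ (Expr.op o e f).cost := by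
      rw [← pow_add]; exact Nat.pow_le_pow_right (by omega) (by simp [cost])
    have h4 : 2 ≤ M ^ e.cost := hM.trans (Nat.le_self_pow (by have := e.one_le_cost; omega) M)
    have h5 : 2 ≤ M ^ f.cost := hM.trans (Nat.le_self_pow (by have := f.one_le_cost; omega) M)
    have h6 : M ^ e.cost + M ^ f.cost ≤ M ^ e.cost * M ^ f.cost := Nat.add_le_mul h4 h5
    refine le_trans ?_ h3
    have h7 : M ^ e.cost ≤ M ^ e.cost * M ^ f.cost := Nat.le_mul_of_pos_right _ (by omega)
    cases o
    · change e.eval s + f.eval s ≤ _; omega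
    · change e.eval s - f.eval s ≤ _; omega
    · exact Nat.mul_le_mul h1 h2
    · exact (Nat.div_le_self _ _).trans (h1.trans h7)
    · change (if _ then 1 else 0) ≤ _; split <;> omega
    · change (if _ then 1 else 0) ≤ _; split <;> omega

lemma Expr.cost_le_of_small {c : ℕ} {e : Expr} (h : e.small c = true) : e.cost ≤ c := by
  cases e <;> simp_all [small, cost]

lemma Expr.fits_of_small {Dom : ℕ → ℕ → Prop} {s : Mem} {M c W : ℕ} (hs : s.Bounded Dom M)
    (hM : 2 ≤ M) (hc : c ≤ M) (hW : M ^ c ≤ W) (e : Expr) (he : e.Safe Dom s)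
    (h : e.small c = true) : e.Fits W s := by
  have hle : ∀ f : Expr, f.Safe Dom s → f.small c = true → f.eval s ≤ W := fun f h1 h2 =>
    (Expr.eval_le_pow hs hM hc f h1 h2).trans
      ((Nat.pow_le_pow_right (by omega) (Expr.cost_le_of_small h2)).trans hW)
  induction e with
  | lit k => exact hle _ he h
  | reg x => exact hle _ he h
  | get a idx ih =>
    have h' := h
    simp only [small, Bool.and_eq_true] at h'
    exact ⟨ih he.1 h'.1, hle _ he h⟩
  | op o e f ihe ihf =>
    have h' := h
    simp only [small, Bool.and_eq_true] at h'
    exact ⟨ihe he.1 h'.1.1, ihf he.2 h'.1.2, hle _ he h⟩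

namespace LoopProg

/-- Every array cell that is read satisfies `Dom`. -/
def Safe (Dom : ℕ → ℕ → Prop) : LoopProg → Mem → Prop
  | assign _ e, s => e.Safe Dom s
  | store _ idx e, s => idx.Safe Dom s ∧ e.Safe Dom s
  | seq p q, s => p.Safe Dom s ∧ q.Safe Dom (p.run s)
  | ite e p q, s => e.Safe Dom s ∧ if e.eval s ≠ 0 then p.Safe Dom s else q.Safe Dom s
  | loop x r b, s => ∀ k < s.reg r, b.Safe Dom (iter b.run x s k)

/-- The arrays that are read are among those with number at least `7`. -/
def noInput : LoopProg → Bool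
  | assign _ e => e.noInput
  | store _ idx e => idx.noInput && e.noInput
  | seq p q => p.noInput && q.noInput
  | ite e p q => e.noInput && p.noInput && q.noInput
  | loop _ _ b => b.noInput

/-- All constants in the program are at most `c`, values that are written exceed the contents of the
memory by at most `c`, and the first seven arrays are not written. -/
def tame (c : ℕ) : LoopProg → Bool
  | assign _ e => e.small c && e.growsBy c
  | store a idx e => idx.small c && e.small c && e.growsBy c && decide (7 ≤ a)
  | seq p q => p.tame c && q.tame c
  | ite e p q => e.small c && p.tame c && q.tame c
  | loop _ _ b => b.tame c && decide (1 ≤ c)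

lemma Safe.of_noInput {Dom : ℕ → ℕ → Prop} (hD : ∀ a i, 7 ≤ a → Dom a i) (p : LoopProg)
    (s : Mem) (h : p.noInput = true) : p.Safe Dom s := by
  induction p generalizing s with
  | assign x e => exact Expr.Safe.of_noInput hD h
  | store a idx e =>
    simp only [noInput, Bool.and_eq_true] at h
    exact ⟨Expr.Safe.of_noInput hD h.1, Expr.Safe.of_noInput hD h.2⟩
  | seq p q ihp ihq =>
    simp only [noInput, Bool.and_eq_true] at h
    exact ⟨ihp _ h.1, ihq _ h.2⟩
  | ite e p q ihp ihq =>
    simp only [noInput, Bool.and_eq_true] at h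
    refine ⟨Expr.Safe.of_noInput hD h.1.1, ?_⟩
    split
    · exact ihp _ h.1.2
    · exact ihq _ h.2
  | loop x r b ih => exact fun k _ => ih _ h

/-- The numbers in memory after some of the rounds of a counting loop. -/
lemma bounded_iter {Dom : ℕ → ℕ → Prop} {c x r : ℕ} {b : LoopProg} {s : Mem} {M : ℕ}
    (hs : s.Bounded Dom M) (hc : 1 ≤ c) (hsafe : ∀ k < s.reg r, b.Safe Dom (iter b.run x s k))
    (hb : ∀ (s : Mem) (M : ℕ), s.Bounded Dom M → b.Safe Dom s →
      (b.run s).Bounded Dom (M + c * b.time s)) :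
    ∀ k ≤ s.reg r, (iter b.run x s k).Bounded Dom
      (M + c * ∑ l ∈ Finset.range k, (b.time (iter b.run x s l) + 8)) := by
  intro k
  induction k with
  | zero =>
    intro _
    refine ⟨fun y => ?_, fun a i hd => (hs.2 a i hd).trans (by omega)⟩
    rw [iter, Mem.setReg_reg]
    split
    · omega
    · exact (hs.1 y).trans (by omega)
  | succ k ihk =>
    intro hk
    have h3 := hb _ _ (ihk (by omega)) (hsafe k (by omega))
    rw [Finset.sum_range_succ]
    -- every round takes at least one step, so the counter grows no faster than the time
    have h5 : k ≤ ∑ l ∈ Finset.range k, (b.time (iter b.run x s l) + 8) := by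
      have := Finset.card_nsmul_le_sum (Finset.range k)
        (fun l => b.time (iter b.run x s l) + 8) 1 (fun l _ => by omega)
      simpa using this
    set S := ∑ l ∈ Finset.range k, (b.time (iter b.run x s l) + 8)
    have hle : M + c * S + c * b.time (iter b.run x s k) ≤
        M + c * (S + (b.time (iter b.run x s k) + 8)) := by nlinarith
    refine ⟨fun y => ?_, fun a i hd => (h3.2 a i hd).trans hle⟩
    rw [iter, Mem.setReg_reg]
    split
    · have : k + 1 ≤ c * (S + (b.time (iter b.run x s k) + 8)) := by nlinarith
      omega
    · exact (h3.1 y).trans hle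

/-- The numbers in memory grow by at most a constant in every step. -/
lemma bounded_run {Dom : ℕ → ℕ → Prop} {c : ℕ} (p : LoopProg) (s : Mem) (M : ℕ)
    (hs : s.Bounded Dom M) (hsafe : p.Safe Dom s) (h : p.tame c = true) :
    (p.run s).Bounded Dom (M + c * p.time s) := by
  have mono : ∀ (s : Mem) (M M' : ℕ), M ≤ M' → s.Bounded Dom M → s.Bounded Dom M' :=
    fun s M M' hMM h => ⟨fun x => (h.1 x).trans hMM, fun a i hd => (h.2 a i hd).trans hMM⟩
  induction p generalizing s M with
  | assign x e =>
    simp only [tame, Bool.and_eq_true] at h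
    have h1 := Expr.eval_le_of_growsBy hs e c hsafe h.2
    refine mono _ (M + c) _ (by simp only [time]; nlinarith) ⟨fun y => ?_, fun a i hd => ?_⟩
    · rw [run, Mem.setReg_reg]
      split
      · exact h1
      · exact (hs.1 y).trans (by omega)
    · exact (hs.2 a i hd).trans (by omega)
  | store b idx e =>
    simp only [tame, Bool.and_eq_true] at h
    have h1 := Expr.eval_le_of_growsBy hs e c hsafe.2 h.1.2
    refine mono _ (M + c) _ (by simp only [time]; nlinarith) ⟨fun y => ?_, fun a i hd => ?_⟩
    · exact (hs.1 y).trans (by omega)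
    · rw [run, Mem.setArr_arr]
      split
      · exact h1
      · exact (hs.2 a i hd).trans (by omega)
  | seq p q ihp ihq =>
    simp only [tame, Bool.and_eq_true] at h
    have := ihq _ _ (ihp s M hs hsafe.1 h.1) hsafe.2 h.2
    refine mono _ _ _ (le_of_eq ?_) this
    simp only [time]; ring
  | ite e p q ihp ihq =>
    simp only [tame, Bool.and_eq_true] at h
    obtain ⟨-, hsafe⟩ := hsafe
    rw [run, time]
    split_ifs at hsafe ⊢ with hz
    · exact mono _ _ _ (by nlinarith) (ihp s M hs hsafe h.1.2)
    · exact mono _ _ _ (by nlinarith) (ihq s M hs hsafe h.2)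
  | loop x r b ih =>
    simp only [tame, Bool.and_eq_true, decide_eq_true_eq] at h
    rw [run, time]
    exact mono _ _ _ (by nlinarith)
      (bounded_iter hs h.2 hsafe (fun s M hs hsafe => ih s M hs hsafe h.1) _ le_rfl)

/-- A tame program that starts with small numbers in memory does not overflow. -/
theorem fits_of_tame {Dom : ℕ → ℕ → Prop} {c W M : ℕ} (p : LoopProg) (s : Mem) (N : ℕ)
    (hs : s.Bounded Dom N) (hN : N + c * p.time s ≤ M) (hM : 2 ≤ M) (hc : c ≤ M)
    (hc1 : 1 ≤ c) (hW : M ^ c ≤ W) (hsafe : p.Safe Dom s) (h : p.tame c = true) : p.Fits W s := by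
  have mono : ∀ (s : Mem) (M M' : ℕ), M ≤ M' → s.Bounded Dom M → s.Bounded Dom M' :=
    fun s M M' hMM h => ⟨fun x => (h.1 x).trans hMM, fun a i hd => (h.2 a i hd).trans hMM⟩
  induction p generalizing s N with
  | assign x e =>
    simp only [tame, Bool.and_eq_true] at h
    exact Expr.fits_of_small (mono _ _ _ (by omega) hs) hM hc hW e hsafe h.1
  | store b idx e =>
    simp only [tame, Bool.and_eq_true] at h
    exact ⟨Expr.fits_of_small (mono _ _ _ (by omega) hs) hM hc hW _ hsafe.1 h.1.1.1,
      Expr.fits_of_small (mono _ _ _ (by omega) hs) hM hc hW _ hsafe.2 h.1.1.2⟩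
  | seq p q ihp ihq =>
    simp only [tame, Bool.and_eq_true] at h
    simp only [time, mul_add] at hN
    exact ⟨ihp s N hs (by omega) hsafe.1 h.1,
      ihq _ _ (bounded_run p s N hs hsafe.1 h.1) (by omega) hsafe.2 h.2⟩
  | ite e p q ihp ihq =>
    simp only [tame, Bool.and_eq_true] at h
    obtain ⟨hse, hsafe⟩ := hsafe
    refine ⟨Expr.fits_of_small (mono _ _ _ (by omega) hs) hM hc hW e hse h.1.1, ?_⟩
    simp only [time, mul_add] at hN
    split_ifs at hsafe hN ⊢ with hz
    · exact ihp s N hs (by omega) hsafe h.1.2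
    · exact ihq s N hs (by omega) hsafe h.2
  | loop x r b ih =>
    have hb := h
    simp only [tame, Bool.and_eq_true, decide_eq_true_eq] at hb
    have hNM : N ≤ M := by omega
    refine ⟨(hs.1 r).trans (hNM.trans ((Nat.le_self_pow (by omega) M).trans hW)), fun k hk => ?_⟩
    have h1 := bounded_iter hs hc1 hsafe
      (fun s M hs hsafe => bounded_run b s M hs hsafe hb.1) k hk.le
    refine ih _ _ h1 ?_ (hsafe k hk) hb.1
    have h6 : ∑ l ∈ Finset.range (k + 1), (b.time (iter b.run x s l) + 8) ≤
        ∑ l ∈ Finset.range (s.reg r), (b.time (iter b.run x s l) + 8) :=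
      Finset.sum_le_sum_of_subset (Finset.range_mono hk)
    rw [Finset.sum_range_succ] at h6
    simp only [time] at hN
    have h7 := Nat.mul_le_mul_left c h6
    simp only [mul_add] at h7 hN ⊢
    omega

/-! ### Running times -/

/-- A bound on the time in terms of the values of the loop bounds. -/
def timeBound (ρ : ℕ → ℕ) : LoopProg → ℕ
  | assign _ e => e.cost + 1
  | store _ idx e => idx.cost + e.cost + 1
  | seq p q => p.timeBound ρ + q.timeBound ρ
  | ite e p q => e.cost + 1 + (p.timeBound ρ + q.timeBound ρ)
  | loop _ r b => 6 + ρ r * (b.timeBound ρ + 8)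

/-- The registers that bound the loops of a program. -/
def bounds : LoopProg → List ℕ
  | assign _ _ => []
  | store _ _ _ => []
  | seq p q => p.bounds ++ q.bounds
  | ite _ p q => p.bounds ++ q.bounds
  | loop _ r b => r :: b.bounds

lemma time_le_timeBound (ρ : ℕ → ℕ) (p : LoopProg) (s : Mem) (hρ : ∀ r ∈ p.bounds, s.reg r = ρ r)
    (h : ∀ r ∈ p.bounds, r ∉ p.regs) : p.time s ≤ p.timeBound ρ := by
  induction p generalizing s with
  | assign x e => exact le_rfl
  | store b idx e => exact le_rfl
  | seq p q ihp ihq =>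
    simp only [bounds, regs, List.mem_append, not_or] at h hρ
    refine Nat.add_le_add (ihp s (fun r hr => hρ r (Or.inl hr)) fun r hr => (h r (Or.inl hr)).1)
      (ihq _ (fun r hr => ?_) fun r hr => (h r (Or.inr hr)).2)
    rw [run_reg_of_notMem _ _ (h r (Or.inr hr)).1]
    exact hρ r (Or.inr hr)
  | ite e p q ihp ihq =>
    simp only [bounds, regs, List.mem_append, not_or] at h hρ
    have h1 := ihp s (fun r hr => hρ r (Or.inl hr)) fun r hr => (h r (Or.inl hr)).1
    have h2 := ihq s (fun r hr => hρ r (Or.inr hr)) fun r hr => (h r (Or.inr hr)).2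
    rw [time, timeBound]
    split <;> omega
  | loop x r b ih =>
    simp only [bounds, regs, List.mem_cons, not_or] at h hρ
    rw [time, timeBound, hρ r (Or.inl rfl)]
    have : ∑ k ∈ Finset.range (ρ r), (b.time (iter b.run x s k) + 8) ≤
        (Finset.range (ρ r)).card • (b.timeBound ρ + 8) := by
      refine Finset.sum_le_card_nsmul _ _ _ fun k _ => Nat.add_le_add_right (ih _ ?_ ?_) 8
      · intro y hy
        rw [iter_reg_of_notMem _ _ _ _ (h y (Or.inr hy)).1 (h y (Or.inr hy)).2]
        exact hρ y (Or.inr hy)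
      · exact fun y hy => (h y (Or.inr hy)).2
    rw [Finset.card_range, smul_eq_mul] at this
    omega

/-- The total cost of the instructions in the text of a program. -/
def weight : LoopProg → ℕ
  | assign _ e => e.cost + 1
  | store _ idx e => idx.cost + e.cost + 1
  | seq p q => p.weight + q.weight
  | ite e p q => e.cost + 1 + (p.weight + q.weight)
  | loop _ _ b => b.weight + 14

/-- The loops are nested in such a way that the bounds of nested loops can be charged to a budget of
`a` bounds by the number of nodes, `b` bounds by the number of arcs and `l` bounds by the length of
labels. The registers `0` and `7` bound loops over nodes, the register `2` loops over arcs and the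
register `3` loops over label entries; a loop over nodes can also be charged as a loop over arcs. -/
def nested : LoopProg → ℕ → ℕ → ℕ → Bool
  | assign _ _, _, _, _ => true
  | store _ _ _, _, _, _ => true
  | seq p q, a, b, l => p.nested a b l && q.nested a b l
  | ite _ p q, a, b, l => p.nested a b l && q.nested a b l
  | loop _ r p, a, b, l =>
    if r = 0 ∨ r = 7 then
      if a = 0 then decide (0 < b) && p.nested a (b - 1) l else p.nested (a - 1) b l
    else if r = 2 then decide (0 < b) && p.nested a (b - 1) l
    else if r = 3 then decide (0 < l) && p.nested a b (l - 1)
    else false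

/-- The running time of a program without data-dependent loop bounds is at most its weight times the
product of the bounds of its nested loops. -/
lemma timeBound_le {ρ : ℕ → ℕ} {n m L : ℕ} (h0 : ρ 0 ≤ n) (h7 : ρ 7 ≤ n) (h2 : ρ 2 ≤ m)
    (h3 : ρ 3 ≤ L) (hn : 1 ≤ n) (hnm : n ≤ m) (hL : 1 ≤ L) (p : LoopProg) (a b l : ℕ)
    (hp : p.nested a b l = true) : p.timeBound ρ ≤ p.weight * (n ^ a * m ^ b * L ^ l) := by
  have hm : 1 ≤ m := hn.trans hnm
  have hpos : ∀ a b l : ℕ, 1 ≤ n ^ a * m ^ b * L ^ l := fun a b l =>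
    Nat.succ_le_of_lt (by positivity)
  induction p generalizing a b l with
  | assign x e => simpa [timeBound, weight] using Nat.mul_le_mul_left (e.cost + 1) (hpos a b l)
  | store c idx e =>
    simpa [timeBound, weight] using Nat.mul_le_mul_left (idx.cost + e.cost + 1) (hpos a b l)
  | seq p q ihp ihq =>
    simp only [nested, Bool.and_eq_true] at hp
    rw [timeBound, weight, add_mul]
    exact Nat.add_le_add (ihp _ _ _ hp.1) (ihq _ _ _ hp.2)
  | ite e p q ihp ihq =>
    simp only [nested, Bool.and_eq_true] at hp
    have h1 := ihp _ _ _ hp.1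
    have h2 := ihq _ _ _ hp.2
    have h3 := Nat.mul_le_mul_left (e.cost + 1) (hpos a b l)
    rw [timeBound, weight, add_mul, add_mul p.weight]
    omega
  | loop x r p ih =>
    have main : ∀ {a' b' l' N : ℕ}, ρ r ≤ N → p.nested a' b' l' = true →
        N * (n ^ a' * m ^ b' * L ^ l') ≤ n ^ a * m ^ b * L ^ l →
        (loop x r p).timeBound ρ ≤ (loop x r p).weight * (n ^ a * m ^ b * L ^ l) := by
      intro a' b' l' N hN hp' hle
      have h := ih _ _ _ hp'
      have h1 := hpos a' b' l'
      have h2 := hpos a b l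
      rw [timeBound, weight]
      set Q := n ^ a' * m ^ b' * L ^ l'
      set R := n ^ a * m ^ b * L ^ l
      calc 6 + ρ r * (p.timeBound ρ + 8) ≤ 6 * R + N * (p.weight * Q + 8 * Q) := by
            refine Nat.add_le_add (by omega) (Nat.mul_le_mul hN (Nat.add_le_add h (by omega)))
        _ = 6 * R + (p.weight + 8) * (N * Q) := by ring
        _ ≤ 6 * R + (p.weight + 8) * R := by gcongr
        _ = (p.weight + 14) * R := by ring
    simp only [nested] at hp
    split_ifs at hp with hr ha hr2 hr3
    · simp only [Bool.and_eq_true, decide_eq_true_eq] at hp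
      have hrn : ρ r ≤ m := by rcases hr with rfl | rfl <;> omega
      refine main hrn hp.2 (le_of_eq ?_)
      obtain ⟨b, rfl⟩ : ∃ b', b = b' + 1 := ⟨b - 1, by omega⟩
      simp only [Nat.add_sub_cancel, pow_succ]; ring
    · have hrn : ρ r ≤ n := by rcases hr with rfl | rfl <;> omega
      refine main hrn hp (le_of_eq ?_)
      obtain ⟨a, rfl⟩ : ∃ b', a = b' + 1 := ⟨a - 1, by omega⟩
      simp only [Nat.add_sub_cancel, pow_succ]; ring
    · simp only [Bool.and_eq_true, decide_eq_true_eq] at hp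
      subst hr2
      refine main h2 hp.2 (le_of_eq ?_)
      obtain ⟨b, rfl⟩ : ∃ b', b = b' + 1 := ⟨b - 1, by omega⟩
      simp only [Nat.add_sub_cancel, pow_succ]; ring
    · simp only [Bool.and_eq_true, decide_eq_true_eq] at hp
      subst hr3
      refine main h3 hp.2 (le_of_eq ?_)
      obtain ⟨l, rfl⟩ : ∃ b', l = b' + 1 := ⟨l - 1, by omega⟩
      simp only [Nat.add_sub_cancel, pow_succ]; ring

/-! ### The program: operations on labels -/

/-- The instruction that has no effect on the registers in use. -/
def nop : LoopProg := assign 30 0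

/-- Register `22` receives the distance between the registers `y` and `4`. -/
def absTo (y : ℕ) : LoopProg :=
  ite (Expr.less (.reg y) (.reg 4)) (assign 22 (.reg 4 - .reg y)) (assign 22 (.reg y - .reg 4))

/-- The cell of array `a` that holds the entry with index `reg 10` of the row with index `reg u`. -/
def cell (a u : ℕ) : Expr := .get a (.reg 3 * .reg u + .reg 10)

/-- Array `16` receives the sequence `fillSeq` of the row `reg u` of array `a`. -/
def fill (a u : ℕ) : LoopProg :=
  loop 10 3 <| seq (assign 21 (cell a u)) <| seq (absTo 21) <|
    ite (Expr.less (.reg 12) (.reg 22)) (store 16 (.reg 10) (.reg 21))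
      (store 16 (.reg 10) (.reg 4 - .reg 12))

/-- If the present entry can be increased to the value in register `23`, or can become the end of the
sequence, its position and its new value are recorded in the registers `18` and `19`. -/
def record : LoopProg :=
  ite (Expr.less (.reg 10) (.reg 13))
    (ite (Expr.less (.reg 4 + .reg 17) (.reg 23)) nop
      (seq (assign 18 (.reg 10)) <| seq (assign 19 (.reg 23)) (assign 20 1)))
    (ite (Expr.same (.reg 10) (.reg 13))
      (ite (Expr.less (.reg 21 + .reg 12) (.reg 4))
        (seq (assign 18 (.reg 10)) <| seq (assign 19 (.reg 4 - .reg 12)) (assign 20 1)) nop) nop)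

/-- One step of the search for the last entry that can be increased. -/
def scanStep (a u : ℕ) : LoopProg :=
  seq (assign 21 (cell a u)) <| seq (absTo 21) <|
  seq (ite (Expr.less (.reg 12) (.reg 22)) (assign 23 (.reg 21 + 1))
    (assign 23 (.reg 6 - (.reg 4 + 1 - .reg 12)))) <|
  seq record <| ite (Expr.less (.reg 12) (.reg 22)) (assign 17 (.reg 22)) (assign 17 0)

/-- The search for the last entry of the row `reg u` of array `a` that can be increased, where the
registers `12`, `13` and `14` hold the parameters `g`, `B` and `J` of `CanIncr`. -/
def scan (a u : ℕ) : LoopProg :=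
  seq (assign 17 (.reg 14)) <| seq (assign 20 0) <| loop 10 3 (scanStep a u)

/-- Array `16` receives the row `reg u` of array `a`, increased at the entry found. -/
def advance (a u : ℕ) : LoopProg :=
  loop 10 3 <| ite (Expr.less (.reg 10) (.reg 18)) (store 16 (.reg 10) (cell a u)) <|
    ite (Expr.same (.reg 10) (.reg 18)) (store 16 (.reg 10) (.reg 19)) <|
    ite (Expr.less (.reg 10) (.reg 13)) (store 16 (.reg 10) (.reg 4 - .reg 22))
      (store 16 (.reg 10) (.reg 4 - .reg 12))

/-- Array `16` receives the code of the top label. -/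
def topRow : LoopProg := loop 10 3 (store 16 (.reg 10) (.reg 5))

/-- Array `16` receives the sequence `nextSeq` of the row `reg u` of array `a`, or the code of the
top label if no entry can be increased. -/
def next (a u : ℕ) : LoopProg :=
  seq (scan a u) <| ite (Expr.same (.reg 20) 0) topRow (seq (absTo 19) (advance a u))

/-- Register `24` receives `1` if array `16` is lexicographically smaller than the row `reg 25` of
array `15`. -/
def compare : LoopProg :=
  seq (assign 24 0) <| loop 10 3 <| ite (Expr.same (.reg 24) 0)
    (ite (Expr.less (.get 16 (.reg 10)) (cell 15 25)) (assign 24 1)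
      (ite (Expr.less (cell 15 25) (.get 16 (.reg 10))) (assign 24 2) nop)) nop

/-- If register `24` is `1`, array `16` is copied to the row `reg 25` of array `15`. -/
def copyIf : LoopProg :=
  loop 10 3 <| ite (Expr.same (.reg 24) 1)
    (store 15 (.reg 3 * .reg 25 + .reg 10) (.get 16 (.reg 10))) nop

/-- The sequence `z` of length `s.reg 3`, shifted by `s.reg 4`, is stored in the row `v` of array
`a`. -/
def HasRow (s : Mem) (a v : ℕ) (z : ℕ → ℤ) : Prop :=
  ∀ t < s.reg 3, (s.arr a (s.reg 3 * v + t) : ℤ) = z t + s.reg 4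

/-- The sequence `z` of length `s.reg 3`, shifted by `s.reg 4`, is stored in array `16`. -/
def HasTmp (s : Mem) (z : ℕ → ℤ) : Prop :=
  ∀ t < s.reg 3, (s.arr 16 t : ℤ) = z t + s.reg 4

lemma run_absTo {s : Mem} {y : ℕ} {z : ℤ} (hz : (s.reg y : ℤ) = z + s.reg 4) :
    (absTo y).run s = s.setReg 22 z.natAbs := by
  rw [absTo, run]
  simp only [Expr.eval_less, Expr.eval_reg, run, Expr.eval_sub]
  have h1 : s.reg y < s.reg 4 → s.reg 4 - s.reg y = z.natAbs := by omega
  have h2 : ¬ s.reg y < s.reg 4 → s.reg y - s.reg 4 = z.natAbs := by omega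
  by_cases h : s.reg y < s.reg 4
  · simp [h, h1 h]
  · simp [h, h2 h]

lemma hasTmp_fill {s : Mem} {a u : ℕ} {z : ℕ → ℤ} (hr : HasRow s a (s.reg u) z) (ha : a ≠ 16)
    (hu : u ∉ (fill a u).regs) (hg : s.reg 12 ≤ s.reg 4) :
    HasTmp ((fill a u).run s) (fillSeq (s.reg 12) z) := by
  have key : ∀ t < s.reg 3, (((fill a u).run s).arr 16 t : ℤ) =
      fillSeq (s.reg 12) z t + s.reg 4 := by
    refine loop_induct (I := fun k s' => ∀ t < k, (s'.arr 16 t : ℤ) =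
      fillSeq (s.reg 12) z t + s.reg 4) (by simp) ?_
    intro k hk s' hx hreg harr hI t ht
    have e3 := hreg 3 (by decide) (by simp [regs, absTo])
    have e4 := hreg 4 (by decide) (by simp [regs, absTo])
    have e12 := hreg 12 (by decide) (by simp [regs, absTo])
    have eu := hreg u (by simp [regs, fill] at hu; tauto) (by simp [regs, fill, absTo] at hu ⊢; tauto)
    have ea := harr a (by simp [arrs, absTo, ha])
    have hrow := hr k hk
    simp only [run, cell, Expr.eval_get, Expr.eval_add, Expr.eval_mul, Expr.eval_reg, hx, e3, eu, ea]
    rw [run_absTo (z := z k) (by simp [e4, hrow])]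
    simp only [Expr.eval_less, Expr.eval_reg, Mem.setReg_reg, e12]
    have hfs : fillSeq (s.reg 12) z k = if |z k| ≤ s.reg 12 then -(s.reg 12 : ℤ) else z k := rfl
    rw [Int.abs_eq_natAbs] at hfs
    by_cases hc : s.reg 12 < (z k).natAbs
    · simp [hc, hx]
      split
      · subst t; rw [hfs, if_neg (by omega), hrow]
      · exact hI t (by omega)
    · simp [hc, hx, e4, e12]
      split
      · subst t; rw [hfs, if_pos (by omega)]; omega
      · exact hI t (by omega)
  intro t ht
  rw [run_reg_of_notMem _ _ (by simp [fill, regs, absTo])] at ht ⊢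
  exact key t ht

lemma hasTmp_topRow {s : Mem} {c : ℤ} (hc : (s.reg 5 : ℤ) = c + s.reg 4) :
    HasTmp (topRow.run s) (fun _ => c) := by
  have key : ∀ t < s.reg 3, (topRow.run s).arr 16 t = s.reg 5 := by
    refine loop_induct (I := fun k s' => ∀ t < k, s'.arr 16 t = s.reg 5) (by simp) ?_
    intro k hk s' hx hreg harr hI t ht
    have e5 := hreg 5 (by decide) (by simp [regs])
    simp [run, hx, e5]
    intro h
    exact hI t (by omega)
  intro t ht
  rw [run_reg_of_notMem _ _ (by simp [topRow, regs])] at ht ⊢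
  rw [key t ht, hc]

/-- The result of the search after `k` steps. -/
structure Scanned (L g B J H : ℕ) (z : ℕ → ℤ) (k : ℕ) (s : Mem) : Prop where
  prev : (s.reg 17 : ℤ) = prevAbs g J z k
  none : s.reg 20 = 0 → ∀ t < k, ¬ CanIncr L g B J z t
  some : s.reg 20 ≠ 0 → s.reg 18 < k ∧ CanIncr L g B J z (s.reg 18) ∧
    (∀ t < k, CanIncr L g B J z t → t ≤ s.reg 18) ∧
    (s.reg 19 : ℤ) = incrVal g B z (s.reg 18) + H

/-- The register `17` holds the absolute value of the preceding truncated entry, register `20` tells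
whether an increase is possible at one of the positions read, and the registers `18` and `19` hold the
last such position and the new value. -/
lemma scanned_scan {s : Mem} {a u : ℕ} {z : ℕ → ℤ} (hr : HasRow s a (s.reg u) z)
    (hu : u ∉ (scan a u).regs) (hg : s.reg 12 ≤ s.reg 4)
    (h6 : s.reg 6 = 2 * s.reg 4 + 2) :
    Scanned (s.reg 3) (s.reg 12) (s.reg 13) (s.reg 14) (s.reg 4) z (s.reg 3) ((scan a u).run s) := by
  have hreg' : ∀ y, y ∉ (scan a u).regs → y ≠ 17 ∧ y ≠ 20 ∧ y ≠ 10 := by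
    intro y hy; simp [scan, regs] at hy; tauto
  have h3 : ((s.setReg 17 (s.reg 14)).setReg 20 0).reg 3 = s.reg 3 := by simp
  rw [scan, run, run, run, run, Expr.eval_reg, Expr.eval_ofNat]
  rw [← h3]
  refine loop_induct (s := (s.setReg 17 (s.reg 14)).setReg 20 0)
    (I := fun k s' => Scanned _ (s.reg 12) (s.reg 13) (s.reg 14) (s.reg 4) z k s')
    ⟨by simp [prevAbs], by simp, by simp⟩ ?_
  rw [h3]
  intro k hk s' hx hreg harr hI
  have e3 := hreg 3 (by decide) (by simp [regs, scanStep, record, absTo, nop])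
  have e4 := hreg 4 (by decide) (by simp [regs, scanStep, record, absTo, nop])
  have e6 := hreg 6 (by decide) (by simp [regs, scanStep, record, absTo, nop])
  have e12 := hreg 12 (by decide) (by simp [regs, scanStep, record, absTo, nop])
  have e13 := hreg 13 (by decide) (by simp [regs, scanStep, record, absTo, nop])
  have eu := hreg u (hreg' u hu).2.2 (by simp [regs, scan] at hu; tauto)
  have ea := harr a (by simp [arrs, scanStep, record, absTo, nop])
  simp at e3 e4 e6 e12 e13 ea
  simp [(hreg' u hu)] at eu
  have hrow := hr k hk
  have hprev : prevAbs (s.reg 12) (s.reg 14) z (k + 1) =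
      if (z k).natAbs ≤ s.reg 12 then 0 else ((z k).natAbs : ℤ) := by
    simp only [prevAbs, truncSeq, Nat.add_sub_cancel]
    rw [if_neg (by omega), Int.abs_eq_natAbs (z k)]
    norm_cast
    split <;> simp
  have hincr : incr (s.reg 12) z k = if (z k).natAbs ≤ s.reg 12 then (s.reg 12 : ℤ) + 1 else z k + 1 := by
    rw [incr, Int.abs_eq_natAbs (z k)]
    norm_cast
  have hcan : CanIncr (s.reg 3) (s.reg 12) (s.reg 13) (s.reg 14) z k ↔
      ((k < s.reg 13 ∧ incr (s.reg 12) z k ≤ s'.reg 17) ∨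
        (k = s.reg 13 ∧ z k < -(s.reg 12 : ℤ))) := by
    rw [CanIncr, hI.prev]; simp [hk]
  -- the memory after the increased value has been computed
  obtain ⟨s₁, hs₁, f1⟩ : ∃ s₁ : Mem, s₁ = (((s'.setReg 21 (s.arr a (s.reg 3 * s.reg u + k))).setReg 22
      (z k).natAbs).setReg 23 (incr (s.reg 12) z k + s.reg 4).toNat) ∧
      (scanStep a u).run s' = LoopProg.run (seq record (ite (Expr.less (.reg 12) (.reg 22)) (assign 17 (.reg 22)) (assign 17 0))) s₁ := by
    refine ⟨_, rfl, ?_⟩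
    rw [scanStep, run, run, run, run_absTo (z := z k) (by
      simp [cell, hx, e3, e4, eu, ea, hrow]), run]
    congr 1
    simp only [run, cell, Expr.eval_get, Expr.eval_add, Expr.eval_mul, Expr.eval_reg, hx, e3, eu, ea,
      Expr.eval_less, Expr.eval_sub, Expr.eval_ofNat, Mem.setReg_reg, e4, e6, e12]
    by_cases hc : s.reg 12 < (z k).natAbs
    · have : s.arr a (s.reg 3 * s.reg u + k) + 1 = (incr (s.reg 12) z k + s.reg 4).toNat := by
        rw [hincr, if_neg (not_le.2 hc)]; omega
      simp [hc, this]
    · have : 2 * s.reg 4 + 2 - (s.reg 4 + 1 - s.reg 12) =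
          (incr (s.reg 12) z k + s.reg 4).toNat := by
        rw [hincr, if_pos (not_lt.1 hc)]; omega
      simp [hc, this, h6]
  have hnn : (0 : ℤ) ≤ incr (s.reg 12) z k + s.reg 4 := by
    rw [hincr]; split <;> omega
  obtain ⟨v, hv⟩ := Int.eq_ofNat_of_zero_le hnn
  rw [hv, Int.toNat_natCast] at hs₁
  rw [f1]
  by_cases hC : CanIncr (s.reg 3) (s.reg 12) (s.reg 13) (s.reg 14) z k
  · obtain ⟨s₂, hs₂, h20, h18, h19⟩ : ∃ s₂ : Mem, record.run s₁ = s₂ ∧ s₂.reg 20 = 1 ∧ s₂.reg 18 = k ∧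
          (s₂.reg 19 : ℤ) = incrVal (s.reg 12) (s.reg 13) z k + s.reg 4 := by
      refine ⟨_, rfl, ?_⟩
      rcases hcan.1 hC with ⟨h1, h2⟩ | ⟨h1, h2⟩
      · have h3 : ¬ s.reg 4 + s'.reg 17 < v := by omega
        simp [record, run, hs₁, hx, e13, e4, h1, h3, incrVal, hv]
      · have h3 : s.arr a (s.reg 3 * s.reg u + k) + s.reg 12 < s.reg 4 := by omega
        simp only [record, run, hs₁, Expr.eval_less, Expr.eval_reg, Expr.eval_same, Expr.eval_add,
          Mem.setReg_reg]
        simp only [hx, e13, e4, e12, h1, incrVal]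
        rw [h1] at h3
        simp [h3, e4, e12]
        omega
    have h10 : s₂.reg 10 = k ∧ s₂.reg 12 = s.reg 12 ∧ s₂.reg 22 = (z k).natAbs := by
      rw [← hs₂]
      refine ⟨?_, ?_, ?_⟩ <;> rw [run_reg_of_notMem _ _ (by simp [regs, record, nop])] <;>
        simp [hs₁, hx, e12]
    rw [run, hs₂, run]
    simp only [Expr.eval_less, Expr.eval_reg, h10]
    refine ⟨?_, ?_, ?_⟩
    · rw [hprev]
      by_cases hc : s.reg 12 < (z k).natAbs
      · simp [hc, run, h10]
      · simp [hc, run, not_lt.1 hc]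
    · by_cases hc : s.reg 12 < (z k).natAbs <;> simp [hc, run, h20]
    · intro _
      have h5 : ∀ s' : Mem, s'.reg 18 = k → (s'.reg 19 : ℤ) = incrVal (s.reg 12) (s.reg 13) z k + s.reg 4
          → s'.reg 18 < k + 1 ∧ CanIncr (s.reg 3) (s.reg 12) (s.reg 13) (s.reg 14) z (s'.reg 18) ∧
          (∀ t < k + 1, CanIncr (s.reg 3) (s.reg 12) (s.reg 13) (s.reg 14) z t → t ≤ s'.reg 18) ∧
          (s'.reg 19 : ℤ) = incrVal (s.reg 12) (s.reg 13) z (s'.reg 18) + s.reg 4 := by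
        intro s' h6 h7
        rw [h6]
        exact ⟨by omega, hC, fun t ht _ => by omega, h7⟩
      apply h5
      · by_cases hc : s.reg 12 < (z k).natAbs <;> simp [hc, run, h18]
      · by_cases hc : s.reg 12 < (z k).natAbs <;> simp [hc, run, h19]
  · obtain ⟨s₂, hs₂, hs₃⟩ : ∃ s₂ : Mem, record.run s₁ = s₂ ∧ ∀ y, y ≠ 30 → s₂.reg y = s₁.reg y := by
      refine ⟨_, rfl, ?_⟩
      intro y hy
      rw [hcan] at hC
      push Not at hC
      by_cases h1 : k < s.reg 13
      · have h3 : s.reg 4 + s'.reg 17 < v := by have := hC.1 h1; omega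
        simp [record, run, hs₁, hx, e13, e4, h1, h3, nop, hy]
      · by_cases h2 : k = s.reg 13
        · have h3 : ¬ s.arr a (s.reg 3 * s.reg u + k) + s.reg 12 < s.reg 4 := by
            have := hC.2 h2; omega
          rw [h2] at h3
          simp [record, run, hs₁, hx, e13, e4, h2, h3, nop, hy, e12]
        · simp [record, run, hs₁, hx, e13, h1, h2, nop, hy]
    rw [run, hs₂, run]
    simp only [Expr.eval_less, Expr.eval_reg, hs₃ 12 (by decide), hs₃ 22 (by decide)]
    have h10 : s₁.reg 12 = s.reg 12 ∧ s₁.reg 22 = (z k).natAbs ∧ s₁.reg 18 = s'.reg 18 ∧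
      s₁.reg 19 = s'.reg 19 ∧ s₁.reg 20 = s'.reg 20 := by simp [hs₁, e12]
    rw [h10.1, h10.2.1]
    refine ⟨?_, ?_, ?_⟩
    · rw [hprev]
      by_cases hc : s.reg 12 < (z k).natAbs
      · simp [hc, run, h10, hs₃]
      · simp [hc, run, not_lt.1 hc]
    · intro h20 t ht
      have h21 : s'.reg 20 = 0 := by
        by_cases hc : s.reg 12 < (z k).natAbs <;> simp [hc, run, hs₃, h10] at h20 <;> exact h20
      rcases Nat.lt_succ_iff_lt_or_eq.1 ht with ht | rfl
      · exact hI.none h21 t ht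
      · exact hC
    · intro h20
      have h21 : s'.reg 20 ≠ 0 := by
        by_cases hc : s.reg 12 < (z k).natAbs <;> simp [hc, run, hs₃, h10] at h20 <;> exact h20
      obtain ⟨j1, j2, j3, j4⟩ := hI.some h21
      have h5 : ∀ s'' : Mem, s''.reg 18 = s'.reg 18 → s''.reg 19 = s'.reg 19
          → s''.reg 18 < k + 1 ∧ CanIncr (s.reg 3) (s.reg 12) (s.reg 13) (s.reg 14) z (s''.reg 18) ∧
          (∀ t < k + 1, CanIncr (s.reg 3) (s.reg 12) (s.reg 13) (s.reg 14) z t → t ≤ s''.reg 18) ∧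
          (s''.reg 19 : ℤ) = incrVal (s.reg 12) (s.reg 13) z (s''.reg 18) + s.reg 4 := by
        intro s'' h6 h7
        rw [h6, h7]
        refine ⟨by omega, j2, fun t ht hct => ?_, j4⟩
        rcases Nat.lt_succ_iff_lt_or_eq.1 ht with ht | rfl
        · exact j3 t ht hct
        · exact absurd hct hC
      apply h5
      · by_cases hc : s.reg 12 < (z k).natAbs <;> simp [hc, run, h10, hs₃]
      · by_cases hc : s.reg 12 < (z k).natAbs <;> simp [hc, run, h10, hs₃]

lemma hasTmp_advance {s : Mem} {a u : ℕ} {z : ℕ → ℤ} {b : ℕ} (hr : HasRow s a (s.reg u) z)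
    (ha : a ≠ 16) (hu : u ≠ 10) (h18 : s.reg 18 = b)
    (h19 : (s.reg 19 : ℤ) = incrVal (s.reg 12) (s.reg 13) z b + s.reg 4)
    (h22 : s.reg 22 = (incrVal (s.reg 12) (s.reg 13) z b).natAbs)
    (hle : |incrVal (s.reg 12) (s.reg 13) z b| ≤ s.reg 4) (hg : s.reg 12 ≤ s.reg 4) :
    HasTmp ((advance a u).run s) (nextSeq (s.reg 12) (s.reg 13) z b) := by
  rw [Int.abs_eq_natAbs] at hle
  have key : ∀ t < s.reg 3, (((advance a u).run s).arr 16 t : ℤ) =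
      nextSeq (s.reg 12) (s.reg 13) z b t + s.reg 4 := by
    refine loop_induct (I := fun k s' => ∀ t < k, (s'.arr 16 t : ℤ) =
      nextSeq (s.reg 12) (s.reg 13) z b t + s.reg 4) (by simp) ?_
    intro k hk s' hx hreg harr hI t ht
    have e3 := hreg 3 (by decide) (by simp [regs])
    have e4 := hreg 4 (by decide) (by simp [regs])
    have e12 := hreg 12 (by decide) (by simp [regs])
    have e13 := hreg 13 (by decide) (by simp [regs])
    have e18 := hreg 18 (by decide) (by simp [regs])
    have e19 := hreg 19 (by decide) (by simp [regs])
    have e22 := hreg 22 (by decide) (by simp [regs])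
    have eu := hreg u hu (by simp [regs])
    have ea := harr a (by simp [arrs, ha])
    have hrow := hr k hk
    rw [h18] at e18
    have hval : ∀ v : ℕ, (v : ℤ) = nextSeq (s.reg 12) (s.reg 13) z b k + s.reg 4 →
        (((s'.setArr 16 k v).setReg 10 (k + 1)).arr 16 t : ℤ) =
          nextSeq (s.reg 12) (s.reg 13) z b t + s.reg 4 := by
      intro v hv
      simp only [Mem.setReg_arr, Mem.setArr_arr, true_and]
      split
      · subst t; exact hv
      · exact hI t (by omega)
    have hns : nextSeq (s.reg 12) (s.reg 13) z b k = if k < b then z k else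
      if k = b then incrVal (s.reg 12) (s.reg 13) z b
      else if k < s.reg 13 then -|incrVal (s.reg 12) (s.reg 13) z b| else -(s.reg 12 : ℤ) := rfl
    rw [Int.abs_eq_natAbs] at hns
    simp only [run, cell, Expr.eval_get, Expr.eval_add, Expr.eval_mul, Expr.eval_reg, hx, e3, eu, ea,
      Expr.eval_less, Expr.eval_same, e18, e13, e19, Expr.eval_sub, e4, e22, e12]
    by_cases c1 : k < b
    · rw [if_pos (by simp [c1])]
      exact hval _ (by rw [hns, if_pos c1]; exact hrow)
    rw [if_neg (by simp [c1])]
    by_cases c2 : k = b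
    · rw [if_pos (by simp [c2])]
      exact hval _ (by rw [hns, if_neg c1, if_pos c2]; exact h19)
    rw [if_neg (by simp [c2])]
    by_cases c3 : k < s.reg 13
    · rw [if_pos (by simp [c3])]
      exact hval _ (by rw [hns, if_neg c1, if_neg c2, if_pos c3, h22]; omega)
    · rw [if_neg (by simp [c3])]
      exact hval _ (by rw [hns, if_neg c1, if_neg c2, if_neg c3]; omega)
  intro t ht
  rw [run_reg_of_notMem _ _ (by simp [advance, regs])] at ht ⊢
  exact key t ht

/-- The specification of `next`. -/
lemma hasTmp_next {s : Mem} {a u : ℕ} {z : ℕ → ℤ} (hr : HasRow s a (s.reg u) z)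
    (ha : a ≠ 16) (hu : u ∉ (next a u).regs) (hg : s.reg 12 ≤ s.reg 4) (hB : s.reg 13 ≤ s.reg 3)
    (h5 : s.reg 5 = 2 * s.reg 4 + 1) (h6 : s.reg 6 = 2 * s.reg 4 + 2) :
    ((∀ t, ¬ CanIncr (s.reg 3) (s.reg 12) (s.reg 13) (s.reg 14) z t) →
      HasTmp ((next a u).run s) (fun _ => s.reg 4 + 1)) ∧
    ∀ b, CanIncr (s.reg 3) (s.reg 12) (s.reg 13) (s.reg 14) z b →
      (∀ t, CanIncr (s.reg 3) (s.reg 12) (s.reg 13) (s.reg 14) z t → t ≤ b) →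
      |incrVal (s.reg 12) (s.reg 13) z b| ≤ s.reg 4 →
      HasTmp ((next a u).run s) (nextSeq (s.reg 12) (s.reg 13) z b) := by
  have hu' : u ∉ (scan a u).regs ∧ u ≠ 10 ∧ u ≠ 22 := by
    simp [next, regs, absTo, topRow, advance] at hu; tauto
  have hS := scanned_scan hr hu'.1 hg h6
  have hlt : ∀ t, CanIncr (s.reg 3) (s.reg 12) (s.reg 13) (s.reg 14) z t → t < s.reg 3 := by
    rintro t (⟨h1, -⟩ | ⟨-, h1, -⟩) <;> omega
  have fr : ∀ y, y ∉ [17, 20, 10, 21, 22, 23, 18, 19, 30] →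
      ((scan a u).run s).reg y = s.reg y := by
    intro y hy
    refine run_reg_of_notMem _ _ ?_
    simp [scan, regs, scanStep, absTo, record, nop] at hy ⊢
    tauto
  have fa : ((scan a u).run s).arr a = s.arr a :=
    run_arr_of_notMem _ _ (by simp [scan, arrs, scanStep, absTo, record, nop])
  have eu : ((scan a u).run s).reg u = s.reg u := run_reg_of_notMem _ _ hu'.1
  set s₁ := (scan a u).run s with hs₁
  have e3 := fr 3 (by decide)
  have e4 := fr 4 (by decide)
  have e5 := fr 5 (by decide)
  have e12 := fr 12 (by decide)
  have e13 := fr 13 (by decide)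
  rw [next, run, run_ite_same, ← hs₁, Expr.eval_reg, Expr.eval_ofNat]
  constructor
  · intro hno
    have h20 : s₁.reg 20 = 0 := by
      by_contra h20
      exact hno _ (hS.some h20).2.1
    rw [if_pos h20]
    have := hasTmp_topRow (s := s₁) (c := s.reg 4 + 1) (by rw [e4, e5, h5]; push_cast; ring)
    exact this
  · intro b hb hmax hle
    have h20 : s₁.reg 20 ≠ 0 := fun h20 => hS.none h20 b (hlt b hb) hb
    obtain ⟨j1, j2, j3, j4⟩ := hS.some h20
    have hbe : s₁.reg 18 = b := le_antisymm (hmax _ j2) (j3 b (hlt b hb) hb)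
    rw [hbe] at j4
    rw [if_neg h20, run, run_absTo (z := incrVal (s.reg 12) (s.reg 13) z b) (by rw [e4]; exact j4)]
    have := hasTmp_advance (s := s₁.setReg 22 (incrVal (s.reg 12) (s.reg 13) z b).natAbs) (a := a) (u := u)
      (z := z) (b := b) (by
        simp only [HasRow, Mem.setReg_reg, Mem.setReg_arr, if_neg hu'.2.2, eu, fa]
        simpa [e3, e4, HasRow] using hr) ha hu'.2.1 (by simpa using hbe)
        (by simpa [e12, e13, e4] using j4) (by simp [e12, e13]) (by simpa [e12, e13, e4] using hle)
        (by simpa [e12, e4] using hg)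
    simpa [e12, e13] using this

/-- The result of a lexicographic comparison. -/
lemma run_compare {s : Mem} {x y : ℕ → ℤ} (hx : HasTmp s x) (hy : HasRow s 15 (s.reg 25) y) :
    (compare.run s).reg 24 = 1 ↔ LexLT (s.reg 3) x y := by
  have key : ((compare.run s).reg 24 = 0 → ∀ t < s.reg 3, x t = y t) ∧
      ((compare.run s).reg 24 = 1 → LexLT (s.reg 3) x y) ∧
      ((compare.run s).reg 24 ≠ 0 → (compare.run s).reg 24 ≠ 1 → LexLT (s.reg 3) y x) := by
    rw [compare, run, run]
    have h3 : (s.setReg 24 0).reg 3 = s.reg 3 := by simp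
    simp only [Expr.eval_ofNat]
    rw [← h3]
    refine loop_induct (s := s.setReg 24 0) (I := fun k s' => (s'.reg 24 = 0 → ∀ t < k, x t = y t) ∧
      (s'.reg 24 = 1 → LexLT k x y) ∧ (s'.reg 24 ≠ 0 → s'.reg 24 ≠ 1 → LexLT k y x)) (by simp) ?_
    rw [h3]
    intro k hk s' hx10 hreg harr hI
    have e3 := hreg 3 (by decide) (by simp [regs, nop])
    have e25 := hreg 25 (by decide) (by simp [regs, nop])
    have a15 := harr 15 (by simp [arrs, nop])
    have a16 := harr 16 (by simp [arrs, nop])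
    simp only [Mem.setReg_reg, Mem.setReg_arr, Nat.reduceEqDiff, if_false] at e3 e25 a15 a16
    have h1 := hx k hk
    have h2 := hy k hk
    obtain ⟨I0, I1, I2⟩ := hI
    have mono : ∀ {x y : ℕ → ℤ}, LexLT k x y → LexLT (k + 1) x y := by
      rintro x y ⟨t, ht, h⟩; exact ⟨t, by omega, h⟩
    simp only [run, cell, Expr.eval_get, Expr.eval_add, Expr.eval_mul, Expr.eval_reg, hx10, e3, e25,
      a15, a16, Expr.eval_same, Expr.eval_less, Expr.eval_ofNat, nop]
    by_cases c0 : s'.reg 24 = 0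
    · have I0 := I0 c0
      by_cases c1 : s.arr 16 k < s.arr 15 (s.reg 3 * s.reg 25 + k)
      · simp [c0, c1]
        exact ⟨k, by omega, I0, by omega⟩
      · by_cases c2 : s.arr 15 (s.reg 3 * s.reg 25 + k) < s.arr 16 k
        · simp [c0, c1, c2]
          exact ⟨k, by omega, fun t ht => (I0 t ht).symm, by omega⟩
        · simp [c0, c1, c2]
          intro t ht
          rcases ht.lt_or_eq with ht | rfl
          · exact I0 t ht
          · omega
    · simp [c0]
      exact ⟨fun h => mono (I1 h), fun h => mono (I2 c0 h)⟩
  refine ⟨key.2.1, fun h => ?_⟩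
  by_contra h1
  by_cases h0 : (compare.run s).reg 24 = 0
  · obtain ⟨t, ht, -, hlt⟩ := h
    rw [key.1 h0 t ht] at hlt
    exact lt_irrefl _ hlt
  · exact h.asymm (key.2.2 h0 h1)

/-- Rows of length `L` do not overlap. -/
lemma row_eq_iff {L v w t r : ℕ} (ht : t < L) (hr : r < L) : L * v + t = L * w + r ↔ v = w ∧ t = r := by
  constructor
  · intro h
    have h1 : (L * v + t) / L = v := by
      rw [Nat.mul_add_div (by omega), Nat.div_eq_of_lt ht, add_zero]
    have h2 : (L * w + r) / L = w := by
      rw [Nat.mul_add_div (by omega), Nat.div_eq_of_lt hr, add_zero]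
    have : v = w := by rw [← h1, h, h2]
    subst this
    exact ⟨rfl, by omega⟩
  · rintro ⟨rfl, rfl⟩; rfl

lemma run_copyIf (s : Mem) (v : ℕ) {t : ℕ} (ht : t < s.reg 3) :
    (copyIf.run s).arr 15 (s.reg 3 * v + t) =
      if s.reg 24 = 1 ∧ v = s.reg 25 then s.arr 16 t else s.arr 15 (s.reg 3 * v + t) := by
  have key : ∀ v, ∀ t < s.reg 3, (copyIf.run s).arr 15 (s.reg 3 * v + t) =
      if s.reg 24 = 1 ∧ v = s.reg 25 ∧ t < s.reg 3 then s.arr 16 t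
      else s.arr 15 (s.reg 3 * v + t) := by
    refine loop_induct (s := s) (I := fun k s' => ∀ v, ∀ t < s.reg 3, s'.arr 15 (s.reg 3 * v + t) =
      if s.reg 24 = 1 ∧ v = s.reg 25 ∧ t < k then s.arr 16 t
      else s.arr 15 (s.reg 3 * v + t)) (by simp) ?_
    intro k hk s' hx10 hreg harr hI v t ht
    have e3 := hreg 3 (by decide) (by simp [regs, nop])
    have e24 := hreg 24 (by decide) (by simp [regs, nop])
    have e25 := hreg 25 (by decide) (by simp [regs, nop])
    have a16 := harr 16 (by simp [arrs, nop])
    simp only [run, Expr.eval_get, Expr.eval_add, Expr.eval_mul, Expr.eval_reg, hx10, e3, e25, e24,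
      a16, Expr.eval_same, Expr.eval_ofNat, nop]
    by_cases c : s.reg 24 = 1
    · have hI := hI v t ht
      simp only [c, true_and] at hI
      simp [c, row_eq_iff ht hk, hI]
      by_cases c1 : v = s.reg 25
      · by_cases c2 : t = k
        · simp [c1, c2]
        · have : t < k ↔ t < k + 1 := by omega
          simp [c1, c2, this]
      · simp [c1]
    · have := hI v t ht
      simp [c] at this ⊢
      exact this
  rw [key v t ht]
  simp [ht]

/-! ### The program: the Bellman–Ford procedure -/

/-- The instruction for one arc, whose index is in register `9`: the label of the tail is dropped, if
the priority of the tail is less than register `15`. -/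
def dropStep : LoopProg :=
  seq (assign 25 (.get 19 (.reg 9))) <| seq (assign 26 (.get 20 (.reg 9))) <|
  seq (assign 11 (.get 21 (.reg 25))) <|
  ite (Expr.less (.reg 11) (.reg 15))
    (seq (assign 12 (.reg 11 / 2)) <|
      seq (ite (Expr.same (.reg 11) (.reg 12 + .reg 12)) (fill 15 26)
        (seq (assign 13 (.reg 3)) (next 15 26))) <|
      seq compare copyIf) nop

/-- All rounds of the Bellman–Ford procedure. -/
def bellmanFord : LoopProg := loop 16 7 (loop 9 2 dropStep)

variable {n d : ℕ} {G : ParityGame n d} {es : List (Fin n × Fin n)}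

/-- The registers and arrays that hold the game and the parameters of the encoding of labels. An entry
`z` of a code is stored as `z + d / 2`, hence register `5` holds the representation of the entries of
the top label. -/
structure Setup (G : ParityGame n d) (es : List (Fin n × Fin n)) (s : Mem) : Prop where
  r0 : s.reg 0 = n
  r1 : s.reg 1 = d
  r2 : s.reg 2 = es.length
  r3 : s.reg 3 = Nat.log 2 n
  r4 : s.reg 4 = d / 2
  r5 : s.reg 5 = 2 * (d / 2) + 1
  r6 : s.reg 6 = 2 * (d / 2) + 2
  r7 : s.reg 7 = n - 1
  tail : ∀ (t : ℕ) (ht : t < es.length), s.arr 19 t = (es[t]).1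
  head : ∀ (t : ℕ) (ht : t < es.length), s.arr 20 t = (es[t]).2
  prio : ∀ v : Fin n, s.arr 21 v = G.prio v

lemma Setup.congr {s s' : Mem} (h : Setup G es s) (hr : ∀ y < 8, s'.reg y = s.reg y)
    (ha : ∀ a, 19 ≤ a → a ≤ 21 → s'.arr a = s.arr a) : Setup G es s' where
  r0 := (hr 0 (by omega)).trans h.r0
  r1 := (hr 1 (by omega)).trans h.r1
  r2 := (hr 2 (by omega)).trans h.r2
  r3 := (hr 3 (by omega)).trans h.r3
  r4 := (hr 4 (by omega)).trans h.r4
  r5 := (hr 5 (by omega)).trans h.r5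
  r6 := (hr 6 (by omega)).trans h.r6
  r7 := (hr 7 (by omega)).trans h.r7
  tail := by rw [ha 19 le_rfl (by omega)]; exact h.tail
  head := by rw [ha 20 (by omega) (by omega)]; exact h.head
  prio := by rw [ha 21 (by omega) le_rfl]; exact h.prio

/-- No register with number less than `8` and none of the arrays `19`, `20`, `21` is written. -/
def keepsSetup (p : LoopProg) : Bool :=
  p.regs.all (fun y => decide (8 ≤ y)) && p.arrs.all (fun a => decide (a < 19))

lemma Setup.run {s : Mem} (h : Setup G es s) (p : LoopProg) (hp : p.keepsSetup = true) :
    Setup G es (p.run s) := by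
  simp only [keepsSetup, Bool.and_eq_true, List.all_eq_true, decide_eq_true_eq] at hp
  refine h.congr (fun y hy => run_reg_of_notMem _ _ fun h => ?_)
    (fun a ha _ => run_arr_of_notMem _ _ fun h => ?_)
  · have := hp.1 y h; omega
  · have := hp.2 a h; omega

/-- The setup is intact in every round of a loop whose body keeps it. -/
lemma Setup.of_agree {s s' : Mem} (h : Setup G es s) (p : LoopProg) (x : ℕ)
    (hp : p.keepsSetup = true) (hx : 8 ≤ x)
    (hr : ∀ y, y ≠ x → y ∉ p.regs → s'.reg y = s.reg y)
    (ha : ∀ a, a ∉ p.arrs → s'.arr a = s.arr a) : Setup G es s' := by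
  simp only [keepsSetup, Bool.and_eq_true, List.all_eq_true, decide_eq_true_eq] at hp
  refine h.congr (fun y hy => hr y (by omega) fun h => ?_) (fun a h1 _ => ha a fun h => ?_)
  · have := hp.1 y h; omega
  · have := hp.2 a h; omega

lemma HasRow.congr {s s' : Mem} {a v : ℕ} {z : ℕ → ℤ} (h : HasRow s a v z)
    (h3 : s'.reg 3 = s.reg 3) (h4 : s'.reg 4 = s.reg 4) (ha : s'.arr a = s.arr a) :
    HasRow s' a v z := by
  unfold HasRow; rw [h3, h4, ha]; exact h

/-- `next` computes any label that is `⊤` or the result of an increase, depending on whether an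
increase is possible. -/
lemma hasTmp_next_label {L j H : ℕ} {b x : Label (bitTree L j)} {s : Mem} {a u : ℕ}
    (h3 : s.reg 3 = L) (h4 : s.reg 4 = H) (h14 : s.reg 14 = j) (hjH : j ≤ H) (hr : HasRow s a (s.reg u) (code H b))
    (ha : a ≠ 16) (hu : u ∉ (next a u).regs) (hg : s.reg 12 ≤ j) (hB : s.reg 13 ≤ L)
    (h5 : s.reg 5 = 2 * s.reg 4 + 1) (h6 : s.reg 6 = 2 * s.reg 4 + 2)
    (hno : (∀ t, ¬ CanIncr L (s.reg 12) (s.reg 13) j (code H b) t) → x = ⊤)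
    (hyes : ∀ t₀, CanIncr L (s.reg 12) (s.reg 13) j (code H b) t₀ →
      (∀ t, CanIncr L (s.reg 12) (s.reg 13) j (code H b) t → t ≤ t₀) →
      ∀ t < L, code H x t = nextSeq (s.reg 12) (s.reg 13) (code H b) t₀ t) :
    HasTmp ((next a u).run s) (code H x) := by
  subst h3 h4 h14
  obtain ⟨k1, k2⟩ := hasTmp_next hr ha hu (hg.trans hjH) hB h5 h6
  have e3 : ((next a u).run s).reg 3 = s.reg 3 :=
    run_reg_of_notMem _ _ (by simp [next, scan, scanStep, record, absTo, topRow, advance, regs, nop])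
  by_cases hc : ∃ t, CanIncr (s.reg 3) (s.reg 12) (s.reg 13) (s.reg 14) (code (s.reg 4) b) t
  · have hbd : ∀ t, CanIncr (s.reg 3) (s.reg 12) (s.reg 13) (s.reg 14) (code (s.reg 4) b) t →
        t ≤ s.reg 3 := by
      rintro t (⟨h1, -⟩ | ⟨-, h1, -⟩) <;> omega
    obtain ⟨t₀, hmem, hmax⟩ : ∃ t₀,
        CanIncr (s.reg 3) (s.reg 12) (s.reg 13) (s.reg 14) (code (s.reg 4) b) t₀ ∧
        ∀ t, CanIncr (s.reg 3) (s.reg 12) (s.reg 13) (s.reg 14) (code (s.reg 4) b) t → t ≤ t₀ := by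
      obtain ⟨t, ht⟩ := hc
      exact ⟨_, Nat.findGreatest_spec (P := fun t => CanIncr (s.reg 3) (s.reg 12) (s.reg 13)
        (s.reg 14) (code (s.reg 4) b) t) (hbd t ht) ht,
        fun t ht => Nat.le_findGreatest (hbd t ht) ht⟩
    have hle : |incrVal (s.reg 12) (s.reg 13) (code (s.reg 4) b) t₀| ≤ s.reg 4 := by
      rcases eq_or_ne b ⊤ with rfl | hb
      · exact absurd hmem (not_canIncr_top hjH _ _ _)
      · obtain ⟨b, rfl⟩ := WithTop.ne_top_iff_exists.mp hb
        exact (abs_incrVal_le (leaf_valid b) hB hmem).1.trans (by exact_mod_cast hjH)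
    intro t ht
    have := k2 t₀ hmem hmax hle t ht
    rw [this, hyes t₀ hmem hmax t (by rwa [← e3])]
  · push Not at hc
    rw [hno hc]
    exact k1 hc

/-- The labels of a labeling are stored in the rows of array `15`. -/
def HasLabels {L j : ℕ} (s : Mem) (H : ℕ) (ν : Labeling n (bitTree L j)) : Prop :=
  ∀ v : Fin n, HasRow s 15 v (code H (ν v))

lemma HasLabels.congr {L j H : ℕ} {s s' : Mem} {ν : Labeling n (bitTree L j)}
    (h : HasLabels s H ν) (h3 : s'.reg 3 = s.reg 3) (h4 : s'.reg 4 = s.reg 4)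
    (ha : s'.arr 15 = s.arr 15) : HasLabels s' H ν :=
  fun v => (h v).congr h3 h4 ha

/-- After the comparison and the conditional copy, the row contains the smaller label. -/
lemma hasLabels_copy {L j H : ℕ} {s : Mem} {ν : Labeling n (bitTree L j)} {u : Fin n}
    {x : Label (bitTree L j)} (h3 : s.reg 3 = L) (hj : j ≤ H) (hL : 0 < L)
    (h25 : s.reg 25 = u) (hν : HasLabels s H ν) (hx : HasTmp s (code H x)) :
    HasLabels ((seq compare copyIf).run s) H (Function.update ν u (min (ν u) x)) := by
  have hu : HasRow s 15 (s.reg 25) (code H (ν u)) := by rw [h25]; exact hν u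
  have hc := run_compare hx hu
  rw [h3, ← code_lt_iff hj hL] at hc
  have fr : ∀ y, y ∉ [24, 10, 30] → (compare.run s).reg y = s.reg y := by
    intro y hy
    refine run_reg_of_notMem _ _ ?_
    simp [compare, regs, nop] at hy ⊢; tauto
  have fa : ∀ a, (compare.run s).arr a = s.arr a := fun a => run_arr_of_notMem _ _ (by simp [compare, arrs, nop])
  have gr : ∀ y, y ∉ [10, 30] → (copyIf.run (compare.run s)).reg y = (compare.run s).reg y := by
    intro y hy
    refine run_reg_of_notMem _ _ ?_
    simp [copyIf, regs, nop] at hy ⊢; tauto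
  rw [run]
  intro v t ht
  rw [gr 3 (by decide)] at ht ⊢
  rw [gr 4 (by decide), run_copyIf _ _ ht, fr 25 (by decide), fr 3 (by decide), fr 4 (by decide), h25, fa, fa]
  rw [fr 3 (by decide)] at ht
  by_cases hv : v = u
  · subst hv
    rw [Function.update_self]
    by_cases hlt : x < ν v
    · rw [if_pos ⟨hc.2 hlt, rfl⟩, min_eq_right hlt.le]
      exact hx t ht
    · rw [if_neg (fun h => hlt (hc.1 h.1)), min_eq_left (not_lt.1 hlt)]
      exact hν v t ht
  · rw [Function.update_of_ne hv, if_neg (fun h => hv (Fin.ext h.2))]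
    exact hν v t ht

/-- The specification of `dropStep`. -/
lemma hasLabels_dropStep {j k : ℕ} {s : Mem} {ν : Labeling n (bitTree (Nat.log 2 n) j)}
    (hs : Setup G es s) (hn : 2 ≤ n) (hk : k < es.length) (h9 : s.reg 9 = k) (h14 : s.reg 14 = j)
    (hj : j ≤ d / 2) (hp : ∀ v, G.prio v < s.reg 15 → G.prio v / 2 ≤ j)
    (hν : HasLabels s (d / 2) ν) :
    HasLabels (dropStep.run s) (d / 2)
      (if G.prio es[k].1 < s.reg 15 then dropArc G es[k].1 es[k].2 ν else ν) := by
  have hL : 0 < Nat.log 2 n := Nat.log_pos (by omega) hn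
  obtain ⟨s₁, hs₁⟩ : ∃ s₁, s₁ = ((s.setReg 25 es[k].1).setReg 26 es[k].2).setReg 11
    (G.prio es[k].1) := ⟨_, rfl⟩
  have hfr : ∀ y, y ∉ [25, 26, 11] → s₁.reg y = s.reg y := by
    intro y hy; simp at hy; simp [hs₁, hy]
  have hfa : ∀ a, s₁.arr a = s.arr a := by intro a; simp [hs₁]
  have hset : Setup G es s₁ := hs.congr (fun y hy => hfr y (by simp; omega)) (fun a _ _ => hfa a)
  have hrun : dropStep.run s = if G.prio es[k].1 < s.reg 15 then (seq (assign 12 (.reg 11 / 2)) <|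
      seq (ite (Expr.same (.reg 11) (.reg 12 + .reg 12)) (fill 15 26)
        (seq (assign 13 (.reg 3)) (next 15 26))) <|
      seq compare copyIf).run s₁ else nop.run s₁ := by
    simp only [dropStep, run_seq, run_assign, Expr.eval_get, Expr.eval_reg, h9, hs.tail k hk,
      Mem.setReg_arr, Mem.setReg_reg, run_ite_less]
    simp [hs.head k hk, hs.prio, ← hs₁]
  have hν₁ : HasLabels s₁ (d / 2) ν := hν.congr (hfr 3 (by decide)) (hfr 4 (by decide)) (hfa 15)
  rw [hrun]
  split_ifs with hlt
  · have hpj := hp _ hlt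
    set s₂ := s₁.setReg 12 (G.prio es[k].1 / 2) with hs₂
    have hset₂ : Setup G es s₂ := hset.congr (fun y hy => by simp [hs₂]; omega) (fun a _ _ => rfl)
    have h26 : s₂.reg 26 = es[k].2 := by simp [hs₂, hs₁]
    have h25 : s₂.reg 25 = es[k].1 := by simp [hs₂, hs₁]
    have h11 : s₂.reg 11 = G.prio es[k].1 := by simp [hs₂, hs₁]
    have h12 : s₂.reg 12 = G.prio es[k].1 / 2 := by simp [hs₂]
    have h14' : s₂.reg 14 = j := by simp [hs₂, hfr 14, h14]
    have hν₂ : HasLabels s₂ (d / 2) ν := hν₁.congr (by simp [hs₂]) (by simp [hs₂]) (by simp [hs₂])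
    have e1 : (assign 12 (.reg 11 / 2)).run s₁ = s₂ := by
      simp [LoopProg.run, hs₂, hs₁]
    rw [LoopProg.run, e1, LoopProg.run]
    -- the program for the tight label, in array `16`
    set q : LoopProg := ite (Expr.same (.reg 11) (.reg 12 + .reg 12)) (fill 15 26)
        (seq (assign 13 (.reg 3)) (next 15 26)) with hq
    have qr : ∀ y, y ∉ q.regs → (q.run s₂).reg y = s₂.reg y := fun y hy => run_reg_of_notMem _ _ hy
    have qa : (q.run s₂).arr 15 = s₂.arr 15 := run_arr_of_notMem _ _ (by decide)
    have htmp : HasTmp (q.run s₂) (code (d / 2) (tight (G.prio es[k].1) (ν es[k].2))) := by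
      have hrow : HasRow s₂ 15 (s₂.reg 26) (code (d / 2) (ν es[k].2)) := by
        rw [h26]; exact hν₂ _
      rw [hq, run_ite_same]
      simp only [Expr.eval_reg, Expr.eval_add, h11, h12]
      split_ifs with heven
      · have hev : Even (G.prio es[k].1) := ⟨_, heven⟩
        have := hasTmp_fill hrow (by decide) (by decide) (by rw [h12, hset₂.r4]; omega)
        intro t ht
        rw [this t ht, h12, code_tight_even hj hev hpj _ t]
        rwa [run_reg_of_notMem _ _ (by decide), hset₂.r3] at ht
      · have hodd : ¬ Even (G.prio es[k].1) := by
          rintro ⟨r, hr⟩; omega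
        obtain ⟨k1, k2⟩ := code_tight_odd hj hodd hpj (ν es[k].2)
        rw [LoopProg.run, LoopProg.run, Expr.eval_reg]
        have g12 : (s₂.setReg 13 (s₂.reg 3)).reg 12 = G.prio es[k].1 / 2 := by simp [h12]
        have g13 : (s₂.setReg 13 (s₂.reg 3)).reg 13 = Nat.log 2 n := by simp [hset₂.r3]
        refine hasTmp_next_label (L := Nat.log 2 n) (j := j) (b := ν es[k].2)
          (by simp [hset₂.r3]) (by simp [hset₂.r4])
          (by simp [h14']) hj (HasRow.congr (s := s₂) (by simpa using hrow) (by simp) (by simp) rfl) (by decide) (by decide) (by rw [g12]; exact hpj)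
          (by rw [g13]) (by simp [hset₂.r4, hset₂.r5]) (by simp [hset₂.r4, hset₂.r6]) ?_ ?_
        · rw [g12, g13]; exact k1
        · rw [g12, g13]; exact k2
    have := hasLabels_copy (s := q.run s₂) (ν := ν) (u := es[k].1)
      (x := tight (G.prio es[k].1) (ν es[k].2))
      ((qr 3 (by decide)).trans hset₂.r3) hj hL ((qr 25 (by decide)).trans h25)
      (hν₂.congr (qr 3 (by decide)) (qr 4 (by decide)) qa) htmp
    rwa [← dropArc_eq] at this
  · exact hν₁.congr (by simp [nop, LoopProg.run]) (by simp [nop, LoopProg.run]) (by simp [nop, LoopProg.run])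

/-- The specification of `bellmanFord`. -/
lemma hasLabels_bellmanFord {j : ℕ} {s : Mem} {ν : Labeling n (bitTree (Nat.log 2 n) j)}
    (hs : Setup G es s) (hn : 2 ≤ n) (h14 : s.reg 14 = j)
    (hj : j ≤ d / 2) (hp : ∀ v, G.prio v < s.reg 15 → G.prio v / 2 ≤ j)
    (hν : HasLabels s (d / 2) ν) :
    HasLabels (bellmanFord.run s) (d / 2)
      (rounds G (es.filter (fun e => G.prio e.1 < s.reg 15)) (n - 1) ν) := by
  rw [← hs.r7]
  refine loop_induct (I := fun k s' => HasLabels s' (d / 2)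
    (rounds G (es.filter (fun e => G.prio e.1 < s.reg 15)) k ν))
    (by rw [rounds_zero]; exact hν.congr (by simp) (by simp) rfl) ?_
  intro k hk s' hx hreg harr hI
  have hs' : Setup G es s' := hs.of_agree _ 16 (by decide) (by decide) hreg harr
  have h14' := (hreg 14 (by decide) (by decide)).trans h14
  have h15' := hreg 15 (by decide) (by decide)
  rw [rounds_succ]
  refine HasLabels.congr (s := (loop 9 2 dropStep).run s') ?_ (by simp) (by simp) rfl
  have key := loop_induct (x := 9) (r := 2) (b := dropStep) (s := s')
    (I := fun k s'' => HasLabels s'' (d / 2)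
      (relax G ((es.take k).filter (fun e => G.prio e.1 < s.reg 15))
        (rounds G (es.filter (fun e => G.prio e.1 < s.reg 15)) (s'.reg 16) ν)))
    (by simp only [List.take_zero, List.filter_nil, relax_nil]
        rw [hx]; exact hI.congr (by simp) (by simp) rfl) (by
      intro i hi s'' hx' hreg' harr' hI'
      have hs'' : Setup G es s'' := hs'.of_agree _ 9 (by decide) (by decide) hreg' harr'
      have h14'' := (hreg' 14 (by decide) (by decide)).trans h14'
      have h15'' := (hreg' 15 (by decide) (by decide)).trans h15'
      rw [hs'.r2] at hi
      have := hasLabels_dropStep hs'' hn hi hx' h14'' hj (by rw [h15'']; exact hp) hI'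
      rw [h15''] at this
      rw [List.take_succ_eq_append_getElem hi, List.filter_append, relax_append]
      refine HasLabels.congr (s := dropStep.run s'') ?_ (by simp) (by simp) rfl
      convert this using 1
      by_cases hlt : G.prio es[i].1 < s.reg 15
      · simp [hlt, relax_cons, relax_nil]
      · simp [hlt, relax_nil])
  rw [hs'.r2, List.take_length, hx] at key
  exact key

/-! ### The program: arc costs -/

/-- Array `15` receives the initial labels for the node `reg 8`: the least leaf of the tree of height
`reg 14` at this node, and `⊤` elsewhere. -/
def initLabels : LoopProg :=
  loop 29 0 <| loop 10 3 <| ite (Expr.same (.reg 29) (.reg 8))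
    (store 15 (.reg 3 * .reg 29 + .reg 10) (.reg 4 - .reg 14))
    (store 15 (.reg 3 * .reg 29 + .reg 10) (.reg 5))

/-- Register `27` receives one more than the number of leading entries of the row `reg 26` of array
`15` that are minimal in the tree of height `reg 14`. -/
def leading : LoopProg :=
  seq (assign 27 1) <| seq (assign 24 0) <| loop 10 3 <|
    ite (Expr.same (.reg 24) 0)
      (ite (Expr.same (cell 15 26) (.reg 4 - .reg 14)) (assign 27 (.reg 27 + 1)) (assign 24 1)) nop

/-- Register `27` receives the slack of the row `reg 26` of array `15`: the number `L + 1 - i` for the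
least index `i` of a tree of the chain that contains the label, or `0` for `⊤`. If the base node has
priority `d`, the chain contains only one tree, and the slack of every leaf is `L + 1`. -/
def slack : LoopProg :=
  seq leading <| seq (ite (Expr.same (.reg 1) (.reg 15)) (assign 27 (.reg 3 + 1)) nop) <|
    ite (Expr.same (.get 15 (.reg 3 * .reg 26)) (.reg 5)) (assign 27 0) nop

/-- The instruction for the arc with index `reg 9` in the computation of arc costs. Array `18` holds
the slacks of the arcs of the auxiliary digraph, array `7` their costs. -/
def costStep : LoopProg :=
  seq (assign 25 (.get 19 (.reg 9))) <| seq (assign 26 (.get 20 (.reg 9))) <|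
  ite (Expr.same (.get 21 (.reg 25)) (.reg 15))
    (seq slack <| ite (Expr.less (.get 18 (.reg 0 * .reg 25 + .reg 8)) (.reg 27))
      (seq (store 18 (.reg 0 * .reg 25 + .reg 8) (.reg 27))
        (store 7 (.reg 0 * .reg 25 + .reg 8) (.reg 3 + 2 - .reg 27))) nop) nop

/-- The costs of all arcs of the auxiliary digraph with head `reg 8`. -/
def costColumn : LoopProg :=
  seq (assign 15 (.get 21 (.reg 8))) <| seq (assign 14 (.reg 15 / 2)) <|
  ite (Expr.same (.reg 15) (.reg 14 + .reg 14))
    (seq initLabels <| seq bellmanFord <| loop 9 2 costStep) nop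

/-- The costs of all arcs of the auxiliary digraph. -/
def arcCosts : LoopProg := loop 8 0 costColumn

variable {n d : ℕ} {G : ParityGame n d} {τ : OddStrategy G} {es : List (Fin n × Fin n)}

/-- The smallest leaf of the tree of height `j` is coded by entries `-j`. -/
lemma hasLabels_initLabels {s : Mem} {w : Fin n} (hs : Setup G es s) (h8 : s.reg 8 = w)
    (h14 : s.reg 14 = G.prio w / 2) :
    HasLabels (initLabels.run s) (d / 2) (baseInit G (Nat.log 2 n) w) := by
  have hjH : G.prio w / 2 ≤ d / 2 := Nat.div_le_div_right (G.prio_le w)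
  have key : ∀ v < s.reg 0, ∀ t < s.reg 3, (initLabels.run s).arr 15 (s.reg 3 * v + t) =
      if v = w then s.reg 4 - s.reg 14 else s.reg 5 := by
    refine loop_induct (I := fun k s' => ∀ v < k, ∀ t < s.reg 3, s'.arr 15 (s.reg 3 * v + t) =
      if v = w then s.reg 4 - s.reg 14 else s.reg 5) (by simp) ?_
    intro k hk s' hx hreg harr hI v hv t ht
    rw [Mem.setReg_arr]
    have e3 := hreg 3 (by decide) (by decide)
    have e4 := hreg 4 (by decide) (by decide)
    have e5 := hreg 5 (by decide) (by decide)
    have e8 := hreg 8 (by decide) (by decide)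
    have e14 := hreg 14 (by decide) (by decide)
    have key := loop_induct (x := 10) (r := 3) (s := s') (b := ite (Expr.same (.reg 29) (.reg 8))
      (store 15 (.reg 3 * .reg 29 + .reg 10) (.reg 4 - .reg 14))
      (store 15 (.reg 3 * .reg 29 + .reg 10) (.reg 5)))
      (I := fun i s'' => ∀ v < k + 1, ∀ t < s.reg 3, (v < k ∨ t < i) →
        s''.arr 15 (s.reg 3 * v + t) = if v = w then s.reg 4 - s.reg 14 else s.reg 5)
      (by
        intro v hv t ht h
        exact hI v (by omega) t ht) (by
        intro i hi s'' hx' hreg' harr' hI' v hv t ht h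
        have f3 := (hreg' 3 (by decide) (by decide)).trans e3
        have f4 := (hreg' 4 (by decide) (by decide)).trans e4
        have f5 := (hreg' 5 (by decide) (by decide)).trans e5
        have f8 := (hreg' 8 (by decide) (by decide)).trans e8
        have f14 := (hreg' 14 (by decide) (by decide)).trans e14
        have f29 := (hreg' 29 (by decide) (by decide)).trans hx
        rw [e3] at hi
        simp only [run_ite_same, Expr.eval_reg, f29, f8, h8]
        have hval : ∀ x : ℕ, x = (if k = w then s.reg 4 - s.reg 14 else s.reg 5) →
            (((s''.setArr 15 (s.reg 3 * k + i) x).setReg 10 (i + 1)).arr 15 (s.reg 3 * v + t)) =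
              if v = w then s.reg 4 - s.reg 14 else s.reg 5 := by
          rintro x rfl
          rw [Mem.setReg_arr, Mem.setArr_arr]
          simp only [row_eq_iff ht hi, true_and]
          by_cases hc : v = k ∧ t = i
          · rw [if_pos hc, hc.1]
          · rw [if_neg hc, hI' v hv t ht (by omega)]
        by_cases hkw : k = w
        · rw [if_pos hkw]
          have := hval _ (if_pos hkw).symm
          simpa only [run, Expr.eval_add, Expr.eval_mul, Expr.eval_reg, Expr.eval_sub, f3, f29, hx', f4, f14]
            using this
        · rw [if_neg hkw]
          have := hval _ (if_neg hkw).symm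
          simpa only [run, Expr.eval_add, Expr.eval_mul, Expr.eval_reg, f3, f29, hx', f5]
            using this)
    exact key v hv t ht (by omega)
  intro v t ht
  have r3 : (initLabels.run s).reg 3 = s.reg 3 := run_reg_of_notMem _ _ (by decide)
  have r4 : (initLabels.run s).reg 4 = s.reg 4 := run_reg_of_notMem _ _ (by decide)
  rw [r3] at ht ⊢
  rw [r4, key v (by rw [hs.r0]; exact v.2) t ht, hs.r4, hs.r5, h14, baseInit]
  by_cases hv : v = w
  · subst hv
    rw [if_pos rfl, Function.update_self, code_min t (by rwa [← hs.r3])]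
    omega
  · rw [if_neg (fun h => hv (Fin.ext h)), Function.update_of_ne hv, code_top]
    push_cast; ring

/-- Register `24` becomes `1` at the first entry that is not minimal. -/
lemma run_leading {s : Mem} {z : ℕ → ℤ} (hz : HasRow s 15 (s.reg 26) z) (hj : s.reg 14 ≤ s.reg 4) :
    ((leading.run s).reg 27 ≤ s.reg 3 + 1) ∧ 1 ≤ (leading.run s).reg 27 ∧ ∀ i ≤ s.reg 3,
      i + 1 ≤ (leading.run s).reg 27 ↔ ∀ t < i, z t = -(s.reg 14 : ℤ) := by
  rw [leading, run_seq, run_seq, run_assign, run_assign, Expr.eval_ofNat, Expr.eval_ofNat]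
  set s₀ := (s.setReg 27 1).setReg 24 0 with hs₀
  have h3 : s₀.reg 3 = s.reg 3 := by simp [hs₀]
  rw [← h3]
  have := loop_induct (x := 10) (r := 3) (s := s₀) (b := ite (Expr.same (.reg 24) 0)
      (ite (Expr.same (cell 15 26) (.reg 4 - .reg 14)) (assign 27 (.reg 27 + 1)) (assign 24 1)) nop)
    (I := fun k s' => (s'.reg 27 ≤ k + 1) ∧ 1 ≤ s'.reg 27 ∧
      ((s'.reg 24 = 0 → s'.reg 27 = k + 1) ∧ (s'.reg 24 ≠ 0 → s'.reg 27 ≤ k)) ∧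
      ∀ i ≤ k, i + 1 ≤ s'.reg 27 ↔ ∀ t < i, z t = -(s.reg 14 : ℤ)) (by simp [hs₀]) (by
      intro k hk s' hx hreg harr ⟨I1, I2, I3, I4⟩
      have e3 := (hreg 3 (by decide) (by decide))
      have e4 := (hreg 4 (by decide) (by decide))
      have e14 := (hreg 14 (by decide) (by decide))
      have e26 := (hreg 26 (by decide) (by decide))
      have a15 := harr 15 (by decide)
      simp [hs₀] at e3 e4 e14 e26 a15
      rw [h3] at hk
      have hrow := hz k hk
      simp only [run_ite_same, Expr.eval_reg, Expr.eval_ofNat, cell, Expr.eval_get, Expr.eval_add,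
        Expr.eval_mul, Expr.eval_sub, hx, e3, e4, e14, e26, a15]
      by_cases c0 : s'.reg 24 = 0
      · rw [if_pos c0]
        have I3 := I3.1 c0
        have hall := (I4 k le_rfl).1 (by omega)
        by_cases c1 : s.arr 15 (s.reg 3 * s.reg 26 + k) = s.reg 4 - s.reg 14
        · have hzk : z k = -(s.reg 14 : ℤ) := by omega
          rw [if_pos c1]
          refine ⟨by simp [run]; omega, by simp [run], ⟨by simp [run]; omega, by simp [run, c0]⟩,
            fun i hi => ?_⟩
          refine iff_of_true (by simp [run]; omega) fun t ht => ?_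
          rcases (show t ≤ k by omega).lt_or_eq with h | rfl
          · exact hall t h
          · exact hzk
        · have hzk : z k ≠ -(s.reg 14 : ℤ) := by omega
          rw [if_neg c1]
          refine ⟨by simp [run]; omega, by simp [run]; omega, ⟨by simp [run], by simp [run]; omega⟩,
            fun i hi => ?_⟩
          rcases hi.lt_or_eq with h | rfl
          · have := I4 i (by omega)
            simpa [run] using this
          · refine iff_of_false (by simp [run]; omega) fun h => hzk (h k (by omega))
      · rw [if_neg c0]
        have hfr : ∀ y, y ≠ 30 → y ≠ 10 → ((nop.run s').setReg 10 (k + 1)).reg y = s'.reg y := by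
          intro y h1 h2; simp [nop, run, h1, h2]
        rw [hfr 27 (by decide) (by decide), hfr 24 (by decide) (by decide)]
        have I3 := I3.2 c0
        refine ⟨by omega, I2, ⟨fun h => absurd h c0, fun _ => by omega⟩, fun i hi => ?_⟩
        rcases hi.lt_or_eq with h | rfl
        · exact I4 i (by omega)
        · refine iff_of_false (by omega) fun h => ?_
          have := (I4 k le_rfl).2 fun t ht => h t (by omega)
          omega)
  exact ⟨this.1, this.2.1, this.2.2.2⟩

/-- The tree with index `L + 1 - x` contains the label. -/
def SlackGE {L j : ℕ} (h x : ℕ) (b : Label (bitTree L j)) : Prop :=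
  ∃ a : Leaf (bitTree L j), b = (a : Label (bitTree L j)) ∧
    ∀ t < L - chainBits L h j (L + 1 - x), codeSeq a.1 t = -(j : ℤ)

lemma code_zero_eq_top_iff {L j H : ℕ} (hj : j ≤ H) (hL : 0 < L) (b : Label (bitTree L j)) :
    code H b 0 = H + 1 ↔ b = ⊤ := by
  constructor
  · intro h
    by_contra hb
    obtain ⟨b, rfl⟩ := WithTop.ne_top_iff_exists.mp hb
    have := (abs_le.mp ((leaf_valid b).1 0 hL)).2
    rw [code_coe] at h
    omega
  · rintro rfl; exact code_top 0

/-- The specification of `slack`. -/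
lemma run_slack {s : Mem} {u w : Fin n} {ν : Labeling n (bitTree (Nat.log 2 n) (G.prio w / 2))}
    (hs : Setup G es s) (hn : 2 ≤ n) (hev : Even (G.prio w))
    (h26 : s.reg 26 = u) (h14 : s.reg 14 = G.prio w / 2)
    (h15 : s.reg 15 = G.prio w) (hν : HasLabels s (d / 2) ν) :
    (slack.run s).reg 27 ≤ Nat.log 2 n + 1 ∧ ∀ x, 1 ≤ x → x ≤ Nat.log 2 n + 1 →
      (x ≤ (slack.run s).reg 27 ↔ SlackGE (d / 2) x (ν u)) := by
  have hL : 0 < Nat.log 2 n := Nat.log_pos (by omega) hn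
  have hpd := G.prio_le w
  have hjH : G.prio w / 2 ≤ d / 2 := Nat.div_le_div_right hpd
  have hde := G.even_d
  obtain ⟨k1, k2, k3⟩ := run_leading (z := code (d / 2) (ν u)) (by rw [h26]; exact hν u)
    (by rw [h14, hs.r4]; exact hjH)
  rw [h14] at k3
  have hs' : Setup G es (leading.run s) := hs.run _ (by decide)
  have e15 : (leading.run s).reg 15 = G.prio w := (run_reg_of_notMem _ _ (by decide)).trans h15
  have e26 : (leading.run s).reg 26 = u := (run_reg_of_notMem _ _ (by decide)).trans h26
  have e15a : (leading.run s).arr 15 = s.arr 15 := run_arr_of_notMem _ _ (by decide)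
  rw [hs.r3] at k1 k3
  rw [slack, run_seq, run_seq]
  set s₁ := leading.run s
  obtain ⟨s₂, hs₂, g27, g5, g3, g26, g15⟩ : ∃ s₂,
      (ite (Expr.same (.reg 1) (.reg 15)) (assign 27 (.reg 3 + 1)) nop).run s₁ = s₂ ∧
      s₂.reg 27 = (if d = G.prio w then Nat.log 2 n + 1 else s₁.reg 27) ∧
      s₂.reg 5 = s₁.reg 5 ∧ s₂.reg 3 = s₁.reg 3 ∧ s₂.reg 26 = s₁.reg 26 ∧ s₂.arr 15 = s₁.arr 15 := by
    refine ⟨_, rfl, ?_, run_reg_of_notMem _ _ (by decide), run_reg_of_notMem _ _ (by decide),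
      run_reg_of_notMem _ _ (by decide), run_arr_of_notMem _ _ (by decide)⟩
    rw [run_ite_same, Expr.eval_reg, Expr.eval_reg, hs'.r1, e15]
    split_ifs with h
    · simp [run, hs'.r3]
    · simp [run, nop]
  have hz0 := hν u 0 (by rw [hs.r3]; exact hL)
  rw [hs.r3, hs.r4, add_zero] at hz0
  rw [hs₂, run_ite_same]
  simp only [Expr.eval_get, Expr.eval_mul, Expr.eval_reg, g3, g26, g15, g5, e26, e15a, hs'.r3, hs'.r5]
  have htop : s.arr 15 (Nat.log 2 n * u) = 2 * (d / 2) + 1 ↔ ν u = ⊤ := by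
    rw [← code_zero_eq_top_iff hjH hL]
    omega
  simp only [htop]
  split_ifs with ht
  · refine ⟨by simp [run], fun x hx hxL => iff_of_false (by simp [run]; omega) ?_⟩
    rintro ⟨a, ha, -⟩
    rw [ht] at ha
    exact WithTop.coe_ne_top ha.symm
  · obtain ⟨a, ha⟩ := WithTop.ne_top_iff_exists.mp ht
    have hn27 : (nop.run s₂).reg 27 = s₂.reg 27 := by simp [nop, run]
    rw [hn27, g27]
    have hS : ∀ x, SlackGE (d / 2) x (ν u) ↔
        ∀ t < Nat.log 2 n - chainBits (Nat.log 2 n) (d / 2) (G.prio w / 2) (Nat.log 2 n + 1 - x),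
          codeSeq a.1 t = -((G.prio w / 2 : ℕ) : ℤ) := by
      intro x
      constructor
      · rintro ⟨a', ha', h⟩
        rw [← ha, WithTop.coe_inj] at ha'
        rw [ha']; exact h
      · intro h
        exact ⟨a, ha.symm, h⟩
    rw [← ha, code_coe] at k3
    split_ifs with hd
    · refine ⟨le_rfl, fun x hx hxL => iff_of_true hxL ?_⟩
      rw [hS, chainBits, if_neg (by omega)]
      intro t ht
      omega
    · refine ⟨k1, fun x hx hxL => ?_⟩
      have hlt : G.prio w / 2 < d / 2 := by
        obtain ⟨a, ha⟩ := hev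
        obtain ⟨b, hb⟩ := hde
        omega
      rw [hS, chainBits, if_pos hlt]
      have := k3 (x - 1) (by omega)
      rw [show x - 1 + 1 = x by omega] at this
      rw [this]
      rw [show Nat.log 2 n - (Nat.log 2 n + 1 - x) = x - 1 by omega]

/-- The cell `c` of array `18` holds the greatest `x ≤ L + 1` with the downward closed property `P`,
and the cell `c` of array `7` holds the corresponding cost. -/
structure CostCell (s : Mem) (L c : ℕ) (P : ℕ → Prop) : Prop where
  le : s.arr 18 c ≤ L + 1
  iff : ∀ x, 1 ≤ x → x ≤ L + 1 → (x ≤ s.arr 18 c ↔ P x)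
  cost : s.arr 7 c = if s.arr 18 c = 0 then 0 else L + 2 - s.arr 18 c

lemma CostCell.congr {s s' : Mem} {L c : ℕ} {P Q : ℕ → Prop} (h : CostCell s L c P)
    (h18 : s'.arr 18 c = s.arr 18 c) (h7 : s'.arr 7 c = s.arr 7 c)
    (hPQ : ∀ x, 1 ≤ x → x ≤ L + 1 → (P x ↔ Q x)) : CostCell s' L c Q := by
  refine ⟨?_, ?_, ?_⟩
  · rw [h18]; exact h.le
  · intro x h1 h2; rw [h18, h.iff x h1 h2, hPQ x h1 h2]
  · rw [h18, h7]; exact h.cost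

/-- The entry for the tail of the arc becomes the maximum of its old value and the slack of the head;
no other column is changed. -/
lemma costCell_costStep {s : Mem} {k : ℕ} {w : Fin n} {P : Fin n → ℕ → Prop}
    {ν : Labeling n (bitTree (Nat.log 2 n) (G.prio w / 2))}
    (hs : Setup G es s) (hn : 2 ≤ n) (hk : k < es.length) (hev : Even (G.prio w))
    (h9 : s.reg 9 = k) (h8 : s.reg 8 = w) (h14 : s.reg 14 = G.prio w / 2)
    (h15 : s.reg 15 = G.prio w) (hν : HasLabels s (d / 2) ν)
    (hP : ∀ v : Fin n, CostCell s (Nat.log 2 n) (n * v + w) (P v)) (v : Fin n) :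
    CostCell (costStep.run s) (Nat.log 2 n) (n * v + w)
      (fun x => P v x ∨ (es[k].1 = v ∧ G.prio v = G.prio w ∧ SlackGE (d / 2) x (ν es[k].2))) ∧
    ∀ v' : Fin n, v' ≠ w → (costStep.run s).arr 18 (n * v + v') = s.arr 18 (n * v + v') ∧
      (costStep.run s).arr 7 (n * v + v') = s.arr 7 (n * v + v') := by
  obtain ⟨s₁, hs₁⟩ : ∃ s₁, s₁ = (s.setReg 25 es[k].1).setReg 26 es[k].2 := ⟨_, rfl⟩
  have hfr : ∀ y, y ∉ [25, 26] → s₁.reg y = s.reg y := by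
    intro y hy; simp at hy; simp [hs₁, hy]
  have hfa : ∀ a, s₁.arr a = s.arr a := by intro a; simp [hs₁]
  have hset : Setup G es s₁ := hs.congr (fun y hy => hfr y (by simp; omega)) (fun a _ _ => hfa a)
  have hν₁ : HasLabels s₁ (d / 2) ν := hν.congr (hfr 3 (by decide)) (hfr 4 (by decide)) (hfa 15)
  have h25 : s₁.reg 25 = es[k].1 := by simp [hs₁]
  have h26 : s₁.reg 26 = es[k].2 := by simp [hs₁]
  have e1 : costStep.run s = if G.prio es[k].1 = G.prio w then
      (seq slack <| ite (Expr.less (.get 18 (.reg 0 * .reg 25 + .reg 8)) (.reg 27))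
      (seq (store 18 (.reg 0 * .reg 25 + .reg 8) (.reg 27))
        (store 7 (.reg 0 * .reg 25 + .reg 8) (.reg 3 + 2 - .reg 27))) nop).run s₁ else nop.run s₁ := by
    rw [costStep, run_seq, run_seq, run_assign, run_assign]
    simp only [Expr.eval_get, Expr.eval_reg, h9, hs.tail k hk, Mem.setReg_arr, Mem.setReg_reg]
    simp only [show (9 : ℕ) ≠ 25 by decide, if_false, hs.head k hk, ← hs₁, run_ite_same,
      Expr.eval_get, Expr.eval_reg, h25, hset.prio, hfr 15 (by decide), h15]
  have hout : ∀ {s' : Mem}, (∀ a, s'.arr a = s.arr a) →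
      (es[k].1 = v → G.prio v = G.prio w → ∀ x, 1 ≤ x → x ≤ Nat.log 2 n + 1 →
        SlackGE (d / 2) x (ν es[k].2) → P v x) →
      CostCell s' (Nat.log 2 n) (n * v + w)
      (fun x => P v x ∨ (es[k].1 = v ∧ G.prio v = G.prio w ∧ SlackGE (d / 2) x (ν es[k].2))) ∧
      ∀ v' : Fin n, v' ≠ w → s'.arr 18 (n * v + v') = s.arr 18 (n * v + v') ∧
      s'.arr 7 (n * v + v') = s.arr 7 (n * v + v') := by
    intro s' ha himp
    refine ⟨(hP v).congr (by rw [ha]) (by rw [ha]) fun x h1 h2 => ⟨Or.inl, ?_⟩, fun v' _ => by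
      rw [ha, ha]; exact ⟨rfl, rfl⟩⟩
    rintro (h | ⟨h3, h4, h5⟩)
    · exact h
    · exact himp h3 h4 x h1 h2 h5
  rw [e1]
  split_ifs with hpr
  · obtain ⟨j1, j2⟩ := run_slack hset hn hev h26 ((hfr 14 (by decide)).trans h14)
      ((hfr 15 (by decide)).trans h15) hν₁
    have r0 : (slack.run s₁).reg 0 = n := (hset.run slack (by decide)).r0
    have r3 : (slack.run s₁).reg 3 = Nat.log 2 n := (hset.run slack (by decide)).r3
    have r25 : (slack.run s₁).reg 25 = es[k].1 := (run_reg_of_notMem _ _ (by decide)).trans h25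
    have r8 : (slack.run s₁).reg 8 = w := (run_reg_of_notMem _ _ (by decide)).trans
      ((hfr 8 (by decide)).trans h8)
    have ra : ∀ a, (slack.run s₁).arr a = s.arr a := fun a =>
      (run_arr_of_notMem _ _ (by simp [slack, leading, arrs, nop])).trans (hfa a)
    rw [run_seq]
    set s₂ := slack.run s₁
    rw [run_ite_less]
    simp only [Expr.eval_get, Expr.eval_add, Expr.eval_mul, Expr.eval_reg, r0, r25, r8, ra]
    have hPk := hP es[k].1
    split_ifs with hlt
    · have e2 : (seq (store 18 (.reg 0 * .reg 25 + .reg 8) (.reg 27))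
        (store 7 (.reg 0 * .reg 25 + .reg 8) (.reg 3 + 2 - .reg 27))).run s₂ =
          (s₂.setArr 18 (n * es[k].1 + w) (s₂.reg 27)).setArr 7 (n * es[k].1 + w)
            (Nat.log 2 n + 2 - s₂.reg 27) := by
        rw [run_seq, run, run]
        simp only [Expr.eval_add, Expr.eval_mul, Expr.eval_reg, Expr.eval_sub, Expr.eval_ofNat, r0,
          r25, r8, r3, Mem.setArr_reg]
      rw [e2]
      constructor
      · by_cases hv : es[k].1 = v
        · subst hv
          refine ⟨?_, ?_, ?_⟩
          · simpa using j1
          · intro x h1 h2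
            have h3 := j2 x h1 h2
            have h4 := hPk.iff x h1 h2
            simp only [Mem.setArr_arr, hpr, true_and]
            norm_num
            rw [← h3, ← h4]
            omega
          · have : s₂.reg 27 ≠ 0 := by omega
            simp [this]
        · have hne : (n * (v : ℕ) + w : ℕ) ≠ n * es[k].1 + w := by
            rw [Ne, row_eq_iff w.2 w.2]
            exact fun h => hv (Fin.ext h.1.symm)
          refine (hP v).congr ?_ ?_ fun x _ _ => ?_
          · simp only [Mem.setArr_arr, hne, and_false, if_false, ra]
          · simp only [Mem.setArr_arr, hne, and_false, if_false, ra]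
          · simp [hv]
      · intro v' hv'
        have hne : (n * (v : ℕ) + v' : ℕ) ≠ n * es[k].1 + w := by
          rw [Ne, row_eq_iff v'.2 w.2]
          exact fun h => hv' (Fin.ext h.2)
        simp only [Mem.setArr_arr, hne, and_false, if_false, ra, true_and]
    · refine hout (fun a => (run_arr_of_notMem _ _ (by simp [nop, arrs])).trans (ra a)) ?_
      rintro rfl - x h1 h2 h3
      rw [← j2 x h1 h2] at h3
      exact (hPk.iff x h1 h2).1 (by omega)
  · refine hout (fun a => (run_arr_of_notMem _ _ (by simp [nop, arrs])).trans (hfa a)) ?_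
    rintro rfl h
    exact absurd h hpr

/-- The specification of `costColumn`. -/
lemma costCell_costColumn {s : Mem} {w : Fin n} (hes : ListsArcs G τ es)
    (hs : Setup G es s) (hn : 2 ≤ n) (h8 : s.reg 8 = w)
    (h0 : ∀ v : Fin n, s.arr 18 (n * v + w) = 0 ∧ s.arr 7 (n * v + w) = 0) (v : Fin n) :
    CostCell (costColumn.run s) (Nat.log 2 n) (n * v + w)
      (fun x => CostLE G τ es (Nat.log 2 n) (d / 2) (Nat.log 2 n + 1 - x) v w) ∧
    ∀ v' : Fin n, v' ≠ w → (costColumn.run s).arr 18 (n * v + v') = s.arr 18 (n * v + v') ∧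
      (costColumn.run s).arr 7 (n * v + v') = s.arr 7 (n * v + v') := by
  obtain ⟨s₁, hs₁⟩ : ∃ s₁, s₁ = (s.setReg 15 (G.prio w)).setReg 14 (G.prio w / 2) := ⟨_, rfl⟩
  have hfr : ∀ y, y ∉ [15, 14] → s₁.reg y = s.reg y := by
    intro y hy; simp at hy; simp [hs₁, hy]
  have hfa : ∀ a, s₁.arr a = s.arr a := by intro a; simp [hs₁]
  have hset : Setup G es s₁ := hs.congr (fun y hy => hfr y (by simp; omega)) (fun a _ _ => hfa a)
  have h15 : s₁.reg 15 = G.prio w := by simp [hs₁]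
  have h14 : s₁.reg 14 = G.prio w / 2 := by simp [hs₁]
  have h8₁ : s₁.reg 8 = w := (hfr 8 (by decide)).trans h8
  have e1 : costColumn.run s = if G.prio w = G.prio w / 2 + G.prio w / 2 then
      (seq initLabels <| seq bellmanFord <| loop 9 2 costStep).run s₁ else nop.run s₁ := by
    rw [costColumn, run_seq, run_seq, run_assign, run_assign]
    simp only [Expr.eval_get, Expr.eval_reg, h8, hs.prio, Expr.eval_div, Expr.eval_ofNat,
      Mem.setReg_reg, if_true, ← hs₁, run_ite_same, Expr.eval_add, h14, h15]
  rw [e1]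
  have hjH : G.prio w / 2 ≤ d / 2 := Nat.div_le_div_right (G.prio_le w)
  split_ifs with hpr
  · have hev : Even (G.prio w) := ⟨_, hpr⟩
    rw [run_seq, run_seq]
    have hset₂ := hset.run initLabels (by decide)
    have fr : ∀ y, y ∉ initLabels.regs → (initLabels.run s₁).reg y = s₁.reg y := fun y hy =>
      run_reg_of_notMem _ _ hy
    have h15₂ := (fr 15 (by decide)).trans h15
    have h14₂ := (fr 14 (by decide)).trans h14
    have hν := hasLabels_bellmanFord hset₂ hn h14₂ hjH (fun v hv => by
      rw [h15₂] at hv; exact Nat.div_le_div_right hv.le) (hasLabels_initLabels hset h8₁ h14)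
    have hset₃ := hset₂.run bellmanFord (by decide)
    have fr' : ∀ y, y ∉ bellmanFord.regs → y ∉ initLabels.regs →
        (bellmanFord.run (initLabels.run s₁)).reg y = s₁.reg y := fun y hy hy' =>
      (run_reg_of_notMem _ _ hy).trans (fr y hy')
    rw [h15₂] at hν
    have ha18 : (bellmanFord.run (initLabels.run s₁)).arr 18 = s.arr 18 :=
      (run_arr_of_notMem _ _ (by decide)).trans ((run_arr_of_notMem _ _ (by decide)).trans (hfa 18))
    have ha7 : (bellmanFord.run (initLabels.run s₁)).arr 7 = s.arr 7 :=
      (run_arr_of_notMem _ _ (by decide)).trans ((run_arr_of_notMem _ _ (by decide)).trans (hfa 7))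
    have g8 := (fr' 8 (by decide) (by decide)).trans h8₁
    have g14 := (fr' 14 (by decide) (by decide)).trans h14
    have g15 := (fr' 15 (by decide) (by decide)).trans h15
    change HasLabels _ _ (baseLabels G es (Nat.log 2 n) w) at hν
    set s₃ := bellmanFord.run (initLabels.run s₁) with hs₃
    have key := loop_induct (x := 9) (r := 2) (b := costStep) (s := s₃) (I := fun k s' => ∀ v : Fin n,
      CostCell s' (Nat.log 2 n) (n * v + w) (fun x => ∃ e ∈ es.take k, e.1 = v ∧
        G.prio v = G.prio w ∧ SlackGE (d / 2) x (baseLabels G es (Nat.log 2 n) w e.2)) ∧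
      ∀ v' : Fin n, v' ≠ w → s'.arr 18 (n * v + v') = s.arr 18 (n * v + v') ∧
        s'.arr 7 (n * v + v') = s.arr 7 (n * v + v'))
      (by
        intro v
        simp only [Mem.setReg_arr, ha18, ha7]
        refine ⟨⟨?_, ?_, ?_⟩, by simp⟩
        · simp [ha18, (h0 v).1]
        · intro x hx _
          simp [ha18, (h0 v).1]; omega
        · simp [ha18, ha7, (h0 v).1, (h0 v).2])
      (by
        intro k hk s' hx hreg harr hI v
        have hset' : Setup G es s' := hset₃.of_agree _ 9 (by decide) (by decide) hreg harr
        rw [hset₃.r2] at hk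
        have := costCell_costStep hset' hn hk hev hx ((hreg 8 (by decide) (by decide)).trans g8)
          ((hreg 14 (by decide) (by decide)).trans g14) ((hreg 15 (by decide) (by decide)).trans g15)
          (hν.congr (hreg 3 (by decide) (by decide)) (hreg 4 (by decide) (by decide))
            (harr 15 (by decide))) (fun v => (hI v).1) v
        refine ⟨this.1.congr (by simp) (by simp) fun x _ _ => ?_, fun v' hv' => ?_⟩
        · rw [List.take_succ_eq_append_getElem hk]
          simp only [List.mem_append, List.mem_singleton]
          constructor
          · rintro (⟨e, he, h⟩ | h)
            · exact ⟨e, Or.inl he, h⟩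
            · exact ⟨_, Or.inr rfl, h⟩
          · rintro ⟨e, he | rfl, h⟩
            · exact Or.inl ⟨e, he, h⟩
            · exact Or.inr h
        · simp only [Mem.setReg_arr]
          rw [(this.2 v' hv').1, (this.2 v' hv').2]
          exact (hI v).2 v' hv')
    rw [hset₃.r2, List.take_length] at key
    refine ⟨(key v).1.congr rfl rfl fun x _ _ => ?_, (key v).2⟩
    constructor
    · rintro ⟨e, he, rfl, h1, h2⟩
      exact ⟨h1, hev, e.2, (hes.2 e).1 he, h2⟩
    · rintro ⟨h1, -, u, hu, h2⟩
      exact ⟨(v, u), (hes.2 _).2 hu, rfl, h1, h2⟩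
  · have ha : ∀ a, (nop.run s₁).arr a = s.arr a := fun a =>
      (run_arr_of_notMem _ _ (by simp [nop, arrs])).trans (hfa a)
    refine ⟨⟨?_, ?_, ?_⟩, fun v' _ => by rw [ha, ha]; exact ⟨rfl, rfl⟩⟩
    · rw [ha, (h0 v).1]; omega
    · intro x hx _
      rw [ha, (h0 v).1]
      refine iff_of_false (by omega) ?_
      rintro ⟨-, ⟨r, hr⟩, -⟩
      omega
    · rw [ha, ha, (h0 v).1, (h0 v).2, if_pos rfl]

/-- The specification of `arcCosts`. -/
lemma costCell_arcCosts {s : Mem} (hes : ListsArcs G τ es) (hs : Setup G es s) (hn : 2 ≤ n)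
    (h0 : ∀ x, s.arr 18 x = 0 ∧ s.arr 7 x = 0) (v w : Fin n) :
    CostCell (arcCosts.run s) (Nat.log 2 n) (n * v + w)
      (fun x => CostLE G τ es (Nat.log 2 n) (d / 2) (Nat.log 2 n + 1 - x) v w) := by
  have key := loop_induct (x := 8) (r := 0) (b := costColumn) (s := s) (I := fun k s' =>
    ∀ v w : Fin n, (w < k → CostCell s' (Nat.log 2 n) (n * v + w)
      (fun x => CostLE G τ es (Nat.log 2 n) (d / 2) (Nat.log 2 n + 1 - x) v w)) ∧
      (k ≤ w → s'.arr 18 (n * v + w) = 0 ∧ s'.arr 7 (n * v + w) = 0))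
    (fun v w => ⟨fun h => absurd h (by omega), fun _ => h0 _⟩) (by
      intro k hk s' hx hreg harr hI v w
      have hset' : Setup G es s' := hs.of_agree _ 8 (by decide) (by decide) hreg harr
      rw [hs.r0] at hk
      have hc := costCell_costColumn (w := ⟨k, hk⟩) hes hset' hn hx
        (fun v => (hI v ⟨k, hk⟩).2 le_rfl) v
      constructor
      · intro hw
        rcases (show (w : ℕ) ≤ k by omega).lt_or_eq with h | h
        · have := hc.2 w (by rintro rfl; simp at h)
          exact ((hI v w).1 h).congr this.1 this.2 fun x _ _ => Iff.rfl
        · obtain rfl : w = ⟨k, hk⟩ := Fin.ext h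
          exact hc.1.congr rfl rfl fun x _ _ => Iff.rfl
      · intro hw
        have := hc.2 w (by rintro rfl; simp at hw)
        have h1 := (hI v w).2 (by omega)
        exact ⟨this.1.trans h1.1, this.2.trans h1.2⟩)
  rw [hs.r0] at key
  exact (key v w).1 w.2

end LoopProg

/-! ### Transitive closures -/

/-- The pairs connected by a nonempty walk all of whose inner vertices are less than `k`. -/
def walkBelow {n : ℕ} (R : Fin n → Fin n → Prop) : ℕ → Fin n → Fin n → Prop
  | 0, a, b => R a b
  | k + 1, a, b => walkBelow R k a b ∨
      ∃ hk : k < n, walkBelow R k a ⟨k, hk⟩ ∧ walkBelow R k ⟨k, hk⟩ b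

/-- A walk through `c < k` may be composed at `c`. -/
lemma walkBelow.trans {n : ℕ} {R : Fin n → Fin n → Prop} {k : ℕ} {a b c : Fin n} (hc : c < k)
    (h1 : walkBelow R k a c) (h2 : walkBelow R k c b) : walkBelow R k a b := by
  induction k generalizing a b c with
  | zero => omega
  | succ k ih =>
    rcases (show (c : ℕ) ≤ k by omega).lt_or_eq with h | h
    · rcases h1 with h1 | ⟨hk, h1, h1'⟩ <;> rcases h2 with h2 | ⟨hk, h2, h2'⟩
      · exact Or.inl (ih h h1 h2)
      · exact Or.inr ⟨hk, ih h h1 h2, h2'⟩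
      · exact Or.inr ⟨hk, h1, ih h h1' h2⟩
      · exact Or.inr ⟨hk, h1, h2'⟩
    · have hk : k < n := h ▸ c.2
      obtain rfl : c = ⟨k, hk⟩ := Fin.ext h
      refine Or.inr ⟨hk, ?_, ?_⟩
      · rcases h1 with h1 | ⟨_, h1, -⟩ <;> exact h1
      · rcases h2 with h2 | ⟨_, -, h2⟩ <;> exact h2

lemma walkBelow.mono {n : ℕ} {R : Fin n → Fin n → Prop} {a b : Fin n} (h : R a b) :
    ∀ k, walkBelow R k a b
  | 0 => h
  | k + 1 => Or.inl (walkBelow.mono h k)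

lemma walkBelow_of_transGen {n : ℕ} {R : Fin n → Fin n → Prop} {a b : Fin n}
    (h : Relation.TransGen R a b) : walkBelow R n a b := by
  induction h with
  | single h => exact walkBelow.mono h n
  | tail _ h ih => exact walkBelow.trans (Fin.is_lt _) ih (walkBelow.mono h n)

namespace LoopProg

/-! ### The program: bottleneck costs of cycles -/

/-- The instruction of the Floyd–Warshall algorithm for the intermediate node `reg 28` and the pair
`reg 29`, `reg 31`. -/
def closureStep : LoopProg :=
  seq (assign 27 (.get 18 (.reg 0 * .reg 29 + .reg 28))) <|
  seq (ite (Expr.less (.get 18 (.reg 0 * .reg 28 + .reg 31)) (.reg 27))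
    (assign 27 (.get 18 (.reg 0 * .reg 28 + .reg 31))) nop) <|
  ite (Expr.less (.get 18 (.reg 0 * .reg 29 + .reg 31)) (.reg 27))
    (store 18 (.reg 0 * .reg 29 + .reg 31) (.reg 27)) nop

/-- The Floyd–Warshall algorithm: the entries of array `18` are replaced by the largest minima of the
entries along nonempty walks. -/
def closure : LoopProg := loop 28 0 <| loop 29 0 <| loop 31 0 closureStep

variable {n d : ℕ} {G : ParityGame n d} {τ : OddStrategy G} {es : List (Fin n × Fin n)}

lemma run_closureStep {s : Mem} {k a b : Fin n} (h0 : s.reg 0 = n) (h28 : s.reg 28 = k)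
    (h29 : s.reg 29 = a) (h31 : s.reg 31 = b) (v w : Fin n) :
    (closureStep.run s).arr 18 (n * v + w) = if v = a ∧ w = b then
      max (s.arr 18 (n * v + w)) (min (s.arr 18 (n * v + k)) (s.arr 18 (n * k + w)))
      else s.arr 18 (n * v + w) := by
  have hcell : (n * (v : ℕ) + w = n * a + b) ↔ (v = a ∧ w = b) := by
    rw [row_eq_iff w.2 b.2, Fin.ext_iff, Fin.ext_iff]
  rw [closureStep, run_seq, run_seq, run_assign, run_ite_less, run_ite_less]
  simp only [Expr.eval_get, Expr.eval_add, Expr.eval_mul, Expr.eval_reg, h0, h28, h29, h31,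
    Mem.setReg_arr, Mem.setReg_reg, Nat.reduceEqDiff, if_false, if_true]
  set x := s.arr 18 (n * a + k) with hx
  set y := s.arr 18 (n * k + b) with hy
  obtain ⟨s₁, hs₁, e27, er, ea⟩ : ∃ s₁, s₁ = (if y < x then
      (assign 27 (.get 18 (.reg 0 * .reg 28 + .reg 31))).run (s.setReg 27 x)
      else nop.run (s.setReg 27 x)) ∧ s₁.reg 27 = min x y ∧ (∀ y, y ∉ [27, 30] → s₁.reg y = s.reg y) ∧
      s₁.arr = s.arr := by
    refine ⟨_, rfl, ?_⟩
    split_ifs with hlt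
    · rw [run_assign]
      simp only [Expr.eval_get, Expr.eval_add, Expr.eval_mul, Expr.eval_reg, h0, h28, h31,
        Mem.setReg_arr, Mem.setReg_reg, Nat.reduceEqDiff, if_false, if_true, ← hy]
      refine ⟨by omega, fun z hz => ?_, by simp⟩
      simp at hz; simp [hz]
    · refine ⟨by simp [nop, run]; omega, fun z hz => ?_, by simp [nop, run]⟩
      simp at hz; simp [nop, run, hz]
  rw [← hs₁, e27, er 0 (by decide), er 29 (by decide), er 31 (by decide), ea, h0, h29, h31]
  by_cases hv : v = a ∧ w = b
  · rw [if_pos hv]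
    obtain ⟨rfl, rfl⟩ := hv
    rw [← hx, ← hy]
    split_ifs with hlt
    · simp [run, er, h0, h29, h31, e27]; omega
    · simp [nop, run, ea]; omega
  · rw [if_neg hv]
    split_ifs with hlt
    · have : n * (v : ℕ) + w ≠ n * a + b := fun h => hv (hcell.1 h)
      simp [run, er, h0, h29, h31, ea, this]
    · simp [nop, run, ea]

/-- The specification of `closure`. -/
lemma run_closure {s : Mem} (h0 : s.reg 0 = n) {x : ℕ} (R : Fin n → Fin n → Prop)
    (hR : ∀ v w : Fin n, x ≤ s.arr 18 (n * v + w) ↔ R v w) (v w : Fin n) :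
    x ≤ (closure.run s).arr 18 (n * v + w) ↔ Relation.TransGen R v w := by
  -- values never decrease, and remain sound; a pair that has been treated in round `k` is connected
  -- if there is a walk with inner vertices at most `k`
  have key := loop_induct (x := 28) (r := 0) (s := s) (b := loop 29 0 <| loop 31 0 closureStep)
    (I := fun k s' => ∀ v w : Fin n, (x ≤ s'.arr 18 (n * v + w) → Relation.TransGen R v w) ∧
      (walkBelow R k v w → x ≤ s'.arr 18 (n * v + w)))
    (fun v w => ⟨fun h => .single ((hR v w).1 h), fun h => (hR v w).2 h⟩) (by
      intro k hk s₁ hx₁ hreg₁ harr₁ I₁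
      rw [h0] at hk
      have r0₁ := (hreg₁ 0 (by decide) (by decide)).trans h0
      have key₂ := loop_induct (x := 29) (r := 0) (s := s₁) (b := loop 31 0 closureStep)
        (I := fun i s' => ∀ v w : Fin n, (x ≤ s'.arr 18 (n * v + w) → Relation.TransGen R v w) ∧
          (walkBelow R k v w → x ≤ s'.arr 18 (n * v + w)) ∧
          (v < i → walkBelow R (k + 1) v w → x ≤ s'.arr 18 (n * v + w)))
        (fun v w => ⟨(I₁ v w).1, (I₁ v w).2, fun h => absurd h (by omega)⟩) (by
          intro i hi s₂ hx₂ hreg₂ harr₂ I₂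
          rw [r0₁] at hi
          have r0₂ := (hreg₂ 0 (by decide) (by decide)).trans r0₁
          have r28₂ := (hreg₂ 28 (by decide) (by decide)).trans hx₁
          have key₃ := loop_induct (x := 31) (r := 0) (s := s₂) (b := closureStep)
            (I := fun l s' => ∀ v w : Fin n,
              (x ≤ s'.arr 18 (n * v + w) → Relation.TransGen R v w) ∧
              (walkBelow R k v w → x ≤ s'.arr 18 (n * v + w)) ∧
              (v < i ∨ (v = i ∧ w < l) → walkBelow R (k + 1) v w → x ≤ s'.arr 18 (n * v + w)))
            (fun v w => ⟨(I₂ v w).1, (I₂ v w).2.1, fun h => (I₂ v w).2.2 (by omega)⟩) (by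
              intro l hl s₃ hx₃ hreg₃ harr₃ I₃ v w
              rw [r0₂] at hl
              have r0₃ := (hreg₃ 0 (by decide) (by decide)).trans r0₂
              have r28₃ := (hreg₃ 28 (by decide) (by decide)).trans r28₂
              have r29₃ := (hreg₃ 29 (by decide) (by decide)).trans hx₂
              have hrun := run_closureStep (k := ⟨k, hk⟩) (a := ⟨i, hi⟩) (b := ⟨l, hl⟩) r0₃ r28₃
                r29₃ hx₃ v w
              rw [Mem.setReg_arr, hrun]
              by_cases hvw : v = ⟨i, hi⟩ ∧ w = ⟨l, hl⟩
              · rw [if_pos hvw, le_max_iff, le_min_iff]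
                refine ⟨?_, fun h => Or.inl ((I₃ v w).2.1 h), fun _ h => ?_⟩
                · rintro (h | ⟨h1, h2⟩)
                  · exact (I₃ v w).1 h
                  · exact ((I₃ v ⟨k, hk⟩).1 h1).trans ((I₃ ⟨k, hk⟩ w).1 h2)
                · rcases h with h | ⟨_, h1, h2⟩
                  · exact Or.inl ((I₃ v w).2.1 h)
                  · exact Or.inr ⟨(I₃ v ⟨k, hk⟩).2.1 h1, (I₃ ⟨k, hk⟩ w).2.1 h2⟩
              · rw [if_neg hvw]
                refine ⟨(I₃ v w).1, (I₃ v w).2.1, fun h => (I₃ v w).2.2 ?_⟩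
                rw [Fin.ext_iff, Fin.ext_iff] at hvw
                change ¬ ((v : ℕ) = i ∧ (w : ℕ) = l) at hvw
                omega)
          rw [r0₂] at key₃
          intro v w
          rw [Mem.setReg_arr]
          exact ⟨(key₃ v w).1, (key₃ v w).2.1, fun h => (key₃ v w).2.2 (by have := w.2; omega)⟩)
      rw [r0₁] at key₂
      intro v w
      rw [Mem.setReg_arr]
      exact ⟨(key₂ v w).1, (key₂ v w).2.2 v.2⟩)
  rw [h0] at key
  exact ⟨(key v w).1, fun h => (key v w).2 (walkBelow_of_transGen h)⟩

end LoopProg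

section Slack

variable {n d : ℕ} {G : ParityGame n d} {τ : OddStrategy G} {es : List (Fin n × Fin n)} {L h : ℕ}

/-- At full height the chain contains only one tree, so that all finite costs are `0`. -/
lemma costLE_zero_of_le {i : ℕ} {v w : Fin n} (hh : h ≤ G.prio w / 2)
    (hc : CostLE G τ es L h i v w) : CostLE G τ es L h 0 v w := by
  obtain ⟨h1, h2, u, hu, a, ha, h3⟩ := hc
  refine ⟨h1, h2, u, hu, a, ha, ?_⟩
  rw [chainBits, if_neg (by omega)] at *
  exact h3

/-- The minimum bottleneck cost in terms of the slack, in which the largest bottleneck slack of a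
closed walk is `D`. -/
lemma minCycleCost_of_slack (hes : ListsArcs G τ es) {w : Fin n} {D : ℕ} (hDL : D ≤ L + 1)
    (hD : ∀ x, 1 ≤ x → x ≤ L + 1 →
      (x ≤ D ↔ Relation.TransGen (CostLE G τ es L h (L + 1 - x)) w w)) :
    (D = 0 → minCycleCost G τ (arcCost G τ es L h) w = ⊤) ∧
    (D ≠ 0 → minCycleCost G τ (arcCost G τ es L h) w = (L + 1 - D : ℕ) ∧
      Even (G.prio w) ∧ L + 1 - D < (chainOf L h (G.prio w / 2)).length) := by
  constructor
  · intro h0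
    by_contra hne
    obtain ⟨i, hi⟩ := WithTop.ne_top_iff_exists.mp hne
    have hle : minCycleCost G τ (arcCost G τ es L h) w ≤ i := hi.ge
    have hL : minCycleCost G τ (arcCost G τ es L h) w ≤ L := by
      rw [minCycleCost_le_iff] at hle ⊢
      refine Relation.TransGen.mono (p := fun a b => ArcD G τ a b ∧ arcCost G τ es L h a b ≤ L)
        ?_ w w hle
      rintro a b ⟨h1, h2⟩
      refine ⟨h1, ?_⟩
      by_contra hlt
      have hno : arcCost G τ es L h a b = ⊤ := by
        rw [arcCost, sInf_eq_top]
        rintro x ⟨i', hi', rfl, hc⟩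
        refine absurd ?_ hlt
        exact ((arcCost_le_iff hi').mpr hc).trans (by exact_mod_cast hi')
      rw [hno] at h2
      exact absurd h2 (by simp)
    rw [minCycleCost_arcCost_le_iff hes le_rfl] at hL
    have := (hD 1 le_rfl (by omega)).2 hL
    omega
  · intro h0
    have htr := (hD D (by omega) hDL).1 le_rfl
    have hle := (minCycleCost_arcCost_le_iff hes (show L + 1 - D ≤ L by omega) w).2 htr
    have hev : Even (G.prio w) := (mem_baseNodes_of_minCycleCost hle).1
    refine ⟨le_antisymm hle ?_, hev, ?_⟩
    · by_contra hlt
      rw [not_le] at hlt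
      obtain ⟨i, hi⟩ := WithTop.ne_top_iff_exists.mp hlt.ne_top
      have hi' : minCycleCost G τ (arcCost G τ es L h) w = (i : ℕ) := hi.symm
      rw [hi'] at hlt
      have hlt' : i < L + 1 - D := by exact_mod_cast hlt
      have h1 := (minCycleCost_arcCost_le_iff hes (show i ≤ L by omega) w).1 hi'.le
      have h2 := (hD (L + 1 - i) (by omega) (by omega)).2 (by
        rwa [show L + 1 - (L + 1 - i) = i by omega])
      omega
    · have hj : 0 < G.prio w / 2 := by
        obtain ⟨r, hr⟩ := hev
        have := G.prio_pos w
        omega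
      rw [length_chainOf hj]
      split_ifs with hlt
      · omega
      · have h1 : Relation.TransGen (CostLE G τ es L h 0) w w := by
          refine Relation.TransGen.mono ?_ w w (transGen_closed htr .refl)
          rintro a b ⟨h1, h3, -⟩
          refine costLE_zero_of_le ?_ h1
          rw [(reflTransGen_of_costLE hes (by omega) h3).1]
          omega
        have h2 := (hD (L + 1) (by omega) le_rfl).2 (by
          rwa [Nat.sub_self])
        omega

end Slack

namespace LoopProg

/-! ### The program: initial labels -/

/-- Register `24` receives `0` if the row `reg 8` of array `17` satisfies `CopyMinSeq`. -/
def checkCopy : LoopProg :=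
  seq (assign 24 0) <| loop 10 3 <| seq (assign 21 (cell 17 8)) <| seq (absTo 21) <|
    ite (Expr.same (.reg 21) (.reg 4 - .reg 12)) nop <|
    ite (Expr.less (.reg 10) (.reg 13)) (ite (Expr.less (.reg 12) (.reg 22)) nop (assign 24 1))
      (assign 24 1)

/-- Array `16` receives the row `reg 8` of array `17`. -/
def copyRow : LoopProg := loop 10 3 (store 16 (.reg 10) (cell 17 8))

/-- Array `16` receives the initial label of the node `reg 8`. -/
def raiseLabel : LoopProg :=
  seq (assign 27 (.get 18 (.reg 0 * .reg 8 + .reg 8))) <|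
  ite (Expr.same (.reg 27) 0) topRow <|
    seq (store 8 (.reg 8) (.reg 3 + 2 - .reg 27)) <| seq (assign 13 (.reg 27 - 1)) <|
    seq (assign 12 (.get 21 (.reg 8) / 2)) <| seq checkCopy <|
    ite (Expr.same (.reg 24) 0) copyRow (next 17 8)

/-- Array `16` is copied to the row `reg 8` of array `15`. -/
def writeRow : LoopProg := seq (assign 24 1) <| seq (assign 25 (.reg 8)) copyIf

/-- Array `15` receives the initial labels. -/
def initialLabels : LoopProg :=
  seq (assign 14 (.reg 4)) <| loop 8 0 (seq raiseLabel writeRow)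

variable {n d : ℕ} {G : ParityGame n d} {τ : OddStrategy G} {es : List (Fin n × Fin n)}

lemma run_checkCopy {s : Mem} {z : ℕ → ℤ} (hz : HasRow s 17 (s.reg 8) z)
    (hg : s.reg 12 ≤ s.reg 4) :
    (checkCopy.run s).reg 24 = 0 ↔ CopyMinSeq (s.reg 3) (s.reg 12) (s.reg 13) z := by
  rw [checkCopy, run_seq, run_assign]
  set s₀ := s.setReg 24 (Expr.eval s 0) with hs₀
  have h3 : s₀.reg 3 = s.reg 3 := by simp [hs₀]
  have := loop_induct (x := 10) (r := 3) (s := s₀) (b := seq (assign 21 (cell 17 8)) <|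
      seq (absTo 21) <| ite (Expr.same (.reg 21) (.reg 4 - .reg 12)) nop <|
      ite (Expr.less (.reg 10) (.reg 13)) (ite (Expr.less (.reg 12) (.reg 22)) nop (assign 24 1))
      (assign 24 1))
    (I := fun k s' => s'.reg 24 = 0 ↔ CopyMinSeq k (s.reg 12) (s.reg 13) z)
    (by simp [hs₀, CopyMinSeq]) (by
      intro k hk s' hx hreg harr hI
      have e3 := hreg 3 (by decide) (by decide)
      have e4 := hreg 4 (by decide) (by decide)
      have e8 := hreg 8 (by decide) (by decide)
      have e12 := hreg 12 (by decide) (by decide)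
      have e13 := hreg 13 (by decide) (by decide)
      have a17 := harr 17 (by decide)
      rw [h3] at hk
      simp [hs₀] at e3 e4 e8 e12 e13 a17
      have hrow := hz k hk
      have hsucc : CopyMinSeq (k + 1) (s.reg 12) (s.reg 13) z ↔
          CopyMinSeq k (s.reg 12) (s.reg 13) z ∧ ((k < s.reg 13 → (s.reg 12 : ℤ) < |z k| ∨
            z k = -(s.reg 12 : ℤ)) ∧ (s.reg 13 ≤ k → z k = -(s.reg 12 : ℤ))) := by
        constructor
        · intro h
          exact ⟨fun t ht => h t (by omega), h k (by omega)⟩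
        · rintro ⟨h1, h2⟩ t ht
          rcases (show t ≤ k by omega).lt_or_eq with h | rfl
          · exact h1 t h
          · exact h2
      rw [hsucc, ← hI, Int.abs_eq_natAbs]
      have habs : (absTo 21).run (s'.setReg 21 ((cell 17 8).eval s')) =
          (s'.setReg 21 ((cell 17 8).eval s')).setReg 22 (z k).natAbs :=
        run_absTo (by simp [cell, e3, e8, a17, hx, e4, hrow])
      rw [run_seq, run_seq, run_assign, habs, run_ite_same, run_ite_less, run_ite_less]
      simp only [Expr.eval_reg, Expr.eval_sub, Mem.setReg_reg, Nat.reduceEqDiff, if_false, if_true,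
        e4, e12, e13, hx]
      have hcell : (cell 17 8).eval s' = s.arr 17 (s.reg 3 * s.reg 8 + k) := by
        simp [cell, e3, e8, a17, hx]
      rw [hcell]
      by_cases c1 : s.arr 17 (s.reg 3 * s.reg 8 + k) = s.reg 4 - s.reg 12
      · have c1' : z k = -(s.reg 12 : ℤ) := by omega
        simp [c1, nop, run, c1']
      · have c1' : z k ≠ -(s.reg 12 : ℤ) := by omega
        by_cases c2 : k < s.reg 13
        · by_cases c3 : s.reg 12 < (z k).natAbs
          · have c3' : (s.reg 12 : ℤ) < |z k| := by rw [Int.abs_eq_natAbs]; exact_mod_cast c3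
            simp [c1, nop, run, c1', c2, c3, c3']
          · have c3' : ¬ (s.reg 12 : ℤ) < |z k| := by rw [Int.abs_eq_natAbs]; exact_mod_cast c3
            have c3'' : |z k| ≤ (s.reg 12 : ℤ) := not_lt.1 c3'
            simp [c1, run, c1', c2, c3, c3'']
        · simp [c1, run, c1', c2, not_lt.1 c2])
  rw [h3] at this
  exact this

lemma hasTmp_copyRow {s : Mem} {z : ℕ → ℤ} (hz : HasRow s 17 (s.reg 8) z) :
    HasTmp (copyRow.run s) z := by
  have key := loop_induct (x := 10) (r := 3) (s := s) (b := store 16 (.reg 10) (cell 17 8))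
    (I := fun k s' => ∀ t < k, (s'.arr 16 t : ℤ) = z t + s.reg 4) (by simp) (by
      intro k hk s' hx hreg harr hI t ht
      have e3 := hreg 3 (by decide) (by decide)
      have e8 := hreg 8 (by decide) (by decide)
      have a17 := harr 17 (by decide)
      have hrow := hz k hk
      simp only [run, cell, Expr.eval_get, Expr.eval_add, Expr.eval_mul, Expr.eval_reg, hx, e3, e8,
        a17, Mem.setReg_arr, Mem.setArr_arr, true_and]
      split_ifs with h
      · rw [h]; exact hrow
      · exact hI t (by omega))
  intro t ht
  rw [copyRow, run_reg_of_notMem _ _ (by decide)] at ht ⊢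
  exact key t ht

/-- The initial label of the node `w`, for the largest bottleneck slack `D` of a closed walk. -/
noncomputable def initialLabel (G : ParityGame n d) (μ : Labeling n (bitTree (Nat.log 2 n) (d / 2))) (D : ℕ)
    (w : Fin n) : Label (bitTree (Nat.log 2 n) (d / 2)) :=
  if D = 0 then ⊤ else
    raise (chainOf (Nat.log 2 n) (d / 2) (G.prio w / 2)) (μ w) ((Nat.log 2 n + 1 - D : ℕ) : ℕ∞)

/-- Raising keeps the label if it is the smallest leaf of a suitable copy, and increases it otherwise;
the cost `i_w = L + 1 - D`, increased by one, is written to array `8`. -/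
lemma run_raiseLabel {s : Mem} {w : Fin n} {D : ℕ} {μ : Labeling n (bitTree (Nat.log 2 n) (d / 2))}
    (hs : Setup G es s) (h8 : s.reg 8 = w) (h14 : s.reg 14 = d / 2)
    (hμ : HasRow s 17 w (code (d / 2) (μ w))) (hD : s.arr 18 (n * w + w) = D)
    (hDL : D ≤ Nat.log 2 n + 1)
    (hD0 : D ≠ 0 → Even (G.prio w) ∧
      Nat.log 2 n + 1 - D < (chainOf (Nat.log 2 n) (d / 2) (G.prio w / 2)).length) :
    HasTmp (raiseLabel.run s) (code (d / 2) (initialLabel G μ D w)) ∧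
    ∀ x, (raiseLabel.run s).arr 8 x = if x = w ∧ D ≠ 0 then Nat.log 2 n + 2 - D else s.arr 8 x := by
  rw [raiseLabel, run_seq, run_assign, run_ite_same]
  simp only [Expr.eval_get, Expr.eval_add, Expr.eval_mul, Expr.eval_reg, hs.r0, h8, hD,
    Mem.setReg_reg, if_true, Expr.eval_ofNat]
  set s₁ := s.setReg 27 D with hs₁
  have hset : Setup G es s₁ := hs.congr (fun y hy => by simp [hs₁]; omega) (fun a _ _ => rfl)
  split_ifs with h0
  · rw [initialLabel, if_pos h0]
    refine ⟨hasTmp_topRow (s := s₁) (c := (d / 2 : ℕ) + 1) ?_, fun x => ?_⟩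
    · rw [hset.r5, hset.r4]; push_cast; ring
    · rw [run_arr_of_notMem _ _ (by decide)]
      simp [h0, hs₁]
  · obtain ⟨hev, hlen⟩ := hD0 h0
    have hj : 0 < G.prio w / 2 := by
      obtain ⟨r, hr⟩ := hev
      have := G.prio_pos w
      omega
    have hjH : G.prio w / 2 ≤ d / 2 := Nat.div_le_div_right (G.prio_le w)
    obtain ⟨s₂, hs₂, f8, f12, f13, fr, f8a, fa⟩ : ∃ s₂ : Mem,
        (assign 12 (.get 21 (.reg 8) / 2)).run ((assign 13 (.reg 27 - 1)).run
          ((store 8 (.reg 8) (.reg 3 + 2 - .reg 27)).run s₁)) = s₂ ∧ s₂.reg 8 = w ∧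
        s₂.reg 12 = G.prio w / 2 ∧ s₂.reg 13 = Nat.log 2 n - (Nat.log 2 n + 1 - D) ∧
        (∀ y, y ∉ [12, 13, 27] → s₂.reg y = s.reg y) ∧
        (∀ x, s₂.arr 8 x = if x = w then Nat.log 2 n + 2 - D else s.arr 8 x) ∧
        (∀ a, a ≠ 8 → s₂.arr a = s.arr a) := by
      refine ⟨_, rfl, ?_, ?_, ?_, fun y hy => ?_, fun x => ?_, fun a ha => ?_⟩
      · simp [run, hs₁, h8]
      · simp [run, hs₁, h8, hs.prio]
      · simp [run, hs₁]; omega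
      · simp at hy; simp [run, hs₁, hy]
      · simp [run, hs₁, h8, hs.r3]
      · rw [run_arr_of_notMem _ _ (by simp [arrs]), run_arr_of_notMem _ _ (by simp [arrs]),
          run_arr_of_notMem _ _ (by simp [arrs, ha])]
        rfl
    rw [run_seq, run_seq, run_seq, hs₂, run_seq]
    have hset₂ : Setup G es s₂ := hs.congr (fun y hy => fr y (by simp; omega))
      (fun a h1 _ => fa a (by omega))
    have hrow₂ : HasRow s₂ 17 (s₂.reg 8) (code (d / 2) (μ w)) := by
      rw [f8]; exact hμ.congr (fr 3 (by decide)) (fr 4 (by decide)) (fa 17 (by decide))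
    have hcheck := run_checkCopy hrow₂ (by rw [f12, hset₂.r4]; exact hjH)
    rw [hset₂.r3, f12, f13] at hcheck
    have hset₃ := hset₂.run checkCopy (by decide)
    have g8 : (checkCopy.run s₂).reg 8 = s₂.reg 8 := run_reg_of_notMem _ _ (by decide)
    have g12 : (checkCopy.run s₂).reg 12 = s₂.reg 12 := run_reg_of_notMem _ _ (by decide)
    have g13 : (checkCopy.run s₂).reg 13 = s₂.reg 13 := run_reg_of_notMem _ _ (by decide)
    have g14 : (checkCopy.run s₂).reg 14 = d / 2 :=
      (run_reg_of_notMem _ _ (by decide)).trans ((fr 14 (by decide)).trans h14)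
    have ga : ∀ a, (checkCopy.run s₂).arr a = s₂.arr a := fun a =>
      run_arr_of_notMem _ _ (by simp [checkCopy, arrs, absTo, nop])
    set s₃ := checkCopy.run s₂
    have hrow₃ : HasRow s₃ 17 (s₃.reg 8) (code (d / 2) (μ w)) := by
      rw [g8]; exact hrow₂.congr (hset₃.r3.trans hset₂.r3.symm) (hset₃.r4.trans hset₂.r4.symm) (ga 17)
    rw [run_ite_same, Expr.eval_reg, Expr.eval_ofNat, initialLabel, if_neg h0]
    have hfin : ∀ p : LoopProg, 8 ∉ p.arrs → ∀ x, (p.run s₃).arr 8 x =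
        if x = w ∧ D ≠ 0 then Nat.log 2 n + 2 - D else s.arr 8 x := by
      intro p hp x
      rw [run_arr_of_notMem _ _ hp, ga, f8a]
      simp [h0]
    split_ifs with hc
    · rw [raise_of_copyMinSeq hj hjH hlen (μ w) (hcheck.1 hc)]
      exact ⟨hasTmp_copyRow hrow₃, hfin copyRow (by decide)⟩
    · obtain ⟨k1, k2⟩ := raise_of_not_copyMinSeq (H := d / 2) hj hjH hlen le_rfl (μ w)
        (fun h => hc (hcheck.2 h))
      refine ⟨?_, hfin (next 17 8) (by decide)⟩
      refine hasTmp_next_label hset₃.r3 hset₃.r4 g14 le_rfl hrow₃ (by decide) (by decide)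
        (by rw [g12, f12]; exact hjH) (by rw [g13, f13]; omega) (by rw [hset₃.r5, hset₃.r4])
        (by rw [hset₃.r6, hset₃.r4]) ?_ ?_
      · rw [g12, g13, f12, f13]; exact k1
      · rw [g12, g13, f12, f13]; exact k2

lemma run_writeRow {s : Mem} {v : ℕ} {t : ℕ} (ht : t < s.reg 3) :
    (writeRow.run s).arr 15 (s.reg 3 * v + t) =
      if v = s.reg 8 then s.arr 16 t else s.arr 15 (s.reg 3 * v + t) := by
  rw [writeRow, run_seq, run_seq, run_assign, run_assign]
  have := run_copyIf ((s.setReg 24 (Expr.eval s 1)).setReg 25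
    ((Expr.reg 8).eval (s.setReg 24 (Expr.eval s 1)))) v (t := t) (by simpa using ht)
  simpa using this

/-- The specification of `initialLabels`. -/
lemma hasLabels_initialLabels {s : Mem} {D : Fin n → ℕ}
    {μ : Labeling n (bitTree (Nat.log 2 n) (d / 2))} (hs : Setup G es s)
    (hμ : ∀ w : Fin n, HasRow s 17 w (code (d / 2) (μ w)))
    (hD : ∀ w : Fin n, s.arr 18 (n * w + w) = D w) (hDL : ∀ w, D w ≤ Nat.log 2 n + 1)
    (hD0 : ∀ w, D w ≠ 0 → Even (G.prio w) ∧
      Nat.log 2 n + 1 - D w < (chainOf (Nat.log 2 n) (d / 2) (G.prio w / 2)).length)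
    (h8 : ∀ x, s.arr 8 x = 0) :
    HasLabels (initialLabels.run s) (d / 2) (fun w => initialLabel G μ (D w) w) ∧
    ∀ w : Fin n, (initialLabels.run s).arr 8 w = if D w = 0 then 0 else Nat.log 2 n + 2 - D w := by
  rw [initialLabels, run_seq, run_assign]
  set s₀ := s.setReg 14 ((Expr.reg 4).eval s) with hs₀
  have hset₀ : Setup G es s₀ := hs.congr (fun y hy => by simp [hs₀]; omega) (fun a _ _ => rfl)
  have h14₀ : s₀.reg 14 = d / 2 := by simp [hs₀, hs.r4]
  have key := loop_induct (x := 8) (r := 0) (s := s₀) (b := seq raiseLabel writeRow)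
    (I := fun k s' => ∀ w : Fin n, (w < k → HasRow s' 15 w (code (d / 2) (initialLabel G μ (D w) w)) ∧
      s'.arr 8 w = if D w = 0 then 0 else Nat.log 2 n + 2 - D w) ∧ (k ≤ w → s'.arr 8 w = 0))
    (fun w => ⟨fun h => absurd h (by omega), fun _ => h8 w⟩) (by
      intro k hk s' hx hreg harr hI w
      have hset' : Setup G es s' := hset₀.of_agree _ 8 (by decide) (by decide) hreg harr
      rw [hset₀.r0] at hk
      have h14' := (hreg 14 (by decide) (by decide)).trans h14₀
      obtain ⟨j1, j2⟩ := run_raiseLabel (w := ⟨k, hk⟩) (D := D ⟨k, hk⟩) (μ := μ) hset' hx h14'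
        ((hμ ⟨k, hk⟩).congr (hset'.r3.trans hs.r3.symm) (hset'.r4.trans hs.r4.symm)
          (harr 17 (by decide)))
        (by rw [harr 18 (by decide)]; exact hD ⟨k, hk⟩) (hDL _) (hD0 _)
      have hset₂ := hset'.run raiseLabel (by decide)
      have r8 : (raiseLabel.run s').reg 8 = k := (run_reg_of_notMem _ _ (by decide)).trans hx
      have a15 : (raiseLabel.run s').arr 15 = s'.arr 15 := run_arr_of_notMem _ _ (by decide)
      have hset₃ := hset₂.run writeRow (by decide)
      have a8 : ((seq raiseLabel writeRow).run s').arr 8 = (raiseLabel.run s').arr 8 :=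
        run_arr_of_notMem writeRow (raiseLabel.run s') (by decide)
      have hrowk : ∀ t < Nat.log 2 n,
          ((seq raiseLabel writeRow).run s').arr 15 (Nat.log 2 n * w + t) =
          if (w : ℕ) = k then (raiseLabel.run s').arr 16 t else s'.arr 15 (Nat.log 2 n * w + t) := by
        intro t ht
        rw [run_seq]
        have := run_writeRow (s := raiseLabel.run s') (v := w) (t := t) (by rwa [hset₂.r3])
        rwa [hset₂.r3, r8, a15] at this
      constructor
      · intro hw
        constructor
        · intro t ht
          simp only [Mem.setReg_reg, Mem.setReg_arr, Nat.reduceEqDiff, if_false] at ht ⊢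
          rw [run_seq, hset₃.r3] at ht
          rw [run_seq, hset₃.r3, hset₃.r4, ← run_seq, hrowk t ht]
          rcases (show (w : ℕ) ≤ k by omega).lt_or_eq with h | h
          · have h1 := ((hI w).1 h).1 t (by rwa [hset'.r3])
            rw [hset'.r3, hset'.r4] at h1
            rw [if_neg h.ne]; exact h1
          · obtain rfl : w = ⟨k, hk⟩ := Fin.ext h
            have h1 := j1 t (by rwa [hset₂.r3])
            rw [hset₂.r4] at h1
            rw [if_pos rfl]; exact h1
        · rw [Mem.setReg_arr, a8, j2]
          rcases (show (w : ℕ) ≤ k by omega).lt_or_eq with h | h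
          · rw [if_neg (by rintro ⟨h1, -⟩; exact absurd h1 h.ne)]
            exact ((hI w).1 h).2
          · obtain rfl : w = ⟨k, hk⟩ := Fin.ext h
            by_cases h0 : D ⟨k, hk⟩ = 0
            · simp [h0, (hI ⟨k, hk⟩).2 le_rfl]
            · simp [h0]
      · intro hw
        rw [Mem.setReg_arr, a8, j2, if_neg (by rintro ⟨h1, -⟩; simp at h1; omega)]
        exact (hI w).2 (by omega))
  rw [hset₀.r0] at key
  exact ⟨fun w => ((key w).1 w.2).1, fun w => ((key w).1 w.2).2⟩

end LoopProg

/-! ### The input and output formats of labels -/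

section Encoding

/-- The signed height of a bit: the height of its component above the leaves, with the sign given by
the value of the bit. -/
def signedHeight (h : ℕ) (e : ℕ × Bool) : ℤ := if e.2 then (h : ℤ) - e.1 else -((h : ℤ) - e.1)

lemma map_signedHeight_mapIdx (ξ : List BinStr) (k : ℕ) :
    ((ξ.mapIdx (fun q s => s.bits.map (fun b => (q + k, b)))).flatten).map
      (signedHeight (ξ.length + k)) = symb ξ := by
  induction ξ generalizing k with
  | nil => rfl
  | cons s r ih =>
    have h1 := ih (k + 1)
    rw [List.mapIdx_cons, List.flatten_cons, List.map_append, symb]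
    congr 1
    · rw [List.map_map]
      refine List.map_congr_left fun b _ => ?_
      cases b <;> simp [signedHeight]
    · rw [← h1]
      simp only [List.length_cons, add_comm, add_left_comm]

lemma map_signedHeight_bitList (ξ : List BinStr) :
    (bitList ξ).map (signedHeight ξ.length) = symb ξ := map_signedHeight_mapIdx ξ 0

lemma length_bitList (ξ : List BinStr) : (bitList ξ).length = numBits ξ := by
  rw [← length_symb, ← map_signedHeight_bitList, List.length_map]

lemma codeSeq_eq_signedHeight {ξ : List BinStr} {t : ℕ} (ht : t < (bitList ξ).length) :
    codeSeq ξ t = signedHeight ξ.length (bitList ξ)[t] := by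
  rw [codeSeq_of_lt (by rwa [length_symb, ← length_bitList])]
  simp only [← map_signedHeight_bitList, List.getElem_map]

lemma fst_lt_of_mem_bitList {ξ : List BinStr} {e : ℕ × Bool} (he : e ∈ bitList ξ) :
    e.1 < ξ.length := by
  simp only [bitList, List.mem_flatten, List.mem_mapIdx] at he
  obtain ⟨l, ⟨i, hi, rfl⟩, hl⟩ := he
  obtain ⟨b, -, rfl⟩ := List.mem_map.mp hl
  exact hi

end Encoding

namespace LoopProg

/-! ### The program: reading the input -/

/-- The registers `3` to `7` receive their values. The logarithm is found by repeated halving. -/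
def setRegisters : LoopProg :=
  seq (assign 8 (.reg 0)) <|
  seq (loop 10 0 (ite (Expr.less 1 (.reg 8))
    (seq (assign 8 (.reg 8 / 2)) (assign 3 (.reg 3 + 1))) nop)) <|
  seq (assign 4 (.reg 1 / 2)) <| seq (assign 5 (.reg 1 + 1)) <| seq (assign 6 (.reg 1 + 2))
    (assign 7 (.reg 0 - 1))

/-- The game is copied to the arrays `19`, `20` and `21`. -/
def readGame : LoopProg :=
  seq (loop 9 2 (seq (store 19 (.reg 9) (.get 0 (.reg 9))) (store 20 (.reg 9) (.get 1 (.reg 9)))))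
    (loop 8 0 (store 21 (.reg 8) (.get 2 (.reg 8))))

/-- The address of the entry `reg 10` of the row `reg u`. -/
def address (u : ℕ) : Expr := .reg 3 * .reg u + .reg 10

/-- One entry of array `17`. -/
def readEntry : LoopProg :=
  ite (Expr.less (.reg 10 + 1) (.get 4 (.reg 8)))
    (ite (Expr.same (.get 6 (address 8)) 1) (store 17 (address 8) (.reg 1 - .get 5 (address 8)))
      (store 17 (address 8) (.get 5 (address 8))))
    (ite (Expr.same (.get 4 (.reg 8)) 0) (store 17 (address 8) (.reg 5))
      (store 17 (address 8) (.reg 4)))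

/-- The rows of array `17` receive the codes of the labels in the input. -/
def readLabels : LoopProg := loop 8 0 (loop 10 3 readEntry)

variable {n d : ℕ} {G : ParityGame n d} {τ : OddStrategy G} {es : List (Fin n × Fin n)}

lemma run_setRegisters {s : Mem} (h3 : s.reg 3 = 0) (h0 : 1 ≤ s.reg 0) :
    (setRegisters.run s).reg 3 = Nat.log 2 (s.reg 0) ∧
    (setRegisters.run s).reg 4 = s.reg 1 / 2 ∧ (setRegisters.run s).reg 5 = s.reg 1 + 1 ∧
    (setRegisters.run s).reg 6 = s.reg 1 + 2 ∧ (setRegisters.run s).reg 7 = s.reg 0 - 1 := by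
  rw [setRegisters, run_seq, run_assign, run_seq]
  set s₀ := s.setReg 8 ((Expr.reg 0).eval s) with hs₀
  have key := loop_induct (x := 10) (r := 0) (s := s₀)
    (b := ite (Expr.less 1 (.reg 8)) (seq (assign 8 (.reg 8 / 2)) (assign 3 (.reg 3 + 1))) nop)
    (I := fun k s' => Nat.log 2 (s.reg 0) = s'.reg 3 + Nat.log 2 (s'.reg 8) ∧ 1 ≤ s'.reg 8 ∧
      (s'.reg 8 ≤ 1 ∨ s'.reg 8 + k ≤ s.reg 0))
    (by simp [hs₀, h3, h0]) (by
      rintro k hk s' - - - ⟨h1, h2, h4⟩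
      rw [run_ite_less]
      by_cases hc : 1 < s'.reg 8
      · have h5 := Nat.log_of_one_lt_of_le (b := 2) (by norm_num) (show 2 ≤ s'.reg 8 by omega)
        simp only [Expr.eval_ofNat, Expr.eval_reg, hc, if_true, run_seq, run_assign, Mem.setReg_reg,
          Expr.eval_div, Expr.eval_add, Nat.reduceEqDiff, if_false]
        omega
      · simp only [Expr.eval_ofNat, Expr.eval_reg, hc, if_false, nop, run_assign, Mem.setReg_reg,
          Nat.reduceEqDiff]
        omega)
  set s₁ := (loop 10 0 (ite (Expr.less 1 (.reg 8))
    (seq (assign 8 (.reg 8 / 2)) (assign 3 (.reg 3 + 1))) nop)).run s₀ with hs₁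
  have e0 : s₁.reg 0 = s.reg 0 := by
    rw [hs₁, run_reg_of_notMem _ _ (by decide)]; simp [hs₀]
  have e1 : s₁.reg 1 = s.reg 1 := by
    rw [hs₁, run_reg_of_notMem _ _ (by decide)]; simp [hs₀]
  have e3 : s₁.reg 3 = Nat.log 2 (s.reg 0) := by
    obtain ⟨h1, h2, h4⟩ := key
    have : s₀.reg 0 = s.reg 0 := by simp [hs₀]
    rw [this] at h4
    have h5 : s₁.reg 8 = 1 := by omega
    rw [h5, Nat.log_one_right] at h1
    omega
  simp [run_seq, run_assign, e0, e1, e3]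

lemma setup_read {h : ℕ} {T : OrderedTree BinStr h} {μ : Labeling n T} {s : Mem} (hn : 2 ≤ n)
    (hs : IsInput G es μ s) : Setup G es (readGame.run (setRegisters.run s)) := by
  obtain ⟨h3, h4, h5, h6, h7⟩ := run_setRegisters (hs.reg_other 3 le_rfl) (by rw [hs.reg_n]; omega)
  have hd : d = 2 * (d / 2) := (Nat.two_mul_div_two_of_even G.even_d).symm
  set s₁ := setRegisters.run s with hs₁
  have hreg : ∀ y < 8, (readGame.run s₁).reg y = s₁.reg y := fun y hy =>
    run_reg_of_notMem _ _ (by simp [readGame, regs]; omega)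
  have hreg₁ : ∀ y < 3, s₁.reg y = s.reg y := fun y hy =>
    run_reg_of_notMem _ _ (by simp [setRegisters, nop, regs]; omega)
  have harr₁ : s₁.arr = s.arr := funext fun a => run_arr_of_notMem _ _ (by
    simp [setRegisters, nop, arrs])
  rw [hs.reg_n] at h3 h7
  rw [hs.reg_d] at h4 h5 h6
  set p := loop 9 2 (seq (store 19 (.reg 9) (.get 0 (.reg 9))) (store 20 (.reg 9) (.get 1 (.reg 9))))
    with hp
  have key₁ := loop_induct (x := 9) (r := 2) (s := s₁)
    (b := seq (store 19 (.reg 9) (.get 0 (.reg 9))) (store 20 (.reg 9) (.get 1 (.reg 9))))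
    (I := fun k s' => ∀ t < k, s'.arr 19 t = s.arr 0 t ∧ s'.arr 20 t = s.arr 1 t)
    (by simp) (by
      intro k hk s' hx _ harr hI t ht
      have a0 := harr 0 (by decide)
      have a1 := harr 1 (by decide)
      rw [harr₁] at a0 a1
      simp only [run, Mem.setReg_arr, Mem.setArr_arr, Expr.eval_reg, Expr.eval_get, hx, a0, a1,
        Mem.setArr_reg]
      by_cases htk : t = k
      · simp [htk]
      · simpa [htk] using hI t (by omega))
  rw [hreg₁ 2 (by omega), hs.reg_m, ← hp] at key₁
  have key₂ := loop_induct (x := 8) (r := 0) (s := p.run s₁)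
    (b := store 21 (.reg 8) (.get 2 (.reg 8)))
    (I := fun k s' => ∀ t < k, s'.arr 21 t = s.arr 2 t)
    (by simp) (by
      intro k hk s' hx _ harr hI t ht
      have a2 : s'.arr 2 = s.arr 2 := by
        rw [harr 2 (by decide), run_arr_of_notMem _ _ (by decide), harr₁]
      simp only [run, Mem.setReg_arr, Mem.setArr_arr, Expr.eval_reg, Expr.eval_get, hx, a2]
      by_cases htk : t = k
      · simp [htk]
      · simpa [htk] using hI t (by omega))
  rw [run_reg_of_notMem _ _ (by decide), hreg₁ 0 (by omega), hs.reg_n] at key₂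
  have hrun : readGame.run s₁ = (loop 8 0 (store 21 (.reg 8) (.get 2 (.reg 8)))).run (p.run s₁) := rfl
  have a19 : (readGame.run s₁).arr 19 = (p.run s₁).arr 19 := by
    rw [hrun, run_arr_of_notMem _ _ (by decide)]
  have a20 : (readGame.run s₁).arr 20 = (p.run s₁).arr 20 := by
    rw [hrun, run_arr_of_notMem _ _ (by decide)]
  constructor
  · rw [hreg 0 (by omega), hreg₁ 0 (by omega), hs.reg_n]
  · rw [hreg 1 (by omega), hreg₁ 1 (by omega), hs.reg_d]
  · rw [hreg 2 (by omega), hreg₁ 2 (by omega), hs.reg_m]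
  · rw [hreg 3 (by omega), h3]
  · rw [hreg 4 (by omega), h4]
  · rw [hreg 5 (by omega), h5]; omega
  · rw [hreg 6 (by omega), h6]; omega
  · rw [hreg 7 (by omega), h7]
  · intro t ht
    rw [a19, (key₁ t ht).1, hs.tail t ht]
  · intro t ht
    rw [a20, (key₁ t ht).2, hs.head t ht]
  · intro v
    rw [hrun, key₂ v v.2, hs.prio v]

/-- The specification of `readLabels`. -/
lemma hasRow_readLabels {L : ℕ} {μ : Labeling n (bitTree L (d / 2))} {s : Mem}
    (hs : Setup G es s) (hL : Nat.log 2 n = L) (hμ : StoresLabeling s 4 L μ) (v : Fin n) :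
    HasRow (readLabels.run s) 17 v (code (d / 2) (μ v)) := by
  have hd : d = 2 * (d / 2) := (Nat.two_mul_div_two_of_even G.even_d).symm
  have r3 := hs.r3.trans hL
  -- the number that `readEntry` writes to the entry `t` of the row `v`
  set f : ℕ → ℕ → ℕ := fun v t => if t + 1 < s.arr 4 v then
      if s.arr 6 (L * v + t) = 1 then d - s.arr 5 (L * v + t) else s.arr 5 (L * v + t)
    else if s.arr 4 v = 0 then 2 * (d / 2) + 1 else d / 2 with hf
  have hentry : ∀ {s' : Mem} {k l : ℕ}, s'.reg 8 = k → s'.reg 10 = l → s'.reg 1 = d →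
      s'.reg 3 = L → s'.reg 4 = d / 2 → s'.reg 5 = 2 * (d / 2) + 1 → s'.arr 4 = s.arr 4 →
      s'.arr 5 = s.arr 5 → s'.arr 6 = s.arr 6 →
      readEntry.run s' = s'.setArr 17 (L * k + l) (f k l) := by
    intro s' k l e8 e10 e1 e3 e4 e5 a4 a5 a6
    rw [readEntry, run_ite_less, run_ite_same, run_ite_same]
    simp only [address, run, Expr.eval_add, Expr.eval_mul, Expr.eval_sub, Expr.eval_get,
      Expr.eval_reg, Expr.eval_ofNat, e8, e10, e1, e3, e4, e5, a4, a5, a6, hf]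
    split_ifs <;> rfl
  have key := loop_induct (x := 8) (r := 0) (s := s) (b := loop 10 3 readEntry)
    (I := fun k s' => ∀ w < k, ∀ t < L, s'.arr 17 (L * w + t) = f w t)
    (by simp) (by
      intro k hk s' hx hreg harr hI
      have key' := loop_induct (x := 10) (r := 3) (s := s') (b := readEntry)
        (I := fun l s'' => ∀ w t, t < L → (w < k ∨ w = k ∧ t < l) →
          s''.arr 17 (L * w + t) = f w t)
        (by
          intro w t ht hw
          exact hI w (by omega) t ht) (by
          intro l hl s'' hx' hreg' harr' hI' w t ht hw
          have g : ∀ y, y < 8 → s''.reg y = s.reg y := fun y hy =>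
            (hreg' y (by omega) (by simp [readEntry, regs])).trans
              (hreg y (by omega) (by simp [readEntry, regs]; omega))
          have ga : ∀ a, a ≠ 17 → s''.arr a = s.arr a := fun a ha =>
            (harr' a (by simpa [readEntry, arrs] using ha)).trans
              (harr a (by simpa [readEntry, arrs] using ha))
          rw [hreg 3 (by decide) (by decide), r3] at hl
          rw [hentry ((hreg' 8 (by decide) (by decide)).trans hx) hx' ((g 1 (by omega)).trans hs.r1)
            ((g 3 (by omega)).trans r3) ((g 4 (by omega)).trans hs.r4)
            ((g 5 (by omega)).trans hs.r5) (ga 4 (by omega)) (ga 5 (by omega)) (ga 6 (by omega)),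
            Mem.setReg_arr, Mem.setArr_arr]
          by_cases hc : w = k ∧ t = l
          · rw [if_pos ⟨rfl, (row_eq_iff ht hl).2 hc⟩, hc.1, hc.2]
          · rw [if_neg (fun h => hc ((row_eq_iff ht hl).1 h.2))]
            exact hI' w t ht (by omega))
      rw [hreg 3 (by decide) (by decide), r3] at key'
      intro w hw t ht
      rw [Mem.setReg_arr]
      exact key' w t ht (by omega))
  rw [hs.r0] at key
  intro t ht
  rw [run_reg_of_notMem _ _ (by decide), r3] at ht ⊢
  rw [run_reg_of_notMem _ _ (by decide), hs.r4, readLabels, key v v.2 t ht]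
  obtain ⟨h1, h2⟩ := hμ v
  simp only [hf]
  rcases hv : μ v with _ | ξ
  · rw [hv] at h1
    change s.arr 4 v = 0 at h1
    change _ = code (d / 2) ⊤ t + _
    rw [code_top, h1]
    simp
    ring
  · rw [hv] at h1 h2
    change s.arr 4 v = numBits ξ.1 + 1 at h1
    change ∀ (t : ℕ) (ht : t < (bitList ξ.1).length), _ at h2
    change _ = codeSeq ξ.1 t + _
    rw [h1]
    by_cases hb : t < numBits ξ.1
    · rw [if_pos (by omega)]
      have hb' : t < (bitList ξ.1).length := by rwa [length_bitList]
      obtain ⟨h5, h6⟩ := h2 t hb'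
      rw [codeSeq_eq_signedHeight hb', ξ.2.2]
      have hlt := fst_lt_of_mem_bitList (List.getElem_mem hb')
      rw [ξ.2.2] at hlt
      change s.arr 5 _ = (bitList ξ.1)[t].1 at h5
      change s.arr 6 _ = (bitList ξ.1)[t].2.toNat at h6
      rw [h5, h6, signedHeight]
      cases (bitList ξ.1)[t].2
      · simp
      · simp
        omega
    · rw [if_neg (by omega), if_neg (by omega), codeSeq_of_ge (by omega)]
      simp

/-! ### The program: writing the output -/

/-- One bit of the label of the node `reg 29` is written to the arrays `o + 1` and `o + 2`, if its
code is not zero. Register `27` counts the bits. -/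
def writeEntry (o : ℕ) : LoopProg :=
  seq (assign 21 (cell 15 29)) <| ite (Expr.same (.reg 21) (.reg 4)) nop <|
  seq (assign 27 (.reg 27 + 1)) <| ite (Expr.less (.reg 21) (.reg 4))
    (seq (store (o + 1) (address 29) (.reg 21)) (store (o + 2) (address 29) 0))
    (seq (store (o + 1) (address 29) (.reg 1 - .reg 21)) (store (o + 2) (address 29) 1))

/-- The label of the node `reg 29` is written to the arrays `o`, `o + 1` and `o + 2`. -/
def writeLabel (o : ℕ) : LoopProg :=
  seq (assign 27 1) <| seq (loop 10 3 (writeEntry o)) <|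
  ite (Expr.same (.get 15 (.reg 3 * .reg 29)) (.reg 5)) (store o (.reg 29) 0)
    (store o (.reg 29) (.reg 27))

/-- The labels in array `15` are written to the arrays `o`, `o + 1` and `o + 2`. -/
def writeLabels (o : ℕ) : LoopProg := loop 29 0 (writeLabel o)

lemma run_writeEntry (o : ℕ) {s : Mem} {i y : ℕ} (hi : s.reg 3 * s.reg 29 + s.reg 10 = i)
    (hy : s.arr 15 i = y) :
    ((writeEntry o).run s).reg 27 = (if y = s.reg 4 then s.reg 27 else s.reg 27 + 1) ∧
    (y ≠ s.reg 4 →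
      ((writeEntry o).run s).arr (o + 1) i = (if y < s.reg 4 then y else s.reg 1 - y) ∧
      ((writeEntry o).run s).arr (o + 2) i = if y < s.reg 4 then 0 else 1) ∧
    ∀ a l, l ≠ i → ((writeEntry o).run s).arr a l = s.arr a l := by
  rw [writeEntry, run_seq, run_assign, run_ite_same]
  have hc : (cell 15 29).eval s = y := by simp [cell, hi, hy]
  rw [hc]
  by_cases h4 : y = s.reg 4
  · simp [nop, run, h4]
  · simp only [Expr.eval_reg, Mem.setReg_reg, Nat.reduceEqDiff, if_true, if_false, h4, run_seq,
      run_assign, run_ite_less]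
    by_cases hlt : y < s.reg 4
    · simp [hlt, run, address, hi]
      intro a l h; simp [h]
    · simp [hlt, run, address, hi]
      intro a l h; simp [h]

variable {n d : ℕ} {G : ParityGame n d} {τ : OddStrategy G} {es : List (Fin n × Fin n)}

/-- The nonzero entries of a code precede its zeros, so the bits written are counted by register `27`,
and the positions of the bits agree with the positions of the entries. -/
lemma run_writeLabel {o L : ℕ} (ho : o + 2 < 15) {s : Mem} (hs : Setup G es s) (hn : 2 ≤ n)
    (hL : Nat.log 2 n = L) {v : ℕ} (h29 : s.reg 29 = v) {b : Label (bitTree L (d / 2))}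
    (hrow : HasRow s 15 v (code (d / 2) b)) :
    (((writeLabel o).run s).arr o v = labelSize b ∧
      ∀ (t : ℕ) (ht : t < (labelBits b).length),
        ((writeLabel o).run s).arr (o + 1) (L * v + t) = ((labelBits b)[t]).1 ∧
        ((writeLabel o).run s).arr (o + 2) (L * v + t) = ((labelBits b)[t]).2.toNat) ∧
    ∀ w, w ≠ v → ((writeLabel o).run s).arr o w = s.arr o w ∧ ∀ t < L,
      ((writeLabel o).run s).arr (o + 1) (L * w + t) = s.arr (o + 1) (L * w + t) ∧
      ((writeLabel o).run s).arr (o + 2) (L * w + t) = s.arr (o + 2) (L * w + t) := by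
  have hd : d = 2 * (d / 2) := (Nat.two_mul_div_two_of_even G.even_d).symm
  have hL1 : 1 ≤ L := hL ▸ Nat.log_pos (by norm_num) hn
  have r3 : s.reg 3 = L := hs.r3.trans hL
  rw [writeLabel, run_seq, run_assign, run_seq]
  set s₀ := s.setReg 27 (Expr.eval s 1) with hs₀
  have hr0 : ∀ y, y ≠ 27 → s₀.reg y = s.reg y := fun y hy => by simp [hs₀, hy]
  have hregs : (writeEntry o).regs = [21, 30, 27] := rfl
  have harrs : (writeEntry o).arrs = [o + 1, o + 2, o + 1, o + 2] := rfl
  have key := loop_induct (x := 10) (r := 3) (s := s₀) (b := writeEntry o)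
    (I := fun l s' => (∀ ξ : Leaf (bitTree L (d / 2)), b = (ξ : Label (bitTree L (d / 2))) →
        s'.reg 27 = min l (numBits ξ.1) + 1 ∧ ∀ (t : ℕ) (ht : t < (bitList ξ.1).length), t < l →
          s'.arr (o + 1) (L * v + t) = ((bitList ξ.1)[t]).1 ∧
          s'.arr (o + 2) (L * v + t) = ((bitList ξ.1)[t]).2.toNat) ∧
      ∀ a w t, w ≠ v → t < L → s'.arr a (L * w + t) = s.arr a (L * w + t))
    (by simp [hs₀]) (by
      rintro l hl s' hx hreg harr ⟨hI, hI'⟩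
      rw [hr0 3 (by omega), r3] at hl
      have g : ∀ y, y ≠ 10 → y ≠ 21 → y ≠ 30 → y ≠ 27 → s'.reg y = s.reg y := fun y h1 h2 h3 h4 =>
        (hreg y h1 (by rw [hregs]; simp; omega)).trans (hr0 y h4)
      have a15 : s'.arr 15 = s.arr 15 := harr 15 (by rw [harrs]; simp; omega)
      obtain ⟨k1, k2, k3⟩ := run_writeEntry o (s := s') (i := L * v + l)
        (y := s.arr 15 (L * v + l))
        (by rw [g 3 (by omega) (by omega) (by omega) (by omega),
          g 29 (by omega) (by omega) (by omega) (by omega), r3, h29, hx]) (by rw [a15])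
      rw [g 4 (by omega) (by omega) (by omega) (by omega), hs.r4] at k1 k2
      rw [g 1 (by omega) (by omega) (by omega) (by omega), hs.r1] at k2
      refine ⟨fun ξ hξ => ?_, fun a w t hw ht => ?_⟩
      · obtain ⟨j1, j2⟩ := hI ξ hξ
        have hz := hrow l (by rw [r3]; exact hl)
        rw [hξ, code_coe, r3, hs.r4] at hz
        have hnum := length_bitList ξ.1
        constructor
        · rw [Mem.setReg_reg, if_neg (by omega), k1, j1]
          by_cases hb : l < numBits ξ.1
          · have := codeSeq_ne_zero hb
            rw [if_neg (by omega)]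
            omega
          · rw [codeSeq_of_ge (by omega)] at hz
            rw [if_pos (by omega)]
            omega
        · intro t ht htl
          rw [Mem.setReg_arr]
          by_cases htl' : t = l
          · subst htl'
            have hlt := fst_lt_of_mem_bitList (List.getElem_mem ht)
            rw [codeSeq_eq_signedHeight ht, ξ.2.2, signedHeight] at hz
            rw [ξ.2.2] at hlt
            rcases hbit : (bitList ξ.1)[t].2 with _ | _
            · rw [hbit] at hz
              simp only [Bool.false_eq_true, if_false] at hz
              obtain ⟨k4, k5⟩ := k2 (by omega)
              rw [k4, k5, if_pos (by omega), if_pos (by omega)]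
              exact ⟨by omega, rfl⟩
            · rw [hbit] at hz
              simp only [if_true] at hz
              obtain ⟨k4, k5⟩ := k2 (by omega)
              rw [k4, k5, if_neg (by omega), if_neg (by omega)]
              exact ⟨by omega, rfl⟩
          · have hne : L * v + t ≠ L * v + l := by omega
            rw [k3 _ _ hne, k3 _ _ hne]
            exact j2 t ht (by omega)
      · rw [Mem.setReg_arr, k3 _ _ (fun h => hw ((row_eq_iff ht hl).1 h).1)]
        exact hI' a w t hw ht)
  rw [hr0 3 (by omega), r3] at key
  set s₁ := (loop 10 3 (writeEntry o)).run s₀ with hs₁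
  obtain ⟨key₁, key₂⟩ := key
  have g : ∀ y, y ≠ 10 → y ≠ 21 → y ≠ 30 → y ≠ 27 → s₁.reg y = s.reg y := fun y h1 h2 h3 h4 => by
    rw [hs₁, run_reg_of_notMem _ _ (by simp [regs, hregs]; omega), hr0 y h4]
  have ao : s₁.arr o = s.arr o := by
    rw [hs₁, run_arr_of_notMem _ _ (by simp [arrs, harrs])]; rfl
  have a15 : s₁.arr 15 = s.arr 15 := by
    rw [hs₁, run_arr_of_notMem _ _ (by simp [arrs, harrs]; omega)]; rfl
  have hz := hrow 0 (by rw [r3]; omega)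
  rw [r3, hs.r4, add_zero] at hz
  rw [run_ite_same]
  simp only [Expr.eval_get, Expr.eval_mul, Expr.eval_reg, g 3 (by omega) (by omega) (by omega) (by omega),
    g 29 (by omega) (by omega) (by omega) (by omega), r3, h29, a15,
    g 5 (by omega) (by omega) (by omega) (by omega), hs.r5, run, Expr.eval_ofNat]
  have hrun : ∀ k : ℕ, (∀ a, a ≠ o → (s₁.setArr o v k).arr a = s₁.arr a) := by
    intro k a ha
    funext i
    simp [ha]
  have hcell : ∀ k : ℕ, ∀ w, (s₁.setArr o v k).arr o w = if w = v then k else s.arr o w := by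
    intro k w
    simp [ao]
  have hres : (if s.arr 15 (L * v) = 2 * (d / 2) + 1 then s₁.setArr o v 0
      else s₁.setArr o v (s₁.reg 27)) = s₁.setArr o v (labelSize b) := by
    rcases b with _ | ξ
    · have : code (d / 2) (none : Label (bitTree L (d / 2))) 0 = ((d / 2 : ℕ) : ℤ) + 1 := code_top 0
      rw [this] at hz
      rw [if_pos (by omega)]
      rfl
    · have hle := abs_le.1 (abs_codeSeq_le ξ.1 0)
      rw [ξ.2.2] at hle
      have : code (d / 2) (some ξ : Label (bitTree L (d / 2))) 0 = codeSeq ξ.1 0 := rfl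
      rw [this] at hz
      rw [if_neg (by omega), (key₁ ξ rfl).1]
      have := leaf_numBits ξ
      congr 2
      omega
  rw [hres]
  refine ⟨⟨by rw [hcell, if_pos rfl], fun t ht => ?_⟩, fun w hw => ⟨by rw [hcell, if_neg hw],
    fun t ht => ?_⟩⟩
  · rw [hrun _ _ (by omega), hrun _ _ (by omega)]
    rcases b with _ | ξ
    · exact absurd ht (Nat.not_lt_zero t)
    · have hlen : t < numBits ξ.1 := by rw [← length_bitList]; exact ht
      exact (key₁ ξ rfl).2 t ht (hlen.trans_le (leaf_numBits ξ))
  · rw [hrun _ _ (by omega), hrun _ _ (by omega)]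
    exact ⟨key₂ _ w t hw ht, key₂ _ w t hw ht⟩

/-- The specification of `writeLabels`. -/
lemma storesLabeling_writeLabels {o L : ℕ} (ho : o + 2 < 15) {s : Mem} (hs : Setup G es s)
    (hn : 2 ≤ n) (hL : Nat.log 2 n = L) {ν : Labeling n (bitTree L (d / 2))}
    (hν : HasLabels s (d / 2) ν) : StoresLabeling ((writeLabels o).run s) o L ν := by
  have hregs : (writeLabel o).regs = [27, 10, 21, 30, 27] := rfl
  have harrs : (writeLabel o).arrs = [o + 1, o + 2, o + 1, o + 2, o, o] := rfl
  have hkeep : (writeLabel o).keepsSetup = true := by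
    simp [keepsSetup, hregs, harrs]
    omega
  have key := loop_induct (x := 29) (r := 0) (s := s) (b := writeLabel o)
    (I := fun k s' => ∀ v : Fin n, v < k → s'.arr o v = labelSize (ν v) ∧
      ∀ (t : ℕ) (ht : t < (labelBits (ν v)).length),
        s'.arr (o + 1) (L * v + t) = ((labelBits (ν v))[t]).1 ∧
        s'.arr (o + 2) (L * v + t) = ((labelBits (ν v))[t]).2.toNat)
    (by simp) (by
      intro k hk s' hx hreg harr hI v hv
      rw [hs.r0] at hk
      have hset' : Setup G es s' := hs.of_agree _ 29 hkeep (by omega) hreg harr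
      obtain ⟨h1, h2⟩ := run_writeLabel ho hset' hn hL hx (b := ν ⟨k, hk⟩)
        ((hν ⟨k, hk⟩).congr (hset'.r3.trans hs.r3.symm) (hset'.r4.trans hs.r4.symm)
          (harr 15 (by rw [harrs]; simp; omega)))
      rw [Mem.setReg_arr]
      by_cases hvk : (v : ℕ) = k
      · obtain rfl : v = ⟨k, hk⟩ := Fin.ext hvk
        exact h1
      · obtain ⟨h3, h4⟩ := h2 v hvk
        obtain ⟨h5, h6⟩ := hI v (by omega)
        refine ⟨h3.trans h5, fun t ht => ?_⟩
        have htL : t < L := by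
          rcases hb : ν v with _ | ξ
          · rw [hb] at ht
            exact absurd ht (Nat.not_lt_zero t)
          · rw [hb] at ht
            have hlen : t < numBits ξ.1 := by rw [← length_bitList]; exact ht
            exact hlen.trans_le (leaf_numBits ξ)
        rw [(h4 t htL).1, (h4 t htL).2]
        exact h6 t ht)
  rw [hs.r0] at key
  exact fun v => key v v.2

/-! ### The program: correctness and running time -/

/-- The part of the program that depends on the registers set by `setRegisters`. -/
def mainPart : LoopProg :=
  seq readGame <| seq readLabels <| seq arcCosts <| seq closure <| seq initialLabels <|
  seq (writeLabels 9) <| seq (assign 15 (.reg 1 + 1)) <| seq bellmanFord (writeLabels 12)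

/-- The program. -/
def main : LoopProg := seq setRegisters mainPart

variable {n d : ℕ} {G : ParityGame n d} {τ : OddStrategy G} {es : List (Fin n × Fin n)}

lemma codeENat_natCast (x : ℕ) : codeENat (x : ℕ∞) = x + 1 := by
  rw [codeENat, if_neg (by simp)]; simp

/-- The content of a cell of array `7` is the code of the arc cost. -/
lemma CostCell.codeENat_arcCost {s : Mem} {L h c : ℕ} {v w : Fin n}
    (hc : CostCell s L c (fun x => CostLE G τ es L h (L + 1 - x) v w)) :
    s.arr 7 c = codeENat (arcCost G τ es L h v w) := by
  rw [hc.cost]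
  set D := s.arr 18 c with hD
  have hle := hc.le
  have hex : ∀ i : ℕ, arcCost G τ es L h v w = i → i ≤ L := by
    intro i hi
    have hne : {x : ℕ∞ | ∃ i ≤ L, x = (i : ℕ∞) ∧ CostLE G τ es L h i v w}.Nonempty := by
      by_contra hno
      rw [Set.not_nonempty_iff_eq_empty] at hno
      rw [arcCost, hno, sInf_empty] at hi
      exact absurd hi (by simp)
    obtain ⟨i', hi', h1, -⟩ := csInf_mem hne
    rw [arcCost, h1] at hi
    have : i' = i := by exact_mod_cast hi
    omega
  have hiff : ∀ i ≤ L, arcCost G τ es L h v w ≤ (i : ℕ) ↔ L + 1 - i ≤ D := by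
    intro i hi
    rw [arcCost_le_iff hi, hD, hc.iff _ (by omega) (by omega),
      show L + 1 - (L + 1 - i) = i by omega]
  rcases eq_or_ne (arcCost G τ es L h v w) ⊤ with htop | hne
  · rw [htop] at hiff ⊢
    have := (hiff L le_rfl).not.1 (by simp)
    rw [if_pos (by omega), codeENat, if_pos rfl]
  · obtain ⟨i, hi⟩ := WithTop.ne_top_iff_exists.mp hne
    have hi' : arcCost G τ es L h v w = (i : ℕ) := hi.symm
    have hiL := hex i hi'
    rw [hi', codeENat_natCast]
    have h1 := (hiff i hiL).1 hi'.le
    have h2 : L + 1 - D ≥ i := by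
      have := (hiff (L + 1 - D) (by omega)).2 (by omega)
      rw [hi'] at this
      exact_mod_cast this
    rw [if_neg (by omega)]
    omega

/-- The program stores the costs, the bottleneck costs of cycles, the initial labels and the result of
the Bellman–Ford procedure. The arrays `9` to `11` hold the initial labels and the arrays `12` to `14`
the final ones. -/
lemma output_mainPart (hes : ListsArcs G τ es) (hn : 2 ≤ n)
    {μ : Labeling n (bitTree (Nat.log 2 n) (d / 2))} {s s₁ : Mem}
    (hin : IsInput G es μ s) (hs₁ : s₁ = setRegisters.run s) :
    ∃ ν₀ : Labeling n (bitTree (Nat.log 2 n) (d / 2)),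
      (∀ w ∈ baseNodes G τ, ν₀ w =
        if minCycleCost G τ (arcCost G τ es (Nat.log 2 n) (d / 2)) w < ⊤ then
          raise (chainOf (Nat.log 2 n) (d / 2) (G.prio w / 2)) (μ w)
            (minCycleCost G τ (arcCost G τ es (Nat.log 2 n) (d / 2)) w) else ⊤) ∧
      (∀ w, w ∉ baseNodes G τ → ν₀ w = ⊤) ∧
      IsOutput G τ (arcCost G τ es (Nat.log 2 n) (d / 2))
        (minCycleCost G τ (arcCost G τ es (Nat.log 2 n) (d / 2))) ν₀ (rounds G es (n - 1) ν₀)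
        (mainPart.run s₁) := by
  have harr₁ : ∀ a, 7 ≤ a → ∀ x, s₁.arr a x = 0 := fun a ha x => by
    rw [hs₁, run_arr_of_notMem _ _ (by simp [setRegisters, nop, arrs]), hin.arr_other a x ha]
  set s₂ := readGame.run s₁ with hs₂
  have set₂ : Setup G es s₂ := by rw [hs₂, hs₁]; exact setup_read hn hin
  have hlab₂ : StoresLabeling s₂ 4 (Nat.log 2 n) μ := by
    have e : ∀ a, a < 7 → s₂.arr a = s.arr a := fun a ha => by
      rw [hs₂, run_arr_of_notMem _ _ (by simp [readGame, arrs]; omega), hs₁,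
        run_arr_of_notMem _ _ (by simp [setRegisters, nop, arrs])]
    intro v
    rw [e 4 (by omega), e (4 + 1) (by omega), e (4 + 2) (by omega)]
    exact hin.labels v
  set s₃ := readLabels.run s₂ with hs₃
  have set₃ : Setup G es s₃ := set₂.run readLabels (by decide)
  have hrow₃ : ∀ w : Fin n, HasRow s₃ 17 w (code (d / 2) (μ w)) := hasRow_readLabels set₂ rfl hlab₂
  have harr₃ : ∀ a, 7 ≤ a → a ≤ 18 → a ≠ 17 → ∀ x, s₃.arr a x = 0 := fun a h1 h2 h3 x => by
    rw [hs₃, run_arr_of_notMem _ _ (by simp [readLabels, readEntry, arrs]; omega), hs₂,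
      run_arr_of_notMem _ _ (by simp [readGame, arrs]; omega), harr₁ a h1]
  set s₄ := arcCosts.run s₃ with hs₄
  have set₄ : Setup G es s₄ := set₃.run arcCosts (by decide)
  have hcell := costCell_arcCosts hes set₃ hn
    (fun x => ⟨harr₃ 18 (by omega) (by omega) (by omega) x,
      harr₃ 7 (by omega) (by omega) (by omega) x⟩)
  rw [← hs₄] at hcell
  set s₅ := closure.run s₄ with hs₅
  have set₅ : Setup G es s₅ := set₄.run closure (by decide)
  set D : Fin n → ℕ := fun w => s₅.arr 18 (n * w + w) with hD
  have hDL : ∀ w, D w ≤ Nat.log 2 n + 1 := by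
    intro w
    by_contra hlt
    have := (run_closure set₄.r0 (x := (Nat.log 2 n) + 2) (fun _ _ => False) (fun v w => by
      refine iff_of_false ?_ id
      have := (hcell v w).le
      omega) w w).1 (by rw [← hs₅]; change (Nat.log 2 n) + 2 ≤ D w; omega)
    obtain ⟨_, h, -⟩ := Relation.TransGen.head'_iff.mp this
    exact h
  have hDiff : ∀ w, ∀ x, 1 ≤ x → x ≤ Nat.log 2 n + 1 →
      (x ≤ D w ↔ Relation.TransGen (CostLE G τ es (Nat.log 2 n) (d / 2) (Nat.log 2 n + 1 - x)) w w) :=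
    fun w x h1 h2 => run_closure set₄.r0 _ (fun v w => (hcell v w).iff x h1 h2) w w
  have hslack := fun w => minCycleCost_of_slack (h := d / 2) hes (hDL w) (hDiff w)
  set s₆ := initialLabels.run s₅ with hs₆
  have set₆ : Setup G es s₆ := set₅.run initialLabels (by decide)
  obtain ⟨hlab₆, hcyc₆⟩ := hasLabels_initialLabels (D := D) set₅ (μ := μ)
    (fun w => (hrow₃ w).congr (set₅.r3.trans set₃.r3.symm) (set₅.r4.trans set₃.r4.symm)
      ((run_arr_of_notMem _ _ (by decide)).trans (run_arr_of_notMem _ _ (by decide))))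
    (fun w => rfl) hDL (fun w hw => ((hslack w).2 hw).2) (fun x => by
      rw [hs₅, run_arr_of_notMem _ _ (by decide), hs₄, run_arr_of_notMem _ _ (by decide),
        harr₃ 8 (by omega) (by omega) (by omega)])
  rw [← hs₆] at hlab₆ hcyc₆
  set ν₀ : Labeling n (bitTree (Nat.log 2 n) (d / 2)) := fun w => initialLabel G μ (D w) w with hν₀
  set s₇ := (writeLabels 9).run s₆ with hs₇
  have set₇ : Setup G es s₇ := set₆.run (writeLabels 9) (by decide)
  have hout₇ : StoresLabeling s₇ 9 (Nat.log 2 n) ν₀ := storesLabeling_writeLabels (by omega) set₆ hn rfl hlab₆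
  have hlab₇ : HasLabels s₇ (d / 2) ν₀ := hlab₆.congr (set₇.r3.trans set₆.r3.symm)
    (set₇.r4.trans set₆.r4.symm) (run_arr_of_notMem _ _ (by decide))
  -- the priority bound `d + 1` admits all arcs
  set s₈ := s₇.setReg 15 ((Expr.reg 1 + 1).eval s₇) with hs₈
  have set₈ : Setup G es s₈ := set₇.run (assign 15 (Expr.reg 1 + 1)) (by decide)
  have h15 : s₈.reg 15 = d + 1 := by simp [hs₈, set₇.r1]
  have h14 : s₈.reg 14 = d / 2 := by
    have h1 : s₈.reg 14 = s₇.reg 14 := by simp [hs₈]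
    rw [h1, hs₇, run_reg_of_notMem _ _ (by decide), hs₆, initialLabels, run_seq,
      run_reg_of_notMem _ _ (by decide), run_assign]
    simp [set₅.r4]
  have hall : ∀ v, G.prio v < s₈.reg 15 := fun v => by
    rw [h15]; exact Nat.lt_succ_of_le (G.prio_le v)
  set s₉ := bellmanFord.run s₈ with hs₉
  have set₉ : Setup G es s₉ := set₈.run bellmanFord (by decide)
  have hlab₉ : HasLabels s₉ (d / 2) (rounds G es (n - 1) ν₀) := by
    have h1 := hasLabels_bellmanFord set₈ hn h14 le_rfl
      (fun v _ => Nat.div_le_div_right (G.prio_le v))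
      (hlab₇.congr (s' := s₈) (by simp [hs₈]) (by simp [hs₈]) rfl)
    rwa [List.filter_eq_self.2 (fun e _ => by simpa using hall e.1)] at h1
  have hout := storesLabeling_writeLabels (o := 12) (by omega) set₉ hn rfl hlab₉
  have hrun : mainPart.run s₁ = (writeLabels 12).run s₉ := rfl
  refine ⟨ν₀, fun w hw => ?_, fun w hw => ?_, ?_⟩
  · simp only [hν₀, initialLabel]
    by_cases h0 : D w = 0
    · rw [if_pos h0, if_neg (by rw [(hslack w).1 h0]; simp)]
    · rw [if_neg h0, ((hslack w).2 h0).1, if_pos (ENat.natCast_lt_top _)]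
  · simp only [hν₀, initialLabel]
    refine if_pos ?_
    by_contra h0
    exact hw (mem_baseNodes_of_minCycleCost ((hslack w).2 h0).1.le)
  · rw [hrun]
    refine ⟨fun v w _ => ?_, fun w _ => ?_, ?_, hout⟩
    · rw [run_arr_of_notMem _ _ (by decide), hs₉, run_arr_of_notMem _ _ (by decide), hs₈,
        Mem.setReg_arr, hs₇, run_arr_of_notMem _ _ (by decide), hs₆,
        run_arr_of_notMem _ _ (by decide), hs₅, run_arr_of_notMem _ _ (by decide)]
      exact (hcell v w).codeENat_arcCost
    · rw [run_arr_of_notMem _ _ (by decide), hs₉, run_arr_of_notMem _ _ (by decide), hs₈,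
        Mem.setReg_arr, hs₇, run_arr_of_notMem _ _ (by decide), hcyc₆ w]
      by_cases h0 : D w = 0
      · rw [if_pos h0, (hslack w).1 h0, codeENat, if_pos rfl]
      · have := hDL w
        rw [if_neg h0, ((hslack w).2 h0).1, codeENat_natCast]
        omega
    · intro v
      have e : ∀ a, 9 ≤ a → a < 12 → ((writeLabels 12).run s₉).arr a = s₇.arr a := fun a h1 h2 => by
        have : a ∈ [9, 10, 11] := by simp; omega
        rw [run_arr_of_notMem (writeLabels 12) _ (by revert a; decide), hs₉,
          run_arr_of_notMem bellmanFord _ (by revert a; decide)]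
        rfl
      rw [e 9 (by omega) (by omega), e (9 + 1) (by omega) (by omega),
        e (9 + 2) (by omega) (by omega)]
      exact hout₇ v

/-- Every node has an outgoing arc. -/
lemma ListsArcs.le_length (hes : ListsArcs G τ es) : n ≤ es.length := by
  have hsub : (Finset.univ : Finset (Fin n)) ⊆ (es.map Prod.fst).toFinset := by
    intro v _
    rw [List.mem_toFinset, List.mem_map]
    by_cases hv : v ∈ G.V₁
    · refine ⟨(v, τ.next ⟨v, hv⟩), (hes.2 _).2 ?_, rfl⟩
      exact Finset.mem_filter.2 ⟨τ.next_arc ⟨v, hv⟩, fun _ => rfl⟩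
    · obtain ⟨w, hw⟩ := G.sinkless v
      exact ⟨(v, w), (hes.2 _).2 (Finset.mem_filter.2 ⟨hw, fun h => absurd h hv⟩), rfl⟩
  have h1 := Finset.card_le_card hsub
  rw [Finset.card_univ, Fintype.card_fin] at h1
  exact h1.trans ((List.toFinset_card_le _).trans (by simp))

lemma ListsArcs.length_le (hes : ListsArcs G τ es) : es.length ≤ n ^ 2 := by
  have := hes.1.length_le_card
  simpa [sq] using this

/-- Every instruction lies in at most two loops over nodes, one loop over arcs and one loop over label
entries, where the third loop of the Floyd–Warshall algorithm counts as a loop over arcs. The initial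
part is timed separately, as it computes the bounds of the other loops. -/
lemma time_main (hes : ListsArcs G τ es) (hn : 2 ≤ n)
    {μ : Labeling n (bitTree (Nat.log 2 n) (d / 2))} {s : Mem} (hin : IsInput G es μ s) :
    main.time s ≤ main.weight * (es.length * n ^ 2 * Nat.log 2 n) := by
  have set₁ := setup_read hn hin
  have hreg : ∀ y < 8, (setRegisters.run s).reg y = (readGame.run (setRegisters.run s)).reg y :=
    fun y hy => (run_reg_of_notMem _ _ (by simp [readGame, regs]; omega)).symm
  have r0 := (hreg 0 (by omega)).trans set₁.r0
  have r2 := (hreg 2 (by omega)).trans set₁.r2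
  have r3 := (hreg 3 (by omega)).trans set₁.r3
  have r7 := (hreg 7 (by omega)).trans set₁.r7
  have hL1 : 1 ≤ Nat.log 2 n := Nat.log_pos (by norm_num) hn
  have hnm := ListsArcs.le_length hes
  have h1 := time_le_timeBound (fun _ => n) setRegisters s
    (by
      have : ∀ r ∈ setRegisters.bounds, r = 0 := by decide
      intro r hr
      rw [this r hr, hin.reg_n]) (by decide)
  have h2 := timeBound_le (ρ := fun r => (setRegisters.run s).reg r) r0.le
    (by rw [r7]; omega) r2.le r3.le (by omega) hnm hL1 mainPart 2 1 1 (by decide)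
  have h3 := time_le_timeBound (fun r => (setRegisters.run s).reg r) mainPart (setRegisters.run s)
    (fun r _ => rfl) (by decide)
  have h4 : setRegisters.timeBound (fun _ => n) ≤ setRegisters.weight * (n ^ 2 * es.length ^ 1 *
      Nat.log 2 n ^ 1) := by
    have h5 : setRegisters.timeBound (fun _ => n) =
        setRegisters.timeBound (fun r => if r = 0 then n else 0) := rfl
    rw [h5]
    exact timeBound_le (by simp) (by simp) (by simp) (by simp) (by omega) hnm hL1 setRegisters 2 1 1
      (by decide)
  have h6 : n ^ 2 * es.length ^ 1 * Nat.log 2 n ^ 1 = es.length * n ^ 2 * Nat.log 2 n := by ring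
  rw [h6] at h2 h4
  have h7 : main.weight = setRegisters.weight + mainPart.weight := rfl
  have h8 : main.time s = setRegisters.time s + mainPart.time (setRegisters.run s) := rfl
  rw [h7, h8, add_mul]
  omega

lemma safe_readGame {Dom : ℕ → ℕ → Prop} {s : Mem}
    (h2 : ∀ k < s.reg 2, Dom 0 k ∧ Dom 1 k) (h0 : ∀ k < s.reg 0, Dom 2 k) :
    readGame.Safe Dom s := by
  refine ⟨fun k hk => ⟨⟨trivial, trivial, ?_⟩, ⟨trivial, trivial, ?_⟩⟩,
    fun k hk => ⟨trivial, trivial, ?_⟩⟩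
  · simpa [iter_reg_self] using (h2 k hk).1
  · simpa [iter_reg_self, run] using (h2 k hk).2
  · rw [run_reg_of_notMem _ _ (by decide)] at hk
    simpa [iter_reg_self] using h0 k hk

/-- Input cells are read only if they hold a bit of a label. -/
lemma safe_readLabels {Dom : ℕ → ℕ → Prop} {s : Mem} (h4 : ∀ k < s.reg 0, Dom 4 k)
    (h : ∀ k < s.reg 0, ∀ t, t + 1 < s.arr 4 k →
      Dom 5 (s.reg 3 * k + t) ∧ Dom 6 (s.reg 3 * k + t)) : readLabels.Safe Dom s := by
  intro k hk l hl
  set s' := iter (loop 10 3 readEntry).run 8 s k with hs'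
  set s'' := iter readEntry.run 10 s' l with hs''
  have e10 : s''.reg 10 = l := iter_reg_self _ _ _ _
  have e8 : s''.reg 8 = k := by
    rw [hs'', iter_reg_of_notMem _ _ _ _ (by omega) (by decide), hs', iter_reg_self]
  have e3 : s''.reg 3 = s.reg 3 := by
    rw [hs'', iter_reg_of_notMem _ _ _ _ (by omega) (by decide), hs',
      iter_reg_of_notMem _ _ _ _ (by omega) (by decide)]
  have a4 : s''.arr 4 = s.arr 4 := by
    rw [hs'', iter_arr_of_notMem _ _ _ _ (by decide), hs',
      iter_arr_of_notMem _ _ _ _ (by decide)]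
  have hd4 : Dom 4 (s''.reg 8) := e8 ▸ h4 k hk
  have haddr : (address 8).Safe Dom s'' := ⟨⟨trivial, trivial⟩, trivial⟩
  have heval : (address 8).eval s'' = s.reg 3 * k + l := by simp [address, e3, e8, e10]
  refine ⟨⟨⟨trivial, trivial⟩, trivial, hd4⟩, ?_⟩
  simp only [Expr.eval_less, Expr.eval_add, Expr.eval_reg, Expr.eval_ofNat, Expr.eval_get, e10, e8, a4]
  by_cases hc : l + 1 < s.arr 4 k
  · obtain ⟨h5, h6⟩ := h k hk l hc
    rw [← heval] at h5 h6
    simp only [hc, if_true, ne_eq, one_ne_zero, not_false_eq_true]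
    refine ⟨⟨⟨haddr, h6⟩, trivial⟩, ?_⟩
    split
    · exact ⟨haddr, trivial, haddr, h5⟩
    · exact ⟨haddr, haddr, h5⟩
  · simp only [hc, if_false, ne_eq, not_true_eq_false]
    refine ⟨⟨⟨trivial, hd4⟩, trivial⟩, ?_⟩
    split
    · exact ⟨haddr, trivial⟩
    · exact ⟨haddr, trivial⟩

/-! ### The program: word size -/

variable {n d : ℕ} {G : ParityGame n d} {τ : OddStrategy G} {es : List (Fin n × Fin n)}

/-- The array cells that may be read: those that describe the input, and all cells that are
initially zero. -/
def Readable {h : ℕ} {T : OrderedTree BinStr h} (es : List (Fin n × Fin n)) (μ : Labeling n T)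
    (a i : ℕ) : Prop :=
  7 ≤ a ∨ ((a = 0 ∨ a = 1) ∧ i < es.length) ∨ ((a = 2 ∨ a = 4) ∧ i < n) ∨
    ((a = 5 ∨ a = 6) ∧ ∃ v : Fin n, ∃ t, t < (labelBits (μ v)).length ∧ i = Nat.log 2 n * v + t)

lemma length_labelBits {h : ℕ} {T : OrderedTree BinStr h} (b : Label T) :
    (labelBits b).length = labelSize b - 1 := by
  rcases b with _ | ξ
  · rfl
  · exact length_bitList ξ.1

/-- All input numbers are at most `max n² d`. -/
lemma bounded_input (hes : ListsArcs G τ es) (hn : 2 ≤ n) (hd : 2 ≤ d)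
    {μ : Labeling n (bitTree (Nat.log 2 n) (d / 2))} {s : Mem} (hin : IsInput G es μ s) :
    s.Bounded (Readable es μ) ((n * d) ^ 2) := by
  have hnd : n * d ≤ (n * d) ^ 2 := Nat.le_self_pow (by norm_num) _
  have h1 : n ≤ n * d := Nat.le_mul_of_pos_right _ (by omega)
  have h2 : d ≤ n * d := Nat.le_mul_of_pos_left _ (by omega)
  have hm : es.length ≤ (n * d) ^ 2 :=
    (ListsArcs.length_le hes).trans (Nat.pow_le_pow_left h1 2)
  refine ⟨fun x => ?_, fun a i hai => ?_⟩
  · rcases Nat.lt_or_ge x 3 with hx | hx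
    · interval_cases x
      · rw [hin.reg_n]; omega
      · rw [hin.reg_d]; omega
      · rw [hin.reg_m]; exact hm
    · rw [hin.reg_other x hx]; omega
  · rcases hai with h | ⟨rfl | rfl, hi⟩ | ⟨rfl | rfl, hi⟩ | ⟨ha, v, t, ht, rfl⟩
    · rw [hin.arr_other a i h]; omega
    · rw [hin.tail i hi]; have := (es[i]).1.2; omega
    · rw [hin.head i hi]; have := (es[i]).2.2; omega
    · have := hin.prio ⟨i, hi⟩
      have hle := G.prio_le ⟨i, hi⟩
      rw [← this] at hle
      exact hle.trans (h2.trans hnd)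
    · have := (hin.labels ⟨i, hi⟩).1
      change s.arr 4 i = _ at this
      have hlog : Nat.log 2 n < n := Nat.log_lt_self 2 (by omega)
      rw [this]
      rcases μ ⟨i, hi⟩ with _ | ξ
      · exact Nat.zero_le _
      · have := leaf_numBits ξ
        change numBits ξ.1 + 1 ≤ _
        omega
    · obtain ⟨h5, h6⟩ := (hin.labels v).2 t ht
      rcases ha with rfl | rfl
      · rw [h5]
        have key : ∀ (b : Label (bitTree (Nat.log 2 n) (d / 2))) (ht : t < (labelBits b).length),
            ((labelBits b)[t]).1 < d := by
          rintro (_ | ξ) ht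
          · exact absurd ht (Nat.not_lt_zero t)
          · have := fst_lt_of_mem_bitList (ξ := ξ.1) (List.getElem_mem ht)
            rw [ξ.2.2] at this
            exact this.trans (by omega)
        exact (key _ ht).le.trans (h2.trans hnd)
      · rw [h6]
        have := Bool.toNat_le ((labelBits (μ v))[t]).2
        omega

lemma safe_main (hn : 2 ≤ n) {μ : Labeling n (bitTree (Nat.log 2 n) (d / 2))} {s : Mem}
    (hin : IsInput G es μ s) : main.Safe (Readable es μ) s := by
  have hD : ∀ a i, 7 ≤ a → Readable es μ a i := fun a i h => Or.inl h
  have set₂ := setup_read hn hin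
  have hreg : ∀ y < 3, (setRegisters.run s).reg y = s.reg y := fun y hy =>
    run_reg_of_notMem _ _ (by simp [setRegisters, nop, regs]; omega)
  refine ⟨Safe.of_noInput hD _ _ (by decide), ?_, ?_, Safe.of_noInput hD _ _ (by decide)⟩
  · refine safe_readGame (fun k hk => ?_) (fun k hk => ?_)
    · rw [hreg 2 (by omega), hin.reg_m] at hk
      exact ⟨Or.inr (Or.inl ⟨Or.inl rfl, hk⟩), Or.inr (Or.inl ⟨Or.inr rfl, hk⟩)⟩
    · rw [hreg 0 (by omega), hin.reg_n] at hk
      exact Or.inr (Or.inr (Or.inl ⟨Or.inl rfl, hk⟩))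
  · refine safe_readLabels (fun k hk => ?_) (fun k hk t ht => ?_)
    · rw [set₂.r0] at hk
      exact Or.inr (Or.inr (Or.inl ⟨Or.inr rfl, hk⟩))
    · rw [set₂.r0] at hk
      have h4 : (readGame.run (setRegisters.run s)).arr 4 k = labelSize (μ ⟨k, hk⟩) := by
        rw [run_arr_of_notMem _ _ (by decide), run_arr_of_notMem _ _ (by decide)]
        exact (hin.labels ⟨k, hk⟩).1
      have ht' : t < (labelBits (μ ⟨k, hk⟩)).length := by
        rw [length_labelBits]; omega
      rw [set₂.r3]
      exact ⟨Or.inr (Or.inr (Or.inr ⟨Or.inl rfl, ⟨k, hk⟩, t, ht', rfl⟩)),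
        Or.inr (Or.inr (Or.inr ⟨Or.inr rfl, ⟨k, hk⟩, t, ht', rfl⟩))⟩

/-- Words of `O(log n + log d)` bits suffice. -/
lemma fits_main (hes : ListsArcs G τ es) (hn : 2 ≤ n) (hd : 2 ≤ d)
    {μ : Labeling n (bitTree (Nat.log 2 n) (d / 2))} {s : Mem} (hin : IsInput G es μ s) :
    main.Fits ((n * d) ^ ((6 + 20 * main.weight) * 20)) s := by
  have hx : 2 ≤ n * d := hn.trans (Nat.le_mul_of_pos_right _ (by omega))
  have hn1 : n ≤ n * d := Nat.le_mul_of_pos_right _ (by omega)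
  have htime : main.time s ≤ main.weight * (n * d) ^ 5 := by
    refine (time_main hes hn hin).trans (Nat.mul_le_mul_left _ ?_)
    calc es.length * n ^ 2 * Nat.log 2 n ≤ n ^ 2 * n ^ 2 * n := by
          gcongr
          · exact ListsArcs.length_le hes
          · exact (Nat.log_lt_self 2 (by omega)).le
      _ = n ^ 5 := by ring
      _ ≤ (n * d) ^ 5 := Nat.pow_le_pow_left hn1 5
  set A := main.weight
  have hlt : 1 + 20 * A ≤ (n * d) ^ (1 + 20 * A) :=
    (Nat.lt_two_pow_self).le.trans (Nat.pow_le_pow_left hx _)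
  have hpow : (n * d) ^ (6 + 20 * A) = (n * d) ^ (1 + 20 * A) * (n * d) ^ 5 := by
    rw [← pow_add, show 6 + 20 * A = 1 + 20 * A + 5 by omega]
  have h2 : (n * d) ^ 2 ≤ (n * d) ^ 5 := Nat.pow_le_pow_right (by omega) (by norm_num)
  have h32 : 32 ≤ (n * d) ^ 5 := (by norm_num : 32 = 2 ^ 5).trans_le (Nat.pow_le_pow_left hx 5)
  have hM : (n * d) ^ 2 + 20 * main.time s ≤ (n * d) ^ (6 + 20 * A) := by
    rw [hpow]
    calc (n * d) ^ 2 + 20 * main.time s ≤ (n * d) ^ 5 + 20 * (A * (n * d) ^ 5) := by omega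
      _ = (1 + 20 * A) * (n * d) ^ 5 := by ring
      _ ≤ _ := Nat.mul_le_mul_right _ hlt
  have h20 : 20 ≤ (n * d) ^ (6 + 20 * A) := by
    have : (n * d) ^ 5 ≤ (n * d) ^ (6 + 20 * A) :=
      Nat.pow_le_pow_right (by omega) (by omega)
    omega
  refine fits_of_tame (c := 20) main s _ (bounded_input hes hn hd hin) hM (by omega) h20 (by omega)
    (le_of_eq (pow_mul _ _ _).symm) (safe_main hn hin) (by decide)

/-- The cover has one chain per subcover, so only the subcover index `0` occurs. -/
lemma isExecution_rounds (hes : ListsArcs G τ es)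
    {μ ν₀ : Labeling n (succinctTree n (d / 2))}
    (hbase : ∀ w ∈ baseNodes G τ, ν₀ w =
      if minCycleCost G τ (arcCost G τ es (Nat.log 2 n) (d / 2)) w < ⊤ then
        raise (chainOf (Nat.log 2 n) (d / 2) (G.prio w / 2)) (μ w)
          (minCycleCost G τ (arcCost G τ es (Nat.log 2 n) (d / 2)) w) else ⊤)
    (hother : ∀ w, w ∉ baseNodes G τ → ν₀ w = ⊤) :
    IsExecution G τ (succinctCover n (d / 2)) μ
      (fun _ => arcCost G τ es (Nat.log 2 n) (d / 2))
      (fun _ => minCycleCost G τ (arcCost G τ es (Nat.log 2 n) (d / 2))) ν₀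
      (rounds G es (n - 1) ν₀) where
  cost_lower v w hD k hk := by
    simp only [succinctCover_chains, List.length_singleton, Nat.lt_one_iff] at hk ⊢
    subst hk
    exact costLower_le_arcCost hes hD
  cost_upper v w hD k hk := by
    simp only [succinctCover_chains, List.length_singleton, Nat.lt_one_iff] at hk ⊢
    subst hk
    exact arcCost_le_costUpper hes hD
  min_cycle w _ k _ := rfl
  init_base w hw := by
    rw [hbase w hw]
    simp only [succinctCover_chains, List.length_singleton, Nat.lt_one_iff]
    split_ifs with hlt
    · have : {x : Label (succinctTree n (d / 2)) | ∃ (k : ℕ) (hk : k = 0),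
          minCycleCost G τ (arcCost G τ es (Nat.log 2 n) (d / 2)) w < ⊤ ∧
          x = raise ([chainOf (Nat.log 2 n) (d / 2) (G.prio w / 2)][k]'(by simp [hk])) (μ w)
            (minCycleCost G τ (arcCost G τ es (Nat.log 2 n) (d / 2)) w)} =
          {raise (chainOf (Nat.log 2 n) (d / 2) (G.prio w / 2)) (μ w)
            (minCycleCost G τ (arcCost G τ es (Nat.log 2 n) (d / 2)) w)} := by
        ext x
        constructor
        · rintro ⟨k, rfl, -, rfl⟩; rfl
        · rintro rfl; exact ⟨0, rfl, hlt, rfl⟩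
      rw [this]
      exact ((minOf_isLeast (Set.singleton_nonempty _)).1).symm
    · have : {x : Label (succinctTree n (d / 2)) | ∃ (k : ℕ) (hk : k = 0),
          minCycleCost G τ (arcCost G τ es (Nat.log 2 n) (d / 2)) w < ⊤ ∧
          x = raise ([chainOf (Nat.log 2 n) (d / 2) (G.prio w / 2)][k]'(by simp [hk])) (μ w)
            (minCycleCost G τ (arcCost G τ es (Nat.log 2 n) (d / 2)) w)} = ∅ := by
        ext x
        constructor
        · rintro ⟨k, -, h, -⟩; exact absurd h hlt
        · rintro ⟨⟩
      rw [this, minOf, dif_neg (by rintro ⟨x, ⟨⟩, -⟩)]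
  init_other := hother
  bellman_ford := ⟨List.replicate (n - 1) es, by simp, fun _ h => List.eq_of_mem_replicate h ▸ hes,
    rfl⟩

end LoopProg
end ParityLC

theorem mainTheorem5 :
    ∃ (P : ParityLC.Prog) (A K : ℕ),
      ∀ (n d : ℕ), 2 ≤ n →
      ∀ (G : ParityLC.ParityGame n d) (τ : ParityLC.OddStrategy G)
        (μ : ParityLC.Labeling n (ParityLC.succinctTree n (d / 2))),
      (∀ v w, ParityLC.Arc G τ v w → ¬ ParityLC.Loose (G.prio v) (μ v) (μ w)) →
      ∀ (es : List (Fin n × Fin n)), ParityLC.ListsArcs G τ es →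
      ∀ s : ParityLC.Mem, ParityLC.IsInput G es μ s →
      ∃ (t : ℕ) (s' : ParityLC.Mem),
        ParityLC.Exec ((n * d) ^ K) P s t s' ∧
        t ≤ A * (es.length * n ^ 2 * Nat.log 2 n * Nat.log 2 d) ∧
        ∃ (c : ℕ → Fin n → Fin n → ℕ∞) (i : ℕ → Fin n → ℕ∞)
          (ν₀ ν : ParityLC.Labeling n (ParityLC.succinctTree n (d / 2))),
          ParityLC.IsExecution G τ (ParityLC.succinctCover n (d / 2)) μ c i ν₀ ν ∧
          ParityLC.IsOutput G τ (c 0) (i 0) ν₀ ν s' ∧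
          ParityLC.IsLeastFixedPoint G τ μ ν := by
  refine ⟨ParityLC.LoopProg.main.compile, ParityLC.LoopProg.main.weight,
    (6 + 20 * ParityLC.LoopProg.main.weight) * 20, ?_⟩
  intro n d hn G τ μ hloose es hes s hin
  have hd : 2 ≤ d := by
    have h1 := G.prio_pos ⟨0, by omega⟩
    have h2 := G.prio_le ⟨0, by omega⟩
    obtain ⟨k, hk⟩ := G.even_d
    omega
  obtain ⟨ν₀, hbase, hother, hout⟩ := ParityLC.LoopProg.output_mainPart hes hn hin rfl
  refine ⟨_, _, ParityLC.LoopProg.exec_compile (Nat.one_le_pow _ _ (by positivity)) _ s (by decide)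
    (ParityLC.LoopProg.fits_main hes hn hd hin), ?_, _, _, ν₀, _,
    ParityLC.LoopProg.isExecution_rounds hes hbase hother, hout,
    ParityLC.isLeastFixedPoint_rounds hes le_rfl (fun v w h => ?_) hbase hother⟩
  · refine (ParityLC.LoopProg.time_main hes hn hin).trans (Nat.mul_le_mul_left _ ?_)
    exact Nat.le_mul_of_pos_right _ (Nat.log_pos (by norm_num) hd)
  · have := hloose v w h
    rwa [ParityLC.loose_iff, not_lt] at this
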